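/- **Setting.** Let $d\in\{2,3\}$ and let $\Omega\subset\mathbb R^d$ be a bounded connected polygon/polyhedron. For $\nu>0$ and $f\in L^2(\Omega)^d$ let $(\mathrm L,u,p)\in H^1(\Omega)^{d\times d}\times H^2(\Omega)^d\times H^1(\Omega)$, with $u \in L^\infty(\Omega)^d$, solve $$\mathrm L=\nabla u,\quad -\nu\nabla\!\cdot\mathrm L+\nabla\!\cdot(u\otimes u)+\nabla p=f,\quad \nabla\!\cdot u=0\ \text{ in }\Omega,\qquad u=0\ \text{ on }\partial\Omega,\quad \int_\Omega p=0 .$$ **Local spaces.** Let $\mathcal T_h$ be a conforming mesh of $\Omega$ by polygons/polyhedra $K$ with flat faces $F$, outward normal $n$ and diameter $h_K$; $h=\max_K h_K$. To each $K$ are attached finite dimensional spaces: $V(K)$ and $V^*(K)\supseteq V(K)$ of vector fields in $L^2(K)^d$ with divergence in $L^2(K)$ and normal trace in $L^2(\partial K)$, a space $W(K)$ of polynomials with $\partial_iW(K)\subseteq W(K)$, and $M(\partial K)=\{m: m|_F\in M(F)\ \forall F\subset\partial K\}$ with $M(F)\subset L^\infty(F)$ depending only on the face $F$. A product $V(K)\times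 W(K)$ *admits an $M(\partial K)$-decomposition* if, with $\mathrm{tr}(v,w)=(v\cdot n+w)|_{\partial K}$, $\mathrm{tr}(V(K)\times W(K))\subseteq M(\partial K)$ and there are subspaces $\widetilde V\subseteq V(K)$, $\widetilde W\subseteq W(K)$ with $\nabla W(K)\subseteq\widetilde V$, $\nabla\!\cdot V(K)\subseteq\widetilde W$ such that $\mathrm{tr}:\widetilde V^\perp\times\widetilde W^\perp\to M(\partial K)$ is an isomorphism, $\perp$ denoting $L^2(K)$-orthogonal complements in $V(K)$ and $W(K)$. It is assumed that $V(K)\times W(K)$ and $V^*(K)\times W(K)$ admit $M(\partial K)$-decompositions, that $\nabla\!\cdot V^*(K)=W(K)$, and that $M_S(\partial K)\subseteq M(\partial K)$ is a subspace with $\dim M_S(\partial K)=\dim\widetilde W^\perp=\dim W(K)-\dim\nabla\!\cdot V(K)$ for which $\|P_{M_S}\cdot\|_{\partial K}$ is a norm on $\widetilde W^\perp$ ($P_{M_S}$ is the $L^2(\partial K)$-projection, acting componentwise on vectors). It is also assumed that $\partial_iW(K)\subseteq\nabla\!\cdot V(K)$ for all $i$ and $W(K)^d\subseteq V^*(K)$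 (both hold if $W(K)^d\subseteq V(K)$), and that for some integer $k\ge0$, $P_k(K)^d\subseteq V(K)$, $P_k(K)\subseteq W(K)$ for all $K$ and $P_k(F)\subseteq M(F)$ for all faces $F$. **Global spaces.** $\mathcal G_h$: matrix fields with all rows in $V(K)$ on each $K$. $V_h$: vector fields with all components in $W(K)$ on each $K$. $\mathring Q_h$: functions that lie in $W(K)$ on each $K$ and have zero integral over $\Omega$. $M_h$: vector functions on the union of the faces, single valued, with components in $M(F)$ on each $F$. $M_h(0)$: those that vanish on $\partial\Omega$. Below, $(\cdot,\cdot)_{\mathcal T_h}=\sum_K(\cdot,\cdot)_K$ and $\langle\cdot,\cdot\rangle_{\partial\mathcal T_h}=\sum_K\langle\cdot,\cdot\rangle_{\partial K}$ are sums of $L^2$ inner products. **Method.** Let $(\mathrm L_h,u_h,p_h,\widehat u_h)\in\mathcal G_h\times V_h\times\mathring Q_h\times M_h(0)$ satisfy, for all $(\mathrm G,v,q,\widehat v)$ in the same space, $$(\nu\mathrm L_h,\mathrm G)_{\mathcal T_h}+(u_h,\nu\nabla\!\cdot\mathrm G)_{\mathcal T_h}-\langle\widehat u_h,\nu\mathrm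 Gn\rangle_{\partial\mathcal T_h}=0,$$ $$(\nu\mathrm L_h,\nabla v)_{\mathcal T_h}+\langle-\nu\mathrm L_hn+\tfrac{\nu}{h_K}P_{M_S}(u_h-\widehat u_h),v-\widehat v\rangle_{\partial\mathcal T_h}-(p_h,\nabla\!\cdot v)_{\mathcal T_h}+\langle p_hn,v-\widehat v\rangle_{\partial\mathcal T_h}$$ $$-(u_h\otimes\beta,\nabla v)_{\mathcal T_h}+\langle(\beta\cdot n)\widehat u_h+\max\{\beta\cdot n,0\}(u_h-\widehat u_h),v-\widehat v\rangle_{\partial\mathcal T_h}=(f,v)_{\mathcal T_h},$$ $$-(u_h,\nabla q)_{\mathcal T_h}+\langle\widehat u_h\cdot n,q\rangle_{\partial\mathcal T_h}=0,$$ where $\beta|_K\in V^*(K)$ is given by $(\beta,v)_K=(u_h,v)_K$ for all $v\in\nabla W(K)\oplus\{v\in V^*(K):\nabla\!\cdot v=0,\ v\cdot n|_{\partial K}=0\}$ and $\langle\beta\cdot n,m\rangle_{\partial K}=\langle\widehat u_h\cdot n,m\rangle_{\partial K}$ for all $m\in M(\partial K)$. **Errors.** Let $P_{\mathcal G},P_Q,P_M$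 be the $L^2$-projections onto $\mathcal G_h,\mathring Q_h,M_h$, and let $\Pi u\in V_h$ be given on each $K$ by $(\Pi u,g)_K=(u,g)_K$ for all $g$ with components in $\nabla\!\cdot V(K)$ and $\langle\Pi u,m\rangle_{\partial K}=\langle u,m\rangle_{\partial K}$ for all $m\in M_S(\partial K)^d$. Set $e_L=P_{\mathcal G}\mathrm L-\mathrm L_h$, $e_u=\Pi u-u_h$, $e_{\widehat u}=P_Mu-\widehat u_h$, and $\delta_L=\mathrm L-P_{\mathcal G}\mathrm L$, $\delta_p=p-P_Qp$, $\delta_u=u-\Pi u$, $\delta_{\widehat u}=u-P_Mu$. For $\ell\in\{0,1,\mathrm{PF}\}$ let $|||(v,\widehat v)|||_\ell^2=\sum_{i=1}^d\sum_K|(v_i,\widehat v_i)|_{\ell,K}^2$, where, with $a$ the average of $\widehat w$ over $\partial K$, $$|(w,\widehat w)|_{1,K}^2=\|\nabla w\|_K^2+h_K^{-1}\|w-\widehat w\|_{\partial K}^2,\qquad |(w,\widehat w)|_{\mathrm{PF},K}^2=\|w-a\|_K^2+h_K\|\widehat w-a\|_{\partial K}^2,$$ $$|(w,\widehat w)|_{0,K}^2=\|w\|_K^2+h_K\big(\|\widehat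 w\|_{\partial K}^2+\|w-\widehat w\|_{\partial K}^2\big).$$ **Theorem.** There are constants $C,\varepsilon>0$, depending only on the finite element spaces, the shape-regularity of the mesh and $\Omega$, such that, if $\nu^{-2}\|f\|_{\Omega}\le\varepsilon$ and $\nu^{-1}\|u\|_{\infty,\Omega}\le\varepsilon$, then $$\|e_L\|_{\mathcal T_h}+|||(e_u,e_{\widehat u})|||_1+h^{-1}|||(e_u,e_{\widehat u})|||_{\mathrm{PF}}+\|e_u\|_{\mathcal T_h}\le C\,\nu^{-1}\,\Theta_{ns}^{1/2},$$ $$\Theta_{ns}=\sum_{K}h_K\big(\|\nu\,\delta_L n\|_{\partial K}^2+\|\delta_p\|_{\partial K}^2\big)+\|u\|_{\infty,\Omega}^2\,|||(\delta_u,\delta_{\widehat u})|||_0^2 .$$ The dependence on the spaces and the shape-regularity is understood as follows: there is a real-valued function $c$ of a single element $K$ with its local spaces $(V(K),W(K),M(\partial K),M_S(\partial K),V^*(K))$, invariant under similarities (translations, rotations, reflections and dilations), such that $C$ and $\varepsilon$ depend only on $d$, $\Omega$ and an upper bound for $\max_Kc$. In particular they are independent of $h$, $\nu$, $f$, the exact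 solution, the number of elements and $k$. -/

import Mathlib

open MeasureTheory Set Filter Topology
open scoped ContDiff

noncomputable section

namespace HDG

/-- The ambient Euclidean space. -/
abbrev E (d : ℕ) : Type := EuclideanSpace ℝ (Fin d)

variable {d : ℕ}

/-- Lebesgue measure on `K`. -/
def vol (K : Set (E d)) : Measure (E d) := (volume : Measure (E d)).restrict K

/-- Surface measure on the boundary of `K`: the `(d-1)`-dimensional Hausdorff measure, normalized so
that it is Lebesgue measure on hyperplanes. -/
def bdry (K : Set (E d)) : Measure (E d) := (μHE[d - 1] : Measure (E d)).restrict (frontier K)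

/-- The partial derivative `∂_j f`. -/
def pd (j : Fin d) (f : E d → ℝ) (x : E d) : ℝ := fderiv ℝ f x (EuclideanSpace.single j 1)

open Classical in
/-- The outward unit normal of `K` at a boundary point near which `K` is an open half space
(and `0` at all other points). -/
def outwardNormal (K : Set (E d)) (x : E d) : E d :=
  if h : ∃ n : E d, ‖n‖ = 1 ∧ ∀ᶠ y in 𝓝 x, (y ∈ K ↔ inner ℝ n (y - x) < 0) then h.choose else 0

/-- `K` is a polygonal / polyhedral domain with the given (relatively open, flat) faces: a bounded
connected open set whose boundary is the union of the closed faces and which, near each point of a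
face, is the open half space on one side of the hyperplane of that face. The elements need not be
convex, and two faces may lie in one hyperplane. -/
structure IsPolyhedral (K : Set (E d)) (faces : Finset (Set (E d))) : Prop where
  isOpen : IsOpen K
  isConnected : IsConnected K
  isBounded : Bornology.IsBounded K
  frontier_eq : frontier K = ⋃ F ∈ faces, closure F
  face_nonempty : ∀ F ∈ faces, F.Nonempty
  face_flat : ∀ F ∈ faces, ∃ (n : E d) (a : ℝ), ‖n‖ = 1 ∧
    (∃ U : Set (E d), IsOpen U ∧ F = U ∩ {x | inner ℝ n x = a}) ∧
    ∀ x ∈ F, ∀ᶠ y in 𝓝 x, (y ∈ K ↔ inner ℝ n y < a)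
  face_disjoint : ∀ F ∈ faces, ∀ F' ∈ faces, F ≠ F' → Disjoint F F'
  face_null : ∀ F ∈ faces, (μHE[d - 1] : Measure (E d)) (closure F \ F) = 0

/-! ### Function spaces on one element -/

/-- Triples `(v, δ, g)` in `L²(K)^d × L²(K) × L²(∂K)`. A vector field with square integrable
divergence and square integrable normal trace is stored as `(v, ∇·v, v·n)`. -/
abbrev Flux (K : Set (E d)) : Type :=
  Lp (E d) 2 (vol K) × Lp ℝ 2 (vol K) × Lp ℝ 2 (bdry K)

/-- The vector field. -/
def field {K : Set (E d)} (t : Flux K) : E d → E d := t.1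

/-- Its divergence. -/
def dvg {K : Set (E d)} (t : Flux K) : E d → ℝ := t.2.1

/-- Its normal trace. -/
def ntr {K : Set (E d)} (t : Flux K) : E d → ℝ := t.2.2

/-- The linear map that takes a flux to its divergence. -/
def dvgMap (K : Set (E d)) : Flux K →ₗ[ℝ] Lp ℝ 2 (vol K) :=
  (LinearMap.fst ℝ (Lp ℝ 2 (vol K)) (Lp ℝ 2 (bdry K))).comp
    (LinearMap.snd ℝ (Lp (E d) 2 (vol K)) (Lp ℝ 2 (vol K) × Lp ℝ 2 (bdry K)))

/-- The second and third entries are the weak divergence and the normal trace of the first, that is,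
`(v, ∇φ)_K + (∇·v, φ)_K = ⟨v·n, φ⟩_{∂K}` for all smooth `φ`. They are determined by `v`. -/
def IsHdiv {K : Set (E d)} (t : Flux K) : Prop :=
  ∀ φ : E d → ℝ, ContDiff ℝ ∞ φ →
    (∑ j, ∫ x, field t x j * pd j φ x ∂(vol K)) + ∫ x, dvg t x * φ x ∂(vol K)
      = ∫ x, ntr t x * φ x ∂(bdry K)

/-- The function `f` is a polynomial function. -/
def IsPoly (f : E d → ℝ) : Prop :=
  ∃ P : MvPolynomial (Fin d) ℝ, ∀ x, f x = MvPolynomial.eval (fun i => x i) P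

/-- The function `f` is a polynomial function of total degree at most `k`. -/
def IsPolyDeg (k : ℕ) (f : E d → ℝ) : Prop :=
  ∃ P : MvPolynomial (Fin d) ℝ, P.totalDegree ≤ k ∧
    ∀ x, f x = MvPolynomial.eval (fun i => x i) P

/-- The function `g` represents, on `∂K`, an element of the trace space `S`. -/
def InTrace {K : Set (E d)} (S : Submodule ℝ (Lp ℝ 2 (bdry K))) (g : E d → ℝ) : Prop :=
  ∃ m ∈ S, g =ᵐ[bdry K] (m : E d → ℝ)

/-- The vector field `v` represents, on `K`, an element of the flux space `S`. -/
def InField {K : Set (E d)} (S : Submodule ℝ (Flux K)) (v : E d → E d) : Prop :=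
  ∃ t ∈ S, v =ᵐ[vol K] field t

open Classical in
/-- The `L²(∂K)`-orthogonal projection of the function `g` onto `S`. -/
def traceProj {K : Set (E d)} (S : Submodule ℝ (Lp ℝ 2 (bdry K))) [S.HasOrthogonalProjection]
    (g : E d → ℝ) : E d → ℝ :=
  if h : MemLp g 2 (bdry K) then (S.starProjection (h.toLp g) : Lp ℝ 2 (bdry K)) else 0

/-- `t` belongs to the `L²(K)`-orthogonal complement of `Vt` in `V`. -/
def InFluxPerp {K : Set (E d)} (V Vt : Submodule ℝ (Flux K)) (t : Flux K) : Prop :=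
  t ∈ V ∧ ∀ s ∈ Vt, inner ℝ s.1 t.1 = 0

/-- `w` belongs to the `L²(K)`-orthogonal complement of `Wt` in `W`. -/
def InScalarPerp (K : Set (E d)) (W Wt : Submodule ℝ (E d → ℝ)) (w : E d → ℝ) : Prop :=
  w ∈ W ∧ ∀ w' ∈ Wt, ∫ x, w' x * w x ∂(vol K) = 0

/-- The subspaces `Vt × Wt` of `V × W` form an `M(∂K)`-decomposition of `V × W`. -/
structure IsMDecomposition (K : Set (E d)) (V : Submodule ℝ (Flux K))
    (W : Submodule ℝ (E d → ℝ)) (M : Submodule ℝ (Lp ℝ 2 (bdry K)))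
    (Vt : Submodule ℝ (Flux K)) (Wt : Submodule ℝ (E d → ℝ)) : Prop where
  Vt_le : Vt ≤ V
  Wt_le : Wt ≤ W
  trace_mem : ∀ t ∈ V, ∀ w ∈ W, InTrace M (fun x => ntr t x + w x)
  grad_mem : ∀ w ∈ W, ∃ t ∈ Vt, ∀ᵐ x ∂(vol K), ∀ j, field t x j = pd j w x
  div_mem : ∀ t ∈ V, ∃ w ∈ Wt, dvg t =ᵐ[vol K] w
  trace_iso : ∀ m ∈ M, ∃! q : Flux K × (E d → ℝ),
    InFluxPerp V Vt q.1 ∧ InScalarPerp K W Wt q.2 ∧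
      (fun x => ntr q.1 x + q.2 x) =ᵐ[bdry K] (m : E d → ℝ)

/-- The two conditions on a stabilization subspace `MS` of `M(∂K)`:
`dim MS = dim Wt^⊥ = dim W - dim ∇·V`, and the seminorm `‖P_{MS} ·‖_{∂K}` is a norm on `Wt^⊥`, that
is, only the zero function of `Wt^⊥` has a trace orthogonal to `MS`. -/
structure IsStabilization (K : Set (E d)) (V : Submodule ℝ (Flux K))
    (W : Submodule ℝ (E d → ℝ)) (M : Submodule ℝ (Lp ℝ 2 (bdry K)))
    (Wt : Submodule ℝ (E d → ℝ)) (MS : Submodule ℝ (Lp ℝ 2 (bdry K))) : Prop where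
  le : MS ≤ M
  dim_perp : Module.finrank ℝ MS + Module.finrank ℝ Wt = Module.finrank ℝ W
  dim_div : Module.finrank ℝ MS + Module.finrank ℝ (V.map (dvgMap K)) = Module.finrank ℝ W
  norm_def : ∀ w, InScalarPerp K W Wt w → (∀ μ ∈ MS, ∫ x, w x * μ x ∂(bdry K) = 0) → w = 0

/-- A polyhedral element `K` together with its finite dimensional local spaces `V(K)`, `W(K)`,
`M(∂K)`, the stabilization space `M_S(∂K)` and the space `V*(K)` of post-processed velocities. -/
structure LocalSpaces (d : ℕ) where
  K : Set (E d)
  faces : Finset (Set (E d))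
  polyhedral : IsPolyhedral K faces
  V : Submodule ℝ (Flux K)
  W : Submodule ℝ (E d → ℝ)
  M : Submodule ℝ (Lp ℝ 2 (bdry K))
  MS : Submodule ℝ (Lp ℝ 2 (bdry K))
  Vstar : Submodule ℝ (Flux K)
  V_fin : FiniteDimensional ℝ V
  W_fin : FiniteDimensional ℝ W
  M_fin : FiniteDimensional ℝ M
  MS_fin : FiniteDimensional ℝ MS
  Vstar_fin : FiniteDimensional ℝ Vstar
  Vstar_hdiv : ∀ t ∈ Vstar, IsHdiv t
  W_poly : ∀ w ∈ W, IsPoly w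
  W_deriv : ∀ w ∈ W, ∀ i, pd i w ∈ W
  -- the traces are bounded
  M_bounded : ∀ m ∈ M, MemLp m ⊤ (bdry K)
  -- `M(∂K)` consists of all functions whose restriction to each face `F` is in some space `M(F)`
  M_faces : ∀ m ∈ M, ∀ F ∈ faces, InTrace M (F.indicator m)
  decomposition : ∃ Vt Wt, IsMDecomposition K V W M Vt Wt ∧ IsStabilization K V W M Wt MS
  V_le_Vstar : V ≤ Vstar
  div_Vstar_mem : ∀ t ∈ Vstar, ∃ w ∈ W, dvg t =ᵐ[vol K] w
  div_Vstar_surj : ∀ w ∈ W, ∃ t ∈ Vstar, dvg t =ᵐ[vol K] w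
  decomposition_Vstar : ∃ Vt Wt, IsMDecomposition K Vstar W M Vt Wt

attribute [instance] LocalSpaces.V_fin LocalSpaces.W_fin LocalSpaces.M_fin LocalSpaces.MS_fin
  LocalSpaces.Vstar_fin

/-- The element diameter `h_K`. -/
def LocalSpaces.h (X : LocalSpaces d) : ℝ := Metric.diam X.K

/-- `Y` is the image of `X` under the similarity `x ↦ r R x + b`, with `r > 0` and `R` orthogonal:
scalar functions and traces are composed with the similarity, vector fields are also rotated. -/
def LocalSpaces.Similar (X Y : LocalSpaces d) : Prop :=
  ∃ (r : ℝ) (R : E d ≃ₗᵢ[ℝ] E d) (b : E d), 0 < r ∧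
    Y.K = (fun x => r • R x + b) '' X.K ∧
    (∀ F : Set (E d), F ∈ X.faces ↔ (fun x => r • R x + b) '' F ∈ Y.faces) ∧
    (∀ w : E d → ℝ, w ∈ Y.W ↔ (fun x => w (r • R x + b)) ∈ X.W) ∧
    (∀ g : E d → ℝ, InTrace Y.M g ↔ InTrace X.M (fun x => g (r • R x + b))) ∧
    (∀ g : E d → ℝ, InTrace Y.MS g ↔ InTrace X.MS (fun x => g (r • R x + b))) ∧
    (∀ v : E d → E d, InField Y.V v ↔ InField X.V (fun x => R.symm (v (r • R x + b)))) ∧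
    (∀ v : E d → E d, InField Y.Vstar v ↔ InField X.Vstar (fun x => R.symm (v (r • R x + b))))

/-- The local spaces contain the polynomials of degree at most `k`:
`P_k(K)^d ⊆ V(K)`, `P_k(K) ⊆ W(K)` and `P_k(F) ⊆ M(F)` for all faces `F`. -/
structure LocalSpaces.ContainsPoly (X : LocalSpaces d) (k : ℕ) : Prop where
  V_mem : ∀ v : E d → E d, (∀ i, IsPolyDeg k (fun x => v x i)) → InField X.V v
  W_mem : ∀ w : E d → ℝ, IsPolyDeg k w → w ∈ X.W
  M_mem : ∀ F ∈ X.faces, ∀ w : E d → ℝ, IsPolyDeg k w → InTrace X.M (F.indicator w)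

/-- The compatibility inclusions `∂_i W(K) ⊆ ∇·V(K)` for all `i`, and `W(K)^d ⊆ V*(K)`.
Both of them hold when `W(K)^d ⊆ V(K)`. -/
structure LocalSpaces.Compatible (X : LocalSpaces d) : Prop where
  deriv_mem : ∀ w ∈ X.W, ∀ i, ∃ t ∈ X.V, dvg t =ᵐ[vol X.K] pd i w
  vec_mem : ∀ v : E d → E d, (∀ i, (fun x => v x i) ∈ X.W) → InField X.Vstar v

/-! ### Meshes and global spaces -/

/-- A conforming mesh of `Ω` with `N` elements, each of them with its local spaces. -/
structure Mesh (Ω : Set (E d)) (N : ℕ) where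
  elem : Fin N → LocalSpaces d
  subset : ∀ K, (elem K).K ⊆ Ω
  disjoint : ∀ K K', K ≠ K' → Disjoint (elem K).K (elem K').K
  cover : closure Ω = ⋃ K, closure (elem K).K
  -- each face of an element is a boundary face or a face of another element
  conforming : ∀ K, ∀ F ∈ (elem K).faces,
    F ⊆ frontier Ω ∨ ∃ K', K' ≠ K ∧ F ∈ (elem K').faces
  -- the space `M(F)` of a face `F` is the same for the two elements that share `F`
  trace_compat : ∀ K K', ∀ F ∈ (elem K).faces, F ∈ (elem K').faces → ∀ g : E d → ℝ,
    (InTrace (elem K).M (F.indicator g) ↔ InTrace (elem K').M (F.indicator g))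

variable {Ω : Set (E d)} {N : ℕ}

/-- The mesh size `h`, the largest element diameter. -/
def Mesh.h (T : Mesh Ω N) : ℝ := ⨆ K, (T.elem K).h

/-- Elementwise families of matrix fields; row `i` on the element `K` is `G K i`. -/
abbrev Mesh.Tensor (T : Mesh Ω N) : Type := (K : Fin N) → Fin d → Flux (T.elem K).K

/-- Membership in the global space `𝒢_h` of matrix fields with rows in `V(K)`. -/
def Mesh.InG (T : Mesh Ω N) (G : T.Tensor) : Prop := ∀ K i, G K i ∈ (T.elem K).V

/-- Membership in the global velocity space of vector fields with components in `W(K)`. -/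
def Mesh.InV (T : Mesh Ω N) (v : Fin N → E d → E d) : Prop :=
  ∀ K i, (fun x => v K x i) ∈ (T.elem K).W

/-- Membership in the global pressure space of functions with zero integral over `Ω`. -/
def Mesh.InQ (T : Mesh Ω N) (q : Fin N → E d → ℝ) : Prop :=
  (∀ K, q K ∈ (T.elem K).W) ∧ ∑ K, ∫ x, q K x ∂(vol (T.elem K).K) = 0

/-- Membership in the space of single-valued vector functions on the faces, with components in
`M(F)` on each face `F`. Only the values on the mesh faces matter. -/
def Mesh.InM (T : Mesh Ω N) (vhat : E d → E d) : Prop :=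
  ∀ K i, InTrace (T.elem K).M (fun x => vhat x i)

/-- As `Mesh.InM`, with zero values on the boundary of `Ω`. -/
def Mesh.InM0 (T : Mesh Ω N) (vhat : E d → E d) : Prop :=
  T.InM vhat ∧ ∀ᵐ x ∂(bdry Ω), vhat x = 0

/-! ### The method -/

/-- On the element `X`, `β` is the post-processed velocity of `(u, uhat)`:
`(β, v)_K = (u, v)_K` for `v` in `∇W(K)` and for `v` in `V*(K)` with `∇·v = 0` and `v·n = 0`, and
`⟨β·n, m⟩_{∂K} = ⟨uhat·n, m⟩_{∂K}` for `m` in `M(∂K)`. -/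
structure IsPostprocess (X : LocalSpaces d) (u uhat : E d → E d) (β : Flux X.K) : Prop where
  mem : β ∈ X.Vstar
  grad : ∀ w ∈ X.W, ∑ j, ∫ x, field β x j * pd j w x ∂(vol X.K)
    = ∑ j, ∫ x, u x j * pd j w x ∂(vol X.K)
  bubble : ∀ t ∈ X.Vstar, dvg t =ᵐ[vol X.K] 0 → ntr t =ᵐ[bdry X.K] 0 →
    ∑ j, ∫ x, field β x j * field t x j ∂(vol X.K) = ∑ j, ∫ x, u x j * field t x j ∂(vol X.K)
  normal : ∀ m ∈ X.M, ∫ x, ntr β x * m x ∂(bdry X.K)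
    = ∫ x, (∑ j, uhat x j * outwardNormal X.K x j) * m x ∂(bdry X.K)

/-- Left-hand side of the first equation on one element:
`(ν L, G)_K + (u, ν ∇·G)_K - ⟨uhat, ν G n⟩_{∂K}`. -/
def gradientForm (X : LocalSpaces d) (ν : ℝ) (L : Fin d → Flux X.K) (u uhat : E d → E d)
    (G : Fin d → Flux X.K) : ℝ :=
  (∑ i, ∑ j, ∫ x, ν * field (L i) x j * field (G i) x j ∂(vol X.K))
    + (∑ i, ∫ x, u x i * (ν * dvg (G i) x) ∂(vol X.K))
    - ∑ i, ∫ x, uhat x i * (ν * ntr (G i) x) ∂(bdry X.K)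

/-- Viscous part of the second equation on one element:
`(ν L, ∇v)_K + ⟨-ν L n + α_v(u - uhat), v - vhat⟩_{∂K}` with `α_v = (ν / h_K) P_{M_S}`
acting on each component. -/
def viscousForm (X : LocalSpaces d) (ν : ℝ) (L : Fin d → Flux X.K) (u uhat v vhat : E d → E d) : ℝ :=
  (∑ i, ∑ j, ∫ x, ν * field (L i) x j * pd j (fun y => v y i) x ∂(vol X.K))
    + ∑ i, ∫ x, (-ν * ntr (L i) x
        + ν / X.h * traceProj X.MS (fun y => u y i - uhat y i) x) * (v x i - vhat x i) ∂(bdry X.K)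

/-- Pressure part of the second equation on one element:
`-(p, ∇·v)_K + ⟨p n, v - vhat⟩_{∂K}`. -/
def pressureForm (X : LocalSpaces d) (p : E d → ℝ) (v vhat : E d → E d) : ℝ :=
  -(∫ x, p x * ∑ i, pd i (fun y => v y i) x ∂(vol X.K))
    + ∑ i, ∫ x, p x * outwardNormal X.K x i * (v x i - vhat x i) ∂(bdry X.K)

/-- Convective part of the second equation on one element:
`-(u ⊗ β, ∇v)_K + ⟨(β·n) uhat + max(β·n, 0) (u - uhat), v - vhat⟩_{∂K}`. -/
def convectiveForm (X : LocalSpaces d) (β : Flux X.K) (u uhat v vhat : E d → E d) : ℝ :=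
  -(∑ i, ∑ j, ∫ x, u x i * field β x j * pd j (fun y => v y i) x ∂(vol X.K))
    + ∑ i, ∫ x, (ntr β x * uhat x i + max (ntr β x) 0 * (u x i - uhat x i))
        * (v x i - vhat x i) ∂(bdry X.K)

/-- Left-hand side of the third equation on one element: `-(u, ∇q)_K + ⟨uhat·n, q⟩_{∂K}`. -/
def massForm (X : LocalSpaces d) (u uhat : E d → E d) (q : E d → ℝ) : ℝ :=
  -(∑ j, ∫ x, u x j * pd j q x ∂(vol X.K))
    + ∫ x, (∑ j, uhat x j * outwardNormal X.K x j) * q x ∂(bdry X.K)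

/-- `(L, u, p, uhat)` is a solution of the HDG method for the steady Navier-Stokes equations with
viscosity `ν` and body force `f`; `β` is the post-processed velocity. -/
structure IsHDGSolution (T : Mesh Ω N) (ν : ℝ) (f : E d → E d) (L : T.Tensor)
    (u : Fin N → E d → E d) (p : Fin N → E d → ℝ) (uhat : E d → E d) (β : (K : Fin N) → Flux (T.elem K).K) :
    Prop where
  L_mem : T.InG L
  u_mem : T.InV u
  p_mem : T.InQ p
  uhat_mem : T.InM0 uhat
  postprocess : ∀ K, IsPostprocess (T.elem K) (u K) uhat (β K)
  gradient_eq : ∀ G, T.InG G → ∑ K, gradientForm (T.elem K) ν (L K) (u K) uhat (G K) = 0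
  momentum_eq : ∀ v vhat, T.InV v → T.InM0 vhat →
    ∑ K, (viscousForm (T.elem K) ν (L K) (u K) uhat (v K) vhat
      + pressureForm (T.elem K) (p K) (v K) vhat
      + convectiveForm (T.elem K) (β K) (u K) uhat (v K) vhat)
    = ∑ K, ∑ i, ∫ x, f x i * v K x i ∂(vol (T.elem K).K)
  mass_eq : ∀ q, T.InQ q → ∑ K, massForm (T.elem K) (u K) uhat (q K) = 0

/-! ### The exact solution -/

/-- `w` is in `H¹(D)` with weak gradient `g`. -/
def HasWeakGrad (D : Set (E d)) (w : E d → ℝ) (g : E d → E d) : Prop :=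
  MemLp w 2 (vol D) ∧ MemLp g 2 (vol D) ∧
    ∀ φ : E d → ℝ, ContDiff ℝ ∞ φ → HasCompactSupport φ → tsupport φ ⊆ D → ∀ j,
      ∫ x, w x * pd j φ x ∂(vol D) = -∫ x, g x j * φ x ∂(vol D)

/-- `w` is in `H¹(D)` with weak gradient `g` and boundary trace `τ` in `L²(∂D)`, in the sense of
Green's formula `(w, ∂_j φ)_D + (∂_j w, φ)_D = ⟨τ n_j, φ⟩_{∂D}` for all smooth `φ`. -/
def HasTrace (D : Set (E d)) (w : E d → ℝ) (g : E d → E d) (τ : E d → ℝ) : Prop :=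
  MemLp w 2 (vol D) ∧ MemLp g 2 (vol D) ∧ MemLp τ 2 (bdry D) ∧
    ∀ φ : E d → ℝ, ContDiff ℝ ∞ φ → ∀ j,
      (∫ x, w x * pd j φ x ∂(vol D)) + ∫ x, g x j * φ x ∂(vol D)
        = ∫ x, τ x * outwardNormal D x j * φ x ∂(bdry D)

/-- `(L, u, p)` in `H¹ × H² × H¹` solves the steady incompressible Navier-Stokes equations in `Ω` in
gradient-velocity-pressure form: `L = ∇u`, `-ν ∇·L + ∇·(u ⊗ u) + ∇p = f`, `∇·u = 0` in `Ω`, `u = 0` on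
`∂Ω` and `∫_Ω p = 0`. Here `L i` is the `i`-th row of `L`, `DL i j` is the gradient of the entry
`L_ij`, `Dp` is the gradient of `p`, and
`∂_j (u_i u_j) = L_ij u_j + u_i L_jj`. -/
structure IsNSSolution (Ω : Set (E d)) (ν : ℝ) (f : E d → E d) (L : Fin d → E d → E d)
    (DL : Fin d → Fin d → E d → E d) (u : E d → E d) (p : E d → ℝ) (Dp : E d → E d) : Prop where
  u_grad : ∀ i, HasTrace Ω (fun x => u x i) (L i) 0
  L_grad : ∀ i j, HasWeakGrad Ω (fun x => L i x j) (DL i j)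
  p_grad : HasWeakGrad Ω p Dp
  momentum : ∀ᵐ x ∂(vol Ω), ∀ i,
    -ν * (∑ j, DL i j x j) + (∑ j, (L i x j * u x j + u x i * L j x j)) + Dp x i = f x i
  divergence_free : ∀ᵐ x ∂(vol Ω), ∑ i, L i x i = 0
  mean_zero : ∫ x, p x ∂(vol Ω) = 0

/-- `Lt`, `ut`, `pt` are, element by element, the boundary traces of `L`, `u` and `p`. -/
structure IsTraces (T : Mesh Ω N) (L : Fin d → E d → E d) (DL : Fin d → Fin d → E d → E d)
    (u : E d → E d) (p : E d → ℝ) (Dp : E d → E d) (Lt : Fin N → Fin d → E d → E d)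
    (ut : Fin N → E d → E d) (pt : Fin N → E d → ℝ) : Prop where
  L_trace : ∀ K i j, HasTrace (T.elem K).K (fun x => L i x j) (DL i j) (fun x => Lt K i x j)
  u_trace : ∀ K i, HasTrace (T.elem K).K (fun x => u x i) (L i) (fun x => ut K x i)
  p_trace : ∀ K, HasTrace (T.elem K).K p Dp (pt K)

/-! ### Projections and norms -/

/-- `PL`, `Pp`, `Pm` are the `L²`-projections of `L`, `p` and of the trace of `u` onto the discrete
spaces for the gradient, the (mean zero) pressure and the numerical trace, and `Pu` is the
projection of `u` onto the velocity space with
`(Pu, v)_K = (u, v)_K` for `v` in the divergences of matrix fields with rows in `V(K)`, and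
`⟨Pu, m⟩_{∂K} = ⟨u, m⟩_{∂K}` for `m` in `M_S(∂K)^d`. -/
structure IsProjection (T : Mesh Ω N) (L : Fin d → E d → E d) (u : E d → E d) (p : E d → ℝ)
    (ut : Fin N → E d → E d) (PL : T.Tensor) (Pu : Fin N → E d → E d) (Pp : Fin N → E d → ℝ)
    (Pm : E d → E d) : Prop where
  PL_mem : T.InG PL
  PL_orth : ∀ K i, ∀ t ∈ (T.elem K).V,
    ∑ j, ∫ x, (L i x j - field (PL K i) x j) * field t x j ∂(vol (T.elem K).K) = 0
  Pu_mem : T.InV Pu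
  Pu_orth : ∀ K i, ∀ t ∈ (T.elem K).V,
    ∫ x, (u x i - Pu K x i) * dvg t x ∂(vol (T.elem K).K) = 0
  Pu_trace : ∀ K i, ∀ m ∈ (T.elem K).MS,
    ∫ x, (ut K x i - Pu K x i) * m x ∂(bdry (T.elem K).K) = 0
  Pp_mem : T.InQ Pp
  Pp_orth : ∀ q, T.InQ q → ∑ K, ∫ x, (p x - Pp K x) * q K x ∂(vol (T.elem K).K) = 0
  Pm_mem : T.InM Pm
  Pm_orth : ∀ K i, ∀ m ∈ (T.elem K).M,
    ∫ x, (ut K x i - Pm x i) * m x ∂(bdry (T.elem K).K) = 0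

/-- `|(v, vhat)|_{1,K}² = ‖∇v‖_K² + h_K⁻¹ ‖v - vhat‖_{∂K}²`. -/
def seminormOneSq (K : Set (E d)) (v vhat : E d → ℝ) : ℝ :=
  (∑ j, ∫ x, (pd j v x) ^ 2 ∂(vol K))
    + (Metric.diam K)⁻¹ * ∫ x, (v x - vhat x) ^ 2 ∂(bdry K)

/-- `|(v, vhat)|_{PF,K}² = ‖v - a‖_K² + h_K ‖vhat - a‖_{∂K}²` where `a` is the average of `vhat`
over `∂K`. -/
def seminormPFSq (K : Set (E d)) (v vhat : E d → ℝ) : ℝ :=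
  (∫ x, (v x - ⨍ y, vhat y ∂(bdry K)) ^ 2 ∂(vol K))
    + Metric.diam K * ∫ x, (vhat x - ⨍ y, vhat y ∂(bdry K)) ^ 2 ∂(bdry K)

/-- `|(v, vhat)|_{0,K}² = ‖v‖_K² + h_K (‖vhat‖_{∂K}² + ‖v - vhat‖_{∂K}²)`, where `vb` is the trace
of `v` on `∂K`. -/
def normZeroSq (K : Set (E d)) (v vb vhat : E d → ℝ) : ℝ :=
  (∫ x, (v x) ^ 2 ∂(vol K))
    + Metric.diam K * ((∫ x, (vhat x) ^ 2 ∂(bdry K)) + ∫ x, (vb x - vhat x) ^ 2 ∂(bdry K))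

/-- The global norm `‖L‖` of an elementwise matrix field. -/
def tensorNorm (T : Mesh Ω N) (G : T.Tensor) : ℝ :=
  √(∑ K, ∑ i, ∫ x, ‖field (G K i) x‖ ^ 2 ∂(vol (T.elem K).K))

/-- The global norm `‖v‖` of an elementwise vector field. -/
def velocityNorm (T : Mesh Ω N) (v : Fin N → E d → E d) : ℝ :=
  √(∑ K, ∫ x, ‖v K x‖ ^ 2 ∂(vol (T.elem K).K))

/-- The global discrete `H¹`-norm. -/
def normOne (T : Mesh Ω N) (v : Fin N → E d → E d) (vhat : E d → E d) : ℝ :=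
  √(∑ i, ∑ K, seminormOneSq (T.elem K).K (fun x => v K x i) (fun x => vhat x i))

/-- The global Poincaré-Friedrichs seminorm. -/
def normPF (T : Mesh Ω N) (v : Fin N → E d → E d) (vhat : E d → E d) : ℝ :=
  √(∑ i, ∑ K, seminormPFSq (T.elem K).K (fun x => v K x i) (fun x => vhat x i))

/-- The quantity `Θ_ns`: with `δ_L = L - PL`, `δ_p = p - Pp`, `δ_u = u - Pu`, `δ_uhat = u - Pm`,
`∑_K h_K (‖ν δ_L n‖_{∂K}² + ‖δ_p‖_{∂K}²) + ‖u‖_∞² |||(δ_u, δ_uhat)|||_0²`. -/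
def thetaNS (T : Mesh Ω N) (ν : ℝ) (u : E d → E d)
    (Lt : Fin N → Fin d → E d → E d) (ut : Fin N → E d → E d) (pt : Fin N → E d → ℝ)
    (PL : T.Tensor) (Pu : Fin N → E d → E d) (Pp : Fin N → E d → ℝ) (Pm : E d → E d) : ℝ :=
  (∑ K, (T.elem K).h *
    ((∑ i, ∫ x, (ν * ((∑ j, Lt K i x j * outwardNormal (T.elem K).K x j) - ntr (PL K i) x)) ^ 2
        ∂(bdry (T.elem K).K))
      + ∫ x, (pt K x - Pp K x) ^ 2 ∂(bdry (T.elem K).K)))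
  + (eLpNorm u ⊤ (vol Ω)).toReal ^ 2 *
    ∑ i, ∑ K, normZeroSq (T.elem K).K (fun x => u x i - Pu K x i)
      (fun x => ut K x i - Pu K x i) (fun x => ut K x i - Pm x i)

end HDG

end

noncomputable section

namespace HDG

section

variable {d : ℕ}

/-! ### Local half spaces and the outward normal -/

/-- Near `x`, the set `K` is the open half space with outward unit normal `n`. -/
def HalfSpaceAt (K : Set (E d)) (n x : E d) : Prop :=
  ‖n‖ = 1 ∧ ∀ᶠ y in 𝓝 x, (y ∈ K ↔ inner ℝ n (y - x) < 0)

theorem HalfSpaceAt.eq_of_subset {K K' : Set (E d)} {n m x : E d} (h : HalfSpaceAt K n x)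
    (h' : HalfSpaceAt K' m x) (hK : K ⊆ K') : n = m := by
  obtain ⟨hn, h⟩ := h
  obtain ⟨hm, h'⟩ := h'
  by_contra hne
  have hc : inner ℝ n m < 1 := by
    refine lt_of_le_of_ne ?_ fun hh => hne ((inner_eq_one_iff_of_norm_eq_one hn hm).1 hh)
    calc inner ℝ n m ≤ ‖n‖ * ‖m‖ := real_inner_le_norm n m
      _ = 1 := by rw [hn, hm, one_mul]
  have ht : Tendsto (fun s : ℝ => x + s • (m - n)) (𝓝[>] 0) (𝓝 x) := by
    have : Tendsto (fun s : ℝ => x + s • (m - n)) (𝓝 0) (𝓝 (x + (0 : ℝ) • (m - n))) :=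
      Continuous.tendsto (by fun_prop) _
    simp only [zero_smul, add_zero] at this
    exact this.mono_left nhdsWithin_le_nhds
  obtain ⟨s, hs1, hs2, hs⟩ := ((ht.eventually h).and ((ht.eventually h').and
    self_mem_nhdsWithin)).exists
  have hs : 0 < s := hs
  have e1 : inner ℝ n (x + s • (m - n) - x) = s * (inner ℝ n m - 1) := by
    rw [add_sub_cancel_left, inner_smul_right, inner_sub_right, real_inner_self_eq_norm_sq, hn]
    ring
  have e2 : inner ℝ m (x + s • (m - n) - x) = s * (1 - inner ℝ n m) := by
    rw [add_sub_cancel_left, inner_smul_right, inner_sub_right, real_inner_self_eq_norm_sq, hm,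
      real_inner_comm]
    ring
  have h1 := hs1.2 (by rw [e1]; nlinarith)
  have h2 := hs2.1 (hK h1)
  rw [e2] at h2
  nlinarith

theorem HalfSpaceAt.unique {K : Set (E d)} {n m x : E d} (h : HalfSpaceAt K n x)
    (h' : HalfSpaceAt K m x) : n = m := h.eq_of_subset h' Subset.rfl

theorem HalfSpaceAt.outwardNormal_eq {K : Set (E d)} {n x : E d} (h : HalfSpaceAt K n x) :
    outwardNormal K x = n := by
  have hex : ∃ n : E d, ‖n‖ = 1 ∧ ∀ᶠ y in 𝓝 x, (y ∈ K ↔ inner ℝ n (y - x) < 0) := ⟨n, h⟩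
  rw [outwardNormal, dif_pos hex]
  exact HalfSpaceAt.unique (K := K) hex.choose_spec h

theorem outwardNormal_norm_le (K : Set (E d)) (x : E d) : ‖outwardNormal K x‖ ≤ 1 := by
  rw [outwardNormal]
  split_ifs with h
  · exact h.choose_spec.1.le
  · simp

theorem abs_outwardNormal_le (K : Set (E d)) (x : E d) (j : Fin d) :
    |outwardNormal K x j| ≤ 1 :=
  (PiLp.norm_apply_le (outwardNormal K x) j).trans (outwardNormal_norm_le K x)

theorem HalfSpaceAt.exists_ball {K : Set (E d)} {n x : E d} (h : HalfSpaceAt K n x) :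
    ∃ ρ > 0, ∀ y ∈ Metric.ball x ρ, (y ∈ K ↔ inner ℝ n (y - x) < 0) :=
  Metric.eventually_nhds_iff_ball.1 h.2

/-- On a ball where `K` is a half space, its frontier is the bounding hyperplane. -/
theorem mem_frontier_iff_of_ball {K : Set (E d)} {n x : E d} {ρ : ℝ} (hn : ‖n‖ = 1)
    (h : ∀ y ∈ Metric.ball x ρ, (y ∈ K ↔ inner ℝ n (y - x) < 0)) {y : E d}
    (hy : y ∈ Metric.ball x ρ) : y ∈ frontier K ↔ inner ℝ n (y - x) = 0 := by
  have hnn : inner ℝ n n = 1 := by rw [real_inner_self_eq_norm_sq, hn]; norm_num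
  have hB : Metric.ball x ρ ∈ 𝓝 y := Metric.isOpen_ball.mem_nhds hy
  have key : ∀ c : ℝ, Tendsto (fun s : ℝ => y + (c * s) • n) (𝓝[>] 0) (𝓝 y) := by
    intro c
    have : Tendsto (fun s : ℝ => y + (c * s) • n) (𝓝 0) (𝓝 (y + (c * 0 : ℝ) • n)) :=
      Continuous.tendsto (by fun_prop) _
    simp only [mul_zero, zero_smul, add_zero] at this
    exact this.mono_left nhdsWithin_le_nhds
  have hcont : Continuous fun z : E d => inner ℝ n (z - x) := by fun_prop
  rw [frontier_eq_closure_inter_closure]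
  constructor
  · rintro ⟨h1, h2⟩
    by_contra hne
    rcases lt_or_gt_of_ne hne with hlt | hgt
    · obtain ⟨z, ⟨hz1, hz2⟩, hz3⟩ := mem_closure_iff_nhds.1 h2 _
        (inter_mem hB ((hcont.isOpen_preimage _ isOpen_Iio).mem_nhds hlt))
      exact hz3 ((h z hz1).2 hz2)
    · obtain ⟨z, ⟨hz1, hz2⟩, hz3⟩ := mem_closure_iff_nhds.1 h1 _
        (inter_mem hB ((hcont.isOpen_preimage _ isOpen_Ioi).mem_nhds hgt))
      exact lt_asymm hz2 ((h z hz1).1 hz3)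
  · intro h0
    have e : ∀ c : ℝ, inner ℝ n (y + c • n - x) = c := by
      intro c
      rw [show y + c • n - x = (y - x) + c • n by abel, inner_add_right, h0, inner_smul_right, hnn]
      ring
    constructor
    · refine mem_closure_of_tendsto (key (-1)) ?_
      filter_upwards [(key (-1)).eventually hB, self_mem_nhdsWithin] with s hs (hs' : 0 < s)
      rw [h _ hs, e]; linarith
    · refine mem_closure_of_tendsto (key 1) ?_
      filter_upwards [(key 1).eventually hB, self_mem_nhdsWithin] with s hs (hs' : 0 < s)
      rw [mem_compl_iff, h _ hs, e]; linarith

/-- The half space germ is the same at nearby points of the hyperplane. -/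
theorem halfSpaceAt_of_ball {K : Set (E d)} {n x : E d} {ρ : ℝ} (hn : ‖n‖ = 1)
    (h : ∀ y ∈ Metric.ball x ρ, (y ∈ K ↔ inner ℝ n (y - x) < 0)) {y : E d}
    (hy : y ∈ Metric.ball x ρ) (hy0 : inner ℝ n (y - x) = 0) : HalfSpaceAt K n y := by
  refine ⟨hn, ?_⟩
  filter_upwards [Metric.isOpen_ball.mem_nhds hy] with z hz
  rw [h z hz, show z - x = (z - y) + (y - x) by abel, inner_add_right, hy0, add_zero]

/-- Two disjoint open sets that are half spaces near the same point, with a common bounding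
hyperplane or not, have opposite normals. -/
theorem HalfSpaceAt.eq_neg {K K' : Set (E d)} {n m x : E d} (h : HalfSpaceAt K n x)
    (h' : HalfSpaceAt K' m x) (hK : Disjoint K K') : m = -n := by
  obtain ⟨hn, h⟩ := h
  obtain ⟨hm, h'⟩ := h'
  by_contra hne
  have hc : -1 < inner ℝ n m := by
    have h1 : inner ℝ (-n) m ≤ ‖-n‖ * ‖m‖ := real_inner_le_norm _ _
    rw [norm_neg, hn, hm, inner_neg_left (𝕜 := ℝ)] at h1
    refine lt_of_le_of_ne (by linarith) fun hh => hne ?_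
    refine ((inner_eq_one_iff_of_norm_eq_one (𝕜 := ℝ) (by rwa [norm_neg]) hm).1 ?_).symm
    rw [inner_neg_left (𝕜 := ℝ), ← hh]; norm_num
  have ht : Tendsto (fun s : ℝ => x - s • (m + n)) (𝓝[>] 0) (𝓝 x) := by
    have : Tendsto (fun s : ℝ => x - s • (m + n)) (𝓝 0) (𝓝 (x - (0 : ℝ) • (m + n))) :=
      Continuous.tendsto (by fun_prop) _
    simp only [zero_smul, sub_zero] at this
    exact this.mono_left nhdsWithin_le_nhds
  obtain ⟨s, hs1, hs2, hs⟩ := ((ht.eventually h).and ((ht.eventually h').and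
    self_mem_nhdsWithin)).exists
  have hs : 0 < s := hs
  have e1 : inner ℝ n (x - s • (m + n) - x) = - (s * (inner ℝ n m + 1)) := by
    rw [sub_sub_cancel_left, inner_neg_right (𝕜 := ℝ), inner_smul_right, inner_add_right,
      real_inner_self_eq_norm_sq, hn]
    ring
  have e2 : inner ℝ m (x - s • (m + n) - x) = - (s * (1 + inner ℝ n m)) := by
    rw [sub_sub_cancel_left, inner_neg_right (𝕜 := ℝ), inner_smul_right, inner_add_right,
      real_inner_self_eq_norm_sq, hm, real_inner_comm]
    ring
  exact Set.disjoint_left.1 hK (hs1.2 (by rw [e1]; nlinarith)) (hs2.2 (by rw [e2]; nlinarith))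

/-! ### Hyperplanes -/

/-- The hyperplane through `p` with normal `n`. -/
def hyper (n p : E d) : Set (E d) := {x | inner ℝ n (x - p) = 0}

/-- The surface measure. -/
abbrev sig (d : ℕ) : Measure (E d) := μHE[d - 1]

/-- Euclidean coordinates with respect to a unit vector `n` and an origin `p`. -/
def slab {V : Type*} [NormedAddCommGroup V] [InnerProductSpace ℝ V] (n p : V) (q : ℝ × (ℝ ∙ n)ᗮ) : V := p + q.1 • n + (q.2 : V)

theorem slab_inner {V : Type*} [NormedAddCommGroup V] [InnerProductSpace ℝ V] {n p : V} (hn : ‖n‖ = 1) (q : ℝ × (ℝ ∙ n)ᗮ) :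
    inner ℝ n (slab n p q - p) = q.1 := by
  have h0 : inner ℝ n (q.2 : V) = 0 := Submodule.mem_orthogonal_singleton_iff_inner_right.1 q.2.2
  rw [slab, show p + q.1 • n + (q.2 : V) - p = q.1 • n + (q.2 : V) by abel, inner_add_right, h0,
    inner_smul_right, real_inner_self_eq_norm_sq, hn]
  ring

theorem slab_measurePreserving {V : Type*} [NormedAddCommGroup V] [InnerProductSpace ℝ V]
    [FiniteDimensional ℝ V] [MeasurableSpace V] [BorelSpace V] {n : V} (hn : ‖n‖ = 1) (p : V) :
    MeasurePreserving (slab n p) volume volume ∧ MeasurableEmbedding (slab n p) := by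
  let e := ((ℝ ∙ n).measurableEquivProd p).symm
  let f := (LinearIsometryEquiv.toSpanUnitSingleton (𝕜 := ℝ) n hn)
  let g : ℝ × (ℝ ∙ n)ᗮ ≃ᵐ (ℝ ∙ n) × (ℝ ∙ n)ᗮ :=
    f.toHomeomorph.toMeasurableEquiv.prodCongr (MeasurableEquiv.refl _)
  have hslab : slab n p = e ∘ g := by
    ext1 q
    rw [Function.comp_apply, Submodule.measurableEquivProd_symm_apply]
    change _ = ((f q.1 : V) + (q.2 : V)) + p
    rw [slab]
    have : (f q.1 : V) = q.1 • n := rfl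
    rw [this]; abel
  have hg : MeasurePreserving g volume volume := f.measurePreserving.prod (MeasurePreserving.id _)
  have he : MeasurePreserving e volume volume := by
    have := ((ℝ ∙ n).measurePreserving_measurableEquivProd p).symm
    rwa [InnerProductSpace.euclideanHausdorffMeasure_eq_volume] at this
  rw [hslab]
  exact ⟨he.comp hg, e.measurableEmbedding.comp g.measurableEmbedding⟩

theorem finrank_orth {n : E d} (hn : ‖n‖ = 1) : Module.finrank ℝ (ℝ ∙ n)ᗮ = d - 1 := by
  have hn0 : n ≠ 0 := by rintro rfl; simp at hn
  have h1 := (ℝ ∙ n).finrank_add_finrank_orthogonal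
  rw [finrank_span_singleton hn0, finrank_euclideanSpace_fin] at h1
  omega

theorem slab_zero_isometry (n p : E d) : Isometry fun y : (ℝ ∙ n)ᗮ => slab n p (0, y) := by
  refine Isometry.of_dist_eq fun y z => ?_
  simp [slab, dist_eq_norm]

theorem range_slab_zero {n : E d} (hn : ‖n‖ = 1) (p : E d) :
    range (fun y : (ℝ ∙ n)ᗮ => slab n p (0, y)) = hyper n p := by
  ext x
  constructor
  · rintro ⟨y, rfl⟩
    exact slab_inner hn _
  · intro hx
    refine ⟨⟨x - p, Submodule.mem_orthogonal_singleton_iff_inner_right.2 hx⟩, ?_⟩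
    simp [slab]

/-- The surface measure on a hyperplane is Lebesgue measure in Euclidean coordinates. -/
theorem map_slab_zero {n : E d} (hn : ‖n‖ = 1) (p : E d) :
    Measure.map (fun y : (ℝ ∙ n)ᗮ => slab n p (0, y)) volume = (sig d).restrict (hyper n p) := by
  rw [← range_slab_zero hn p, ← (slab_zero_isometry n p).map_euclideanHausdorffMeasure,
    ← finrank_orth hn, InnerProductSpace.euclideanHausdorffMeasure_eq_volume]

theorem isClosed_hyper (n p : E d) : IsClosed (hyper n p) :=
  isClosed_eq (by fun_prop) continuous_const

theorem sig_hyper_preimage {n : E d} (hn : ‖n‖ = 1) (p : E d) {s : Set (E d)} (hs : MeasurableSet s) :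
    sig d (s ∩ hyper n p) = volume ((fun y : (ℝ ∙ n)ᗮ => slab n p (0, y)) ⁻¹' s) := by
  rw [← Measure.restrict_apply hs, ← map_slab_zero hn p, Measure.map_apply
    (slab_zero_isometry n p).continuous.measurable hs]

theorem sig_hyper_lt_top {n : E d} (hn : ‖n‖ = 1) (p : E d) {s : Set (E d)}
    (hs : Bornology.IsBounded s) : sig d (s ∩ hyper n p) < ⊤ := by
  have h1 : s ∩ hyper n p ⊆ closure s ∩ hyper n p := inter_subset_inter_left _ subset_closure
  refine (measure_mono h1).trans_lt ?_
  rw [sig_hyper_preimage hn p isClosed_closure.measurableSet]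
  exact ((slab_zero_isometry n p).antilipschitz.isBounded_preimage hs.closure).measure_lt_top

theorem sig_hyper_pos {n : E d} (hn : ‖n‖ = 1) (p : E d) {U : Set (E d)} (hU : IsOpen U)
    (hne : (U ∩ hyper n p).Nonempty) : 0 < sig d (U ∩ hyper n p) := by
  rw [sig_hyper_preimage hn p hU.measurableSet]
  refine (hU.preimage (slab_zero_isometry n p).continuous).measure_pos _ ?_
  obtain ⟨x, hx, hx'⟩ := hne
  rw [← range_slab_zero hn p] at hx'
  obtain ⟨y, rfl⟩ := hx'
  exact ⟨y, hx⟩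

/-- Two hyperplanes that are not parallel meet in a set of surface measure zero. -/
theorem sig_hyper_inter {n m : E d} (hn : ‖n‖ = 1) (p q : E d) (hm : ∀ c : ℝ, m ≠ c • n) :
    sig d (hyper m q ∩ hyper n p) = 0 := by
  rw [sig_hyper_preimage hn p (isClosed_hyper m q).measurableSet]
  let S : Submodule ℝ (ℝ ∙ n)ᗮ := LinearMap.ker ((innerₛₗ ℝ m).comp (Submodule.subtype _))
  have hS : S ≠ ⊤ := by
    intro h
    have hmem : m ∈ ((ℝ ∙ n)ᗮ)ᗮ := by
      rw [Submodule.mem_orthogonal]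
      intro u hu
      have : (⟨u, hu⟩ : (ℝ ∙ n)ᗮ) ∈ S := by rw [h]; trivial
      rw [real_inner_comm]
      exact this
    rw [Submodule.orthogonal_orthogonal, Submodule.mem_span_singleton] at hmem
    obtain ⟨c, hc⟩ := hmem
    exact hm c hc.symm
  rcases (fun y : (ℝ ∙ n)ᗮ => slab n p (0, y)) ⁻¹' hyper m q |>.eq_empty_or_nonempty with h0 | ⟨y, hy⟩
  · rw [h0, measure_empty]
  · have : (fun y : (ℝ ∙ n)ᗮ => slab n p (0, y)) ⁻¹' hyper m q = (fun z => z - y) ⁻¹' (S : Set (ℝ ∙ n)ᗮ) := by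
      ext z
      have hy' : inner ℝ m (slab n p (0, y) - q) = 0 := hy
      change inner ℝ m (slab n p (0, z) - q) = 0 ↔ inner ℝ m ((z - y : (ℝ ∙ n)ᗮ) : E d) = 0
      have : slab n p (0, z) - q = (slab n p (0, y) - q) + ((z - y : (ℝ ∙ n)ᗮ) : E d) := by
        simp only [slab, zero_smul, add_zero, AddSubgroupClass.coe_sub]; abel
      rw [this, inner_add_right, hy', zero_add]
    simp_rw [sub_eq_add_neg] at this
    rw [this, measure_preimage_add_right]
    exact Measure.addHaar_submodule _ _ hS

end

section

variable {d : ℕ}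

theorem halfSpace_preimage {n : E d} (hn : ‖n‖ = 1) (p : E d) :
    slab n p ⁻¹' {x | inner ℝ n (x - p) < 0} = Iio 0 ×ˢ univ := by
  ext q
  simp [slab_inner hn q]

theorem setIntegral_halfSpace {n : E d} (hn : ‖n‖ = 1) (p : E d) (f : E d → ℝ) :
    ∫ x in {x | inner ℝ n (x - p) < 0}, f x
      = ∫ q, f (slab n p q) ∂(((volume : Measure ℝ).restrict (Iio 0)).prod volume) := by
  obtain ⟨h1, h2⟩ := slab_measurePreserving hn p
  rw [← h1.setIntegral_preimage_emb h2, halfSpace_preimage hn, Measure.volume_eq_prod,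
    ← Measure.prod_restrict, Measure.restrict_univ]

/-- The divergence theorem on a half space, for compactly supported functions. -/
theorem halfSpace_divergence {n : E d} (hn : ‖n‖ = 1) (p : E d) {φ : E d → ℝ} (hφ : ContDiff ℝ 1 φ)
    (hc : HasCompactSupport φ) (v : E d) :
    ∫ x in {x | inner ℝ n (x - p) < 0}, fderiv ℝ φ x v
      = inner ℝ n v * ∫ x, φ x ∂((sig d).restrict (hyper n p)) := by
  obtain ⟨hmp, hemb⟩ := slab_measurePreserving hn p
  have hint : ∀ v : E d, Integrable (fun q => fderiv ℝ φ (slab n p q) v)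
      (((volume : Measure ℝ).restrict (Iio 0)).prod (volume : Measure (ℝ ∙ n)ᗮ)) := by
    intro v
    have h1 : Integrable (fun x => fderiv ℝ φ x v) := by
      refine Continuous.integrable_of_hasCompactSupport ?_ ?_
      · exact (hφ.continuous_fderiv one_ne_zero).clm_apply continuous_const
      · exact hc.fderiv_apply (𝕜 := ℝ) v
    have h2 := (hmp.integrable_comp_emb hemb).2 h1
    rw [Measure.volume_eq_prod] at h2
    exact h2.mono_measure (Measure.prod_mono Measure.restrict_le_self le_rfl)
  have hdiff : Differentiable ℝ φ := hφ.differentiable one_ne_zero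
  -- tangential directions
  have htan : ∀ w : (ℝ ∙ n)ᗮ, ∫ x in {x | inner ℝ n (x - p) < 0}, fderiv ℝ φ x w = 0 := by
    intro w
    rw [setIntegral_halfSpace hn, integral_prod _ (hint w)]
    have : ∀ t : ℝ, ∫ y : (ℝ ∙ n)ᗮ, fderiv ℝ φ (slab n p (t, y)) w = 0 := by
      intro t
      let A : (ℝ ∙ n)ᗮ → E d := fun y => slab n p (t, y)
      have hAd : ∀ y, HasFDerivAt A ((ℝ ∙ n)ᗮ.subtypeL) y := by
        intro y
        exact (((ℝ ∙ n)ᗮ.subtypeL).hasFDerivAt).const_add (p + t • n)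
      have hder : ∀ y, HasFDerivAt (φ ∘ A) ((fderiv ℝ φ (A y)).comp ((ℝ ∙ n)ᗮ.subtypeL)) y :=
        fun y => (hdiff (A y)).hasFDerivAt.comp y (hAd y)
      have hAiso : Isometry A := Isometry.of_dist_eq fun y z => by
        simp [A, slab, dist_eq_norm]
      have hgc : HasCompactSupport (φ ∘ A) :=
        hc.comp_isClosedEmbedding hAiso.isClosedEmbedding
      have hcont : Continuous (φ ∘ A) := hφ.continuous.comp hAiso.continuous
      have hI : Integrable (φ ∘ A) := hcont.integrable_of_hasCompactSupport hgc
      have hI' : Integrable (fun y => fderiv ℝ φ (A y) w) := by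
        refine Continuous.integrable_of_hasCompactSupport ?_ ?_
        · exact ((hφ.continuous_fderiv one_ne_zero).comp hAiso.continuous).clm_apply
            continuous_const
        · exact (hc.fderiv_apply (𝕜 := ℝ) (w : E d)).comp_isClosedEmbedding hAiso.isClosedEmbedding
      have := integral_bilinear_hasFDerivAt_right_eq_neg_left_of_integrable
        (μ := (volume : Measure (ℝ ∙ n)ᗮ))
        (f := fun _ => (1 : ℝ)) (f' := fun _ => 0) (g := φ ∘ A)
        (g' := fun y => (fderiv ℝ φ (A y)).comp ((ℝ ∙ n)ᗮ.subtypeL)) (v := w)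
        (B := ContinuousLinearMap.mul ℝ ℝ) (by simp) (by simpa using hI')
        (by simpa [Function.comp_def] using hI)
        (fun x _ => hasFDerivAt_const _ _) (fun x _ => hder x)
      simpa using this
    simp [this]
  -- the normal direction
  have hnor : ∫ x in {x | inner ℝ n (x - p) < 0}, fderiv ℝ φ x n
      = ∫ x, φ x ∂((sig d).restrict (hyper n p)) := by
    rw [setIntegral_halfSpace hn, integral_prod_symm _ (hint n), ← map_slab_zero hn p,
      (slab_zero_isometry n p).isClosedEmbedding.measurableEmbedding.integral_map]
    refine integral_congr_ae (Eventually.of_forall fun y => ?_)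
    have hAiso : Isometry fun t : ℝ => slab n p (t, y) := Isometry.of_dist_eq fun s t => by
      have e : slab n p (s, y) - slab n p (t, y) = (s - t) • n := by
        simp only [slab, sub_smul]; abel
      rw [dist_eq_norm, e, norm_smul, hn, mul_one, Real.dist_eq, Real.norm_eq_abs]
    have hder : ∀ t : ℝ, HasDerivAt (fun t => φ (slab n p (t, y))) (fderiv ℝ φ (slab n p (t, y)) n) t := by
      intro t
      have h1 : HasDerivAt (fun t : ℝ => slab n p (t, y)) n t := by
        have := (((hasDerivAt_id t).smul_const n).const_add p).add_const (y : E d)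
        simpa [slab] using this
      exact (hdiff _).hasFDerivAt.comp_hasDerivAt t h1
    have hgc : HasCompactSupport (fun t : ℝ => φ (slab n p (t, y))) :=
      hc.comp_isClosedEmbedding hAiso.isClosedEmbedding
    have hI' : Integrable (fun t : ℝ => fderiv ℝ φ (slab n p (t, y)) n) := by
      refine Continuous.integrable_of_hasCompactSupport ?_ ?_
      · exact ((hφ.continuous_fderiv one_ne_zero).comp hAiso.continuous).clm_apply
          continuous_const
      · exact (hc.fderiv_apply (𝕜 := ℝ) n).comp_isClosedEmbedding hAiso.isClosedEmbedding
    change ∫ t in Iio 0, fderiv ℝ φ (slab n p (t, y)) n = φ (slab n p (0, y))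
    rw [← integral_Iic_eq_integral_Iio,
      integral_Iic_of_hasDerivAt_of_tendsto' (fun t _ => hder t) hI'.integrableOn
        (m := 0), sub_zero]
    have := hgc.is_zero_at_infty
    rw [cocompact_eq_atBot_atTop] at this
    exact this.mono_left le_sup_left
  have hv : v = (inner ℝ n v) • n + ((⟨v - (inner ℝ n v) • n,
      Submodule.mem_orthogonal_singleton_iff_inner_right.2 (by
        rw [inner_sub_right, inner_smul_right, real_inner_self_eq_norm_sq, hn]; ring)⟩ : (ℝ ∙ n)ᗮ) : E d) := by
    simp
  set w : (ℝ ∙ n)ᗮ := (⟨v - (inner ℝ n v) • n, _⟩ : (ℝ ∙ n)ᗮ)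
  have hi2 : ∀ v : E d, IntegrableOn (fun x => fderiv ℝ φ x v) {x | inner ℝ n (x - p) < 0} := by
    intro v
    refine Integrable.integrableOn (Continuous.integrable_of_hasCompactSupport ?_ ?_)
    · exact (hφ.continuous_fderiv one_ne_zero).clm_apply continuous_const
    · exact hc.fderiv_apply (𝕜 := ℝ) v
  have : ∀ x, fderiv ℝ φ x v = inner ℝ n v * fderiv ℝ φ x n + fderiv ℝ φ x w := by
    intro x
    conv_lhs => rw [hv]
    rw [map_add, map_smul, smul_eq_mul]
  simp_rw [this]
  rw [integral_add ((hi2 n).const_mul _) (hi2 w), htan w, integral_const_mul, hnor, add_zero]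

end

section

variable {d : ℕ}

variable {K : Set (E d)} {faces : Finset (Set (E d))}

theorem inner_sub_base {n x : E d} {a : ℝ} (h : inner ℝ n x = a) (y : E d) :
    inner ℝ n (y - x) = inner ℝ n y - a := by rw [inner_sub_right, h]

theorem IsPolyhedral.exists_normal (hK : IsPolyhedral K faces) {F : Set (E d)} (hF : F ∈ faces) :
    ∃ n : E d, ‖n‖ = 1 ∧ (∀ x ∈ F, HalfSpaceAt K n x) ∧
      ∃ U : Set (E d), IsOpen U ∧ ∀ x ∈ F, F = U ∩ hyper n x := by
  obtain ⟨n, a, hn, ⟨U, hU, hFU⟩, hloc⟩ := hK.face_flat F hF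
  have hmem : ∀ x ∈ F, inner ℝ n x = a := fun x hx => by rw [hFU] at hx; exact hx.2
  refine ⟨n, hn, fun x hx => ⟨hn, ?_⟩, U, hU, fun x hx => ?_⟩
  · filter_upwards [hloc x hx] with y hy
    rw [hy, inner_sub_base (hmem x hx), sub_neg]
  · rw [hFU]
    ext y
    simp only [mem_inter_iff, mem_ofPred_eq, hyper, inner_sub_base (hmem x hx), sub_eq_zero]

theorem IsPolyhedral.measurableSet_face (hK : IsPolyhedral K faces) {F : Set (E d)}
    (hF : F ∈ faces) : MeasurableSet F := by
  obtain ⟨n, -, -, U, hU, h⟩ := hK.exists_normal hF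
  obtain ⟨x, hx⟩ := hK.face_nonempty F hF
  rw [h x hx]
  exact hU.measurableSet.inter (isClosed_hyper n x).measurableSet

theorem IsPolyhedral.face_subset (hK : IsPolyhedral K faces) {F : Set (E d)}
    (hF : F ∈ faces) : F ⊆ frontier K := by
  rw [hK.frontier_eq]
  exact subset_closure.trans (subset_biUnion_of_mem (u := fun F => closure F) hF)

theorem IsPolyhedral.isBounded_frontier (hK : IsPolyhedral K faces) :
    Bornology.IsBounded (frontier K) := hK.isBounded.closure.subset frontier_subset_closure

theorem IsPolyhedral.isFiniteMeasure_bdry (hK : IsPolyhedral K faces) :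
    IsFiniteMeasure (bdry K) := by
  constructor
  rw [bdry, Measure.restrict_apply_univ]
  have hb := hK.isBounded_frontier
  rw [hK.frontier_eq]
  refine (measure_biUnion_finset_le _ _).trans_lt (ENNReal.sum_lt_top.2 fun F hF => ?_)
  obtain ⟨n, hn, -, U, hU, h⟩ := hK.exists_normal hF
  obtain ⟨x, hx⟩ := hK.face_nonempty F hF
  have h1 : F ⊆ hyper n x := by
    conv_lhs => rw [h x hx]
    exact inter_subset_right
  have h2 : closure F ⊆ closure F ∩ hyper n x :=
    subset_inter Subset.rfl (closure_minimal h1 (isClosed_hyper n x))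
  refine (measure_mono h2).trans_lt (sig_hyper_lt_top hn x ?_)
  exact (hb.subset (hK.face_subset hF)).closure

theorem IsPolyhedral.isFiniteMeasure_vol (hK : IsPolyhedral K faces) :
    IsFiniteMeasure (vol K) :=
  ⟨by rw [vol, Measure.restrict_apply_univ]; exact hK.isBounded.measure_lt_top⟩

theorem IsPolyhedral.ae_face (hK : IsPolyhedral K faces) :
    ∀ᵐ x ∂(bdry K), ∃ F ∈ faces, x ∈ F := by
  have h0 : sig d (⋃ F ∈ faces, closure F \ F) = 0 :=
    (measure_biUnion_null_iff faces.countable_toSet).2 fun F hF => hK.face_null F hF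
  rw [bdry]
  rw [ae_restrict_iff' isClosed_frontier.measurableSet]
  filter_upwards [measure_eq_zero_iff_ae_notMem.1 h0] with x hx hxK
  rw [hK.frontier_eq] at hxK
  simp only [mem_iUnion] at hxK hx
  obtain ⟨F, hF, hxF⟩ := hxK
  by_contra hcon
  push Not at hcon
  exact hx ⟨F, hF, hxF, hcon F hF⟩

theorem IsPolyhedral.halfSpaceAt (hK : IsPolyhedral K faces) {F : Set (E d)} (hF : F ∈ faces)
    {x : E d} (hx : x ∈ F) : HalfSpaceAt K (outwardNormal K x) x := by
  obtain ⟨n, -, h, -⟩ := hK.exists_normal hF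
  rw [(h x hx).outwardNormal_eq]
  exact h x hx

theorem IsPolyhedral.ae_halfSpaceAt (hK : IsPolyhedral K faces) :
    ∀ᵐ x ∂(bdry K), HalfSpaceAt K (outwardNormal K x) x := by
  filter_upwards [hK.ae_face] with x ⟨F, hF, hx⟩
  exact hK.halfSpaceAt hF hx

theorem ae_bdry_mem_frontier (K : Set (E d)) : ∀ᵐ x ∂(bdry K), x ∈ frontier K :=
  ae_restrict_mem isClosed_frontier.measurableSet

theorem IsPolyhedral.bdry_face_pos (hK : IsPolyhedral K faces) {F : Set (E d)} (hF : F ∈ faces) :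
    0 < bdry K F := by
  rw [bdry, Measure.restrict_apply (hK.measurableSet_face hF), inter_eq_left.2 (hK.face_subset hF)]
  obtain ⟨n, hn, -, U, hU, h⟩ := hK.exists_normal hF
  obtain ⟨x, hx⟩ := hK.face_nonempty F hF
  have h1 := h x hx
  rw [h1]
  exact sig_hyper_pos hn x hU (by rw [← h1]; exact ⟨x, hx⟩)

theorem IsPolyhedral.nonempty (hK : IsPolyhedral K faces) : K.Nonempty := hK.isConnected.nonempty

theorem IsPolyhedral.frontier_nonempty (hK : IsPolyhedral K faces) (hd : 0 < d) :
    (frontier K).Nonempty := by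
  have : Nonempty (Fin d) := ⟨⟨0, hd⟩⟩
  refine nonempty_frontier_iff.2 ⟨hK.nonempty, ?_⟩
  rintro rfl
  exact NormedSpace.unbounded_univ ℝ (E d) hK.isBounded

theorem IsPolyhedral.faces_nonempty (hK : IsPolyhedral K faces) (hd : 0 < d) :
    ∃ F, F ∈ faces := by
  obtain ⟨x, hx⟩ := hK.frontier_nonempty hd
  rw [hK.frontier_eq] at hx
  simp only [mem_iUnion] at hx
  obtain ⟨F, hF, -⟩ := hx
  exact ⟨F, hF⟩

theorem IsPolyhedral.bdry_ne_zero (hK : IsPolyhedral K faces) (hd : 0 < d) : bdry K ≠ 0 := by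
  obtain ⟨F, hF⟩ := hK.faces_nonempty hd
  intro h
  have := hK.bdry_face_pos hF
  simp [h] at this

theorem IsPolyhedral.diam_pos (hK : IsPolyhedral K faces) (hd : 0 < d) : 0 < Metric.diam K := by
  have : Nonempty (Fin d) := ⟨⟨0, hd⟩⟩
  obtain ⟨x, hx⟩ := hK.nonempty
  obtain ⟨ρ, hρ, hb⟩ := Metric.isOpen_iff.1 hK.isOpen x hx
  have hnt : (Metric.ball x ρ).Nontrivial := by
    refine ⟨x, Metric.mem_ball_self hρ, x + (ρ / 2) • EuclideanSpace.single ⟨0, hd⟩ 1, ?_, ?_⟩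
    · rw [Metric.mem_ball, dist_eq_norm, add_sub_cancel_left, norm_smul]
      simp [abs_of_pos hρ]
      linarith
    · intro h
      have := congrArg (fun y => y ⟨0, hd⟩) h
      simp at this
      linarith
  exact Metric.diam_pos (hnt.mono hb) hK.isBounded

open Classical in
/-- Multiplication by a component of the outward normal is, up to a null set, a linear combination of
restrictions to faces. -/
theorem IsPolyhedral.exists_faceNormal (hK : IsPolyhedral K faces) :
    ∃ nF : Set (E d) → E d, ∀ (g : E d → ℝ) (j : Fin d),
      (fun x => outwardNormal K x j * g x) =ᵐ[bdry K]
        fun x => ∑ F ∈ faces, nF F j * F.indicator g x := by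
  have hex : ∀ F, ∃ n : E d, F ∈ faces → ∀ x ∈ F, outwardNormal K x = n := by
    intro F
    by_cases hF : F ∈ faces
    · obtain ⟨n, -, h, -⟩ := hK.exists_normal hF
      exact ⟨n, fun _ x hx => (h x hx).outwardNormal_eq⟩
    · exact ⟨0, fun h => absurd h hF⟩
  choose nF hnF using hex
  refine ⟨nF, fun g j => ?_⟩
  filter_upwards [hK.ae_face] with x ⟨F, hF, hx⟩
  rw [Finset.sum_eq_single F]
  · rw [indicator_of_mem hx, hnF F hF x hx]
  · intro F' hF' hne
    rw [indicator_of_notMem, mul_zero]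
    exact fun hx' => Set.disjoint_left.1 (hK.face_disjoint F' hF' F hF hne) hx' hx
  · exact fun h => absurd hF h

theorem IsPolyhedral.aestronglyMeasurable_normal (hK : IsPolyhedral K faces) (j : Fin d) :
    AEStronglyMeasurable (fun x => outwardNormal K x j) (bdry K) := by
  obtain ⟨nF, h⟩ := hK.exists_faceNormal
  have h1 := h (fun _ => 1) j
  simp only [mul_one] at h1
  refine AEStronglyMeasurable.congr ?_ h1.symm
  refine Finset.aestronglyMeasurable_fun_sum _ fun F hF => ?_
  exact ((aestronglyMeasurable_const (b := (1:ℝ))).indicator (hK.measurableSet_face hF)).const_mul _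

theorem IsPolyhedral.memLp_top_normal (hK : IsPolyhedral K faces) (j : Fin d) :
    MemLp (fun x => outwardNormal K x j) ⊤ (bdry K) :=
  memLp_top_of_bound (hK.aestronglyMeasurable_normal j) 1
    (Eventually.of_forall fun x => abs_outwardNormal_le K x j)

theorem inner_eq_sum (v w : E d) : inner ℝ v w = ∑ j, v j * w j := by
  simp [PiLp.inner_apply, mul_comm]

theorem memLp_component {α : Type*} [MeasurableSpace α] {μ : Measure α} {p : ENNReal} {v : α → E d}
    (h : MemLp v p μ) (j : Fin d) : MemLp (fun x => v x j) p μ :=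
  (EuclideanSpace.proj j : E d →L[ℝ] ℝ).comp_memLp' h

end

section

variable {d : ℕ}

theorem fderiv_eq_sum_pd (f : E d → ℝ) (x v : E d) : fderiv ℝ f x v = ∑ j, v j * pd j f x := by
  have hv : v = ∑ j, v j • (EuclideanSpace.single j (1 : ℝ) : E d) := by
    ext i
    simp [Finset.sum_apply, Pi.single_apply]
  conv_lhs => rw [hv]
  simp [map_sum, pd]

theorem pd_mul {f g : E d → ℝ} {x : E d} (hf : DifferentiableAt ℝ f x) (hg : DifferentiableAt ℝ g x)
    (j : Fin d) : pd j (fun y => f y * g y) x = f x * pd j g x + g x * pd j f x := by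
  simp [pd, fderiv_fun_mul hf hg]

theorem contDiff_pd {f : E d → ℝ} (hf : ContDiff ℝ ∞ f) (j : Fin d) : ContDiff ℝ ∞ (pd j f) :=
  (hf.fderiv_right (m := ∞) (by simp)).clm_apply contDiff_const

theorem smooth_differentiable {f : E d → ℝ} (hf : ContDiff ℝ ∞ f) : Differentiable ℝ f :=
  hf.differentiable (by simp)

theorem hasCompactSupport_pd {f : E d → ℝ} (hf : HasCompactSupport f) (j : Fin d) :
    HasCompactSupport (pd j f) := hf.fderiv_apply (𝕜 := ℝ) _

theorem pd_eq_zero_of_notMem_tsupport {f : E d → ℝ} {x : E d} (h : x ∉ tsupport f) (j : Fin d) :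
    pd j f x = 0 := by
  have : fderiv ℝ f x = 0 := by
    by_contra hne
    exact h (support_fderiv_subset ℝ hne)
  simp [pd, this]

theorem integral_pd_eq_zero {f : E d → ℝ} (hf : ContDiff ℝ ∞ f) (hc : HasCompactSupport f)
    (j : Fin d) : ∫ x, pd j f x = 0 := by
  have h1 : Integrable (pd j f) :=
    (contDiff_pd hf j).continuous.integrable_of_hasCompactSupport (hasCompactSupport_pd hc j)
  have h2 : Integrable f := hf.continuous.integrable_of_hasCompactSupport hc
  have := integral_bilinear_hasFDerivAt_right_eq_neg_left_of_integrable
        (μ := (volume : Measure (E d)))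
        (f := fun _ => (1 : ℝ)) (f' := fun _ => 0) (g := f)
        (g' := fun y => fderiv ℝ f y) (v := EuclideanSpace.single j 1)
        (B := ContinuousLinearMap.mul ℝ ℝ) (by simp) (by simpa using! h1)
        (by simpa using h2)
        (fun x _ => hasFDerivAt_const _ _) (fun x _ => (smooth_differentiable hf x).hasFDerivAt)
  simpa using! this

/-- The divergence theorem on `K`, for smooth functions. -/
def DivergenceTheorem (K : Set (E d)) : Prop :=
  ∀ φ : E d → ℝ, ContDiff ℝ ∞ φ → ∀ j,
    ∫ x, pd j φ x ∂(vol K) = ∫ x, outwardNormal K x j * φ x ∂(bdry K)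

variable {K : Set (E d)} {faces : Finset (Set (E d))}

/-- Localized form of the divergence theorem near a boundary point where `K` is a half space. -/
theorem divergence_of_ball {n x : E d} {ρ : ℝ} (hn : ‖n‖ = 1)
    (h : ∀ y ∈ Metric.ball x ρ, (y ∈ K ↔ inner ℝ n (y - x) < 0)) (hKo : IsOpen K)
    {φ : E d → ℝ} (hφ : ContDiff ℝ ∞ φ) (hc : HasCompactSupport φ)
    (hs : tsupport φ ⊆ Metric.ball x ρ) (j : Fin d) :
    ∫ y, pd j φ y ∂(vol K) = ∫ y, outwardNormal K y j * φ y ∂(bdry K) := by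
  have h1 := halfSpace_divergence hn x (hφ.of_le (by simp)) hc (EuclideanSpace.single j 1)
  have hnj : inner ℝ n (EuclideanSpace.single j (1:ℝ)) = n j := by simp [inner_eq_sum]
  have hout : ∀ y, y ∉ Metric.ball x ρ → φ y = 0 := fun y hy =>
    image_eq_zero_of_notMem_tsupport fun hh => hy (hs hh)
  have hout' : ∀ y, y ∉ Metric.ball x ρ → pd j φ y = 0 := fun y hy =>
    pd_eq_zero_of_notMem_tsupport (fun hh => hy (hs hh)) j
  have hmeas : MeasurableSet {y | inner ℝ n (y - x) < 0} :=
    (isOpen_lt (by fun_prop) continuous_const).measurableSet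
  have e1 : ∫ y, pd j φ y ∂(vol K) = ∫ y in {y | inner ℝ n (y - x) < 0}, pd j φ y := by
    rw [vol, ← integral_indicator hKo.measurableSet, ← integral_indicator hmeas]
    congr 1
    ext y
    by_cases hy : y ∈ Metric.ball x ρ
    · simp only [indicator, h y hy, mem_ofPred_eq]
    · simp only [indicator, hout' y hy, ite_self]
  have e2 : ∫ y, outwardNormal K y j * φ y ∂(bdry K)
      = ∫ y, n j * φ y ∂((sig d).restrict (hyper n x)) := by
    rw [bdry, ← integral_indicator isClosed_frontier.measurableSet,
      ← integral_indicator (isClosed_hyper n x).measurableSet]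
    congr 1
    ext y
    by_cases hy : y ∈ Metric.ball x ρ
    · have hf := mem_frontier_iff_of_ball hn h hy
      by_cases hy0 : inner ℝ n (y - x) = 0
      · rw [indicator_of_mem (hf.2 hy0), indicator_of_mem (show y ∈ hyper n x from hy0),
          (halfSpaceAt_of_ball hn h hy hy0).outwardNormal_eq]
      · rw [indicator_of_notMem (fun hh => hy0 (hf.1 hh)),
          indicator_of_notMem (fun hh : y ∈ hyper n x => hy0 hh)]
    · simp only [indicator, hout y hy, mul_zero, ite_self]
  rw [e1, e2, integral_const_mul, ← hnj]
  exact h1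

theorem divergenceTheorem_of_flux (hK : IsPolyhedral K faces)
    (h : ∀ j, ∃ t : Flux K, IsHdiv t ∧
      field t =ᵐ[vol K] fun _ => (EuclideanSpace.single j 1 : E d)) : DivergenceTheorem K := by
  have := hK.isFiniteMeasure_bdry
  have := hK.isFiniteMeasure_vol
  intro φ hφ j
  obtain ⟨t, ht, hfield⟩ := h j
  have hsum : ∀ φ : E d → ℝ, ∑ i, ∫ x, field t x i * pd i φ x ∂(vol K) = ∫ x, pd j φ x ∂(vol K) := by
    intro φ
    rw [Finset.sum_eq_single j]
    · refine integral_congr_ae ?_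
      filter_upwards [hfield] with x hx
      simp [hx]
    · intro i _ hij
      rw [integral_eq_zero_of_ae]
      filter_upwards [hfield] with x hx
      simp [hx, hij]
    · simp
  have hδ : ∀ᵐ x ∂(vol K), dvg t x = 0 := by
    have hδi : Integrable (dvg t) (vol K) := (Lp.memLp t.2.1).integrable (by norm_num)
    have h1 := hK.isOpen.ae_eq_zero_of_integral_contDiff_smul_eq_zero
      (hδi.locallyIntegrable.locallyIntegrableOn K) (fun φ hφ hc hs => by
        have h2 := ht φ hφ
        rw [hsum] at h2
        have h3 : ∫ x, pd j φ x ∂(vol K) = 0 := by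
          rw [vol, setIntegral_eq_integral_of_forall_compl_eq_zero, integral_pd_eq_zero hφ hc]
          exact fun x hx => pd_eq_zero_of_notMem_tsupport (fun hh => hx (hs hh)) j
        have h4 : ∫ x, ntr t x * φ x ∂(bdry K) = 0 := by
          rw [integral_eq_zero_of_ae]
          filter_upwards [ae_bdry_mem_frontier K] with x hx
          have : φ x = 0 := image_eq_zero_of_notMem_tsupport fun hh => by
            rw [hK.isOpen.frontier_eq] at hx
            exact hx.2 (hs hh)
          simp [this]
        rw [h3, h4, zero_add] at h2
        simpa [mul_comm] using h2)
    have h2 : ∀ᵐ x ∂(vol K), x ∈ K := ae_restrict_mem hK.isOpen.measurableSet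
    filter_upwards [h1, h2] with x hx hx' using hx hx'
  have hgreen : ∀ φ : E d → ℝ, ContDiff ℝ ∞ φ →
      ∫ x, pd j φ x ∂(vol K) = ∫ x, ntr t x * φ x ∂(bdry K) := by
    intro φ hφ
    have h1 := ht φ hφ
    rw [hsum] at h1
    have h2 : ∫ x, dvg t x * φ x ∂(vol K) = 0 := by
      rw [integral_eq_zero_of_ae]
      filter_upwards [hδ] with x hx
      simp [hx]
    rw [← h1, h2, add_zero]
  have hnt : Integrable (ntr t) (bdry K) := (Lp.memLp t.2.2).integrable (by norm_num)
  have hnn : Integrable (fun x => outwardNormal K x j) (bdry K) :=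
    (hK.memLp_top_normal j).integrable le_top
  have hntr : ∀ᵐ x ∂(bdry K), ntr t x = outwardNormal K x j := by
    have hloc : ∀ x, HalfSpaceAt K (outwardNormal K x) x → ∃ ρ > 0, ∀ᵐ y ∂(bdry K),
        y ∈ Metric.ball x ρ → ntr t y - outwardNormal K y j = 0 := by
      intro x hx
      obtain ⟨ρ, hρ, hb⟩ := hx.exists_ball
      refine ⟨ρ, hρ, ?_⟩
      refine Metric.isOpen_ball.ae_eq_zero_of_integral_contDiff_smul_eq_zero
        ((hnt.sub hnn).locallyIntegrable.locallyIntegrableOn _) fun φ hφ hc hs => ?_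
      have h1 := hgreen φ hφ
      rw [divergence_of_ball hx.1 hb hK.isOpen hφ hc hs j] at h1
      obtain ⟨C, hC⟩ := hc.exists_bound_of_continuous hφ.continuous
      have i1 : Integrable (fun y => φ y * ntr t y) (bdry K) :=
        hnt.bdd_mul hφ.continuous.aestronglyMeasurable (Eventually.of_forall hC)
      have i2 : Integrable (fun y => φ y * outwardNormal K y j) (bdry K) :=
        hnn.bdd_mul hφ.continuous.aestronglyMeasurable (Eventually.of_forall hC)
      simp only [smul_eq_mul, mul_sub]
      rw [integral_sub i1 i2, sub_eq_zero]
      simpa [mul_comm] using h1.symm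
    have h1 := hK.ae_halfSpaceAt
    set s := {x | HalfSpaceAt K (outwardNormal K x) x ∧ ¬ ntr t x = outwardNormal K x j} with hs
    have h2 : bdry K s = 0 := by
      refine measure_null_of_locally_null s fun x hx => ?_
      obtain ⟨ρ, hρ, hb⟩ := hloc x hx.1
      refine ⟨s ∩ Metric.ball x ρ, inter_mem self_mem_nhdsWithin
        (mem_nhdsWithin_of_mem_nhds (Metric.ball_mem_nhds x hρ)), ?_⟩
      refine measure_mono_null ?_ (ae_iff.1 hb)
      rintro y ⟨hy, hyb⟩
      simp only [mem_ofPred_eq, not_forall]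
      exact ⟨hyb, fun h => hy.2 (sub_eq_zero.1 h)⟩
    filter_upwards [h1, measure_eq_zero_iff_ae_notMem.1 h2] with x hx hx2
    by_contra hcon
    exact hx2 ⟨hx, hcon⟩
  rw [hgreen φ hφ]
  refine integral_congr_ae ?_
  filter_upwards [hntr] with x hx
  rw [hx]

theorem LocalSpaces.ContainsPoly.divergenceTheorem {X : LocalSpaces d} {k : ℕ}
    (h : X.ContainsPoly k) : DivergenceTheorem X.K := by
  refine divergenceTheorem_of_flux X.polyhedral fun j => ?_
  obtain ⟨t, ht, hf⟩ := h.V_mem (fun _ => EuclideanSpace.single j 1) fun i => by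
    refine ⟨MvPolynomial.C ((EuclideanSpace.single j (1:ℝ) : E d) i), by rw [MvPolynomial.totalDegree_C]; exact Nat.zero_le k, fun x => by simp⟩
  exact ⟨t, X.Vstar_hdiv t (X.V_le_Vstar ht), hf.symm⟩

end

section

variable {d : ℕ}

/-! ### The `L²` norm of a function -/

section L2

variable {α : Type*} [MeasurableSpace α] {μ : Measure α} {f g : α → ℝ}

/-- The `L²(μ)`-norm of a function. -/
def l2 (μ : Measure α) (f : α → ℝ) : ℝ := √(∫ x, f x ^ 2 ∂μ)

theorem l2_nonneg (μ : Measure α) (f : α → ℝ) : 0 ≤ l2 μ f := Real.sqrt_nonneg _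

theorem l2_sq (μ : Measure α) (f : α → ℝ) : l2 μ f ^ 2 = ∫ x, f x ^ 2 ∂μ :=
  Real.sq_sqrt (integral_nonneg fun _ => sq_nonneg _)

theorem integrable_mul2 (hf : MemLp f 2 μ) (hg : MemLp g 2 μ) :
    Integrable (fun x => f x * g x) μ := hf.integrable_mul hg

theorem integrable_sq2 (hf : MemLp f 2 μ) : Integrable (fun x => f x ^ 2) μ := hf.integrable_sq

theorem inner_toLp (hf : MemLp f 2 μ) (hg : MemLp g 2 μ) :
    inner ℝ (hf.toLp f) (hg.toLp g) = ∫ x, f x * g x ∂μ := by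
  rw [L2.inner_def]
  refine integral_congr_ae ?_
  filter_upwards [hf.coeFn_toLp, hg.coeFn_toLp] with x h1 h2
  rw [h1, h2]
  simp [mul_comm]

theorem l2_eq_norm (hf : MemLp f 2 μ) : l2 μ f = ‖hf.toLp f‖ := by
  have h := inner_toLp hf hf
  rw [real_inner_self_eq_norm_sq] at h
  rw [l2, ← Real.sqrt_sq (norm_nonneg (hf.toLp f)), h]
  simp [sq]

theorem abs_integral_mul_le (hf : MemLp f 2 μ) (hg : MemLp g 2 μ) :
    |∫ x, f x * g x ∂μ| ≤ l2 μ f * l2 μ g := by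
  rw [← inner_toLp hf hg, l2_eq_norm hf, l2_eq_norm hg]
  exact abs_real_inner_le_norm _ _

theorem l2_mono (hg : MemLp g 2 μ) (h : ∀ᵐ x ∂μ, |f x| ≤ |g x|) : l2 μ f ≤ l2 μ g := by
  refine Real.sqrt_le_sqrt (integral_mono_of_nonneg (Eventually.of_forall fun _ => sq_nonneg _)
    hg.integrable_sq ?_)
  filter_upwards [h] with x hx using sq_le_sq.2 hx

theorem l2_le_of_sq_le {C : ℝ} (hC : 0 ≤ C) (h : ∫ x, f x ^ 2 ∂μ ≤ C ^ 2) : l2 μ f ≤ C := by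
  rw [l2]; exact (Real.sqrt_le_sqrt h).trans (Real.sqrt_sq hC).le

theorem ae_eq_zero_of_l2 (hf : MemLp f 2 μ) (h : l2 μ f = 0) : f =ᵐ[μ] 0 := by
  rw [l2_eq_norm hf, norm_eq_zero] at h
  have h1 := hf.coeFn_toLp
  rw [h] at h1
  exact h1.symm.trans (Lp.coeFn_zero _ _ _)

theorem memLp_bdd_mul {p : ENNReal} (hf : MemLp f ⊤ μ) (hg : MemLp g p μ) :
    MemLp (fun x => f x * g x) p μ := hg.mul hf

theorem memLp_mul_bdd {p : ENNReal} (hf : MemLp f p μ) (hg : MemLp g ⊤ μ) :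
    MemLp (fun x => f x * g x) p μ := hg.mul' hf

theorem memLp_top_of_ae {C : ℝ} (hf : AEStronglyMeasurable f μ) (h : ∀ᵐ x ∂μ, |f x| ≤ C) :
    MemLp f ⊤ μ := memLp_top_of_bound hf C h

end L2

/-! ### Mollification -/

/-- Correlations of square integrable functions are continuous. -/
theorem tendsto_correlation {a b : E d → ℝ} (ha : MemLp a 2 volume) (hb : MemLp b 2 volume) :
    Tendsto (fun z : E d => ∫ y, a y * b (y - z)) (𝓝 0) (𝓝 (∫ y, a y * b y)) := by
  let T : E d → C(E d, E d) := fun z => ⟨fun y => y - z, by fun_prop⟩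
  have hT : Tendsto T (𝓝 0) (𝓝 (T 0)) := by
    have : Continuous T := ContinuousMap.continuous_of_continuous_uncurry _ (by
      change Continuous fun q : E d × E d => q.2 - q.1
      fun_prop)
    exact this.tendsto 0
  have hTm : ∀ z, MeasurePreserving (T z) (volume : Measure (E d)) volume := fun z =>
    measurePreserving_sub_right volume z
  have h1 := Filter.Tendsto.compMeasurePreservingLp (μ := (volume : Measure (E d))) (ν := volume)
    (f := fun _ : E d => hb.toLp b) (f₀ := hb.toLp b) tendsto_const_nhds hT hTm (hTm 0) (by simp)
  have h2 := (tendsto_const_nhds (x := ha.toLp a)).inner (𝕜 := ℝ) h1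
  have h3 : ∀ z, inner ℝ (ha.toLp a) (Lp.compMeasurePreserving (T z) (hTm z) (hb.toLp b))
      = ∫ y, a y * b (y - z) := by
    intro z
    rw [Lp.toLp_compMeasurePreserving hb (hTm z)]
    exact inner_toLp ha (hb.comp_measurePreserving (hTm z))
  simp_rw [h3] at h2
  simpa using h2

/-- A family of mollifiers that concentrate at the origin, with supports centered off it. -/
structure IsMollifier (e : E d) (s : ℝ) (ψ : E d → ℝ) : Prop where
  smooth : ContDiff ℝ ∞ ψ
  nonneg : ∀ x, 0 ≤ ψ x
  tsupp : tsupport ψ ⊆ Metric.closedBall (s • e) (s / 2)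
  integral_eq : ∫ x, ψ x = 1

theorem exists_mollifier (e : E d) {s : ℝ} (hs : 0 < s) : ∃ ψ, IsMollifier e s ψ := by
  let f : ContDiffBump (s • e) := ⟨s / 4, s / 2, by positivity, by linarith⟩
  exact ⟨f.normed volume, f.contDiff_normed, f.nonneg_normed, f.tsupport_normed_eq.subset,
    f.integral_normed⟩

namespace IsMollifier

variable {e : E d} {s : ℝ} {ψ : E d → ℝ}

theorem hasCompactSupport (h : IsMollifier e s ψ) : HasCompactSupport ψ :=
  HasCompactSupport.of_support_subset_isCompact (isCompact_closedBall _ _)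
    ((subset_tsupport _).trans h.tsupp)

theorem eq_zero (h : IsMollifier e s ψ) {z : E d} (hz : z ∉ Metric.closedBall (s • e) (s / 2)) :
    ψ z = 0 := image_eq_zero_of_notMem_tsupport fun hh => hz (h.tsupp hh)

theorem norm_le (he : ‖e‖ ≤ 1) (hs : 0 < s) {z : E d}
    (hz : z ∈ Metric.closedBall (s • e) (s / 2)) : ‖z‖ ≤ 2 * s := by
  rw [Metric.mem_closedBall, dist_eq_norm] at hz
  have h1 : ‖z‖ ≤ ‖z - s • e‖ + ‖s • e‖ := by
    simpa using norm_add_le (z - s • e) (s • e)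
  rw [norm_smul, Real.norm_of_nonneg hs.le] at h1
  nlinarith

end IsMollifier

/-- Convolution with a mollifier. -/
def mollify (ψ b : E d → ℝ) (y : E d) : ℝ := ∫ z, b z * ψ (y - z)

theorem mollify_eq (ψ b : E d → ℝ) (y : E d) : mollify ψ b y = ∫ z, b (y - z) * ψ z := by
  rw [mollify, ← integral_sub_left_eq_self (fun z => b (y - z) * ψ z) volume y]
  simp

theorem integral_mul_mollify {a b ψ : E d → ℝ} (ha : MemLp a 2 volume) (hb : MemLp b 2 volume)
    (hψ : Continuous ψ) (hc : HasCompactSupport ψ) :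
    ∫ y, a y * mollify ψ b y = ∫ z, ψ z * ∫ y, a y * b (y - z) := by
  have hψi : Integrable ψ := hψ.integrable_of_hasCompactSupport hc
  have hψa : Integrable (fun x => |ψ x|) := hψi.abs
  have key : Integrable (fun q : E d × E d => a q.1 * (b (q.1 - q.2) * ψ q.2)) (volume.prod volume) := by
    have h1 : Integrable (fun q : E d × E d => a q.1 ^ 2 * |ψ q.2|) (volume.prod volume) :=
      Integrable.mul_prod (f := fun x => a x ^ 2) (g := fun x => |ψ x|) ha.integrable_sq hψa
    have h2 : Integrable (fun q : E d × E d => |ψ q.2| * b (q.1 - q.2) ^ 2) (volume.prod volume) :=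
      hψa.convolution_integrand (ContinuousLinearMap.mul ℝ ℝ) hb.integrable_sq
    have hbm : AEStronglyMeasurable (fun q : E d × E d => b (q.1 - q.2)) (volume.prod volume) :=
      hb.aestronglyMeasurable.comp_quasiMeasurePreserving
        (quasiMeasurePreserving_sub volume volume)
    refine (h1.add h2).mono' ?_ (Eventually.of_forall fun q => ?_)
    · exact ha.aestronglyMeasurable.comp_fst.mul (hbm.mul hψ.aestronglyMeasurable.comp_snd)
    · simp only [Pi.add_apply, norm_mul, Real.norm_eq_abs]
      have h3 : |a q.1| * |b (q.1 - q.2)| ≤ a q.1 ^ 2 + b (q.1 - q.2) ^ 2 := by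
        rw [← sq_abs (a q.1), ← sq_abs (b (q.1 - q.2))]
        nlinarith [sq_nonneg (|a q.1| - |b (q.1 - q.2)|), sq_nonneg (|a q.1|), sq_nonneg (|b (q.1 - q.2)|)]
      calc |a q.1| * (|b (q.1 - q.2)| * |ψ q.2|) = (|a q.1| * |b (q.1 - q.2)|) * |ψ q.2| := by ring
        _ ≤ (a q.1 ^ 2 + b (q.1 - q.2) ^ 2) * |ψ q.2| := by gcongr
        _ = _ := by ring
  calc ∫ y, a y * mollify ψ b y = ∫ y, ∫ z, a y * (b (y - z) * ψ z) := by
        refine integral_congr_ae (Eventually.of_forall fun y => ?_)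
        simp only [mollify_eq, integral_const_mul]
    _ = ∫ z, ∫ y, a y * (b (y - z) * ψ z) := integral_integral_swap key
    _ = _ := by
        refine integral_congr_ae (Eventually.of_forall fun z => ?_)
        simp only
        rw [← integral_const_mul]
        refine integral_congr_ae (Eventually.of_forall fun y => ?_)
        simp only
        ring

/-- Mollification converges weakly in `L²`. -/
theorem tendsto_integral_mollify {a b : E d → ℝ} {e : E d} (he : ‖e‖ ≤ 1) (ha : MemLp a 2 volume)
    (hb : MemLp b 2 volume) {ψ : ℝ → E d → ℝ} (hψ : ∀ s, 0 < s → IsMollifier e s (ψ s)) :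
    Tendsto (fun s => ∫ y, a y * mollify (ψ s) b y) (𝓝[>] 0) (𝓝 (∫ y, a y * b y)) := by
  rw [Metric.tendsto_nhds]
  intro ε hε
  have hcor := Metric.tendsto_nhds.1 (tendsto_correlation ha hb) (ε / 2) (by positivity)
  obtain ⟨δ, hδ, hball⟩ := Metric.eventually_nhds_iff_ball.1 hcor
  have hev : ∀ᶠ s : ℝ in 𝓝[>] 0, s < δ / 2 ∧ 0 < s := by
    filter_upwards [Ioo_mem_nhdsGT (show (0:ℝ) < δ / 2 by positivity)] with s hs
    exact ⟨hs.2, hs.1⟩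
  filter_upwards [hev] with s ⟨hs, hs0⟩
  have hm := hψ s hs0
  have hψi : Integrable (ψ s) := hm.smooth.continuous.integrable_of_hasCompactSupport
    hm.hasCompactSupport
  rw [integral_mul_mollify ha hb hm.smooth.continuous hm.hasCompactSupport]
  set κ : E d → ℝ := fun z => ∫ y, a y * b (y - z)
  set κ0 := ∫ y, a y * b y
  have hint : Integrable fun z => ψ s z * κ z := by
    have hmeas : Continuous κ := by
      have hT : ∀ z0, Tendsto κ (𝓝 z0) (𝓝 (κ z0)) := by
        intro z0
        have hb' : MemLp (fun y => b (y - z0)) 2 volume :=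
          hb.comp_measurePreserving (measurePreserving_sub_right volume z0)
        have h1 := tendsto_correlation ha hb'
        have h2 : Tendsto (fun z => z - z0) (𝓝 z0) (𝓝 0) := by
          have : Tendsto (fun z : E d => z - z0) (𝓝 z0) (𝓝 (z0 - z0)) :=
            Continuous.tendsto (by fun_prop) _
          rwa [sub_self] at this
        have h3 := h1.comp h2
        refine h3.congr fun z => ?_
        simp only [Function.comp_apply, κ]
        refine integral_congr_ae (Eventually.of_forall fun y => ?_)
        simp only
        congr 2
        abel
      exact continuous_iff_continuousAt.2 hT
    exact (hm.smooth.continuous.mul hmeas).integrable_of_hasCompactSupport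
      hm.hasCompactSupport.mul_right
  have e1 : (∫ z, ψ s z * κ z) - κ0 = ∫ z, ψ s z * (κ z - κ0) := by
    simp only [mul_sub]
    rw [integral_sub hint (hψi.mul_const _), integral_mul_const, hm.integral_eq, one_mul]
  rw [Real.dist_eq, e1]
  have : ‖∫ z, ψ s z * (κ z - κ0)‖ ≤ ∫ z, ψ s z * (ε / 2) := by
    refine norm_integral_le_of_norm_le (hψi.mul_const _) (Eventually.of_forall fun z => ?_)
    rw [norm_mul, Real.norm_of_nonneg (hm.nonneg z)]
    by_cases hz : z ∈ Metric.closedBall (s • e) (s / 2)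
    · have h1 := hball z (by
        rw [mem_ball_zero_iff]
        have := IsMollifier.norm_le he hs0 hz
        linarith)
      rw [Real.dist_eq] at h1
      exact mul_le_mul_of_nonneg_left h1.le (hm.nonneg z)
    · rw [hm.eq_zero hz]; simp
  rw [integral_mul_const, hm.integral_eq, one_mul, Real.norm_eq_abs] at this
  linarith

end

section

variable {d : ℕ}

variable {K : Set (E d)} {faces : Finset (Set (E d))}

/-- The field `v` has weak divergence `δ` and normal trace `γ`, all square integrable. -/
structure IsFlux (K : Set (E d)) (v : E d → E d) (δ γ : E d → ℝ) : Prop where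
  memLp : MemLp v 2 (vol K)
  memLp_div : MemLp δ 2 (vol K)
  memLp_ntr : MemLp γ 2 (bdry K)
  green : ∀ φ : E d → ℝ, ContDiff ℝ ∞ φ →
    (∑ j, ∫ x, v x j * pd j φ x ∂(vol K)) + ∫ x, δ x * φ x ∂(vol K) = ∫ x, γ x * φ x ∂(bdry K)

theorem memLp_top_of_continuous {μ : Measure (E d)} {s : Set (E d)} (hs : Bornology.IsBounded s)
    (h : ∀ᵐ x ∂μ, x ∈ s) {f : E d → ℝ} (hf : Continuous f) : MemLp f ⊤ μ := by
  obtain ⟨C, hC⟩ := hs.isCompact_closure.exists_bound_of_continuousOn hf.continuousOn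
  refine memLp_top_of_bound hf.aestronglyMeasurable C ?_
  filter_upwards [h] with x hx using hC x (subset_closure hx)

theorem ae_vol_mem (hK : MeasurableSet K) : ∀ᵐ x ∂(vol K), x ∈ K := ae_restrict_mem hK

theorem IsPolyhedral.memLp_top_vol (hK : IsPolyhedral K faces) {f : E d → ℝ} (hf : Continuous f) :
    MemLp f ⊤ (vol K) :=
  memLp_top_of_continuous hK.isBounded (ae_vol_mem hK.isOpen.measurableSet) hf

theorem IsPolyhedral.memLp_top_bdry (hK : IsPolyhedral K faces) {f : E d → ℝ} (hf : Continuous f) :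
    MemLp f ⊤ (bdry K) :=
  memLp_top_of_continuous hK.isBounded_frontier (ae_bdry_mem_frontier K) hf

theorem IsPolyhedral.memLp_vol (hK : IsPolyhedral K faces) {f : E d → ℝ} (hf : Continuous f)
    (p : ENNReal) : MemLp f p (vol K) := by
  have := hK.isFiniteMeasure_vol
  exact (hK.memLp_top_vol hf).mono_exponent le_top

theorem IsPolyhedral.memLp_bdry (hK : IsPolyhedral K faces) {f : E d → ℝ} (hf : Continuous f)
    (p : ENNReal) : MemLp f p (bdry K) := by
  have := hK.isFiniteMeasure_bdry
  exact (hK.memLp_top_bdry hf).mono_exponent le_top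

theorem contDiff_mollify {ψ b : E d → ℝ} (hb : MemLp b 2 volume) (hψ : ContDiff ℝ ∞ ψ)
    (hc : HasCompactSupport ψ) : ContDiff ℝ ∞ (mollify ψ b) :=
  hc.contDiff_convolution_right (ContinuousLinearMap.mul ℝ ℝ) (hb.locallyIntegrable (by norm_num)) hψ

theorem pd_mollify {ψ b : E d → ℝ} (hb : MemLp b 2 volume) (hψ : ContDiff ℝ ∞ ψ)
    (hc : HasCompactSupport ψ) (j : Fin d) (y : E d) :
    pd j (mollify ψ b) y = mollify (pd j ψ) b y := by
  have hbl : LocallyIntegrable b volume := hb.locallyIntegrable (by norm_num)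
  have h := hc.hasFDerivAt_convolution_right (ContinuousLinearMap.mul ℝ ℝ) hbl
    (hψ.of_le (by simp)) y
  have h2 := convolution_precompR_apply (ContinuousLinearMap.mul ℝ ℝ) hbl (hc.fderiv (𝕜 := ℝ))
    (hψ.continuous_fderiv (by simp)) y (EuclideanSpace.single j 1)
  have h3 := congrArg (fun A => A (EuclideanSpace.single j (1:ℝ))) h.fderiv
  exact h3.trans h2

theorem tendsto_setIntegral_mollify (hK : MeasurableSet K) {a b : E d → ℝ} {e : E d} (he : ‖e‖ ≤ 1)
    (ha : MemLp a 2 (vol K)) (hb : MemLp b 2 (vol K)) {ψ : ℝ → E d → ℝ}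
    (hψ : ∀ s, 0 < s → IsMollifier e s (ψ s)) :
    Tendsto (fun s => ∫ y, a y * mollify (ψ s) (K.indicator b) y ∂(vol K)) (𝓝[>] 0)
      (𝓝 (∫ y, a y * b y ∂(vol K))) := by
  have h := tendsto_integral_mollify he ((memLp_indicator_iff_restrict hK).2 ha)
    ((memLp_indicator_iff_restrict hK).2 hb) hψ
  have e1 : ∀ c : E d → ℝ, ∫ y, K.indicator a y * c y = ∫ y, a y * c y ∂(vol K) := by
    intro c
    rw [vol, ← integral_indicator hK]
    congr 1
    ext y
    by_cases hy : y ∈ K <;> simp [hy]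
  simp_rw [e1] at h
  convert h using 2
  refine integral_congr_ae ?_
  filter_upwards [ae_vol_mem hK] with x hx
  rw [indicator_of_mem hx]

/-- Integration against smooth functions determines weak limits of bounded sequences in `L²`. -/
theorem tendsto_integral_of_dense {μ : Measure (E d)} [IsFiniteMeasure μ] {ι : Type*} {l : Filter ι}
    {F : ι → E d → ℝ} {F0 : E d → ℝ} {C : ℝ} (hC : 0 ≤ C) (hF : ∀ᶠ s in l, MemLp (F s) 2 μ ∧ l2 μ (F s) ≤ C)
    (hF0 : MemLp F0 2 μ)
    (h : ∀ φ : E d → ℝ, ContDiff ℝ ∞ φ → HasCompactSupport φ →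
      Tendsto (fun s => ∫ y, F s y * φ y ∂μ) l (𝓝 (∫ y, F0 y * φ y ∂μ)))
    {γ : E d → ℝ} (hγ : MemLp γ 2 μ) :
    Tendsto (fun s => ∫ y, F s y * γ y ∂μ) l (𝓝 (∫ y, F0 y * γ y ∂μ)) := by
  rw [Metric.tendsto_nhds]
  intro ε hε
  set D := C + l2 μ F0 + 1
  have hD : 0 < D := by have := l2_nonneg μ F0; positivity
  obtain ⟨φ, hφc, hφ, hle⟩ := hγ.exist_eLpNorm_sub_le (by simp) (by norm_num)
    (show 0 < ε / (2 * D) by positivity)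
  have hφm : MemLp φ 2 μ := hφ.continuous.memLp_of_hasCompactSupport hφc
  have hdm : MemLp (fun y => γ y - φ y) 2 μ := hγ.sub hφm
  have hdn : l2 μ (fun y => γ y - φ y) ≤ ε / (2 * D) := by
    rw [l2_eq_norm hdm, Lp.norm_toLp]
    exact ENNReal.toReal_le_of_le_ofReal (by positivity) hle
  filter_upwards [hF, Metric.tendsto_nhds.1 (h φ hφ hφc) (ε / 2) (by positivity)] with s ⟨hs, hsC⟩ hs2
  have e1 : ∀ G : E d → ℝ, MemLp G 2 μ →
      ∫ y, G y * γ y ∂μ = ∫ y, G y * φ y ∂μ + ∫ y, G y * (γ y - φ y) ∂μ := by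
    intro G hG
    rw [← integral_add (integrable_mul2 hG hφm) (integrable_mul2 hG hdm)]
    congr 1; ext y; ring
  have e2 : ∀ G : E d → ℝ, MemLp G 2 μ → |∫ y, G y * (γ y - φ y) ∂μ| ≤ l2 μ G * (ε / (2 * D)) :=
    fun G hG => (abs_integral_mul_le hG hdm).trans
      (mul_le_mul_of_nonneg_left hdn (l2_nonneg _ _))
  rw [e1 _ hs, e1 _ hF0, Real.dist_eq]
  rw [Real.dist_eq] at hs2
  have h3 := e2 _ hs
  have h4 := e2 _ hF0
  have h5 : l2 μ (F s) * (ε / (2 * D)) + l2 μ F0 * (ε / (2 * D)) < ε / 2 := by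
    have : (l2 μ (F s) + l2 μ F0) * (ε / (2 * D)) < D * (ε / (2 * D)) := by
      refine mul_lt_mul_of_pos_right ?_ (by positivity)
      simp only [D]; linarith
    have hD' : D * (ε / (2 * D)) = ε / 2 := by field_simp
    linarith
  rw [abs_lt] at hs2 ⊢
  rw [abs_le] at h3 h4
  constructor <;> linarith

/-- Green's formula, and a bound for the trace, for a bounded function of class `H¹` that has been cut
off near a point at which `K` can be shifted to its interior. -/
theorem green_local (hK : IsPolyhedral K faces) (hdiv : DivergenceTheorem K)
    {w : E d → ℝ} {g : E d → E d} {τ : E d → ℝ} (hw : HasTrace K w g τ) {M : ℝ} (hM0 : 0 ≤ M)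
    (hM : ∀ᵐ x ∂(vol K), |w x| ≤ M) {x e : E d} {ρ : ℝ} (he : ‖e‖ ≤ 1) (hρ : 0 < ρ)
    (hshift : ∀ s, 0 < s → s < ρ / 4 → ∀ y ∈ closure K, y ∈ Metric.ball x ρ →
      ∀ z ∈ Metric.closedBall (s • e) (s / 2), y - z ∈ K)
    (hnormal : ∀ y ∈ frontier K, y ∈ Metric.ball x ρ → outwardNormal K y = e ∧ ‖e‖ = 1)
    {η : E d → ℝ} (hη : ContDiff ℝ ∞ η) (hs : tsupport η ⊆ Metric.ball x (ρ / 2)) {A : ℝ}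
    (hA : ∀ y, |η y| ≤ A) :
    (∀ v δ γ, IsFlux K v δ γ →
      (∑ j, ∫ y, v y j * (g y j * η y + w y * pd j η y) ∂(vol K)) + ∫ y, δ y * (w y * η y) ∂(vol K)
        = ∫ y, γ y * (τ y * η y) ∂(bdry K)) ∧
    ∀ γ, MemLp γ 2 (bdry K) → |∫ y, γ y * (τ y * η y) ∂(bdry K)| ≤ M * A * ∫ y, |γ y| ∂(bdry K) := by
  have := hK.isFiniteMeasure_bdry
  have := hK.isFiniteMeasure_vol
  have hKm := hK.isOpen.measurableSet
  obtain ⟨hw2, hg2, hτ2, hgreen⟩ := hw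
  have hgj := fun j => memLp_component hg2 j
  have hA0 : 0 ≤ A := (abs_nonneg _).trans (hA x)
  have hηv : MemLp η ⊤ (vol K) := hK.memLp_top_vol hη.continuous
  have hpη : ∀ j, MemLp (pd j η) ⊤ (vol K) := fun j => hK.memLp_top_vol (contDiff_pd hη j).continuous
  have hηb : MemLp η ⊤ (bdry K) := hK.memLp_top_bdry hη.continuous
  have hτη : MemLp (fun y => τ y * η y) 2 (bdry K) := memLp_mul_bdd hτ2 hηb
  have hwη : MemLp (fun y => w y * η y) 2 (vol K) := memLp_mul_bdd hw2 hηv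
  have hGj : ∀ j, MemLp (fun y => g y j * η y + w y * pd j η y) 2 (vol K) := fun j =>
    (memLp_mul_bdd (hgj j) hηv).add (memLp_mul_bdd hw2 (hpη j))
  set W : E d → ℝ := K.indicator fun y => w y * η y with hW
  set G : Fin d → E d → ℝ := fun j => K.indicator fun y => g y j * η y + w y * pd j η y with hG
  have hWm : MemLp W 2 volume := (memLp_indicator_iff_restrict hKm).2 hwη
  have hGm : ∀ j, MemLp (G j) 2 volume := fun j => (memLp_indicator_iff_restrict hKm).2 (hGj j)
  choose! ψ hψ using fun (s : ℝ) (hs : 0 < s) => exists_mollifier e hs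
  have hη0 : ∀ z, z ∉ Metric.ball x (ρ / 2) → η z = 0 := fun z hz =>
    image_eq_zero_of_notMem_tsupport fun hh => hz (hs hh)
  have hWs : ∀ s, 0 < s → ContDiff ℝ ∞ (mollify (ψ s) W) := fun s hs =>
    contDiff_mollify hWm (hψ s hs).smooth (hψ s hs).hasCompactSupport
  have hev : ∀ᶠ s : ℝ in 𝓝[>] 0, 0 < s ∧ s < ρ / 4 := by
    filter_upwards [Ioo_mem_nhdsGT (show (0:ℝ) < ρ / 4 by positivity)] with s hs
    exact ⟨hs.1, hs.2⟩
  have hnear : ∀ s, 0 < s → s < ρ / 4 → ∀ y z, z ∈ Metric.ball x (ρ / 2) →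
      y - z ∈ Metric.closedBall (s • e) (s / 2) → y ∈ Metric.ball x ρ := by
    intro s hs0 hs1 y z hz hyz
    have h1 := IsMollifier.norm_le he hs0 hyz
    rw [Metric.mem_ball] at hz ⊢
    have h2 := dist_triangle y z x
    rw [dist_eq_norm y z] at h2
    linarith
  -- the gradient of the mollified function
  have hpd : ∀ s, 0 < s → s < ρ / 4 → ∀ y ∈ closure K, ∀ j,
      pd j (mollify (ψ s) W) y = mollify (ψ s) (G j) y := by
    intro s hs0 hs1 y hy j
    have hm := hψ s hs0
    rw [pd_mollify hWm hm.smooth hm.hasCompactSupport]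
    set Ψ : E d → ℝ := fun z => ψ s (y - z) with hΨ
    have hΨs : ContDiff ℝ ∞ Ψ := hm.smooth.comp (contDiff_const.sub contDiff_id)
    have hΨd : ∀ z, pd j Ψ z = - pd j (ψ s) (y - z) := by
      intro z
      have h1 : HasFDerivAt (fun z : E d => y - z) (-(ContinuousLinearMap.id ℝ (E d))) z :=
        (hasFDerivAt_id z).const_sub y
      have h2 := ((smooth_differentiable hm.smooth (y - z)).hasFDerivAt.comp z h1).fderiv
      have h3 := congrArg (fun A => A (EuclideanSpace.single j (1:ℝ))) h2
      simpa [pd] using! h3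
    have h1 := hgreen (fun z => η z * Ψ z) (hη.mul hΨs) j
    have h2 : ∫ z, τ z * outwardNormal K z j * (η z * Ψ z) ∂(bdry K) = 0 := by
      rw [integral_eq_zero_of_ae]
      filter_upwards [ae_bdry_mem_frontier K] with z hz
      by_cases hz1 : z ∈ Metric.ball x (ρ / 2)
      · by_cases hz2 : y - z ∈ Metric.closedBall (s • e) (s / 2)
        · have h3 := hshift s hs0 hs1 y hy (hnear s hs0 hs1 y z hz1 hz2) _ hz2
          rw [sub_sub_cancel] at h3
          rw [hK.isOpen.frontier_eq] at hz
          exact absurd h3 hz.2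
        · simp [hΨ, hm.eq_zero hz2]
      · simp [hη0 z hz1]
    rw [h2] at h1
    have hΨv : MemLp Ψ ⊤ (vol K) := hK.memLp_top_vol hΨs.continuous
    have hpΨ : MemLp (pd j Ψ) ⊤ (vol K) := hK.memLp_top_vol (contDiff_pd hΨs j).continuous
    have e1 : ∀ z, w z * pd j (fun z => η z * Ψ z) z
        = (w z * η z) * pd j Ψ z + (w z * pd j η z) * Ψ z := by
      intro z
      rw [pd_mul (smooth_differentiable hη z) (smooth_differentiable hΨs z)]
      ring
    have i1 : Integrable (fun z => (w z * η z) * pd j Ψ z) (vol K) :=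
      (memLp_mul_bdd hwη hpΨ).integrable (by norm_num)
    have i2 : Integrable (fun z => (w z * pd j η z) * Ψ z) (vol K) :=
      (memLp_mul_bdd (memLp_mul_bdd hw2 (hpη j)) hΨv).integrable (by norm_num)
    have i3 : Integrable (fun z => g z j * (η z * Ψ z)) (vol K) :=
      (memLp_mul_bdd (hgj j) (memLp_mul_bdd hηv hΨv)).integrable (by norm_num)
    simp_rw [e1] at h1
    rw [integral_add i1 i2] at h1
    have e2 : mollify (pd j (ψ s)) W y = - ∫ z, (w z * η z) * pd j Ψ z ∂(vol K) := by
      rw [mollify, ← integral_neg, vol, ← integral_indicator hKm]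
      congr 1
      ext z
      by_cases hz : z ∈ K
      · simp [hW, hz, hΨd]
      · simp [hW, hz]
    have e3 : mollify (ψ s) (G j) y
        = ∫ z, (w z * pd j η z) * Ψ z ∂(vol K) + ∫ z, g z j * (η z * Ψ z) ∂(vol K) := by
      rw [mollify, ← integral_add i2 i3, vol, ← integral_indicator hKm]
      congr 1
      ext z
      by_cases hz : z ∈ K
      · simp only [hG, indicator_of_mem hz, hΨ]; ring
      · simp [hG, hz]
    rw [e2, e3]
    linarith
  -- uniform bounds
  have hWb : ∀ᵐ z, |W z| ≤ M * A := by
    have h1 := (ae_restrict_iff' hKm).1 hM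
    filter_upwards [h1] with z hz
    by_cases hzK : z ∈ K
    · rw [hW, indicator_of_mem hzK, abs_mul]
      exact mul_le_mul (hz hzK) (hA z) (abs_nonneg _) hM0
    · rw [hW, indicator_of_notMem hzK, abs_zero]; positivity
  have hbound : ∀ s, 0 < s → ∀ y, |mollify (ψ s) W y| ≤ M * A := by
    intro s hs0 y
    have hm := hψ s hs0
    have hi : Integrable (fun z => ψ s (y - z)) :=
      (hm.smooth.continuous.integrable_of_hasCompactSupport hm.hasCompactSupport).comp_sub_left y
    have h1 : ‖∫ z, W z * ψ s (y - z)‖ ≤ ∫ z, M * A * ψ s (y - z) := by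
      refine norm_integral_le_of_norm_le (hi.const_mul _) ?_
      filter_upwards [hWb] with z hz
      rw [norm_mul, Real.norm_of_nonneg (hm.nonneg _)]
      exact mul_le_mul_of_nonneg_right hz (hm.nonneg _)
    rw [integral_const_mul, integral_sub_left_eq_self (fun z => ψ s z), hm.integral_eq, mul_one] at h1
    exact h1
  have hzero : ∀ s, 0 < s → s < ρ / 4 → ∀ y, y ∉ Metric.ball x ρ → mollify (ψ s) W y = 0 := by
    intro s hs0 hs1 y hy
    rw [mollify]
    refine integral_eq_zero_of_ae (Eventually.of_forall fun z => ?_)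
    by_cases hz1 : z ∈ Metric.ball x (ρ / 2)
    · by_cases hz2 : y - z ∈ Metric.closedBall (s • e) (s / 2)
      · exact absurd (hnear s hs0 hs1 y z hz1 hz2) hy
      · simp [(hψ s hs0).eq_zero hz2]
    · simp [hW, hη0 z hz1]
  -- weak convergence of the boundary values
  have hsm : ∀ φ : E d → ℝ, ContDiff ℝ ∞ φ → ∀ j,
      Tendsto (fun s => ∫ y, outwardNormal K y j * (mollify (ψ s) W y * φ y) ∂(bdry K)) (𝓝[>] 0)
        (𝓝 (∫ y, outwardNormal K y j * (τ y * η y * φ y) ∂(bdry K))) := by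
    intro φ hφ j
    have hφv := hK.memLp_vol hφ.continuous 2
    have hpφ := hK.memLp_vol (contDiff_pd hφ j).continuous 2
    have t1 := (tendsto_setIntegral_mollify hKm he hpφ hwη hψ).add
      (tendsto_setIntegral_mollify hKm he hφv (hGj j) hψ)
    have e0 : ∫ y, pd j φ y * (w y * η y) ∂(vol K)
        + ∫ y, φ y * (g y j * η y + w y * pd j η y) ∂(vol K)
        = ∫ y, outwardNormal K y j * (τ y * η y * φ y) ∂(bdry K) := by
      have h1 := hgreen (fun y => η y * φ y) (hη.mul hφ) j
      have i1 : Integrable (fun y => w y * pd j (fun z => η z * φ z) y) (vol K) :=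
        (memLp_mul_bdd hw2 (hK.memLp_top_vol
          (contDiff_pd (hη.mul hφ) j).continuous)).integrable (by norm_num)
      have i2 : Integrable (fun y => g y j * (η y * φ y)) (vol K) :=
        (memLp_mul_bdd (hgj j) (hK.memLp_top_vol
          (hη.mul hφ).continuous)).integrable (by norm_num)
      rw [← integral_add i1 i2] at h1
      rw [← integral_add (integrable_mul2 hpφ hwη) (integrable_mul2 hφv (hGj j))]
      calc _ = ∫ y, w y * pd j (fun z => η z * φ z) y + g y j * (η y * φ y) ∂(vol K) := by
            congr 1
            ext y
            rw [pd_mul (smooth_differentiable hη y) (smooth_differentiable hφ y)]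
            ring
        _ = _ := h1
        _ = _ := by congr 1; ext y; ring
    rw [e0] at t1
    refine t1.congr' ?_
    filter_upwards [hev] with s ⟨hs0, hs1⟩
    have h1 := hdiv _ ((hWs s hs0).mul hφ) j
    simp only at h1
    rw [← h1]
    have hWc := hK.memLp_vol (hWs s hs0).continuous 2
    rw [← integral_add (integrable_mul2 hpφ hWc)]
    · refine integral_congr_ae ?_
      filter_upwards [ae_vol_mem hKm] with y hy
      rw [pd_mul (smooth_differentiable (hWs s hs0) y) (smooth_differentiable hφ y),
        hpd s hs0 hs1 y (subset_closure hy) j]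
      ring
    · have hc : ContDiff ℝ ∞ (mollify (ψ s) (G j)) :=
        contDiff_mollify (hGm j) (hψ s hs0).smooth (hψ s hs0).hasCompactSupport
      exact integrable_mul2 hφv (hK.memLp_vol hc.continuous 2)
  have hsm2 : ∀ φ : E d → ℝ, ContDiff ℝ ∞ φ → HasCompactSupport φ →
      Tendsto (fun s => ∫ y, mollify (ψ s) W y * φ y ∂(bdry K)) (𝓝[>] 0)
        (𝓝 (∫ y, τ y * η y * φ y ∂(bdry K))) := by
    intro φ hφ _
    have hφb : MemLp φ ⊤ (bdry K) := hK.memLp_top_bdry hφ.continuous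
    have key : ∀ H : E d → ℝ, MemLp H 2 (bdry K) → (∀ y, y ∉ Metric.ball x ρ → H y = 0) →
        ∑ j, e j * ∫ y, outwardNormal K y j * (H y * φ y) ∂(bdry K) = ∫ y, H y * φ y ∂(bdry K) := by
      intro H hH hH0
      have hHφ : MemLp (fun y => H y * φ y) 2 (bdry K) := memLp_mul_bdd hH hφb
      simp_rw [← integral_const_mul]
      rw [← integral_finsetSum]
      · refine integral_congr_ae ?_
        filter_upwards [ae_bdry_mem_frontier K] with y hy
        by_cases hyb : y ∈ Metric.ball x ρ
        · obtain ⟨h1, h2⟩ := hnormal y hy hyb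
          have h3 : ∑ j, e j * e j = 1 := by
            rw [← inner_eq_sum, real_inner_self_eq_norm_sq, h2]; norm_num
          rw [h1]
          calc ∑ j, e j * (e j * (H y * φ y)) = (∑ j, e j * e j) * (H y * φ y) := by
                rw [Finset.sum_mul]; exact Finset.sum_congr rfl fun j _ => by ring
            _ = _ := by rw [h3, one_mul]
        · simp [hH0 y hyb]
      · intro j _
        exact ((memLp_bdd_mul (hK.memLp_top_normal j) hHφ).integrable (by norm_num)).const_mul _
    have t1 := tendsto_finsetSum Finset.univ fun j _ => (hsm φ hφ j).const_mul (e j)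
    rw [key (fun y => τ y * η y) hτη] at t1
    · refine t1.congr' ?_
      filter_upwards [hev] with s ⟨hs0, hs1⟩
      exact key _ (hK.memLp_bdry (hWs s hs0).continuous 2) (hzero s hs0 hs1)
    · intro y hy
      rw [hη0 y (fun hh => hy (Metric.ball_subset_ball (by linarith) hh)), mul_zero]
  have hweak : ∀ γ, MemLp γ 2 (bdry K) →
      Tendsto (fun s => ∫ y, mollify (ψ s) W y * γ y ∂(bdry K)) (𝓝[>] 0)
        (𝓝 (∫ y, τ y * η y * γ y ∂(bdry K))) := by
    intro γ hγ
    refine tendsto_integral_of_dense (C := l2 (bdry K) fun _ => M * A) (l2_nonneg _ _) ?_ hτη hsm2 hγ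
    filter_upwards [hev] with s ⟨hs0, hs1⟩
    refine ⟨hK.memLp_bdry (hWs s hs0).continuous 2, l2_mono (memLp_const _)
      (Eventually.of_forall fun y => ?_)⟩
    rw [abs_of_nonneg (show 0 ≤ M * A by positivity)]
    exact hbound s hs0 y
  constructor
  · intro v δ γ hf
    have hvj := fun j => memLp_component hf.memLp j
    have t1 := (tendsto_finsetSum Finset.univ fun j _ =>
      tendsto_setIntegral_mollify hKm he (hvj j) (hGj j) hψ).add
      (tendsto_setIntegral_mollify hKm he hf.memLp_div hwη hψ)
    have t2 := hweak γ hf.memLp_ntr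
    have heq : ∀ᶠ s : ℝ in 𝓝[>] 0, ∫ y, mollify (ψ s) W y * γ y ∂(bdry K)
        = ∑ j, ∫ y, v y j * mollify (ψ s) (G j) y ∂(vol K)
          + ∫ y, δ y * mollify (ψ s) W y ∂(vol K) := by
      filter_upwards [hev] with s ⟨hs0, hs1⟩
      have h1 := hf.green _ (hWs s hs0)
      rw [integral_congr_ae (g := fun y => γ y * mollify (ψ s) W y)
        (Eventually.of_forall fun y => mul_comm _ _), ← h1]
      congr 1
      refine Finset.sum_congr rfl fun j _ => integral_congr_ae ?_
      filter_upwards [ae_vol_mem hKm] with y hy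
      rw [hpd s hs0 hs1 y (subset_closure hy) j]
    have t3 := tendsto_nhds_unique (t2.congr' heq) t1
    rw [← t3]
    congr 1; ext y; ring
  · intro γ hγ
    have t2 := (hweak γ hγ).abs
    have e1 : ∫ y, γ y * (τ y * η y) ∂(bdry K) = ∫ y, τ y * η y * γ y ∂(bdry K) := by
      congr 1; ext y; ring
    rw [e1]
    refine le_of_tendsto t2 ?_
    filter_upwards [hev] with s ⟨hs0, hs1⟩
    have h1 : ‖∫ y, mollify (ψ s) W y * γ y ∂(bdry K)‖ ≤ ∫ y, M * A * |γ y| ∂(bdry K) := by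
      refine norm_integral_le_of_norm_le
        ((hγ.integrable (by norm_num)).abs.const_mul _) (Eventually.of_forall fun y => ?_)
      rw [norm_mul]
      exact mul_le_mul_of_nonneg_right (hbound s hs0 y) (abs_nonneg _)
    rwa [integral_const_mul] at h1

end

section

variable {d : ℕ}

/-! ### Small neighbourhoods of edges -/

theorem norm_le_norm_slab {V : Type*} [NormedAddCommGroup V] [InnerProductSpace ℝ V] (n p : V)
    (q : ℝ × (ℝ ∙ n)ᗮ) : ‖q.2‖ ≤ ‖slab n p q‖ + ‖p‖ := by
  have h0 : inner ℝ n (q.2 : V) = 0 := Submodule.mem_orthogonal_singleton_iff_inner_right.1 q.2.2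
  have h1 : ‖q.1 • n + (q.2 : V)‖ ^ 2 = ‖q.1 • n‖ ^ 2 + ‖(q.2 : V)‖ ^ 2 := by
    rw [norm_add_sq_real, inner_smul_left, h0]; simp
  have h2 : ‖(q.2 : V)‖ ≤ ‖q.1 • n + (q.2 : V)‖ := by
    refine le_of_sq_le_sq ?_ (norm_nonneg _)
    rw [h1]; nlinarith [sq_nonneg ‖q.1 • n‖]
  have h3 : q.1 • n + (q.2 : V) = slab n p q - p := by rw [slab]; abel
  rw [h3] at h2
  exact h2.trans (norm_sub_le _ _)

theorem volume_slab_le {V : Type*} [NormedAddCommGroup V] [InnerProductSpace ℝ V]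
    [FiniteDimensional ℝ V] [MeasurableSpace V] [BorelSpace V] {m : V} (hm : m ≠ 0) (R : ℝ) :
    ∃ C : ℝ, 0 ≤ C ∧ ∀ c r : ℝ, 0 ≤ r →
      volume ({y : V | |inner ℝ m y + c| ≤ r} ∩ Metric.closedBall 0 R) ≤ ENNReal.ofReal (C * r) := by
  have hm0 : 0 < ‖m‖ := norm_pos_iff.2 hm
  set n : V := ‖m‖⁻¹ • m with hn
  have hn1 : ‖n‖ = 1 := by rw [hn, norm_smul, norm_inv, norm_norm, inv_mul_cancel₀ hm0.ne']
  have hmn : m = ‖m‖ • n := by rw [hn, smul_smul, mul_inv_cancel₀ hm0.ne', one_smul]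
  obtain ⟨h1, h2⟩ := slab_measurePreserving hn1 (0 : V)
  set B : Set (ℝ ∙ n)ᗮ := Metric.closedBall 0 R
  have hB : volume B ≠ ⊤ := Metric.isBounded_closedBall.measure_lt_top.ne
  refine ⟨2 / ‖m‖ * (volume B).toReal, by positivity, fun c r hr => ?_⟩
  rw [← h1.measure_preimage_emb h2]
  have hsub : slab n 0 ⁻¹' ({y : V | |inner ℝ m y + c| ≤ r} ∩ Metric.closedBall 0 R)
      ⊆ Metric.closedBall (-c / ‖m‖) (r / ‖m‖) ×ˢ B := by
    rintro ⟨t, y⟩ ⟨hy1, hy2⟩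
    have e1 : inner ℝ m (slab n 0 (t, y)) = ‖m‖ * t := by
      have := slab_inner (p := (0 : V)) hn1 (t, y)
      rw [sub_zero] at this
      conv_lhs => rw [hmn]
      rw [inner_smul_left, this]; simp
    have hy1 : |inner ℝ m (slab n 0 (t, y)) + c| ≤ r := hy1
    rw [e1] at hy1
    refine ⟨?_, ?_⟩
    · rw [Metric.mem_closedBall, Real.dist_eq]
      have : t - -c / ‖m‖ = (‖m‖ * t + c) / ‖m‖ := by field_simp; ring
      rw [this, abs_div, abs_of_pos hm0]
      gcongr
    · have h3 := norm_le_norm_slab n 0 (t, y)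
      rw [norm_zero, add_zero] at h3
      exact mem_closedBall_zero_iff.2 (h3.trans (mem_closedBall_zero_iff.1 hy2))
  refine (measure_mono hsub).trans ?_
  rw [Measure.volume_eq_prod, Measure.prod_prod, Real.volume_closedBall]
  rw [show 2 / ‖m‖ * (volume B).toReal * r = (2 * (r / ‖m‖)) * (volume B).toReal by ring,
    ENNReal.ofReal_mul (q := (volume B).toReal) (by positivity), ENNReal.ofReal_toReal hB]

theorem volume_edge_le {n m : E d} (hn : ‖n‖ = 1) (hm : ∀ c : ℝ, m ≠ c • n) (p q : E d) (R : ℝ) :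
    ∃ C : ℝ, 0 ≤ C ∧ ∀ r : ℝ, 0 ≤ r →
      volume ({x : E d | |inner ℝ m (x - q)| ≤ r} ∩ {x | |inner ℝ n (x - p)| ≤ r} ∩
        Metric.closedBall 0 R) ≤ ENNReal.ofReal (C * r ^ 2) := by
  set m' : (ℝ ∙ n)ᗮ := ⟨m - (inner ℝ n m) • n, Submodule.mem_orthogonal_singleton_iff_inner_right.2 (by
        rw [inner_sub_right, inner_smul_right, real_inner_self_eq_norm_sq, hn]; ring)⟩ with hm'
  have hm0 : m' ≠ 0 := by
    intro h
    have := congrArg Subtype.val h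
    exact hm (inner ℝ n m) (sub_eq_zero.1 this)
  obtain ⟨C, hC, hvol⟩ := volume_slab_le hm0 (R + ‖p‖)
  refine ⟨2 * C, by positivity, fun r hr => ?_⟩
  obtain ⟨h1, h2⟩ := slab_measurePreserving hn p
  set s := {x : E d | |inner ℝ m (x - q)| ≤ r} ∩ {x | |inner ℝ n (x - p)| ≤ r} ∩ Metric.closedBall 0 R
  have hs : MeasurableSet s := by
    refine MeasurableSet.inter (MeasurableSet.inter ?_ ?_) Metric.isClosed_closedBall.measurableSet
    · exact (isClosed_le (by fun_prop) continuous_const).measurableSet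
    · exact (isClosed_le (by fun_prop) continuous_const).measurableSet
  rw [← h1.measure_preimage_emb h2, Measure.volume_eq_prod,
    Measure.prod_apply (h1.measurable hs)]
  have hbd : ∀ t : ℝ, volume (Prod.mk t ⁻¹' (slab n p ⁻¹' s))
      ≤ (Icc (-r) r).indicator (fun _ => ENNReal.ofReal (C * r)) t := by
    intro t
    by_cases ht : t ∈ Icc (-r) r
    · rw [indicator_of_mem ht]
      refine (measure_mono ?_).trans (hvol (inner ℝ m (p - q) + t * inner ℝ m n) r hr)
      rintro y ⟨⟨hy1, -⟩, hy3⟩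
      refine ⟨?_, ?_⟩
      · have hy1 : |inner ℝ m (slab n p (t, y) - q)| ≤ r := hy1
        have h0 : inner ℝ n (y : E d) = 0 := Submodule.mem_orthogonal_singleton_iff_inner_right.1 y.2
        have e1 : inner ℝ m (slab n p (t, y) - q)
            = inner ℝ m' y + (inner ℝ m (p - q) + t * inner ℝ m n) := by
          rw [show slab n p (t, y) - q = (p - q) + t • n + (y : E d) by rw [slab]; abel,
            inner_add_right, inner_add_right, inner_smul_right]
          change _ = inner ℝ (m - (inner ℝ n m) • n) (y : E d) + _
          rw [inner_sub_left, inner_smul_left, h0]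
          simp; ring
        rw [e1] at hy1
        exact hy1
      · have h3 := norm_le_norm_slab n p (t, y)
        have h4 := mem_closedBall_zero_iff.1 hy3
        exact mem_closedBall_zero_iff.2 (by linarith)
    · rw [indicator_of_notMem ht]
      refine le_of_eq (measure_mono_null (t := ∅) ?_ measure_empty)
      rintro y ⟨⟨-, hy2⟩, -⟩
      have hy2 : |inner ℝ n (slab n p (t, y) - p)| ≤ r := hy2
      rw [slab_inner hn] at hy2
      exact absurd (abs_le.1 hy2) ht
  refine (lintegral_mono hbd).trans ?_
  rw [lintegral_indicator measurableSet_Icc, setLIntegral_const, Real.volume_Icc,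
    ← ENNReal.ofReal_mul (by positivity)]
  refine ENNReal.ofReal_le_ofReal (le_of_eq (by ring))

/-! ### Regular points -/

variable {K : Set (E d)} {faces : Finset (Set (E d))}

theorem shift_interior (hK : IsOpen K) {x : E d} (hx : x ∈ K) : ∃ ρ > 0,
    (∀ s, 0 < s → s < ρ / 4 → ∀ y ∈ closure K, y ∈ Metric.ball x ρ →
      ∀ z ∈ Metric.closedBall (s • (0 : E d)) (s / 2), y - z ∈ K) ∧
    ∀ y ∈ frontier K, y ∈ Metric.ball x ρ → outwardNormal K y = 0 ∧ ‖(0 : E d)‖ = 1 := by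
  obtain ⟨ρ, hρ, hb⟩ := Metric.isOpen_iff.1 hK x hx
  refine ⟨ρ / 2, by positivity, ?_, ?_⟩
  · intro s hs0 hs1 y _ hy z hz
    apply hb
    have h1 := IsMollifier.norm_le (by simp) hs0 hz
    rw [Metric.mem_ball, dist_eq_norm] at hy ⊢
    rw [show y - z - x = (y - x) - z by abel]
    have := norm_sub_le (y - x) z
    linarith
  · intro y hy hyb
    rw [hK.frontier_eq] at hy
    exact absurd (hb (Metric.ball_subset_ball (by linarith) hyb)) hy.2

theorem shift_boundary {n x : E d} (h : HalfSpaceAt K n x) : ∃ ρ > 0,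
    (∀ s, 0 < s → s < ρ / 4 → ∀ y ∈ closure K, y ∈ Metric.ball x ρ →
      ∀ z ∈ Metric.closedBall (s • n) (s / 2), y - z ∈ K) ∧
    ∀ y ∈ frontier K, y ∈ Metric.ball x ρ → outwardNormal K y = n ∧ ‖n‖ = 1 := by
  obtain ⟨ρ, hρ, hb⟩ := h.exists_ball
  have hn := h.1
  refine ⟨ρ / 2, by positivity, ?_, ?_⟩
  · intro s hs0 hs1 y hyc hy z hz
    have h1 := IsMollifier.norm_le hn.le hs0 hz
    have hyz : y - z ∈ Metric.ball x ρ := by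
      rw [Metric.mem_ball, dist_eq_norm] at hy ⊢
      rw [show y - z - x = (y - x) - z by abel]
      have := norm_sub_le (y - x) z
      linarith
    rw [hb _ hyz]
    have hy0 : inner ℝ n (y - x) ≤ 0 := by
      by_contra hcon
      push Not at hcon
      have hcont : Continuous fun z : E d => inner ℝ n (z - x) := by fun_prop
      obtain ⟨z, ⟨hz1, hz2⟩, hz3⟩ := mem_closure_iff_nhds.1 hyc _
        (inter_mem (Metric.isOpen_ball.mem_nhds
          (Metric.ball_subset_ball (show ρ / 2 ≤ ρ by linarith) hy))
          ((hcont.isOpen_preimage _ isOpen_Ioi).mem_nhds hcon))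
      exact lt_asymm hz2 ((hb z hz1).1 hz3)
    have hz0 : 0 < inner ℝ n z := by
      rw [Metric.mem_closedBall, dist_eq_norm] at hz
      have h2 : inner ℝ n z = s + inner ℝ n (z - s • n) := by
        rw [inner_sub_right, inner_smul_right, real_inner_self_eq_norm_sq, hn]; ring
      have h3 := abs_real_inner_le_norm n (z - s • n)
      rw [hn, one_mul] at h3
      have h4 := (abs_le.1 h3).1
      linarith
    rw [show y - z - x = (y - x) - z by abel, inner_sub_right]
    linarith
  · intro y hy hyb
    have hyb' := Metric.ball_subset_ball (show ρ / 2 ≤ ρ by linarith) hyb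
    exact ⟨(halfSpaceAt_of_ball hn hb hyb' ((mem_frontier_iff_of_ball hn hb hyb').1 hy)).outwardNormal_eq,
      hn⟩

theorem hyper_smul {n x y : E d} {c : ℝ} (hc : c ≠ 0) (hx : x ∈ hyper (c • n) y) :
    hyper (c • n) y = hyper n x := by
  ext z
  simp only [hyper, mem_ofPred_eq, inner_smul_left, RCLike.conj_to_real] at hx ⊢
  have hx' := (mul_eq_zero.1 hx).resolve_left hc
  rw [mul_eq_zero, or_iff_right hc, show z - y = (z - x) + (x - y) by abel, inner_add_right, hx',
    add_zero]

theorem exists_mem_frontier_of_isPreconnected (hK : IsOpen K) {t : Set (E d)}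
    (ht : IsPreconnected t) {y z : E d} (hy : y ∈ t) (hyK : y ∈ K) (hz : z ∈ t) (hzK : z ∉ K) :
    ∃ q ∈ t, q ∈ frontier K := by
  by_contra hcon
  push Not at hcon
  have hcl : ∀ q ∈ t, q ∉ K → q ∉ closure K := by
    intro q hq hqK hqc
    exact hcon q hq (by rw [hK.frontier_eq]; exact ⟨hqc, hqK⟩)
  obtain ⟨q, -, hq1, hq2⟩ := ht K (closure K)ᶜ hK isClosed_closure.isOpen_compl
    (fun q hq => by
      by_cases hqK : q ∈ K
      · exact Or.inl hqK
      · exact Or.inr (hcl q hq hqK)) ⟨y, hy, hyK⟩ ⟨z, hz, hcl z hz hzK⟩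
  exact hq2 (subset_closure hq1)

/-- A polyhedral domain is a half space near every boundary point that does not lie on two hyperplanes
of faces that are not parallel. -/
theorem IsPolyhedral.halfSpaceAt_of_regular (hK : IsPolyhedral K faces) {nF xF : Set (E d) → E d}
    (hn : ∀ F ∈ faces, ‖nF F‖ = 1) (hh : ∀ F ∈ faces, ∀ x ∈ F, HalfSpaceAt K (nF F) x)
    (hsub : ∀ F ∈ faces, F ⊆ hyper (nF F) (xF F)) {x : E d} (hx : x ∈ frontier K)
    (hreg : ∀ F ∈ faces, ∀ F' ∈ faces, x ∈ hyper (nF F) (xF F) → x ∈ hyper (nF F') (xF F') →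
      ∃ c : ℝ, nF F' = c • nF F) : ∃ n, HalfSpaceAt K n x := by
  have hx' := hx
  rw [hK.frontier_eq] at hx'
  simp only [mem_iUnion] at hx'
  obtain ⟨F, hF, hxF⟩ := hx'
  have hcl : ∀ F ∈ faces, closure F ⊆ hyper (nF F) (xF F) := fun F hF =>
    closure_minimal (hsub F hF) (isClosed_hyper _ _)
  set n := nF F with hnF
  have hn1 : ‖n‖ = 1 := hn F hF
  -- a ball that meets only the hyperplanes through `x`
  have hball : ∀ᶠ y in 𝓝 x, ∀ F' ∈ faces, y ∈ hyper (nF F') (xF F') → x ∈ hyper (nF F') (xF F') := by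
    rw [Filter.eventually_all_finset]
    intro F' _
    by_cases hxF' : x ∈ hyper (nF F') (xF F')
    · exact Eventually.of_forall fun _ _ => hxF'
    · filter_upwards [(isClosed_hyper _ _).isOpen_compl.mem_nhds hxF'] with y hy hy'
      exact absurd hy' hy
  obtain ⟨ρ, hρ, hb⟩ := Metric.eventually_nhds_iff_ball.1 hball
  have hfr : ∀ y ∈ Metric.ball x ρ, y ∈ frontier K → inner ℝ n (y - x) = 0 := by
    intro y hy hyK
    rw [hK.frontier_eq] at hyK
    simp only [mem_iUnion] at hyK
    obtain ⟨F', hF', hyF'⟩ := hyK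
    have h1 := hcl F' hF' hyF'
    have h2 := hb y hy F' hF' h1
    obtain ⟨c, hc⟩ := hreg F hF F' hF' (hcl F hF hxF) h2
    have hc0 : c ≠ 0 := by
      rintro rfl
      have := hn F' hF'
      rw [hc] at this
      simp at this
    rw [hc] at h1 h2
    rw [hyper_smul hc0 h2] at h1
    exact h1
  have hcont : Continuous fun z : E d => inner ℝ n (z - x) := by fun_prop
  -- a point of the face in the ball
  obtain ⟨y, hyb, hyF⟩ := mem_closure_iff_nhds.1 hxF _ (Metric.ball_mem_nhds x hρ)
  have hy0 := hfr y hyb (hK.face_subset hF hyF)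
  obtain ⟨r, hr, hyr⟩ := (hh F hF y hyF).exists_ball
  have hpt : ∀ c : ℝ, ∀ᶠ s : ℝ in 𝓝[>] 0, y + (s * c) • n ∈ Metric.ball x ρ ∩ Metric.ball y r := by
    intro c
    have h1 : Tendsto (fun s : ℝ => y + (s * c) • n) (𝓝 0) (𝓝 (y + (0 * c : ℝ) • n)) :=
      Continuous.tendsto (by fun_prop) _
    rw [zero_mul, zero_smul, add_zero] at h1
    exact (h1.mono_left nhdsWithin_le_nhds).eventually
      (inter_mem (Metric.isOpen_ball.mem_nhds hyb) (Metric.ball_mem_nhds y hr))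
  have hin : ∀ c : ℝ, inner ℝ n (y + c • n - y) = c := by
    intro c
    rw [add_sub_cancel_left, inner_smul_right, real_inner_self_eq_norm_sq, hn1]; ring
  have hin' : ∀ c : ℝ, inner ℝ n (y + c • n - x) = c := by
    intro c
    rw [show y + c • n - x = (y + c • n - y) + (y - x) by abel, inner_add_right, hin, hy0, add_zero]
  have hminus : Metric.ball x ρ ∩ {z | inner ℝ n (z - x) < 0} ⊆ K := by
    intro z hz
    by_contra hzK
    have hconv : Convex ℝ (Metric.ball x ρ ∩ {z | inner ℝ n (z - x) < 0}) := by
      refine (convex_ball x ρ).inter ?_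
      have : {z | inner ℝ n (z - x) < 0} = {z | (innerₗ (E d) n) z < inner ℝ n x} := by
        ext z
        simp only [mem_ofPred_eq, inner_sub_right, sub_neg, innerₗ_apply_apply]
      rw [this]
      exact convex_halfSpace_lt (innerₗ (E d) n).isLinear _
    obtain ⟨s, hs, hs0⟩ := ((hpt (-1)).and self_mem_nhdsWithin).exists
    have hs0 : 0 < s := hs0
    have h1 : y + (s * (-1)) • n ∈ K := by
      rw [hyr _ hs.2, hin]; linarith
    obtain ⟨q, hq, hq2⟩ := exists_mem_frontier_of_isPreconnected hK.isOpen
      hconv.isPreconnected ⟨hs.1, by change inner ℝ n _ < 0; rw [hin']; linarith⟩ h1 hz hzK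
    have := hfr q hq.1 hq2
    exact absurd hq.2 (by change ¬ inner ℝ n _ < 0; rw [this]; exact lt_irrefl _)
  have hplus : ∀ z ∈ Metric.ball x ρ, 0 < inner ℝ n (z - x) → z ∉ K := by
    intro z hzb hz hzK
    have hconv : Convex ℝ (Metric.ball x ρ ∩ {z | 0 < inner ℝ n (z - x)}) := by
      refine (convex_ball x ρ).inter ?_
      have : {z | 0 < inner ℝ n (z - x)} = {z | inner ℝ n x < (innerₗ (E d) n) z} := by
        ext z
        simp only [mem_ofPred_eq, inner_sub_right, sub_pos, innerₗ_apply_apply]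
      rw [this]
      exact convex_halfSpace_gt (innerₗ (E d) n).isLinear _
    obtain ⟨s, hs, hs0⟩ := ((hpt 1).and self_mem_nhdsWithin).exists
    have hs0 : 0 < s := hs0
    have h1 : y + (s * 1) • n ∉ K := by
      rw [hyr _ hs.2, hin]; linarith
    obtain ⟨q, hq, hq2⟩ := exists_mem_frontier_of_isPreconnected hK.isOpen
      hconv.isPreconnected ⟨hzb, hz⟩ hzK ⟨hs.1, by change 0 < inner ℝ n _; rw [hin']; linarith⟩ h1
    have := hfr q hq.1 hq2
    exact absurd hq.2 (by change ¬ 0 < inner ℝ n _; rw [this]; exact lt_irrefl _)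
  refine ⟨n, hn1, ?_⟩
  filter_upwards [Metric.ball_mem_nhds x hρ] with z hz
  refine ⟨fun hzK => ?_, fun hz0 => hminus ⟨hz, hz0⟩⟩
  rcases lt_trichotomy (inner ℝ n (z - x)) 0 with h1 | h1 | h1
  · exact h1
  · exfalso
    have h2 : Tendsto (fun s : ℝ => z + s • n) (𝓝[>] 0) (𝓝 z) := by
      have h1 : Tendsto (fun s : ℝ => z + s • n) (𝓝 0) (𝓝 (z + (0 : ℝ) • n)) :=
        Continuous.tendsto (by fun_prop) _
      rw [zero_smul, add_zero] at h1
      exact h1.mono_left nhdsWithin_le_nhds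
    obtain ⟨s, hs, hs0⟩ := ((h2.eventually (inter_mem (Metric.isOpen_ball.mem_nhds hz)
      (hK.isOpen.mem_nhds hzK))).and self_mem_nhdsWithin).exists
    have hs0 : 0 < s := hs0
    refine hplus _ hs.1 ?_ hs.2
    rw [show z + s • n - x = (z - x) + s • n by abel, inner_add_right, h1, inner_smul_right,
      real_inner_self_eq_norm_sq, hn1]
    linarith
  · exact absurd hzK (hplus z hz h1)

end

section

variable {d : ℕ}

open scoped Manifold in
theorem exists_smooth_partition {ι : Type*} {s : Set (E d)} (hs : IsClosed s) (U : ι → Set (E d))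
    (hU : ∀ i, IsOpen (U i)) (hsU : s ⊆ ⋃ i, U i) :
    ∃ f : ι → E d → ℝ, (∀ i, ContDiff ℝ ∞ (f i)) ∧ (∀ i, tsupport (f i) ⊆ U i) ∧
      ∀ x ∈ s, ∑ᶠ i, f i x = 1 := by
  obtain ⟨f, hf⟩ := SmoothPartitionOfUnity.exists_isSubordinate 𝓘(ℝ, E d) hs U hU hsU
  exact ⟨fun i => f i, fun i => (f i).contMDiff.contDiff, hf, fun x hx => f.sum_eq_one hx⟩

variable {K : Set (E d)} {faces : Finset (Set (E d))}

/-- Green's formula for a flux and the product of a function of class `H¹` with `η`. -/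
def GreenFor (K : Set (E d)) (v : E d → E d) (δ γ w : E d → ℝ) (g : E d → E d) (τ η : E d → ℝ) : Prop :=
  (∑ j, ∫ y, v y j * (g y j * η y + w y * pd j η y) ∂(vol K)) + ∫ y, δ y * (w y * η y) ∂(vol K)
    = ∫ y, γ y * (τ y * η y) ∂(bdry K)

section

variable {v : E d → E d} {δ γ w : E d → ℝ} {g : E d → E d} {τ : E d → ℝ}

theorem greenFor_zero : GreenFor K v δ γ w g τ 0 := by
  have : ∀ (j : Fin d) (y : E d), pd j (0 : E d → ℝ) y = 0 := by simp [pd]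
  simp [GreenFor, this]

theorem GreenFor.add (hK : IsPolyhedral K faces) (hf : IsFlux K v δ γ) (hw : HasTrace K w g τ)
    {η θ : E d → ℝ} (hη : ContDiff ℝ ∞ η) (hθ : ContDiff ℝ ∞ θ) (h1 : GreenFor K v δ γ w g τ η)
    (h2 : GreenFor K v δ γ w g τ θ) : GreenFor K v δ γ w g τ (η + θ) := by
  obtain ⟨hw2, hg2, hτ2, -⟩ := hw
  have i1 : ∀ j, ∀ η : E d → ℝ, ContDiff ℝ ∞ η →
      Integrable (fun y => v y j * (g y j * η y + w y * pd j η y)) (vol K) := fun j η hη =>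
    integrable_mul2 (memLp_component hf.memLp j)
      ((memLp_mul_bdd (memLp_component hg2 j) (hK.memLp_top_vol hη.continuous)).add
        (memLp_mul_bdd hw2 (hK.memLp_top_vol (contDiff_pd hη j).continuous)))
  have i2 : ∀ η : E d → ℝ, ContDiff ℝ ∞ η → Integrable (fun y => δ y * (w y * η y)) (vol K) :=
    fun η hη => integrable_mul2 hf.memLp_div (memLp_mul_bdd hw2 (hK.memLp_top_vol hη.continuous))
  have i3 : ∀ η : E d → ℝ, ContDiff ℝ ∞ η → Integrable (fun y => γ y * (τ y * η y)) (bdry K) :=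
    fun η hη => integrable_mul2 hf.memLp_ntr (memLp_mul_bdd hτ2 (hK.memLp_top_bdry hη.continuous))
  have e1 : ∀ j, ∫ y, v y j * (g y j * (η + θ) y + w y * pd j (η + θ) y) ∂(vol K)
      = ∫ y, v y j * (g y j * η y + w y * pd j η y) ∂(vol K)
        + ∫ y, v y j * (g y j * θ y + w y * pd j θ y) ∂(vol K) := by
    intro j
    rw [← integral_add (i1 j η hη) (i1 j θ hθ)]
    congr 1
    ext y
    have : pd j (η + θ) y = pd j η y + pd j θ y := by
      simp [pd, fderiv_add (smooth_differentiable hη y) (smooth_differentiable hθ y)]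
    rw [this, Pi.add_apply]
    ring
  have e2 : ∫ y, δ y * (w y * (η + θ) y) ∂(vol K)
      = ∫ y, δ y * (w y * η y) ∂(vol K) + ∫ y, δ y * (w y * θ y) ∂(vol K) := by
    rw [← integral_add (i2 η hη) (i2 θ hθ)]
    congr 1; ext y; rw [Pi.add_apply]; ring
  have e3 : ∫ y, γ y * (τ y * (η + θ) y) ∂(bdry K)
      = ∫ y, γ y * (τ y * η y) ∂(bdry K) + ∫ y, γ y * (τ y * θ y) ∂(bdry K) := by
    rw [← integral_add (i3 η hη) (i3 θ hθ)]
    congr 1; ext y; rw [Pi.add_apply]; ring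
  rw [GreenFor] at h1 h2 ⊢
  simp_rw [e1, Finset.sum_add_distrib]
  rw [e2, e3, ← h1, ← h2]
  ring

theorem GreenFor.sum (hK : IsPolyhedral K faces) (hf : IsFlux K v δ γ) (hw : HasTrace K w g τ)
    {ι : Type*} (s : Finset ι) {η : ι → E d → ℝ} (hη : ∀ i ∈ s, ContDiff ℝ ∞ (η i))
    (h : ∀ i ∈ s, GreenFor K v δ γ w g τ (η i)) : GreenFor K v δ γ w g τ (∑ i ∈ s, η i) := by
  classical
  induction s using Finset.induction_on with
  | empty => exact greenFor_zero
  | insert a s ha ih =>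
    rw [Finset.sum_insert ha]
    refine GreenFor.add hK hf hw (hη a (Finset.mem_insert_self _ _)) ?_
      (h a (Finset.mem_insert_self _ _))
      (ih (fun i hi => hη i (Finset.mem_insert_of_mem hi)) fun i hi => h i (Finset.mem_insert_of_mem hi))
    have : (∑ i ∈ s, η i) = fun x => ∑ i ∈ s, η i x := by ext x; simp
    rw [this]
    exact ContDiff.sum fun i hi => hη i (Finset.mem_insert_of_mem hi)

theorem GreenFor.of_local (hK : IsPolyhedral K faces) (hf : IsFlux K v δ γ) (hw : HasTrace K w g τ)
    {η : E d → ℝ} (hη : ContDiff ℝ ∞ η) (hc : HasCompactSupport η)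
    (h : ∀ x ∈ tsupport η, ∃ ρ > 0, ∀ θ : E d → ℝ, ContDiff ℝ ∞ θ → HasCompactSupport θ →
      tsupport θ ⊆ Metric.ball x ρ → GreenFor K v δ γ w g τ θ) : GreenFor K v δ γ w g τ η := by
  choose! ρ hρ hloc using h
  obtain ⟨t, ht, hcov⟩ := hc.elim_nhds_subcover (fun x => Metric.ball x (ρ x))
    fun x hx => Metric.ball_mem_nhds x (hρ x hx)
  obtain ⟨f, hfs, hfsub, hfsum⟩ := exists_smooth_partition (isClosed_tsupport η)
    (fun x : t => Metric.ball (x : E d) (ρ x)) (fun _ => Metric.isOpen_ball) (by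
      intro x hx
      have := hcov hx
      simp only [mem_iUnion] at this ⊢
      obtain ⟨i, hi, hxi⟩ := this
      exact ⟨⟨i, hi⟩, hxi⟩)
  have hsum : η = ∑ i : t, fun x => f i x * η x := by
    ext x
    rw [Finset.sum_apply, ← Finset.sum_mul]
    by_cases hx : x ∈ tsupport η
    · rw [← finsum_eq_sum_of_fintype, hfsum x hx, one_mul]
    · rw [image_eq_zero_of_notMem_tsupport hx, mul_zero]
  rw [hsum]
  refine GreenFor.sum hK hf hw _ (fun i _ => (hfs i).mul hη) fun i _ => ?_
  exact hloc i (ht i i.2) _ ((hfs i).mul hη) hc.mul_left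
    ((tsupport_mul_subset_left (f := f i) (g := η)).trans (hfsub i))

end

/-! ### Removing edges -/

theorem smoothTransition_deriv_bound :
    ∃ C : ℝ, 0 ≤ C ∧ ∀ t : ℝ, |deriv Real.smoothTransition t| ≤ C := by
  have hcont : Continuous (deriv Real.smoothTransition) :=
    (Real.smoothTransition.contDiff (n := 1)).continuous_deriv le_rfl
  obtain ⟨C, hC⟩ := (isCompact_Icc (a := (0:ℝ)) (b := 1)).exists_bound_of_continuousOn hcont.continuousOn
  refine ⟨max C 0, le_max_right _ _, fun t => ?_⟩
  by_cases ht : t ∈ Icc (0:ℝ) 1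
  · exact (hC t ht).trans (le_max_left _ _)
  · have : deriv Real.smoothTransition t = 0 := by
      rcases lt_or_ge t 0 with h | h
      · have : Real.smoothTransition =ᶠ[𝓝 t] fun _ => 0 := by
          filter_upwards [Iio_mem_nhds h] with s hs
          exact Real.smoothTransition.zero_of_nonpos (le_of_lt hs)
        rw [this.deriv_eq]; simp
      · have h1 : 1 < t := by
          by_contra hcon
          exact ht ⟨h, not_lt.1 hcon⟩
        have : Real.smoothTransition =ᶠ[𝓝 t] fun _ => 1 := by
          filter_upwards [Ioi_mem_nhds h1] with s hs
          exact Real.smoothTransition.one_of_one_le (le_of_lt hs)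
        rw [this.deriv_eq]; simp
    rw [this, abs_zero]
    exact le_max_right _ _

/-- The sum of the squared distances to two hyperplanes. -/
def edgeDist (n m p q x : E d) : ℝ := inner ℝ m (x - q) ^ 2 + inner ℝ n (x - p) ^ 2

/-- A function that vanishes near the intersection of two hyperplanes. -/
def edgeCut (n m p q : E d) (r : ℝ) (x : E d) : ℝ :=
  Real.smoothTransition (r⁻¹ ^ 2 * edgeDist n m p q x - 1)

theorem contDiff_edgeDist (n m p q : E d) : ContDiff ℝ ∞ (edgeDist n m p q) := by
  exact ((contDiff_const.inner ℝ (contDiff_id.sub contDiff_const)).pow 2).add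
    ((contDiff_const.inner ℝ (contDiff_id.sub contDiff_const)).pow 2)

theorem contDiff_edgeCut (n m p q : E d) (r : ℝ) : ContDiff ℝ ∞ (edgeCut n m p q r) :=
  Real.smoothTransition.contDiff.comp
    ((contDiff_const.mul (contDiff_edgeDist n m p q)).sub contDiff_const)

theorem edgeDist_nonneg (n m p q x : E d) : 0 ≤ edgeDist n m p q x := by unfold edgeDist; positivity

theorem abs_edgeCut_le (n m p q : E d) (r : ℝ) (x : E d) : |edgeCut n m p q r x| ≤ 1 := by
  rw [edgeCut, abs_of_nonneg (Real.smoothTransition.nonneg _)]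
  exact Real.smoothTransition.le_one _

theorem edgeCut_eq_one {n m p q : E d} {r : ℝ} (hr : 0 < r) {x : E d}
    (h : 2 * r ^ 2 ≤ edgeDist n m p q x) : edgeCut n m p q r x = 1 := by
  refine Real.smoothTransition.one_of_one_le ?_
  have : r⁻¹ ^ 2 * (2 * r ^ 2) = 2 := by field_simp
  have h2 := mul_le_mul_of_nonneg_left h (sq_nonneg r⁻¹)
  linarith

theorem tsupport_edgeCut_subset {n m p q : E d} {r : ℝ} (hr : 0 < r) :
    tsupport (edgeCut n m p q r) ⊆ {x | r ^ 2 ≤ edgeDist n m p q x} := by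
  refine closure_minimal (fun x hx => ?_)
    (isClosed_le continuous_const (contDiff_edgeDist n m p q).continuous)
  by_contra hcon
  have hcon : edgeDist n m p q x < r ^ 2 := not_le.1 hcon
  refine hx (Real.smoothTransition.zero_of_nonpos ?_)
  have : r⁻¹ ^ 2 * r ^ 2 = 1 := by field_simp
  have h2 := mul_le_mul_of_nonneg_left hcon.le (sq_nonneg r⁻¹)
  linarith

theorem pd_edgeCut_bound : ∃ C : ℝ, 0 ≤ C ∧ ∀ (n m p q : E d), ‖n‖ = 1 → ‖m‖ = 1 → ∀ r > 0,
    ∀ j x, |pd j (edgeCut n m p q r) x| ≤ C * r⁻¹ ∧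
      (2 * r ^ 2 < edgeDist n m p q x → pd j (edgeCut n m p q r) x = 0) := by
  obtain ⟨C, hC, hCb⟩ := smoothTransition_deriv_bound
  refine ⟨8 * C, by positivity, fun n m p q hn hm r hr j x => ?_⟩
  have hz : 2 * r ^ 2 < edgeDist n m p q x → pd j (edgeCut n m p q r) x = 0 := by
    intro h
    have : edgeCut n m p q r =ᶠ[𝓝 x] fun _ => 1 := by
      filter_upwards [(isOpen_lt continuous_const (contDiff_edgeDist n m p q).continuous).mem_nhds h]
        with y hy
      exact edgeCut_eq_one hr (le_of_lt hy)
    rw [pd, this.fderiv_eq]; simp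
  refine ⟨?_, hz⟩
  by_cases hfar : 2 * r ^ 2 < edgeDist n m p q x
  · rw [hz hfar, abs_zero]; positivity
  rw [not_lt] at hfar
  have hin : ∀ a b : E d, HasFDerivAt (fun y : E d => inner ℝ a (y - b)) (innerSL ℝ a) x := fun a b => by
    have := ((innerSL ℝ a).hasFDerivAt (x := x)).sub_const (inner ℝ a b)
    refine this.congr_of_eventuallyEq (Eventually.of_forall fun y => ?_)
    simp [inner_sub_right]
  have hd1 : HasFDerivAt (edgeDist n m p q) ((2 * inner ℝ m (x - q)) • innerSL ℝ m
      + (2 * inner ℝ n (x - p)) • innerSL ℝ n) x := by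
    have := ((hin m q).pow 2).add ((hin n p).pow 2)
    simpa using! this
  have hT : HasDerivAt Real.smoothTransition
      (deriv Real.smoothTransition (r⁻¹ ^ 2 * edgeDist n m p q x - 1))
      (r⁻¹ ^ 2 * edgeDist n m p q x - 1) :=
    ((Real.smoothTransition.contDiff (n := 1)).differentiable one_ne_zero _).hasDerivAt
  have hd2 : HasFDerivAt (edgeCut n m p q r) _ x :=
    hT.comp_hasFDerivAt x ((hd1.const_mul (r⁻¹ ^ 2)).sub_const 1)
  have e1 : pd j (edgeCut n m p q r) x = deriv Real.smoothTransition (r⁻¹ ^ 2 * edgeDist n m p q x - 1)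
      * (r⁻¹ ^ 2 * (2 * inner ℝ m (x - q) * m j + 2 * inner ℝ n (x - p) * n j)) := by
    rw [pd, hd2.fderiv]
    simp [inner_eq_sum]
    ring
  have hmj : |m j| ≤ 1 := (PiLp.norm_apply_le m j).trans hm.le
  have hnj : |n j| ≤ 1 := (PiLp.norm_apply_le n j).trans hn.le
  have hb : ∀ t : ℝ, t ^ 2 ≤ edgeDist n m p q x → |t| ≤ 2 * r := by
    intro t ht
    refine abs_le_of_sq_le_sq (by nlinarith) (by positivity)
  have hb1 := hb (inner ℝ m (x - q)) (by unfold edgeDist; nlinarith [sq_nonneg (inner ℝ n (x - p))])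
  have hb2 := hb (inner ℝ n (x - p)) (by unfold edgeDist; nlinarith [sq_nonneg (inner ℝ m (x - q))])
  have e2 : |2 * inner ℝ m (x - q) * m j + 2 * inner ℝ n (x - p) * n j| ≤ 8 * r := by
    have a1 : |2 * inner ℝ m (x - q) * m j| ≤ 2 * (2 * r) * 1 := by
      rw [abs_mul, abs_mul, abs_two]; gcongr
    have a2 : |2 * inner ℝ n (x - p) * n j| ≤ 2 * (2 * r) * 1 := by
      rw [abs_mul, abs_mul, abs_two]; gcongr
    refine (abs_add_le _ _).trans ?_
    linarith
  rw [e1, abs_mul, abs_mul, abs_of_nonneg (sq_nonneg r⁻¹)]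
  calc _ ≤ C * (r⁻¹ ^ 2 * (8 * r)) := by
        gcongr
        exact hCb _
    _ = 8 * C * r⁻¹ := by field_simp

end

section

variable {d : ℕ}

variable {K : Set (E d)} {faces : Finset (Set (E d))}

theorem edgeDist_eq_zero_iff {n m p q x : E d} :
    edgeDist n m p q x = 0 ↔ x ∈ hyper m q ∩ hyper n p := by
  constructor
  · intro h
    unfold edgeDist at h
    constructor
    · change inner ℝ m (x - q) = 0
      nlinarith [sq_nonneg (inner ℝ m (x - q)), sq_nonneg (inner ℝ n (x - p))]
    · change inner ℝ n (x - p) = 0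
      nlinarith [sq_nonneg (inner ℝ m (x - q)), sq_nonneg (inner ℝ n (x - p))]
  · rintro ⟨h1, h2⟩
    have h1 : inner ℝ m (x - q) = 0 := h1
    have h2 : inner ℝ n (x - p) = 0 := h2
    simp [edgeDist, h1, h2]

theorem GreenFor.remove_edge (hK : IsPolyhedral K faces) {v : E d → E d} {δ γ w : E d → ℝ}
    {g : E d → E d} {τ : E d → ℝ} (hf : IsFlux K v δ γ) (hw : HasTrace K w g τ) {M : ℝ} (hM0 : 0 ≤ M)
    (hM : ∀ᵐ x ∂(vol K), |w x| ≤ M) {n m : E d} (hn : ‖n‖ = 1) (hm : ‖m‖ = 1)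
    (hnm : ∀ c : ℝ, m ≠ c • n) (p q : E d) (S : Set (E d))
    (h : ∀ η : E d → ℝ, ContDiff ℝ ∞ η → HasCompactSupport η →
      Disjoint (tsupport η) (S ∪ (hyper m q ∩ hyper n p)) → GreenFor K v δ γ w g τ η)
    {η : E d → ℝ} (hη : ContDiff ℝ ∞ η) (hc : HasCompactSupport η) (hS : Disjoint (tsupport η) S) :
    GreenFor K v δ γ w g τ η := by
  have := hK.isFiniteMeasure_vol
  have hKm := hK.isOpen.measurableSet
  obtain ⟨hw2, hg2, hτ2, -⟩ := id hw
  have hvj := fun j => memLp_component hf.memLp j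
  set r : ℕ → ℝ := fun k => 1 / ((k : ℝ) + 1) with hr
  have hr0 : ∀ k, 0 < r k := fun k => by positivity
  have hrt : Tendsto r atTop (𝓝 0) := tendsto_one_div_add_atTop_nhds_zero_nat
  set ζ : ℕ → E d → ℝ := fun k => edgeCut n m p q (r k) with hζdef
  have hζ : ∀ k, ContDiff ℝ ∞ (ζ k) := fun k => contDiff_edgeCut n m p q (r k)
  set Z := hyper m q ∩ hyper n p with hZ
  obtain ⟨R, hR⟩ := hK.isBounded.subset_closedBall (0 : E d)
  obtain ⟨C2, hC2, hvol⟩ := volume_edge_le hn hnm p q R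
  obtain ⟨A, hA⟩ := hc.exists_bound_of_continuous hη.continuous
  have hA0 : 0 ≤ A := (norm_nonneg _).trans (hA 0)
  obtain ⟨C1, hC1, hpd⟩ := pd_edgeCut_bound (d := d)
  -- pointwise convergence of the cut-off functions
  have hfar : ∀ x, x ∉ Z → ∀ᶠ k in atTop, 2 * r k ^ 2 < edgeDist n m p q x := by
    intro x hx
    have hpos : 0 < edgeDist n m p q x :=
      lt_of_le_of_ne (edgeDist_nonneg _ _ _ _ _) fun h0 => hx (edgeDist_eq_zero_iff.1 h0.symm)
    have h1 : Tendsto (fun k => 2 * r k ^ 2) atTop (𝓝 (2 * 0 ^ 2)) := (hrt.pow 2).const_mul 2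
    rw [show (2 : ℝ) * 0 ^ 2 = 0 by norm_num] at h1
    exact h1.eventually_lt_const hpos
  have hζ1 : ∀ x, x ∉ Z → Tendsto (fun k => ζ k x) atTop (𝓝 1) := by
    intro x hx
    refine tendsto_const_nhds.congr' ?_
    filter_upwards [hfar x hx] with k hk
    exact (edgeCut_eq_one (hr0 k) hk.le).symm
  have hZv : ∀ᵐ x ∂(vol K), x ∉ Z := by
    have h1 := hvol 0 le_rfl
    rw [show C2 * (0:ℝ) ^ 2 = 0 by ring, ENNReal.ofReal_zero, nonpos_iff_eq_zero] at h1
    have h2 := measure_eq_zero_iff_ae_notMem.1 h1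
    filter_upwards [ae_restrict_of_ae h2, ae_vol_mem hKm] with x hx hxK hxZ
    have h3 : inner ℝ m (x - q) = 0 := hxZ.1
    have h4 : inner ℝ n (x - p) = 0 := hxZ.2
    exact hx ⟨⟨by simp [h3], by simp [h4]⟩, hR hxK⟩
  have hZb : ∀ᵐ x ∂(bdry K), x ∉ Z :=
    ae_restrict_of_ae (measure_eq_zero_iff_ae_notMem.1 (sig_hyper_inter hn p q hnm))
  have hdom : ∀ {μ : Measure (E d)} (f : E d → ℝ), Integrable f μ → (∀ᵐ x ∂μ, x ∉ Z) →
      Tendsto (fun k => ∫ x, f x * ζ k x ∂μ) atTop (𝓝 (∫ x, f x ∂μ)) := by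
    intro μ f hfi hZ
    refine tendsto_integral_of_dominated_convergence (fun x => |f x|) (fun k => ?_) hfi.abs
      (fun k => Eventually.of_forall fun x => ?_) ?_
    · exact hfi.aestronglyMeasurable.mul (hζ k).continuous.aestronglyMeasurable
    · rw [norm_mul, Real.norm_eq_abs, Real.norm_eq_abs]
      exact mul_le_of_le_one_right (abs_nonneg _) (abs_edgeCut_le _ _ _ _ _ _)
    · filter_upwards [hZ] with x hx
      simpa using (hζ1 x hx).const_mul (f x)
  -- the term with the gradient of the cut-off function
  have hsmall : ∀ j, Tendsto (fun k => ∫ y, v y j * (w y * η y * pd j (ζ k) y) ∂(vol K)) atTop (𝓝 0) := by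
    intro j
    set Nk : ℕ → Set (E d) := fun k => {x | edgeDist n m p q x ≤ 2 * r k ^ 2} with hNk
    have hNm : ∀ k, MeasurableSet (Nk k) := fun k =>
      (isClosed_le (contDiff_edgeDist n m p q).continuous continuous_const).measurableSet
    have hvN : ∀ k, MemLp ((Nk k).indicator fun y => v y j) 2 (vol K) := fun k =>
      (hvj j).indicator (hNm k)
    have hcut : ∀ k, MemLp (fun y => w y * η y * pd j (ζ k) y) 2 (vol K) := fun k =>
      memLp_mul_bdd (memLp_mul_bdd hw2 (hK.memLp_top_vol hη.continuous))
        (hK.memLp_top_vol (contDiff_pd (hζ k) j).continuous)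
    set D := M * A * C1 * √(4 * C2)
    have hb1 : ∀ k, l2 (vol K) (fun y => w y * η y * pd j (ζ k) y) ≤ D := by
      intro k
      refine l2_le_of_sq_le (by positivity) ?_
      have h1 : ∀ᵐ y ∂(vol K), (w y * η y * pd j (ζ k) y) ^ 2
          ≤ (Nk k).indicator (fun _ => (M * A * (C1 * (r k)⁻¹)) ^ 2) y := by
        filter_upwards [hM] with y hy
        obtain ⟨h2, h3⟩ := hpd n m p q hn hm (r k) (hr0 k) j y
        by_cases hyN : y ∈ Nk k
        · rw [indicator_of_mem hyN]
          refine sq_le_sq' ?_ ?_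
          all_goals
            have h4 : |w y * η y * pd j (ζ k) y| ≤ M * A * (C1 * (r k)⁻¹) := by
              rw [abs_mul, abs_mul]
              have := hA y
              rw [Real.norm_eq_abs] at this
              gcongr
            rw [abs_le] at h4
            linarith [h4.1, h4.2]
        · rw [indicator_of_notMem hyN, h3 (not_le.1 hyN)]
          simp
      have hi : Integrable ((Nk k).indicator (fun _ => (M * A * (C1 * (r k)⁻¹)) ^ 2)) (vol K) :=
        (integrable_const _).indicator (hNm k)
      refine (integral_mono_ae (hcut k).integrable_sq hi h1).trans ?_
      rw [integral_indicator_const _ (hNm k), smul_eq_mul]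
      have h5 : (vol K).real (Nk k) ≤ C2 * (2 * r k) ^ 2 := by
        refine ENNReal.toReal_le_of_le_ofReal (by positivity) ?_
        refine le_trans ?_ (hvol (2 * r k) (by have := hr0 k; positivity))
        rw [vol, Measure.restrict_apply (hNm k)]
        refine measure_mono ?_
        rintro y ⟨hy, hyK⟩
        have hy : edgeDist n m p q y ≤ 2 * r k ^ 2 := hy
        have hrk := hr0 k
        unfold edgeDist at hy
        refine ⟨⟨?_, ?_⟩, hR hyK⟩
        · have a1 : inner ℝ m (y - q) ^ 2 ≤ (2 * r k) ^ 2 := by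
            have a2 : (0 : ℝ) ≤ inner ℝ n (y - p) ^ 2 := sq_nonneg _
            nlinarith [sq_nonneg (r k)]
          exact abs_le_of_sq_le_sq a1 (by positivity)
        · have a1 : inner ℝ n (y - p) ^ 2 ≤ (2 * r k) ^ 2 := by
            have a2 : (0 : ℝ) ≤ inner ℝ m (y - q) ^ 2 := sq_nonneg _
            nlinarith [sq_nonneg (r k)]
          exact abs_le_of_sq_le_sq a1 (by positivity)
      refine (mul_le_mul_of_nonneg_right h5 (sq_nonneg _)).trans (le_of_eq ?_)
      simp only [D]
      have hs : √(4 * C2) ^ 2 = 4 * C2 := Real.sq_sqrt (by positivity)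
      rw [mul_pow (M * A * C1), hs]
      have := (hr0 k).ne'
      field_simp
      ring
    have hb2 : Tendsto (fun k => l2 (vol K) ((Nk k).indicator fun y => v y j)) atTop (𝓝 0) := by
      have h1 : Tendsto (fun k => ∫ y, ((Nk k).indicator (fun y => v y j) y) ^ 2 ∂(vol K)) atTop
          (𝓝 (∫ y, (0 : ℝ) ∂(vol K))) := by
        refine tendsto_integral_of_dominated_convergence (fun y => v y j ^ 2)
          (fun k => (hvN k).integrable_sq.aestronglyMeasurable) (hvj j).integrable_sq
          (fun k => Eventually.of_forall fun y => ?_) ?_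
        · by_cases hy : y ∈ Nk k
          · simp [hy]
          · simp [hy, sq_nonneg]
        · filter_upwards [hZv] with y hy
          refine tendsto_const_nhds.congr' ?_
          filter_upwards [hfar y hy] with k hk
          have hnot : y ∉ Nk k := fun hh => absurd hk (not_lt.2 hh)
          rw [indicator_of_notMem hnot]
          simp
      rw [integral_zero] at h1
      have := (Real.continuous_sqrt.tendsto 0).comp h1
      rwa [Real.sqrt_zero] at this
    have hb3 := hb2.mul_const D
    rw [zero_mul] at hb3
    refine squeeze_zero_norm (fun k => ?_) hb3
    have e1 : ∫ y, v y j * (w y * η y * pd j (ζ k) y) ∂(vol K)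
        = ∫ y, (Nk k).indicator (fun y => v y j) y * (w y * η y * pd j (ζ k) y) ∂(vol K) := by
      congr 1
      ext y
      by_cases hy : y ∈ Nk k
      · rw [indicator_of_mem hy]
      · rw [(hpd n m p q hn hm (r k) (hr0 k) j y).2 (not_le.1 hy)]; simp
    rw [e1]
    exact (abs_integral_mul_le (hvN k) (hcut k)).trans
      (mul_le_mul_of_nonneg_left (hb1 k) (l2_nonneg _ _))
  have i1 : ∀ j, Integrable (fun y => v y j * (g y j * η y + w y * pd j η y)) (vol K) := fun j =>
    integrable_mul2 (hvj j) ((memLp_mul_bdd (memLp_component hg2 j) (hK.memLp_top_vol hη.continuous)).add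
      (memLp_mul_bdd hw2 (hK.memLp_top_vol (contDiff_pd hη j).continuous)))
  have i2 : Integrable (fun y => δ y * (w y * η y)) (vol K) :=
    integrable_mul2 hf.memLp_div (memLp_mul_bdd hw2 (hK.memLp_top_vol hη.continuous))
  have i3 : Integrable (fun y => γ y * (τ y * η y)) (bdry K) :=
    integrable_mul2 hf.memLp_ntr (memLp_mul_bdd hτ2 (hK.memLp_top_bdry hη.continuous))
  have t1 := (tendsto_finsetSum Finset.univ fun j _ => (hdom _ (i1 j) hZv).add (hsmall j)).add
    (hdom _ i2 hZv)
  have t2 := hdom _ i3 hZb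
  simp only [add_zero] at t1
  refine tendsto_nhds_unique (t1.congr fun k => ?_) t2
  have hg := h (fun y => η y * ζ k y) (hη.mul (hζ k)) hc.mul_right (by
    rw [disjoint_union_right]
    refine ⟨hS.mono_left (tsupport_mul_subset_left (f := η) (g := ζ k)), ?_⟩
    rw [Set.disjoint_left]
    intro x hx hxZ
    have h1 := tsupport_edgeCut_subset (hr0 k) (tsupport_mul_subset_right (f := η) (g := ζ k) hx)
    have h2 : r k ^ 2 ≤ edgeDist n m p q x := h1
    rw [edgeDist_eq_zero_iff.2 hxZ] at h2
    have := pow_pos (hr0 k) 2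
    linarith)
  rw [GreenFor] at hg
  have e1 : ∀ j, ∫ y, v y j * (g y j * η y + w y * pd j η y) * ζ k y ∂(vol K)
      + ∫ y, v y j * (w y * η y * pd j (ζ k) y) ∂(vol K)
      = ∫ y, v y j * (g y j * (η y * ζ k y) + w y * pd j (fun y => η y * ζ k y) y) ∂(vol K) := by
    intro j
    rw [← integral_add]
    · congr 1
      ext y
      rw [pd_mul (smooth_differentiable hη y) (smooth_differentiable (hζ k) y)]
      ring
    · have := (i1 j).bdd_mul (hζ k).continuous.aestronglyMeasurable
        (Eventually.of_forall fun y => abs_edgeCut_le n m p q (r k) y)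
      simpa [mul_comm] using this
    · exact integrable_mul2 (hvj j) (memLp_mul_bdd (memLp_mul_bdd hw2 (hK.memLp_top_vol hη.continuous))
        (hK.memLp_top_vol (contDiff_pd (hζ k) j).continuous))
  simp_rw [e1, mul_assoc]
  exact hg

/-- A cut-off function that is one on `K`. -/
theorem exists_cutoff (hb : Bornology.IsBounded K) : ∃ χ : E d → ℝ, ContDiff ℝ ∞ χ ∧
    HasCompactSupport χ ∧ ∀ x ∈ closure K, χ x = 1 ∧ ∀ j, pd j χ x = 0 := by
  obtain ⟨R, hR⟩ := hb.closure.subset_closedBall (0 : E d)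
  let f : ContDiffBump (0 : E d) := ⟨|R| + 1, |R| + 2, by positivity, by linarith⟩
  refine ⟨f, f.contDiff, f.hasCompactSupport, fun x hx => ?_⟩
  have h1 : ∀ᶠ y in 𝓝 x, f y = 1 := by
    have : x ∈ Metric.ball (0 : E d) (|R| + 1) := by
      have h1 := mem_closedBall_zero_iff.1 (hR hx)
      rw [mem_ball_zero_iff]
      linarith [le_abs_self R]
    filter_upwards [Metric.isOpen_ball.mem_nhds this] with y hy
    exact f.one_of_mem_closedBall (Metric.ball_subset_closedBall hy)
  refine ⟨h1.self_of_nhds, fun j => ?_⟩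
  have h2 : (f : E d → ℝ) =ᶠ[𝓝 x] fun _ => 1 := h1
  rw [pd, h2.fderiv_eq]
  simp

/-- Green's formula for a flux and a bounded function of class `H¹` on a polyhedral domain. -/
theorem green_of_bounded (hK : IsPolyhedral K faces) (hdiv : DivergenceTheorem K)
    {v : E d → E d} {δ γ w : E d → ℝ} {g : E d → E d} {τ : E d → ℝ} (hf : IsFlux K v δ γ)
    (hw : HasTrace K w g τ) {M : ℝ} (hM0 : 0 ≤ M) (hM : ∀ᵐ x ∂(vol K), |w x| ≤ M) :
    (∑ j, ∫ y, v y j * g y j ∂(vol K)) + ∫ y, δ y * w y ∂(vol K) = ∫ y, γ y * τ y ∂(bdry K) := by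
  classical
  have hdat : ∀ F : Set (E d), ∃ n x : E d, F ∈ faces → ‖n‖ = 1 ∧
      (∀ y ∈ F, HalfSpaceAt K n y) ∧ F ⊆ hyper n x := by
    intro F
    by_cases hF : F ∈ faces
    · obtain ⟨n, hn, hh, U, -, hU⟩ := hK.exists_normal hF
      obtain ⟨x, hx⟩ := hK.face_nonempty F hF
      refine ⟨n, x, fun _ => ⟨hn, hh, ?_⟩⟩
      rw [hU x hx]
      exact inter_subset_right
    · exact ⟨0, 0, fun h => absurd h hF⟩
  choose nF xF hF using hdat
  let P : Finset (Set (E d) × Set (E d)) :=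
    (faces ×ˢ faces).filter fun a => ∀ c : ℝ, nF a.2 ≠ c • nF a.1
  let edge : Set (E d) × Set (E d) → Set (E d) := fun a =>
    hyper (nF a.2) (xF a.2) ∩ hyper (nF a.1) (xF a.1)
  have hball : ∀ x : E d, ∀ ρ > 0, ∀ e : E d, ‖e‖ ≤ 1 →
      (∀ s, 0 < s → s < ρ / 4 → ∀ y ∈ closure K, y ∈ Metric.ball x ρ →
        ∀ z ∈ Metric.closedBall (s • e) (s / 2), y - z ∈ K) →
      (∀ y ∈ frontier K, y ∈ Metric.ball x ρ → outwardNormal K y = e ∧ ‖e‖ = 1) →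
      ∀ θ : E d → ℝ, ContDiff ℝ ∞ θ → HasCompactSupport θ → tsupport θ ⊆ Metric.ball x (ρ / 2) →
        GreenFor K v δ γ w g τ θ := by
    intro x ρ hρ e he h1 h2 θ hθ hc hs
    obtain ⟨A, hA⟩ := hc.exists_bound_of_continuous hθ.continuous
    exact (green_local hK hdiv hw hM0 hM he hρ h1 h2 hθ hs hA).1 v δ γ hf
  -- functions that vanish near all edges
  have hbase : ∀ η : E d → ℝ, ContDiff ℝ ∞ η → HasCompactSupport η →
      Disjoint (tsupport η) (⋃ a ∈ P, edge a) → GreenFor K v δ γ w g τ η := by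
    intro η hη hc hS
    refine GreenFor.of_local hK hf hw hη hc fun x hx => ?_
    have hxS := Set.disjoint_left.1 hS hx
    by_cases hxc : x ∈ closure K
    · by_cases hxK : x ∈ K
      · obtain ⟨ρ, hρ, h1, h2⟩ := shift_interior hK.isOpen hxK
        exact ⟨ρ / 2, by positivity, hball x ρ hρ 0 (by simp) h1 h2⟩
      · have hxf : x ∈ frontier K := by rw [hK.isOpen.frontier_eq]; exact ⟨hxc, hxK⟩
        obtain ⟨n, hn⟩ := hK.halfSpaceAt_of_regular (fun F h => (hF F h).1) (fun F h => (hF F h).2.1)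
          (fun F h => (hF F h).2.2) hxf (by
            intro F hFm F' hFm' h1 h2
            by_contra hcon
            push Not at hcon
            refine hxS ?_
            simp only [mem_iUnion]
            exact ⟨(F, F'), Finset.mem_filter.2 ⟨Finset.mem_product.2 ⟨hFm, hFm'⟩, hcon⟩, h2, h1⟩)
        obtain ⟨ρ, hρ, h1, h2⟩ := shift_boundary hn
        exact ⟨ρ / 2, by positivity, hball x ρ hρ n hn.1.le h1 h2⟩
    · obtain ⟨ρ, hρ, hb⟩ := Metric.isOpen_iff.1 isClosed_closure.isOpen_compl x hxc
      refine ⟨ρ / 2, by positivity, hball x ρ hρ 0 (by simp) ?_ ?_⟩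
      · intro s _ _ y hy hyb
        exact absurd hy (hb hyb)
      · intro y hy hyb
        exact absurd (frontier_subset_closure hy) (hb hyb)
  have hall : ∀ Q : Finset (Set (E d) × Set (E d)), Q ⊆ P → ∀ η : E d → ℝ, ContDiff ℝ ∞ η →
      HasCompactSupport η → Disjoint (tsupport η) (⋃ a ∈ P \ Q, edge a) →
      GreenFor K v δ γ w g τ η := by
    intro Q
    induction Q using Finset.induction_on with
    | empty =>
      intro _ η hη hc hS
      rw [Finset.sdiff_empty] at hS
      exact hbase η hη hc hS
    | insert a Q ha ih =>
      intro hQ η hη hc hS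
      have haP := hQ (Finset.mem_insert_self a Q)
      have haP' := Finset.mem_filter.1 haP
      have hm := Finset.mem_product.1 haP'.1
      refine GreenFor.remove_edge hK hf hw hM0 hM (hF a.1 hm.1).1 (hF a.2 hm.2).1 haP'.2 (xF a.1) (xF a.2)
        (⋃ b ∈ P \ insert a Q, edge b) ?_ hη hc hS
      intro θ hθ hθc hθS
      refine ih (fun b hb => hQ (Finset.mem_insert_of_mem hb)) θ hθ hθc (hθS.mono_right ?_)
      intro x hx
      simp only [mem_iUnion] at hx
      obtain ⟨b, hb, hxb⟩ := hx
      by_cases hba : b = a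
      · right
        rw [hba] at hxb
        exact hxb
      · left
        simp only [mem_iUnion]
        refine ⟨b, ?_, hxb⟩
        rw [Finset.mem_sdiff] at hb ⊢
        exact ⟨hb.1, fun h => (Finset.mem_insert.1 h).elim hba hb.2⟩
  obtain ⟨χ, hχ, hχc, hχ1⟩ := exists_cutoff hK.isBounded
  have hfin := hall P Finset.Subset.rfl χ hχ hχc (by simp)
  rw [GreenFor] at hfin
  have e1 : ∀ j, ∫ y, v y j * (g y j * χ y + w y * pd j χ y) ∂(vol K) = ∫ y, v y j * g y j ∂(vol K) := by
    intro j
    refine integral_congr_ae ?_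
    filter_upwards [ae_vol_mem hK.isOpen.measurableSet] with y hy
    obtain ⟨h1, h2⟩ := hχ1 y (subset_closure hy)
    rw [h1, h2 j]; ring
  have e2 : ∫ y, δ y * (w y * χ y) ∂(vol K) = ∫ y, δ y * w y ∂(vol K) := by
    refine integral_congr_ae ?_
    filter_upwards [ae_vol_mem hK.isOpen.measurableSet] with y hy
    rw [(hχ1 y (subset_closure hy)).1, mul_one]
  have e3 : ∫ y, γ y * (τ y * χ y) ∂(bdry K) = ∫ y, γ y * τ y ∂(bdry K) := by
    refine integral_congr_ae ?_
    filter_upwards [ae_bdry_mem_frontier K] with y hy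
    rw [(hχ1 y (frontier_subset_closure hy)).1, mul_one]
  simp_rw [e1, e2, e3] at hfin
  exact hfin

/-- The trace of a bounded function is bounded by the same constant. -/
theorem trace_le_of_bounded (hK : IsPolyhedral K faces) (hdiv : DivergenceTheorem K)
    {w : E d → ℝ} {g : E d → E d} {τ : E d → ℝ} (hw : HasTrace K w g τ) {M : ℝ} (hM0 : 0 ≤ M)
    (hM : ∀ᵐ x ∂(vol K), |w x| ≤ M) : ∀ᵐ x ∂(bdry K), |τ x| ≤ M := by
  have := hK.isFiniteMeasure_bdry
  have hτ2 := hw.2.2.1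
  have hloc : ∀ x, HalfSpaceAt K (outwardNormal K x) x → ∃ ρ > 0, ∀ᵐ y ∂(bdry K),
      y ∈ Metric.ball x ρ → |τ y| ≤ M := by
    intro x hx
    obtain ⟨ρ, hρ, h1, h2⟩ := shift_boundary hx
    let f : ContDiffBump x := ⟨ρ / 8, ρ / 4, by positivity, by linarith⟩
    have hs : tsupport f ⊆ Metric.ball x (ρ / 2) := by
      rw [f.tsupport_eq]
      exact Metric.closedBall_subset_ball (by simp only [f]; linarith)
    have hf1 : ∀ y, |f y| ≤ 1 := fun y => by rw [abs_of_nonneg f.nonneg]; exact f.le_one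
    have hb := (green_local hK hdiv hw hM0 hM hx.1.le hρ h1 h2 f.contDiff hs hf1).2
    refine ⟨ρ / 8, by positivity, ?_⟩
    -- test with the sign of the trace on the set where the bound fails
    have hτi : Integrable τ (bdry K) := hτ2.integrable (by norm_num)
    obtain ⟨τ', hτ's, hττ'⟩ := hτi.aestronglyMeasurable
    have hτ'm := hτ's.measurable
    have key : ∀ c : ℝ, |c| = 1 → ∀ᵐ y ∂(bdry K), y ∈ Metric.ball x (ρ / 8) → c * τ y ≤ M := by
      intro c hc
      set B := {y | M < c * τ' y} ∩ Metric.ball x (ρ / 8) with hB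
      have hBm : MeasurableSet B :=
        (measurableSet_lt measurable_const (hτ'm.const_mul c)).inter measurableSet_ball
      have hγ : MemLp (B.indicator fun _ => c) 2 (bdry K) := (memLp_const c).indicator hBm
      have h3 := hb _ hγ
      have e1 : ∫ y, B.indicator (fun _ => c) y * (τ y * f y) ∂(bdry K)
          = ∫ y in B, c * τ' y ∂(bdry K) := by
        rw [← integral_indicator hBm]
        refine integral_congr_ae ?_
        filter_upwards [hττ'] with y hy
        by_cases hyB : y ∈ B
        · rw [indicator_of_mem hyB, indicator_of_mem hyB, hy, f.one_of_mem_closedBall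
            (Metric.ball_subset_closedBall hyB.2), mul_one]
        · simp [hyB]
      have e2 : ∫ y, |B.indicator (fun _ => c) y| ∂(bdry K) = ∫ y in B, (1:ℝ) ∂(bdry K) := by
        rw [← integral_indicator hBm]
        congr 1
        ext y
        by_cases hyB : y ∈ B
        · simp [hyB, hc]
        · simp [hyB]
      rw [e1, e2, mul_one, ← integral_const_mul] at h3
      have hi1 : IntegrableOn (fun y => c * τ' y - M) B (bdry K) :=
        (((hτi.congr hττ').const_mul c).sub (integrable_const M)).integrableOn
      have h4 : ∫ y in B, (c * τ' y - M) ∂(bdry K) ≤ 0 := by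
        rw [integral_sub ((hτi.congr hττ').const_mul c).integrableOn (integrable_const M).integrableOn]
        have := (le_abs_self _).trans h3
        simp only [mul_one] at this
        linarith
      have h5 : ∀ᵐ y ∂(bdry K).restrict B, c * τ' y - M = 0 := by
        have hnn : 0 ≤ᵐ[(bdry K).restrict B] fun y => c * τ' y - M := by
          filter_upwards [ae_restrict_mem hBm] with y hy
          have : M < c * τ' y := hy.1
          simp only [Pi.zero_apply]; linarith
        exact (integral_eq_zero_iff_of_nonneg_ae hnn hi1).1
          (le_antisymm h4 (integral_nonneg_of_ae hnn))
      rw [ae_restrict_iff' hBm] at h5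
      filter_upwards [h5, hττ'] with y hy hy2 hyb
      by_contra hcon
      rw [hy2, not_le] at hcon
      have := hy ⟨hcon, hyb⟩
      linarith
    filter_upwards [key 1 (by simp), key (-1) (by simp)] with y h1 h2 hy
    rw [abs_le]
    constructor
    · linarith [h2 hy]
    · linarith [h1 hy]
  set s := {x | HalfSpaceAt K (outwardNormal K x) x ∧ ¬ |τ x| ≤ M} with hs
  have h2 : bdry K s = 0 := by
    refine measure_null_of_locally_null s fun x hx => ?_
    obtain ⟨ρ, hρ, hb⟩ := hloc x hx.1
    refine ⟨s ∩ Metric.ball x ρ, inter_mem self_mem_nhdsWithin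
      (mem_nhdsWithin_of_mem_nhds (Metric.ball_mem_nhds x hρ)), ?_⟩
    refine measure_mono_null ?_ (ae_iff.1 hb)
    rintro y ⟨hy, hyb⟩
    simp only [mem_ofPred_eq, not_forall]
    exact ⟨hyb, hy.2⟩
  filter_upwards [hK.ae_halfSpaceAt, measure_eq_zero_iff_ae_notMem.1 h2] with x hx hx2
  by_contra hcon
  exact hx2 ⟨hx, hcon⟩

end

section

variable {d : ℕ}

variable {K : Set (E d)} {faces : Finset (Set (E d))}

theorem ae_bdry_iff {P : E d → Prop} :
    (∀ᵐ x ∂(bdry K), P x) ↔ ∀ᵐ x ∂(sig d), x ∈ frontier K → P x :=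
  ae_restrict_iff' isClosed_frontier.measurableSet

theorem volume_hyper {n : E d} (hn : ‖n‖ = 1) (p : E d) : volume (hyper n p) = 0 := by
  have hn0 : n ≠ 0 := fun h => by simp [h] at hn
  have h1 : ∀ k : ℕ, volume (hyper n p ∩ Metric.closedBall 0 (k : ℝ)) = 0 := by
    intro k
    obtain ⟨C, -, hC⟩ := volume_slab_le hn0 (k : ℝ)
    have h2 := hC (-inner ℝ n p) 0 le_rfl
    rw [mul_zero, ENNReal.ofReal_zero, nonpos_iff_eq_zero] at h2
    refine measure_mono_null (inter_subset_inter_left _ fun x hx => ?_) h2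
    have hx : inner ℝ n (x - p) = 0 := hx
    rw [inner_sub_right] at hx
    change |inner ℝ n x + -inner ℝ n p| ≤ 0
    rw [← sub_eq_add_neg, hx, abs_zero]
  have h3 : hyper n p ⊆ ⋃ k : ℕ, hyper n p ∩ Metric.closedBall 0 (k : ℝ) := by
    intro x hx
    obtain ⟨k, hk⟩ := exists_nat_ge ‖x‖
    exact mem_iUnion.2 ⟨k, hx, by simpa using hk⟩
  exact measure_mono_null h3 (measure_iUnion_null h1)

theorem IsPolyhedral.volume_frontier (hK : IsPolyhedral K faces) : volume (frontier K) = 0 := by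
  rw [hK.frontier_eq]
  refine (measure_biUnion_null_iff faces.countable_toSet).2 fun F hF => ?_
  obtain ⟨n, hn, -, U, -, hU⟩ := hK.exists_normal hF
  obtain ⟨x, hx⟩ := hK.face_nonempty F hF
  refine measure_mono_null (closure_minimal ?_ (isClosed_hyper n x)) (volume_hyper hn x)
  rw [hU x hx]
  exact inter_subset_right

variable {Ω : Set (E d)} {N : ℕ} {facesΩ : Finset (Set (E d))}

theorem Mesh.vol_le (T : Mesh Ω N) (K : Fin N) : vol (T.elem K).K ≤ vol Ω :=
  Measure.restrict_mono (T.subset K) le_rfl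

theorem Mesh.frontier_subset_closure (T : Mesh Ω N) (K : Fin N) :
    frontier (T.elem K).K ⊆ closure Ω :=
  _root_.frontier_subset_closure.trans (closure_mono (T.subset K))

theorem Mesh.integral_eq_sum (T : Mesh Ω N) {f : E d → ℝ}
    (hf : Integrable f (vol Ω)) : ∫ x, f x ∂(vol Ω) = ∑ K, ∫ x, f x ∂(vol (T.elem K).K) := by
  have h1 : Ω =ᵐ[volume] ⋃ K, (T.elem K).K := by
    have h2 : volume (⋃ K, frontier (T.elem K).K) = 0 :=
      measure_iUnion_null fun K => (T.elem K).polyhedral.volume_frontier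
    filter_upwards [measure_eq_zero_iff_ae_notMem.1 h2] with x hx
    refine propext ⟨fun h => ?_, fun h => ?_⟩
    · have h3 : x ∈ closure Ω := subset_closure h
      rw [T.cover, mem_iUnion] at h3
      obtain ⟨K, hK⟩ := h3
      refine mem_iUnion.2 ⟨K, ?_⟩
      by_contra hcon
      refine hx (mem_iUnion.2 ⟨K, ?_⟩)
      rw [(T.elem K).polyhedral.isOpen.frontier_eq]
      exact ⟨hK, hcon⟩
    · obtain ⟨K, hK⟩ := mem_iUnion.1 h
      exact T.subset K hK
  rw [vol, Measure.restrict_congr_set h1]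
  exact integral_iUnion_fintype (fun K => (T.elem K).polyhedral.isOpen.measurableSet)
    (fun K K' h => T.disjoint K K' h) fun K => hf.mono_measure (T.vol_le K)

/-- Almost every point of the mesh skeleton is either a boundary point of `Ω` that belongs to a
single element, or an interior point shared by exactly two elements with opposite normals. -/
theorem Mesh.ae_interface (T : Mesh Ω N) (hΩ : IsPolyhedral Ω facesΩ) :
    ∀ᵐ x ∂(sig d), ∀ K, x ∈ frontier (T.elem K).K →
      ‖outwardNormal (T.elem K).K x‖ = 1 ∧
      ((x ∈ frontier Ω ∧ ∀ K', K' ≠ K → x ∉ frontier (T.elem K').K) ∨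
      (x ∈ Ω ∧ ∃ K', K' ≠ K ∧ x ∈ frontier (T.elem K').K ∧
        outwardNormal (T.elem K').K x = -outwardNormal (T.elem K).K x ∧
        ∀ K'', K'' ≠ K → K'' ≠ K' → x ∉ frontier (T.elem K'').K)) := by
  have h1 : ∀ᵐ x ∂(sig d), ∀ K, x ∈ frontier (T.elem K).K →
      (∃ F ∈ (T.elem K).faces, x ∈ F) ∧ HalfSpaceAt (T.elem K).K (outwardNormal (T.elem K).K x) x :=
    ae_all_iff.2 fun K => ae_bdry_iff.1 <| by
      filter_upwards [(T.elem K).polyhedral.ae_face, (T.elem K).polyhedral.ae_halfSpaceAt] with x hx hy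
      exact ⟨hx, hy⟩
  filter_upwards [h1, ae_bdry_iff.1 hΩ.ae_halfSpaceAt] with x hx hxΩ K hK
  obtain ⟨⟨F, hF, hxF⟩, hn⟩ := hx K hK
  have hopp : ∀ K₁ K₂, K₁ ≠ K₂ → x ∈ frontier (T.elem K₁).K → x ∈ frontier (T.elem K₂).K →
      outwardNormal (T.elem K₂).K x = -outwardNormal (T.elem K₁).K x := fun K₁ K₂ h a b =>
    (hx K₁ a).2.eq_neg (hx K₂ b).2 (T.disjoint _ _ h)
  have hne : ∀ K₁ K₂, K₁ ≠ K₂ → x ∈ frontier (T.elem K₁).K → x ∈ frontier (T.elem K₂).K →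
      outwardNormal (T.elem K₂).K x ≠ outwardNormal (T.elem K₁).K x := by
    intro K₁ K₂ h a b hcon
    have h2 := hopp K₁ K₂ h a b
    rw [hcon, eq_neg_iff_add_eq_zero, ← two_smul ℝ] at h2
    have h3 := (hx K₁ a).2.1
    rw [(smul_eq_zero.1 h2).resolve_left two_ne_zero, norm_zero] at h3
    norm_num at h3
  refine ⟨hn.1, ?_⟩
  have hcl : x ∈ closure Ω := T.frontier_subset_closure K hK
  by_cases hxf : x ∈ frontier Ω
  · left
    refine ⟨hxf, fun K' hK' hx' => hne K K' hK'.symm hK hx' ?_⟩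
    rw [hn.eq_of_subset (hxΩ hxf) (T.subset K), (hx K' hx').2.eq_of_subset (hxΩ hxf) (T.subset K')]
  · right
    have hxo : x ∈ Ω := by
      by_contra hcon
      exact hxf (by rw [hΩ.isOpen.frontier_eq]; exact ⟨hcl, hcon⟩)
    refine ⟨hxo, ?_⟩
    rcases T.conforming K F hF with hb | ⟨K', hK', hF'⟩
    · exact absurd (hb hxF) hxf
    · have hx' : x ∈ frontier (T.elem K').K := (T.elem K').polyhedral.face_subset hF' hxF
      refine ⟨K', hK', hx', hopp K K' hK'.symm hK hx', fun K'' h1 h2 hx'' => ?_⟩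
      refine hne K' K'' h2.symm hx' hx'' ?_
      rw [hopp K K' hK'.symm hK hx', hopp K K'' h1.symm hK hx'']

/-- Boundary integrals of quantities that cancel on interior faces and vanish on `∂Ω`. -/
theorem Mesh.sum_boundary_eq_zero (T : Mesh Ω N) (hΩ : IsPolyhedral Ω facesΩ)
    {G : Fin N → E d → ℝ} (hi : ∀ K, Integrable (G K) (bdry (T.elem K).K))
    (h0 : ∀ K, ∀ᵐ x ∂(bdry (T.elem K).K), x ∈ frontier Ω → G K x = 0)
    (h1 : ∀ K K', K ≠ K' → ∀ᵐ x ∂(sig d), x ∈ Ω → x ∈ frontier (T.elem K).K →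
      x ∈ frontier (T.elem K').K →
      outwardNormal (T.elem K').K x = -outwardNormal (T.elem K).K x → G K x + G K' x = 0) :
    ∑ K, ∫ x, G K x ∂(bdry (T.elem K).K) = 0 := by
  classical
  have hm : ∀ K, MeasurableSet (frontier (T.elem K).K) := fun K => isClosed_frontier.measurableSet
  have e1 : ∀ K, ∫ x, G K x ∂(bdry (T.elem K).K)
      = ∫ x, (frontier (T.elem K).K).indicator (G K) x ∂(sig d) := fun K =>
    (integral_indicator (hm K)).symm
  simp_rw [e1]
  rw [← integral_finsetSum _ fun K _ => (integrable_indicator_iff (hm K)).2 (hi K)]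
  refine integral_eq_zero_of_ae ?_
  have h1' : ∀ᵐ x ∂(sig d), ∀ K K', K ≠ K' → x ∈ Ω → x ∈ frontier (T.elem K).K →
      x ∈ frontier (T.elem K').K →
      outwardNormal (T.elem K').K x = -outwardNormal (T.elem K).K x → G K x + G K' x = 0 :=
    ae_all_iff.2 fun K => ae_all_iff.2 fun K' => by
      by_cases h : K = K'
      · exact Eventually.of_forall fun x h' => absurd h h'
      · filter_upwards [h1 K K' h] with x hx _
        exact hx
  have h0' : ∀ᵐ x ∂(sig d), ∀ K, x ∈ frontier (T.elem K).K → x ∈ frontier Ω → G K x = 0 :=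
    ae_all_iff.2 fun K => ae_bdry_iff.1 (h0 K)
  filter_upwards [T.ae_interface hΩ, h1', h0'] with x hx hx1 hx0
  simp only [Pi.zero_apply]
  by_cases hex : ∃ K, x ∈ frontier (T.elem K).K
  · obtain ⟨K, hK⟩ := hex
    rcases (hx K hK).2 with ⟨hf, hother⟩ | ⟨ho, K', hne, hK', hn, hother⟩
    · rw [Finset.sum_eq_single K, indicator_of_mem hK, hx0 K hK hf]
      · exact fun K' _ h => indicator_of_notMem (hother K' h) _
      · simp
    · rw [Finset.sum_eq_add K K' hne.symm, indicator_of_mem hK, indicator_of_mem hK',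
        hx1 K K' hne.symm ho hK hK' hn]
      · exact fun K'' _ h => indicator_of_notMem (hother K'' h.1 h.2) _
      · simp
      · simp
  · push Not at hex
    exact Finset.sum_eq_zero fun K _ => indicator_of_notMem (hex K) _

/-- The elementwise traces of a function that is of class `H¹` across element boundaries in `U`. -/
theorem Mesh.ae_jump (T : Mesh Ω N) {U : Set (E d)} (hU : IsOpen U)
    (hΩ : IsPolyhedral Ω facesΩ) {w : E d → ℝ} {g : E d → E d} {τ : Fin N → E d → ℝ}
    (hw : MemLp w 2 (vol Ω)) (hg : MemLp g 2 (vol Ω))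
    (hτ : ∀ K, HasTrace (T.elem K).K w g (τ K))
    (h : ∀ φ : E d → ℝ, ContDiff ℝ ∞ φ → HasCompactSupport φ → tsupport φ ⊆ U → ∀ j,
      (∫ x, w x * pd j φ x ∂(vol Ω)) + ∫ x, g x j * φ x ∂(vol Ω) = 0) :
    ∀ᵐ x ∂(sig d), x ∈ U → ∀ j, ∑ K, (frontier (T.elem K).K).indicator
      (fun y => τ K y * outwardNormal (T.elem K).K y j) x = 0 := by
  have hm : ∀ K, MeasurableSet (frontier (T.elem K).K) := fun K => isClosed_frontier.measurableSet
  have hfin := fun K => (T.elem K).polyhedral.isFiniteMeasure_bdry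
  have hi : ∀ K j, Integrable (fun y => τ K y * outwardNormal (T.elem K).K y j)
      (bdry (T.elem K).K) := fun K j =>
    (memLp_mul_bdd (hτ K).2.2.1 ((T.elem K).polyhedral.memLp_top_normal j)).integrable (by norm_num)
  have hi' : ∀ K j, Integrable ((frontier (T.elem K).K).indicator
      fun y => τ K y * outwardNormal (T.elem K).K y j) (sig d) := fun K j =>
    (integrable_indicator_iff (hm K)).2 (hi K j)
  have key : ∀ j, ∀ᵐ x ∂(sig d), x ∈ U → ∑ K, (frontier (T.elem K).K).indicator
      (fun y => τ K y * outwardNormal (T.elem K).K y j) x = 0 := by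
    intro j
    refine hU.ae_eq_zero_of_integral_contDiff_smul_eq_zero
      ((integrable_finsetSum _ fun K _ => hi' K j).locallyIntegrable.locallyIntegrableOn U) ?_
    intro φ hφ hc hs
    have e1 : ∀ x, φ x • ∑ K, (frontier (T.elem K).K).indicator
        (fun y => τ K y * outwardNormal (T.elem K).K y j) x
        = ∑ K, (frontier (T.elem K).K).indicator
          (fun y => τ K y * outwardNormal (T.elem K).K y j * φ y) x := by
      intro x
      rw [Finset.smul_sum]
      refine Finset.sum_congr rfl fun K _ => ?_
      by_cases hx : x ∈ frontier (T.elem K).K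
      · rw [indicator_of_mem hx, indicator_of_mem hx, smul_eq_mul]; ring
      · rw [indicator_of_notMem hx, indicator_of_notMem hx, smul_zero]
    simp_rw [e1]
    rw [integral_finsetSum]
    · have e2 : ∀ K, ∫ x, (frontier (T.elem K).K).indicator
          (fun y => τ K y * outwardNormal (T.elem K).K y j * φ y) x ∂(sig d)
          = (∫ x, w x * pd j φ x ∂(vol (T.elem K).K)) + ∫ x, g x j * φ x ∂(vol (T.elem K).K) := by
        intro K
        rw [integral_indicator (hm K), (hτ K).2.2.2 φ hφ j]
        rfl
      simp_rw [e2]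
      rw [Finset.sum_add_distrib, ← T.integral_eq_sum, ← T.integral_eq_sum]
      · exact h φ hφ hc hs j
      · have := hΩ.isFiniteMeasure_vol
        exact (memLp_mul_bdd (memLp_component hg j)
          (hΩ.memLp_top_vol hφ.continuous)).integrable (by norm_num)
      · have := hΩ.isFiniteMeasure_vol
        exact (memLp_mul_bdd hw
          (hΩ.memLp_top_vol (contDiff_pd hφ j).continuous)).integrable (by norm_num)
    · intro K _
      refine (integrable_indicator_iff (hm K)).2 ?_
      exact (memLp_mul_bdd (memLp_mul_bdd (hτ K).2.2.1 ((T.elem K).polyhedral.memLp_top_normal j))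
        ((T.elem K).polyhedral.memLp_top_bdry hφ.continuous)).integrable (by norm_num)
  filter_upwards [ae_all_iff.2 key] with x hx hxU j
  exact hx j hxU

theorem exists_component_ne_zero {n : E d} (hn : ‖n‖ = 1) : ∃ j, n j ≠ 0 := by
  by_contra hcon
  push Not at hcon
  have : n = 0 := by ext j; exact hcon j
  simp [this] at hn

/-- Traces of a function of class `H¹` agree on interior faces. -/
theorem Mesh.ae_trace_eq (T : Mesh Ω N) (hΩ : IsPolyhedral Ω facesΩ) {w : E d → ℝ} {g : E d → E d}
    {τ : Fin N → E d → ℝ} (hw : HasWeakGrad Ω w g) (hτ : ∀ K, HasTrace (T.elem K).K w g (τ K)) :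
    ∀ᵐ x ∂(sig d), x ∈ Ω → ∀ K K', K ≠ K' → x ∈ frontier (T.elem K).K →
      x ∈ frontier (T.elem K').K → τ K x = τ K' x := by
  have hj := T.ae_jump hΩ.isOpen hΩ hw.1 hw.2.1 hτ fun φ hφ hc hs j => by
    rw [hw.2.2 φ hφ hc hs j, neg_add_cancel]
  filter_upwards [hj, T.ae_interface hΩ] with x hx hi hxΩ K K' hne hK hK'
  obtain ⟨hn, ⟨hf, -⟩ | ⟨-, K₁, hne₁, hK₁, hn₁, hother⟩⟩ := hi K hK
  · exact absurd hxΩ (by rw [hΩ.isOpen.frontier_eq] at hf; exact hf.2)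
  · have hKK : K' = K₁ := by
      by_contra hcon
      exact hother K' hne.symm hcon hK'
    subst hKK
    obtain ⟨j, hj⟩ := exists_component_ne_zero hn
    have h2 := hx hxΩ j
    rw [Finset.sum_eq_add K K' hne, indicator_of_mem hK, indicator_of_mem hK', hn₁] at h2
    · have h3 : (τ K x - τ K' x) * outwardNormal (T.elem K).K x j = 0 := by
        have : (-outwardNormal (T.elem K).K x) j = -(outwardNormal (T.elem K).K x j) := rfl
        rw [this] at h2
        linarith
      exact sub_eq_zero.1 ((mul_eq_zero.1 h3).resolve_right hj)
    · exact fun K'' _ h => indicator_of_notMem (hother K'' h.1 h.2) _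
    · simp
    · simp

/-- Elementwise traces of a function with zero trace on `∂Ω` vanish on `∂Ω`. -/
theorem Mesh.ae_trace_zero (T : Mesh Ω N) (hΩ : IsPolyhedral Ω facesΩ) {w : E d → ℝ} {g : E d → E d}
    {τ : Fin N → E d → ℝ} (hw : HasTrace Ω w g 0) (hτ : ∀ K, HasTrace (T.elem K).K w g (τ K)) :
    ∀ᵐ x ∂(sig d), x ∈ frontier Ω → ∀ K, x ∈ frontier (T.elem K).K → τ K x = 0 := by
  have hj := T.ae_jump isOpen_univ hΩ hw.1 hw.2.1 hτ fun φ hφ hc hs j => by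
    rw [hw.2.2.2 φ hφ j]
    simp
  filter_upwards [hj, T.ae_interface hΩ] with x hx hi hxΩ K hK
  obtain ⟨hn, ⟨-, hother⟩ | ⟨ho, -⟩⟩ := hi K hK
  · obtain ⟨j, hj⟩ := exists_component_ne_zero hn
    have h2 := hx (mem_univ x) j
    rw [Finset.sum_eq_single K, indicator_of_mem hK] at h2
    · exact (mul_eq_zero.1 h2).resolve_right hj
    · exact fun K' _ h => indicator_of_notMem (hother K' h) _
    · simp
  · rw [hΩ.isOpen.frontier_eq] at hxΩ
    exact absurd ho hxΩ.2

theorem HasTrace.hasWeakGrad (hΩ : IsOpen Ω) {w : E d → ℝ} {g : E d → E d} {τ : E d → ℝ}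
    (h : HasTrace Ω w g τ) : HasWeakGrad Ω w g := by
  refine ⟨h.1, h.2.1, fun φ hφ hc hs j => ?_⟩
  have h1 := h.2.2.2 φ hφ j
  have h2 : ∫ x, τ x * outwardNormal Ω x j * φ x ∂(bdry Ω) = 0 := by
    refine integral_eq_zero_of_ae ?_
    filter_upwards [ae_bdry_mem_frontier Ω] with x hx
    have : φ x = 0 := by
      refine image_eq_zero_of_notMem_tsupport fun hxs => ?_
      rw [hΩ.frontier_eq] at hx
      exact hx.2 (hs hxs)
    rw [this, mul_zero]; rfl
  linarith

end

section

variable {d : ℕ}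

/-! ### Similarities -/

/-- The similarity `x ↦ r R x + b`. -/
def simMap (r : ℝ) (R : E d ≃ₗᵢ[ℝ] E d) (b : E d) (x : E d) : E d := r • R x + b

/-- The inverse of the similarity `simMap r R b`. -/
def simInv (r : ℝ) (R : E d ≃ₗᵢ[ℝ] E d) (b : E d) (y : E d) : E d := R.symm (r⁻¹ • (y - b))

section

variable {r : ℝ} {R : E d ≃ₗᵢ[ℝ] E d} {b : E d}

theorem simMap_simInv (hr : 0 < r) (y : E d) : simMap r R b (simInv r R b y) = y := by
  simp [simMap, simInv, smul_smul, mul_inv_cancel₀ hr.ne']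

theorem simInv_simMap (hr : 0 < r) (x : E d) : simInv r R b (simMap r R b x) = x := by
  simp [simMap, simInv, smul_smul, inv_mul_cancel₀ hr.ne']

theorem simInv_eq (r : ℝ) (R : E d ≃ₗᵢ[ℝ] E d) (b : E d) :
    simInv r R b = simMap r⁻¹ R.symm (-(r⁻¹ • R.symm b)) := by
  ext1 y
  simp [simMap, simInv, sub_eq_add_neg]

theorem contDiff_simMap (r : ℝ) (R : E d ≃ₗᵢ[ℝ] E d) (b : E d) : ContDiff ℝ ∞ (simMap r R b) :=
  (R.contDiff.const_smul r).add contDiff_const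

theorem contDiff_simInv (r : ℝ) (R : E d ≃ₗᵢ[ℝ] E d) (b : E d) : ContDiff ℝ ∞ (simInv r R b) := by
  rw [simInv_eq]
  exact contDiff_simMap _ _ _

/-- A similarity as a homeomorphism. -/
def simHomeo (hr : 0 < r) (R : E d ≃ₗᵢ[ℝ] E d) (b : E d) : E d ≃ₜ E d where
  toFun := simMap r R b
  invFun := simInv r R b
  left_inv := simInv_simMap hr
  right_inv := simMap_simInv hr
  continuous_toFun := (contDiff_simMap r R b).continuous
  continuous_invFun := (contDiff_simInv r R b).continuous

open scoped Pointwise in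
theorem measure_simMap_image (hr : 0 < r) (k : ℕ) (s : Set (E d)) :
    (μHE[k] : Measure (E d)) (simMap r R b '' s) = ENNReal.ofReal (r ^ k) * μHE[k] s := by
  have h1 : simMap r R b '' s = (fun y => y + b) '' (r • (R '' s)) := by
    rw [← image_smul, image_image, image_image]
    rfl
  rw [h1, (isometry_add_right b).euclideanHausdorffMeasure_image,
    Measure.euclideanHausdorffMeasure_smul₀ k hr.ne', R.isometry.euclideanHausdorffMeasure_image,
    ENNReal.ofReal_pow hr.le]
  rw [ENNReal.smul_def, smul_eq_mul, ENNReal.coe_pow]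
  congr 2
  rw [← enorm_eq_nnnorm, Real.enorm_of_nonneg hr.le]

theorem map_simMap (hr : 0 < r) (k : ℕ) (A : Set (E d)) :
    ((μHE[k] : Measure (E d)).restrict A).map (simMap r R b)
      = ENNReal.ofReal ((r ^ k)⁻¹) • (μHE[k] : Measure (E d)).restrict (simMap r R b '' A) := by
  have hmeas : Measurable (simMap r R b) := (contDiff_simMap r R b).continuous.measurable
  ext B hB
  rw [Measure.map_apply hmeas hB, Measure.restrict_apply (hmeas hB), Measure.smul_apply,
    Measure.restrict_apply hB, smul_eq_mul]
  have h1 : B ∩ simMap r R b '' A = simMap r R b '' (simMap r R b ⁻¹' B ∩ A) := by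
    rw [inter_comm (simMap r R b ⁻¹' B), image_inter_preimage, inter_comm]
  rw [h1, measure_simMap_image hr, ← mul_assoc, ← ENNReal.ofReal_mul (by positivity),
    inv_mul_cancel₀ (by positivity), ENNReal.ofReal_one, one_mul]

variable {K L : Set (E d)}

theorem vol_map_sim (hr : 0 < r) (hL : L = simMap r R b '' K) :
    (vol K).map (simMap r R b) = ENNReal.ofReal ((r ^ d)⁻¹) • vol L := by
  have := map_simMap (R := R) (b := b) hr d K
  rw [EuclideanSpace.euclideanHausdorffMeasure_eq_volume] at this
  rw [hL]
  exact this

theorem bdry_map_sim (hr : 0 < r) (hL : L = simMap r R b '' K) :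
    (bdry K).map (simMap r R b) = ENNReal.ofReal ((r ^ (d - 1))⁻¹) • bdry L := by
  have := map_simMap (R := R) (b := b) hr (d - 1) (frontier K)
  have h2 : frontier L = simMap r R b '' frontier K := by
    rw [hL]
    exact ((simHomeo hr R b).image_frontier K).symm
  rw [bdry, bdry, h2]
  exact this

open scoped Pointwise in
theorem diam_sim (hr : 0 < r) (hL : L = simMap r R b '' K) : Metric.diam L = r * Metric.diam K := by
  have h1 : simMap r R b '' K = (fun y => y + b) '' (r • (R '' K)) := by
    rw [← image_smul, image_image, image_image]
    rfl
  rw [hL, h1, (isometry_add_right b).diam_image, diam_smul₀, R.isometry.diam_image,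
    Real.norm_of_nonneg hr.le]

theorem measurableEmbedding_sim (hr : 0 < r) : MeasurableEmbedding (simMap r R b) :=
  (simHomeo hr R b).measurableEmbedding

theorem integral_map_smul {μ ν : Measure (E d)} {S : E d → E d} (hS : MeasurableEmbedding S) {c : ℝ}
    (hc : 0 ≤ c) (h : μ.map S = ENNReal.ofReal c • ν) (f : E d → ℝ) :
    ∫ x, f (S x) ∂μ = c * ∫ y, f y ∂ν := by
  rw [← hS.integral_map, h, integral_smul_measure, ENNReal.toReal_ofReal hc, smul_eq_mul]

theorem memLp_of_map_smul {F : Type*} [NormedAddCommGroup F] {μ ν : Measure (E d)} {S : E d → E d}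
    (hS : MeasurableEmbedding S) {c : ℝ} (h : μ.map S = ENNReal.ofReal c • ν) {f : E d → F}
    {p : ENNReal} (hf : MemLp f p ν) : MemLp (fun x => f (S x)) p μ := by
  have h1 : MemLp f p (μ.map S) := by
    rw [h]
    exact hf.smul_measure ENNReal.ofReal_ne_top
  exact h1.comp_of_map hS.measurable.aemeasurable

end

/-! ### Scaled integrals -/

/-- The integral over `K`, scaled by the diameter. -/
def avv (K : Set (E d)) (f : E d → ℝ) : ℝ := (Metric.diam K ^ d)⁻¹ * ∫ x, f x ∂(vol K)

/-- The integral over `∂K`, scaled by the diameter. -/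
def avb (K : Set (E d)) (f : E d → ℝ) : ℝ := (Metric.diam K ^ (d - 1))⁻¹ * ∫ x, f x ∂(bdry K)

theorem avv_nonneg (K : Set (E d)) {f : E d → ℝ} (h : ∀ x, 0 ≤ f x) : 0 ≤ avv K f :=
  mul_nonneg (by positivity) (integral_nonneg h)

theorem avb_nonneg (K : Set (E d)) {f : E d → ℝ} (h : ∀ x, 0 ≤ f x) : 0 ≤ avb K f :=
  mul_nonneg (by positivity) (integral_nonneg h)

theorem avv_const_mul (K : Set (E d)) (c : ℝ) (f : E d → ℝ) :
    avv K (fun x => c * f x) = c * avv K f := by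
  rw [avv, avv, integral_const_mul]; ring

theorem avb_const_mul (K : Set (E d)) (c : ℝ) (f : E d → ℝ) :
    avb K (fun x => c * f x) = c * avb K f := by
  rw [avb, avb, integral_const_mul]; ring

section

variable {r : ℝ} {R : E d ≃ₗᵢ[ℝ] E d} {b : E d} {K L : Set (E d)}

theorem avv_sim (hr : 0 < r) (hL : L = simMap r R b '' K) (f : E d → ℝ) :
    avv K (fun x => f (simMap r R b x)) = avv L f := by
  rw [avv, avv, integral_map_smul (measurableEmbedding_sim hr) (by positivity) (vol_map_sim hr hL),
    diam_sim hr hL, mul_pow, mul_inv]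
  ring

theorem avb_sim (hr : 0 < r) (hL : L = simMap r R b '' K) (f : E d → ℝ) :
    avb K (fun x => f (simMap r R b x)) = avb L f := by
  rw [avb, avb, integral_map_smul (measurableEmbedding_sim hr) (by positivity) (bdry_map_sim hr hL),
    diam_sim hr hL, mul_pow, mul_inv]
  ring

end

theorem hasFDerivAt_sim (r : ℝ) (R : E d ≃ₗᵢ[ℝ] E d) (b x : E d) :
    HasFDerivAt (simMap r R b) (r • (R.toContinuousLinearEquiv : E d →L[ℝ] E d)) x :=
  ((R.toContinuousLinearEquiv.hasFDerivAt (x := x)).const_smul r).add_const b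

theorem fderiv_sim (r : ℝ) (R : E d ≃ₗᵢ[ℝ] E d) (b : E d) {w : E d → ℝ} (hw : Differentiable ℝ w)
    (x v : E d) : fderiv ℝ (fun x => w (simMap r R b x)) x v
      = r * fderiv ℝ w (simMap r R b x) (R v) := by
  have h := ((hw (simMap r R b x)).hasFDerivAt).comp x (hasFDerivAt_sim r R b x)
  have h2 : fderiv ℝ (fun x => w (simMap r R b x)) x = _ := h.fderiv
  rw [h2]
  simp

theorem norm_fderiv_sim {r : ℝ} (hr : 0 < r) (R : E d ≃ₗᵢ[ℝ] E d) (b : E d) {w : E d → ℝ}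
    (hw : Differentiable ℝ w) (x : E d) : ‖fderiv ℝ (fun x => w (simMap r R b x)) x‖
      = r * ‖fderiv ℝ w (simMap r R b x)‖ := by
  have h1 : fderiv ℝ (fun x => w (simMap r R b x)) x
      = r • (fderiv ℝ w (simMap r R b x)).comp (R.toContinuousLinearEquiv : E d →L[ℝ] E d) := by
    ext1 v
    rw [fderiv_sim r R b hw]
    rfl
  rw [h1, norm_smul, Real.norm_of_nonneg hr.le]
  congr 1
  exact ContinuousLinearMap.opNorm_comp_linearIsometryEquiv _ R

theorem norm_fderiv_sq (w : E d → ℝ) (x : E d) : ‖fderiv ℝ w x‖ ^ 2 = ∑ j, pd j w x ^ 2 := by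
  let g : E d := (InnerProductSpace.toDual ℝ (E d)).symm (fderiv ℝ w x)
  have h1 : ‖g‖ = ‖fderiv ℝ w x‖ := LinearIsometryEquiv.norm_map _ _
  have h2 : ∀ j, g j = pd j w x := by
    intro j
    have h3 : inner ℝ g (EuclideanSpace.single j 1) = fderiv ℝ w x (EuclideanSpace.single j 1) :=
      InnerProductSpace.toDual_symm_apply
    rw [pd, ← h3, EuclideanSpace.inner_single_right]
    simp
  rw [← h1, EuclideanSpace.norm_sq_eq]
  simp_rw [h2, Real.norm_eq_abs, sq_abs]

end

section

variable {d : ℕ}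

theorem IsPoly.contDiff {f : E d → ℝ} (h : IsPoly f) : ContDiff ℝ ∞ f := by
  obtain ⟨P, hP⟩ := h
  have h1 : f = fun x => ∑ s ∈ P.support, P.coeff s * ∏ i, x i ^ s i := by
    ext x
    rw [hP x, MvPolynomial.eval_eq']
  rw [h1]
  refine ContDiff.sum fun s _ => contDiff_const.mul (contDiff_prod fun i _ => ?_)
  exact (contDiff_euclidean.1 contDiff_id i).pow _

theorem LocalSpaces.contDiff (X : LocalSpaces d) {w : E d → ℝ} (hw : w ∈ X.W) : ContDiff ℝ ∞ w :=
  (X.W_poly w hw).contDiff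

theorem LocalSpaces.differentiable (X : LocalSpaces d) {w : E d → ℝ} (hw : w ∈ X.W) :
    Differentiable ℝ w := smooth_differentiable (X.contDiff hw)

theorem IsPolyhedral.sum_integral_eq {K : Set (E d)} {faces : Finset (Set (E d))}
    (hK : IsPolyhedral K faces) {v : E d → E d} (hv : MemLp v 2 (vol K)) {φ : E d → ℝ}
    (hφ : ContDiff ℝ ∞ φ) :
    ∑ j, ∫ x, v x j * pd j φ x ∂(vol K) = ∫ x, fderiv ℝ φ x (v x) ∂(vol K) := by
  have := hK.isFiniteMeasure_vol
  simp_rw [fderiv_eq_sum_pd]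
  rw [integral_finsetSum]
  intro j _
  exact (memLp_mul_bdd (memLp_component hv j)
    (hK.memLp_top_vol (contDiff_pd hφ j).continuous)).integrable (by norm_num)

section

variable {r : ℝ} {R : E d ≃ₗᵢ[ℝ] E d} {b : E d} {K L : Set (E d)}
  {facesK facesL : Finset (Set (E d))}

theorem IsFlux.pull (hd : 0 < d) (hK : IsPolyhedral K facesK) (hLp : IsPolyhedral L facesL) (hr : 0 < r)
    (hL : L = simMap r R b '' K) {v : E d → E d} {δ γ : E d → ℝ} (h : IsFlux L v δ γ) :
    IsFlux K (fun x => R.symm (v (simMap r R b x))) (fun x => r * δ (simMap r R b x))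
      (fun x => γ (simMap r R b x)) := by
  have hS := measurableEmbedding_sim (R := R) (b := b) hr
  have hv : MemLp (fun x => R.symm (v (simMap r R b x))) 2 (vol K) :=
    (memLp_of_map_smul hS (vol_map_sim hr hL) h.memLp).continuousLinearMap_comp
      (R.symm.toContinuousLinearEquiv : E d →L[ℝ] E d)
  refine ⟨hv, (memLp_of_map_smul hS (vol_map_sim hr hL) h.memLp_div).const_mul r,
    memLp_of_map_smul hS (bdry_map_sim hr hL) h.memLp_ntr, fun φ hφ => ?_⟩
  set ψ : E d → ℝ := fun y => φ (simInv r R b y) with hψdef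
  have hψ : ContDiff ℝ ∞ ψ := hφ.comp (contDiff_simInv r R b)
  have hφψ : φ = fun x => ψ (simMap r R b x) := by
    ext x; simp only [hψdef, simInv_simMap hr]
  have hg := h.green ψ hψ
  rw [hLp.sum_integral_eq h.memLp hψ] at hg
  rw [hK.sum_integral_eq hv hφ]
  have e1 : ∫ x, fderiv ℝ φ x (R.symm (v (simMap r R b x))) ∂(vol K)
      = (r ^ d)⁻¹ * (r * ∫ y, fderiv ℝ ψ y (v y) ∂(vol L)) := by
    rw [← integral_const_mul, ← integral_map_smul hS (by positivity) (vol_map_sim hr hL)]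
    congr 1
    ext x
    rw [hφψ, fderiv_sim r R b (smooth_differentiable hψ)]
    simp
  have e2 : ∫ x, r * δ (simMap r R b x) * φ x ∂(vol K)
      = (r ^ d)⁻¹ * (r * ∫ y, δ y * ψ y ∂(vol L)) := by
    rw [← integral_const_mul, ← integral_map_smul hS (by positivity) (vol_map_sim hr hL)]
    congr 1
    ext x
    rw [hφψ]
    ring
  have e3 : ∫ x, γ (simMap r R b x) * φ x ∂(bdry K)
      = (r ^ (d - 1))⁻¹ * ∫ y, γ y * ψ y ∂(bdry L) := by
    rw [← integral_map_smul hS (by positivity) (bdry_map_sim hr hL)]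
    congr 1
    ext x
    rw [hφψ]
  rw [e1, e2, e3, ← hg]
  have h4 : r ^ d = r * r ^ (d - 1) := by
    rw [← pow_succ', Nat.sub_add_cancel hd]
  rw [h4, mul_inv]
  field_simp

theorem IsFlux.push (hd : 0 < d) (hK : IsPolyhedral K facesK) (hLp : IsPolyhedral L facesL)
    (hr : 0 < r) (hL : L = simMap r R b '' K) {v : E d → E d} {δ γ : E d → ℝ} (h : IsFlux K v δ γ) :
    IsFlux L (fun y => R (v (simInv r R b y))) (fun y => r⁻¹ * δ (simInv r R b y))
      (fun y => γ (simInv r R b y)) := by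
  have hK' : K = simMap r⁻¹ R.symm (-(r⁻¹ • R.symm b)) '' L := by
    rw [← simInv_eq, hL, image_image]
    simp [simInv_simMap hr]
  have h2 := IsFlux.pull hd hLp hK (inv_pos.2 hr) hK' h
  rw [← simInv_eq] at h2
  exact h2

end

/-- The constants of the local estimates on an element, in scaled form: inverse trace and inverse
inequalities, the stabilization estimate, the size of the element, the estimate for velocities that
are determined by their normal trace, the bound of the discrete gradient and a Friedrichs inequality. -/
structure LocalBounds (X : LocalSpaces d) (C : ℝ) : Prop where
  nonneg : 0 ≤ C
  trace : ∀ w ∈ X.W, avb X.K (fun x => w x ^ 2) ≤ C * avv X.K (fun x => w x ^ 2)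
  sup : ∀ w ∈ X.W, ∀ x ∈ X.K, w x ^ 2 ≤ C * avv X.K (fun x => w x ^ 2)
  traceSup : ∀ m, InTrace X.M m → ∀ᵐ x ∂(bdry X.K), m x ^ 2 ≤ C * avb X.K (fun x => m x ^ 2)
  stab : ∀ w ∈ X.W, ∀ ξ ζ : E d → ℝ, MemLp ξ 2 (vol X.K) → MemLp ζ 2 (bdry X.K) →
    (∀ v δ γ, InField X.V v → IsFlux X.K v δ γ → avv X.K (fun x => (w x - ξ x) * δ x) = 0) →
    (∀ m, InTrace X.MS m → avb X.K (fun x => (w x - ζ x) * m x) = 0) →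
    avv X.K (fun x => w x ^ 2) ≤ C * (avv X.K (fun x => ξ x ^ 2) + avb X.K (fun x => ζ x ^ 2))
  size : avv X.K (fun _ => 1) ≤ C ∧ avb X.K (fun _ => 1) ≤ C
  normal : ∀ t δ γ, InField X.Vstar t → IsFlux X.K t δ γ →
    (∀ w ∈ X.W, avv X.K (fun x => fderiv ℝ w x (t x)) = 0) →
    (∀ s, InField X.Vstar s → IsFlux X.K s (fun _ => 0) (fun _ => 0) →
      avv X.K (fun x => inner ℝ (t x) (s x)) = 0) →
    avv X.K (fun x => ‖t x‖ ^ 2) ≤ C * avb X.K (fun x => γ x ^ 2)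
  grad : ∀ w ∈ X.W, ∀ m, InTrace X.M m → ∀ l, InField X.V l → ∀ s, InTrace X.MS s →
    (∀ v δ γ, InField X.V v → IsFlux X.K v δ γ →
      X.h * avv X.K (fun x => inner ℝ (l x) (v x)) + X.h * avv X.K (fun x => w x * δ x)
        - avb X.K (fun x => m x * γ x) = 0) →
    (∀ μ, InTrace X.MS μ → avb X.K (fun x => (w x - m x - s x) * μ x) = 0) →
    X.h ^ 2 * avv X.K (fun x => ‖fderiv ℝ w x‖ ^ 2) + avb X.K (fun x => (w x - m x) ^ 2)
      ≤ C * (X.h ^ 2 * avv X.K (fun x => ‖l x‖ ^ 2) + avb X.K (fun x => s x ^ 2))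
  friedrichs : ∀ w ∈ X.W, ∀ m, InTrace X.M m → ∀ a : ℝ, avb X.K (fun x => m x - a) = 0 →
    avv X.K (fun x => (w x - a) ^ 2) + avb X.K (fun x => (m x - a) ^ 2)
      ≤ C * (X.h ^ 2 * avv X.K (fun x => ‖fderiv ℝ w x‖ ^ 2) + avb X.K (fun x => (w x - m x) ^ 2))

theorem LocalSpaces.Similar.symm {X Y : LocalSpaces d} (h : X.Similar Y) : Y.Similar X := by
  obtain ⟨r, R, b, hr, hK, hF, hW, hM, hMS, hV, hVs⟩ := h
  have e : ∀ y, r • R (r⁻¹ • R.symm y + -(r⁻¹ • R.symm b)) + b = y := fun y => by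
    simp [smul_smul, mul_inv_cancel₀ hr.ne']
  have e' : ∀ x, r⁻¹ • R.symm (r • R x + b) + -(r⁻¹ • R.symm b) = x := fun x => by
    simp [smul_smul, inv_mul_cancel₀ hr.ne']
  refine ⟨r⁻¹, R.symm, -(r⁻¹ • R.symm b), inv_pos.2 hr, ?_, fun F => ?_, fun w => ?_, fun g => ?_,
    fun g => ?_, fun v => ?_, fun v => ?_⟩
  · rw [hK, image_image]; simp only [e', image_id']
  · rw [hF, image_image]; simp only [e, image_id']
  · rw [hW]; simp only [e']
  · rw [hM]; simp only [e']
  · rw [hMS]; simp only [e']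
  · rw [hV]; simp only [e', LinearIsometryEquiv.symm_symm, LinearIsometryEquiv.symm_apply_apply]
  · rw [hVs]; simp only [e', LinearIsometryEquiv.symm_symm, LinearIsometryEquiv.symm_apply_apply]

theorem LocalBounds.of_similar (hd : 0 < d) {X Y : LocalSpaces d} (h : X.Similar Y) {C : ℝ}
    (hX : LocalBounds X C) : LocalBounds Y C := by
  obtain ⟨r, R, b, hr, hK, hF, hW, hM, hMS, hV, hVs⟩ := h
  have hK : Y.K = simMap r R b '' X.K := hK
  have hW : ∀ w : E d → ℝ, w ∈ Y.W ↔ (fun x => w (simMap r R b x)) ∈ X.W := hW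
  have hM : ∀ g : E d → ℝ, InTrace Y.M g ↔ InTrace X.M (fun x => g (simMap r R b x)) := hM
  have hMS : ∀ g : E d → ℝ, InTrace Y.MS g ↔ InTrace X.MS (fun x => g (simMap r R b x)) := hMS
  have hV : ∀ v : E d → E d, InField Y.V v ↔ InField X.V (fun x => R.symm (v (simMap r R b x))) := hV
  have hVs : ∀ v : E d → E d,
    InField Y.Vstar v ↔ InField X.Vstar (fun x => R.symm (v (simMap r R b x))) := hVs
  have hS := measurableEmbedding_sim (R := R) (b := b) hr
  have av := avv_sim (R := R) (b := b) hr hK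
  have ab := avb_sim (R := R) (b := b) hr hK
  have hh : Y.h = r * X.h := diam_sim hr hK
  have hmv := vol_map_sim (R := R) (b := b) hr hK
  have hmb := bdry_map_sim (R := R) (b := b) hr hK
  have pull : ∀ {v δ γ}, IsFlux Y.K v δ γ → IsFlux X.K (fun x => R.symm (v (simMap r R b x)))
      (fun x => r * δ (simMap r R b x)) (fun x => γ (simMap r R b x)) :=
    IsFlux.pull hd X.polyhedral Y.polyhedral hr hK
  have push : ∀ {v δ γ}, IsFlux X.K v δ γ → IsFlux Y.K (fun y => R (v (simInv r R b y)))
      (fun y => r⁻¹ * δ (simInv r R b y)) (fun y => γ (simInv r R b y)) :=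
    IsFlux.push hd X.polyhedral Y.polyhedral hr hK
  have si : ∀ x, simInv r R b (simMap r R b x) = x := simInv_simMap hr
  have hV' : ∀ {v}, InField X.V v → InField Y.V (fun y => R (v (simInv r R b y))) := by
    intro v hv
    rw [hV]; simpa only [si, LinearIsometryEquiv.symm_apply_apply] using hv
  have hVs' : ∀ {v}, InField X.Vstar v → InField Y.Vstar (fun y => R (v (simInv r R b y))) := by
    intro v hv
    rw [hVs]; simpa only [si, LinearIsometryEquiv.symm_apply_apply] using hv
  have hMS' : ∀ {m}, InTrace X.MS m → InTrace Y.MS (fun y => m (simInv r R b y)) := by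
    intro m hm
    rw [hMS]; simpa only [si] using hm
  have av' : ∀ {f : E d → ℝ} {g : E d → ℝ}, (∀ x, g x = f (simMap r R b x)) →
      avv X.K g = avv Y.K f := fun {f g} hfg => by rw [← av f]; congr 1; ext x; exact hfg x
  have ab' : ∀ {f : E d → ℝ} {g : E d → ℝ}, (∀ x, g x = f (simMap r R b x)) →
      avb X.K g = avb Y.K f := fun {f g} hfg => by rw [← ab f]; congr 1; ext x; exact hfg x
  have hgrad : ∀ w ∈ Y.W, X.h ^ 2 * avv X.K (fun x => ‖fderiv ℝ (fun x => w (simMap r R b x)) x‖ ^ 2)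
      = Y.h ^ 2 * avv Y.K (fun x => ‖fderiv ℝ w x‖ ^ 2) := by
    intro w hw
    have e : avv X.K (fun x => ‖fderiv ℝ (fun x => w (simMap r R b x)) x‖ ^ 2)
        = r ^ 2 * avv X.K (fun x => ‖fderiv ℝ w (simMap r R b x)‖ ^ 2) := by
      rw [← avv_const_mul]
      refine congrArg (avv X.K) (funext fun x => ?_)
      rw [norm_fderiv_sim hr R b (Y.differentiable hw), mul_pow]
    rw [hh, ← av (fun x => ‖fderiv ℝ w x‖ ^ 2), e]
    ring
  refine ⟨hX.nonneg, fun w hw => ?_, fun w hw y hy => ?_, fun m hm => ?_, fun w hw ξ ζ hξ hζ h1 h2 => ?_,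
    ⟨?_, ?_⟩, fun t δ γ ht hf h1 h2 => ?_, fun w hw m hm l hl s hs h1 h2 => ?_, fun w hw m hm a ha => ?_⟩
  · have := hX.trace _ ((hW w).1 hw)
    rwa [av (fun x => w x ^ 2), ab (fun x => w x ^ 2)] at this
  · rw [hK] at hy
    obtain ⟨x, hx, rfl⟩ := hy
    have := hX.sup _ ((hW w).1 hw) x hx
    rwa [av (fun x => w x ^ 2)] at this
  · have h1 := hX.traceSup _ ((hM m).1 hm)
    rw [ab (fun x => m x ^ 2)] at h1
    have h2 : ∀ᵐ y ∂((bdry X.K).map (simMap r R b)), m y ^ 2 ≤ C * avb Y.K fun x => m x ^ 2 :=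
      hS.ae_map_iff.2 h1
    rw [hmb] at h2
    exact (Measure.ae_ennreal_smul_measure_iff (ENNReal.ofReal_pos.2 (by positivity)).ne').1 h2
  · have := hX.stab _ ((hW w).1 hw) (fun x => ξ (simMap r R b x)) (fun x => ζ (simMap r R b x))
      (memLp_of_map_smul hS hmv hξ) (memLp_of_map_smul hS hmb hζ) ?_ ?_
    · rwa [av (fun x => w x ^ 2), av (fun x => ξ x ^ 2), ab (fun x => ζ x ^ 2)] at this
    · intro v δ γ hv hf
      have h3 := h1 _ _ _ (hV' hv) (push hf)
      rw [← av] at h3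
      simp only [si] at h3
      have h4 : avv X.K (fun x => r⁻¹ * ((w (simMap r R b x) - ξ (simMap r R b x)) * δ x)) = 0 := by
        rw [← h3]
        congr 1
        ext x
        ring
      rw [avv_const_mul] at h4
      exact (mul_eq_zero.1 h4).resolve_left (inv_ne_zero hr.ne')
    · intro m hm
      have h3 := h2 _ (hMS' hm)
      rw [← ab] at h3
      simpa only [si] using h3
  · rw [← av]; exact hX.size.1
  · rw [← ab]; exact hX.size.2
  · have := hX.normal _ _ _ ((hVs t).1 ht) (pull hf) ?_ ?_
    · rwa [av' (f := fun x => ‖t x‖ ^ 2) (fun x => by rw [LinearIsometryEquiv.norm_map]),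
        ab (fun x => γ x ^ 2)] at this
    · intro w hw
      have hw' : (fun y => w (simInv r R b y)) ∈ Y.W := by
        rw [hW]; simpa only [si] using hw
      have h3 := h1 _ hw'
      rw [← av] at h3
      have h4 : avv X.K (fun x => r * fderiv ℝ (fun y => w (simInv r R b y)) (simMap r R b x)
          (t (simMap r R b x))) = 0 := by
        rw [avv_const_mul, h3, mul_zero]
      rw [← h4]
      congr 1
      ext x
      have h5 := fderiv_sim r R b (Y.differentiable hw') x (R.symm (t (simMap r R b x)))
      simp only [si, LinearIsometryEquiv.apply_symm_apply] at h5
      exact h5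
    · intro s hs hsf
      have h4 := push hsf
      simp only [mul_zero] at h4
      have h3 := h2 _ (hVs' hs) h4
      rw [← av] at h3
      rw [← h3]
      congr 1
      ext x
      rw [si, ← R.inner_map_map, LinearIsometryEquiv.apply_symm_apply]
  · have hl' : InField X.V (fun x => r • R.symm (l (simMap r R b x))) := by
      obtain ⟨t, ht, hlt⟩ := (hV l).1 hl
      refine ⟨r • t, X.V.smul_mem r ht, ?_⟩
      have h5 : field (r • t) =ᵐ[vol X.K] r • field t := Lp.coeFn_smul r t.1
      filter_upwards [hlt, h5] with x hx hx2
      rw [hx2, Pi.smul_apply, ← hx]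
    have := hX.grad _ ((hW w).1 hw) _ ((hM m).1 hm) _ hl' _ ((hMS s).1 hs) ?_ ?_
    · rw [hgrad w hw, ab (fun x => (w x - m x) ^ 2), ab (fun x => s x ^ 2)] at this
      have e1 : X.h ^ 2 * avv X.K (fun x => ‖r • R.symm (l (simMap r R b x))‖ ^ 2)
          = Y.h ^ 2 * avv Y.K (fun x => ‖l x‖ ^ 2) := by
        have e : avv X.K (fun x => ‖r • R.symm (l (simMap r R b x))‖ ^ 2)
            = r ^ 2 * avv X.K (fun x => ‖l (simMap r R b x)‖ ^ 2) := by
          rw [← avv_const_mul]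
          refine congrArg (avv X.K) (funext fun x => ?_)
          rw [norm_smul, LinearIsometryEquiv.norm_map, mul_pow, Real.norm_eq_abs, sq_abs]
        rw [hh, ← av (fun x => ‖l x‖ ^ 2), e]
        ring
      rwa [e1] at this
    · intro v δ γ hv hf
      have h3 := h1 _ _ _ (hV' hv) (push hf)
      rw [hh, ← av, ← av, ← ab] at h3
      simp only [si] at h3
      have e1 : avv X.K (fun x => inner ℝ (r • R.symm (l (simMap r R b x))) (v x))
          = r * avv X.K (fun x => inner ℝ (l (simMap r R b x)) (R (v x))) := by
        rw [← avv_const_mul]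
        congr 1
        ext x
        rw [inner_smul_left, ← R.inner_map_map, LinearIsometryEquiv.apply_symm_apply]
        rfl
      have e2 : avv X.K (fun x => w (simMap r R b x) * δ x)
          = r * avv X.K (fun x => w (simMap r R b x) * (r⁻¹ * δ x)) := by
        rw [← avv_const_mul]
        congr 1
        ext x
        field_simp
      rw [e1, e2, ← h3]
      ring
    · intro μ hμ
      have h3 := h2 _ (hMS' hμ)
      rw [← ab] at h3
      simpa only [si] using h3
  · have := hX.friedrichs _ ((hW w).1 hw) _ ((hM m).1 hm) a (by rw [ab (fun x => m x - a)]; exact ha)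
    rwa [hgrad w hw, ab (fun x => (w x - m x) ^ 2), av (fun x => (w x - a) ^ 2),
      ab (fun x => (m x - a) ^ 2)] at this

theorem LocalBounds.mono {X : LocalSpaces d} {C C' : ℝ} (h : LocalBounds X C) (hC : C ≤ C') :
    LocalBounds X C' := by
  have hv : ∀ f : E d → ℝ, 0 ≤ avv X.K (fun x => f x ^ 2) := fun f => avv_nonneg _ fun x => sq_nonneg _
  have hb : ∀ f : E d → ℝ, 0 ≤ avb X.K (fun x => f x ^ 2) := fun f => avb_nonneg _ fun x => sq_nonneg _
  have key : ∀ {a x : ℝ}, a ≤ C * x → 0 ≤ x → a ≤ C' * x := fun h1 h2 =>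
    h1.trans (mul_le_mul_of_nonneg_right hC h2)
  refine ⟨h.nonneg.trans hC, fun w hw => key (h.trace w hw) (hv _), fun w hw x hx =>
    key (h.sup w hw x hx) (hv _), fun m hm => ?_, fun w hw ξ ζ h1 h2 h3 h4 =>
    key (h.stab w hw ξ ζ h1 h2 h3 h4) (add_nonneg (hv _) (hb _)), ⟨h.size.1.trans hC, h.size.2.trans hC⟩,
    fun t δ γ h1 h2 h3 h4 => key (h.normal t δ γ h1 h2 h3 h4) (hb _),
    fun w hw m hm l hl s hs h1 h2 => key (h.grad w hw m hm l hl s hs h1 h2)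
      (add_nonneg (mul_nonneg (sq_nonneg _) (hv _)) (hb _)),
    fun w hw m hm a ha => key (h.friedrichs w hw m hm a ha)
      (add_nonneg (mul_nonneg (sq_nonneg _) (hv _)) (hb _))⟩
  filter_upwards [h.traceSup m hm] with x hx
  exact key hx (hb _)

/-- A natural number that bounds the constants of the local estimates on an element. -/
def localConst (X : LocalSpaces d) : ℝ := (sInf {n : ℕ | LocalBounds X n} : ℕ)

theorem localConst_similar (hd : 0 < d) {X Y : LocalSpaces d} (h : X.Similar Y) :
    localConst X = localConst Y := by
  have : {n : ℕ | LocalBounds X n} = {n : ℕ | LocalBounds Y n} := by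
    ext n
    exact ⟨LocalBounds.of_similar hd h, LocalBounds.of_similar hd h.symm⟩
  rw [localConst, localConst, this]

theorem localBounds_localConst {X : LocalSpaces d} (h : ∃ C, LocalBounds X C) :
    LocalBounds X (localConst X) := by
  obtain ⟨C, hC⟩ := h
  obtain ⟨n, hn⟩ := exists_nat_ge C
  exact Nat.sInf_mem (s := {n : ℕ | LocalBounds X n}) ⟨n, hC.mono hn⟩

end

section

variable {d : ℕ}

theorem exists_bound_of_ker_le {V F G : Type*} [AddCommGroup V] [Module ℝ V] [FiniteDimensional ℝ V]
    [NormedAddCommGroup F] [NormedSpace ℝ F] [NormedAddCommGroup G] [NormedSpace ℝ G]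
    (A : V →ₗ[ℝ] F) (B : V →ₗ[ℝ] G) (h : ∀ x, B x = 0 → A x = 0) :
    ∃ C, 0 ≤ C ∧ ∀ x, ‖A x‖ ≤ C * ‖B x‖ := by
  let A' : LinearMap.range B →ₗ[ℝ] F :=
    ((LinearMap.ker B).liftQ A fun x hx => h x hx) ∘ₗ B.quotKerEquivRange.symm.toLinearMap
  have hA' : ∀ x, A' ⟨B x, LinearMap.mem_range_self B x⟩ = A x := by
    intro x
    have h1 : B.quotKerEquivRange.symm ⟨B x, LinearMap.mem_range_self B x⟩
        = (LinearMap.ker B).mkQ x := by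
      rw [LinearEquiv.symm_apply_eq]
      rfl
    change ((LinearMap.ker B).liftQ A h) (B.quotKerEquivRange.symm ⟨B x, _⟩) = A x
    rw [h1]
    rfl
  refine ⟨‖LinearMap.toContinuousLinearMap A'‖, ContinuousLinearMap.opNorm_nonneg _, fun x => ?_⟩
  have h2 := (LinearMap.toContinuousLinearMap A').le_opNorm ⟨B x, LinearMap.mem_range_self B x⟩
  rw [LinearMap.coe_toContinuousLinearMap', hA'] at h2
  exact h2

theorem exists_sq_bound {V F₁ F₂ G₁ G₂ : Type*} [AddCommGroup V] [Module ℝ V]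
    [FiniteDimensional ℝ V] [NormedAddCommGroup F₁] [NormedSpace ℝ F₁] [NormedAddCommGroup F₂]
    [NormedSpace ℝ F₂] [NormedAddCommGroup G₁] [NormedSpace ℝ G₁] [NormedAddCommGroup G₂]
    [NormedSpace ℝ G₂] (A₁ : V →ₗ[ℝ] F₁) (A₂ : V →ₗ[ℝ] F₂) (B₁ : V →ₗ[ℝ] G₁) (B₂ : V →ₗ[ℝ] G₂)
    (h : ∀ x, B₁ x = 0 → B₂ x = 0 → A₁ x = 0 ∧ A₂ x = 0) {α₁ α₂ β₁ β₂ : ℝ} (h₁ : 0 < α₁)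
    (h₂ : 0 < α₂) (h₃ : 0 < β₁) (h₄ : 0 < β₂) :
    ∃ C, 0 ≤ C ∧ ∀ x, α₁ * ‖A₁ x‖ ^ 2 + α₂ * ‖A₂ x‖ ^ 2
      ≤ C * (β₁ * ‖B₁ x‖ ^ 2 + β₂ * ‖B₂ x‖ ^ 2) := by
  obtain ⟨C, hC, hb⟩ := exists_bound_of_ker_le (A₁.prod A₂) (B₁.prod B₂) (by
    intro x hx
    have hx : (B₁ x, B₂ x) = (0, 0) := hx
    rw [Prod.mk.injEq] at hx
    exact Prod.ext (h x hx.1 hx.2).1 (h x hx.1 hx.2).2)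
  refine ⟨(α₁ + α₂) * C ^ 2 * (β₁⁻¹ + β₂⁻¹), by positivity, fun x => ?_⟩
  set D := ‖B₁ x‖ ^ 2 + ‖B₂ x‖ ^ 2
  have hD : 0 ≤ D := by positivity
  have h5 : ‖(B₁.prod B₂) x‖ ^ 2 ≤ D := by
    rw [LinearMap.prod_apply, Prod.norm_def]
    rcases max_cases ‖B₁ x‖ ‖B₂ x‖ with h | h
    · change max ‖B₁ x‖ ‖B₂ x‖ ^ 2 ≤ D
      rw [h.1]; exact le_add_of_nonneg_right (sq_nonneg _)
    · change max ‖B₁ x‖ ‖B₂ x‖ ^ 2 ≤ D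
      rw [h.1]; exact le_add_of_nonneg_left (sq_nonneg _)
  have h6 : ∀ t : ℝ, 0 ≤ t → t ≤ ‖(A₁.prod A₂) x‖ → t ^ 2 ≤ C ^ 2 * D := by
    intro t ht h
    calc t ^ 2 ≤ (C * ‖(B₁.prod B₂) x‖) ^ 2 := by
          have := hb x
          gcongr
          exact h.trans this
      _ = C ^ 2 * ‖(B₁.prod B₂) x‖ ^ 2 := by ring
      _ ≤ C ^ 2 * D := by gcongr
  have h7 := h6 ‖A₁ x‖ (norm_nonneg _) (norm_fst_le ((A₁.prod A₂) x))
  have h8 := h6 ‖A₂ x‖ (norm_nonneg _) (norm_snd_le ((A₁.prod A₂) x))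
  have h9 : D ≤ (β₁⁻¹ + β₂⁻¹) * (β₁ * ‖B₁ x‖ ^ 2 + β₂ * ‖B₂ x‖ ^ 2) := by
    have e : (β₁⁻¹ + β₂⁻¹) * (β₁ * ‖B₁ x‖ ^ 2 + β₂ * ‖B₂ x‖ ^ 2)
        = D + (β₁⁻¹ * (β₂ * ‖B₂ x‖ ^ 2) + β₂⁻¹ * (β₁ * ‖B₁ x‖ ^ 2)) := by
      simp only [D]
      field_simp
      ring
    rw [e]
    exact le_add_of_nonneg_right (by positivity)
  calc α₁ * ‖A₁ x‖ ^ 2 + α₂ * ‖A₂ x‖ ^ 2 ≤ α₁ * (C ^ 2 * D) + α₂ * (C ^ 2 * D) := by gcongr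
    _ = (α₁ + α₂) * C ^ 2 * D := by ring
    _ ≤ (α₁ + α₂) * C ^ 2 * ((β₁⁻¹ + β₂⁻¹) * (β₁ * ‖B₁ x‖ ^ 2 + β₂ * ‖B₂ x‖ ^ 2)) := by gcongr
    _ = _ := by ring

/-- A linear family of square integrable functions as a linear map into `L²`. -/
def l2Map {V F : Type*} [AddCommGroup V] [Module ℝ V] [NormedAddCommGroup F] [NormedSpace ℝ F]
    {μ : Measure (E d)} (ev : V →ₗ[ℝ] (E d → F)) (h : ∀ v, MemLp (ev v) 2 μ) : V →ₗ[ℝ] Lp F 2 μ where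
  toFun v := (h v).toLp (ev v)
  map_add' v w := by
    rw [← MemLp.toLp_add]
    congr 1
    exact map_add ev v w
  map_smul' c v := by
    rw [RingHom.id_apply, ← MemLp.toLp_const_smul]
    congr 1
    exact map_smul ev c v

theorem norm_toLp_sq {F : Type*} [NormedAddCommGroup F] {μ : Measure (E d)} {f : E d → F}
    (hf : MemLp f 2 μ) : ‖hf.toLp f‖ ^ 2 = ∫ x, ‖f x‖ ^ 2 ∂μ := by
  have h1 : ‖hf.toLp f‖ = ‖hf.norm.toLp (fun x => ‖f x‖)‖ := by
    rw [Lp.norm_toLp, Lp.norm_toLp, eLpNorm_norm]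
  rw [h1, ← l2_eq_norm, l2_sq]

theorem l2Map_coe {V F : Type*} [AddCommGroup V] [Module ℝ V] [NormedAddCommGroup F]
    [NormedSpace ℝ F] {μ : Measure (E d)} (ev : V →ₗ[ℝ] (E d → F)) (h : ∀ v, MemLp (ev v) 2 μ) (v : V) :
    (l2Map ev h v : E d → F) =ᵐ[μ] ev v := (h v).coeFn_toLp

theorem norm_Lp_sq {F : Type*} [NormedAddCommGroup F] {μ : Measure (E d)} (f : Lp F 2 μ) :
    ‖f‖ ^ 2 = ∫ x, ‖f x‖ ^ 2 ∂μ := by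
  conv_lhs => rw [← Lp.toLp_coeFn f (Lp.memLp f)]
  exact norm_toLp_sq _

theorem inner_Lp {μ : Measure (E d)} (f g : Lp ℝ 2 μ) : inner ℝ f g = ∫ x, f x * g x ∂μ := by
  rw [L2.inner_def]
  congr 1
  ext x
  simp [mul_comm]

/-! ### Fluxes -/

variable {K : Set (E d)} {faces : Finset (Set (E d))}

theorem IsHdiv.isFlux {t : Flux K} (h : IsHdiv t) : IsFlux K (field t) (dvg t) (ntr t) :=
  ⟨Lp.memLp _, Lp.memLp _, Lp.memLp _, h⟩

theorem IsFlux.congr {v v' : E d → E d} {δ δ' γ γ' : E d → ℝ} (h : IsFlux K v δ γ)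
    (hv : v =ᵐ[vol K] v') (hδ : δ =ᵐ[vol K] δ') (hγ : γ =ᵐ[bdry K] γ') : IsFlux K v' δ' γ' := by
  refine ⟨(memLp_congr_ae hv).1 h.memLp, (memLp_congr_ae hδ).1 h.memLp_div,
    (memLp_congr_ae hγ).1 h.memLp_ntr, fun φ hφ => ?_⟩
  have e1 : ∀ j, ∫ x, v' x j * pd j φ x ∂(vol K) = ∫ x, v x j * pd j φ x ∂(vol K) := fun j =>
    integral_congr_ae (by filter_upwards [hv] with x hx; rw [hx])
  have e2 : ∫ x, δ' x * φ x ∂(vol K) = ∫ x, δ x * φ x ∂(vol K) :=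
    integral_congr_ae (by filter_upwards [hδ] with x hx; rw [hx])
  have e3 : ∫ x, γ' x * φ x ∂(bdry K) = ∫ x, γ x * φ x ∂(bdry K) :=
    integral_congr_ae (by filter_upwards [hγ] with x hx; rw [hx])
  simp_rw [e1, e2, e3]
  exact h.green φ hφ

/-- The weak divergence and the normal trace are determined by the field. -/
theorem IsFlux.unique (hK : IsPolyhedral K faces) {v v' : E d → E d} {δ δ' γ γ' : E d → ℝ}
    (h : IsFlux K v δ γ) (h' : IsFlux K v' δ' γ') (hv : v =ᵐ[vol K] v') :
    δ =ᵐ[vol K] δ' ∧ γ =ᵐ[bdry K] γ' := by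
  have := hK.isFiniteMeasure_vol
  have := hK.isFiniteMeasure_bdry
  have key : ∀ φ : E d → ℝ, ContDiff ℝ ∞ φ → ∫ x, (δ x - δ' x) * φ x ∂(vol K)
      = ∫ x, (γ x - γ' x) * φ x ∂(bdry K) := by
    intro φ hφ
    have h1 := h.green φ hφ
    have h2 := h'.green φ hφ
    have e1 : ∀ j, ∫ x, v' x j * pd j φ x ∂(vol K) = ∫ x, v x j * pd j φ x ∂(vol K) := fun j =>
      integral_congr_ae (by filter_upwards [hv] with x hx; rw [hx])
    simp_rw [e1] at h2
    simp_rw [sub_mul]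
    have hb1 := hK.memLp_top_vol hφ.continuous
    have hb2 := hK.memLp_top_bdry hφ.continuous
    rw [integral_sub, integral_sub]
    · linarith
    · exact (memLp_mul_bdd h.memLp_ntr hb2).integrable (by norm_num)
    · exact (memLp_mul_bdd h'.memLp_ntr hb2).integrable (by norm_num)
    · exact (memLp_mul_bdd h.memLp_div hb1).integrable (by norm_num)
    · exact (memLp_mul_bdd h'.memLp_div hb1).integrable (by norm_num)
  have i1 : Integrable (fun x => δ x - δ' x) (vol K) :=
    (h.memLp_div.sub h'.memLp_div).integrable (by norm_num)
  have i2 : Integrable (fun x => γ x - γ' x) (bdry K) :=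
    (h.memLp_ntr.sub h'.memLp_ntr).integrable (by norm_num)
  have hδ : δ =ᵐ[vol K] δ' := by
    have h1 := hK.isOpen.ae_eq_zero_of_integral_contDiff_smul_eq_zero (μ := vol K)
      (i1.locallyIntegrable.locallyIntegrableOn K) (by
        intro φ hφ _ hs
        have h2 := key φ hφ
        have h3 : ∫ x, (γ x - γ' x) * φ x ∂(bdry K) = 0 := by
          refine integral_eq_zero_of_ae ?_
          filter_upwards [ae_bdry_mem_frontier K] with x hx
          have : φ x = 0 := by
            refine image_eq_zero_of_notMem_tsupport fun hxs => ?_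
            rw [hK.isOpen.frontier_eq] at hx
            exact hx.2 (hs hxs)
          rw [this, mul_zero]; rfl
        rw [h3] at h2
        simp_rw [smul_eq_mul, mul_comm (φ _)]
        exact h2)
    filter_upwards [h1, ae_vol_mem hK.isOpen.measurableSet] with x hx hxK
    exact sub_eq_zero.1 (hx hxK)
  refine ⟨hδ, ?_⟩
  have h1 := ae_eq_zero_of_integral_contDiff_smul_eq_zero (μ := bdry K) i2.locallyIntegrable (by
    intro φ hφ _
    have h2 := key φ hφ
    have h3 : ∫ x, (δ x - δ' x) * φ x ∂(vol K) = 0 := by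
      refine integral_eq_zero_of_ae ?_
      filter_upwards [hδ] with x hx
      rw [hx, sub_self, zero_mul]; rfl
    rw [h3] at h2
    simp_rw [smul_eq_mul, mul_comm (φ _)]
    exact h2.symm)
  filter_upwards [h1] with x hx
  exact sub_eq_zero.1 hx

namespace LocalSpaces

theorem V_hdiv (X : LocalSpaces d) {t : Flux X.K} (ht : t ∈ X.V) : IsHdiv t :=
  X.Vstar_hdiv t (X.V_le_Vstar ht)

theorem ae_zero (X : LocalSpaces d) {w : E d → ℝ} (hw : w ∈ X.W) (h : w =ᵐ[vol X.K] 0) : w = 0 := by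
  have h1 : EqOn w 0 X.K :=
    Measure.eqOn_open_of_ae_eq h X.polyhedral.isOpen (X.contDiff hw).continuous.continuousOn
      continuousOn_const
  obtain ⟨P, hP⟩ := X.W_poly w hw
  have han : AnalyticOnNhd ℝ w univ := by
    have h2 : AnalyticOnNhd ℝ (fun x : E d => MvPolynomial.aeval (fun i => x i) P) univ :=
      AnalyticOnNhd.aeval_mvPolynomial (fun i x _ =>
        (EuclideanSpace.proj i : E d →L[ℝ] ℝ).analyticAt x) P
    have h3 : w = fun x => MvPolynomial.aeval (fun i => x i) P := by
      ext x
      rw [hP x]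
      rfl
    rw [h3]
    exact h2
  obtain ⟨x, hx⟩ := X.polyhedral.nonempty
  have h4 : w =ᶠ[𝓝 x] 0 := by
    filter_upwards [X.polyhedral.isOpen.mem_nhds hx] with y hy
    exact h1 hy
  exact han.eq_of_eventuallyEq analyticOnNhd_const h4

theorem memLp_W (X : LocalSpaces d) {w : E d → ℝ} (hw : w ∈ X.W) : MemLp w 2 (vol X.K) :=
  X.polyhedral.memLp_vol (X.contDiff hw).continuous 2

theorem memLp_W_bdry (X : LocalSpaces d) {w : E d → ℝ} (hw : w ∈ X.W) : MemLp w 2 (bdry X.K) :=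
  X.polyhedral.memLp_bdry (X.contDiff hw).continuous 2

theorem continuous_fderiv (X : LocalSpaces d) {w : E d → ℝ} (hw : w ∈ X.W) :
    Continuous (fderiv ℝ w) := (X.contDiff hw).continuous_fderiv (by simp)

theorem memLp_fderiv (X : LocalSpaces d) {w : E d → ℝ} (hw : w ∈ X.W) :
    MemLp (fderiv ℝ w) 2 (vol X.K) :=
  (memLp_norm_iff (X.continuous_fderiv hw).aestronglyMeasurable).1
    (X.polyhedral.memLp_vol (X.continuous_fderiv hw).norm 2)

end LocalSpaces

theorem InTrace.memLp {S : Submodule ℝ (Lp ℝ 2 (bdry K))} {g : E d → ℝ} (h : InTrace S g) :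
    MemLp g 2 (bdry K) := by
  obtain ⟨m, -, hm⟩ := h
  exact (memLp_congr_ae hm).2 (Lp.memLp m)

theorem InTrace.sub {S : Submodule ℝ (Lp ℝ 2 (bdry K))} {g g' : E d → ℝ} (h : InTrace S g)
    (h' : InTrace S g') : InTrace S (fun x => g x - g' x) := by
  obtain ⟨m, hm, hg⟩ := h
  obtain ⟨m', hm', hg'⟩ := h'
  refine ⟨m - m', S.sub_mem hm hm', ?_⟩
  filter_upwards [hg, hg', Lp.coeFn_sub m m'] with x h1 h2 h3
  rw [h3, Pi.sub_apply, h1, h2]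

theorem InTrace.add {S : Submodule ℝ (Lp ℝ 2 (bdry K))} {g g' : E d → ℝ} (h : InTrace S g)
    (h' : InTrace S g') : InTrace S (fun x => g x + g' x) := by
  obtain ⟨m, hm, hg⟩ := h
  obtain ⟨m', hm', hg'⟩ := h'
  refine ⟨m + m', S.add_mem hm hm', ?_⟩
  filter_upwards [hg, hg', Lp.coeFn_add m m'] with x h1 h2 h3
  rw [h3, Pi.add_apply, h1, h2]

theorem InTrace.const_mul {S : Submodule ℝ (Lp ℝ 2 (bdry K))} {g : E d → ℝ} (h : InTrace S g)
    (c : ℝ) : InTrace S (fun x => c * g x) := by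
  obtain ⟨m, hm, hg⟩ := h
  refine ⟨c • m, S.smul_mem c hm, ?_⟩
  filter_upwards [hg, Lp.coeFn_smul c m] with x h1 h3
  rw [h3, Pi.smul_apply, h1, smul_eq_mul]

theorem InTrace.zero {S : Submodule ℝ (Lp ℝ 2 (bdry K))} : InTrace S (fun _ => 0) :=
  ⟨0, S.zero_mem, (Lp.coeFn_zero ℝ 2 (bdry K)).symm⟩

theorem InTrace.sum {S : Submodule ℝ (Lp ℝ 2 (bdry K))} {ι : Type*} {s : Finset ι}
    {g : ι → E d → ℝ} (h : ∀ i ∈ s, InTrace S (g i)) : InTrace S (fun x => ∑ i ∈ s, g i x) := by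
  classical
  induction s using Finset.induction_on with
  | empty => simpa using InTrace.zero
  | insert a s ha ih =>
    simp_rw [Finset.sum_insert ha]
    exact (h a (Finset.mem_insert_self a s)).add (ih fun i hi => h i (Finset.mem_insert_of_mem hi))

theorem InTrace.congr {S : Submodule ℝ (Lp ℝ 2 (bdry K))} {g g' : E d → ℝ} (h : InTrace S g)
    (hg : g =ᵐ[bdry K] g') : InTrace S g' := by
  obtain ⟨m, hm, hgm⟩ := h
  exact ⟨m, hm, hg.symm.trans hgm⟩

theorem ntr_zero : ntr (0 : Flux K) =ᵐ[bdry K] fun _ => 0 := Lp.coeFn_zero ℝ 2 (bdry K)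

namespace LocalSpaces

theorem trace_W (X : LocalSpaces d) {w : E d → ℝ} (hw : w ∈ X.W) : InTrace X.M w := by
  obtain ⟨Vt, Wt, h, -⟩ := X.decomposition
  refine (h.trace_mem 0 X.V.zero_mem w hw).congr ?_
  filter_upwards [ntr_zero (K := X.K)] with x hx
  rw [hx, zero_add]

theorem trace_Vstar (X : LocalSpaces d) {t : Flux X.K} (ht : t ∈ X.Vstar) : InTrace X.M (ntr t) := by
  obtain ⟨Vt, Wt, h⟩ := X.decomposition_Vstar
  refine (h.trace_mem t ht 0 X.W.zero_mem).congr ?_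
  filter_upwards with x
  simp

end LocalSpaces

end

section

variable {d : ℕ}

namespace LocalSpaces

variable (X : LocalSpaces d)

/-- The functions of `W(K)` as elements of `L²(K)`. -/
def wVol : X.W →ₗ[ℝ] Lp ℝ 2 (vol X.K) := l2Map X.W.subtype fun w => X.memLp_W w.2

/-- The traces of the functions of `W(K)` as elements of `L²(∂K)`. -/
def wBdry : X.W →ₗ[ℝ] Lp ℝ 2 (bdry X.K) := l2Map X.W.subtype fun w => X.memLp_W_bdry w.2

/-- The derivatives of the functions of `W(K)` as elements of `L²(K)`. -/
def wGrad : X.W →ₗ[ℝ] Lp (E d →L[ℝ] ℝ) 2 (vol X.K) :=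
  l2Map
    { toFun := fun w => fderiv ℝ w
      map_add' := fun v w => by
        ext1 x
        exact fderiv_add (X.differentiable v.2 x) (X.differentiable w.2 x)
      map_smul' := fun c w => by
        ext1 x
        exact fderiv_const_smul (X.differentiable w.2 x) c } fun w => X.memLp_fderiv w.2

theorem wVol_coe (w : X.W) : (X.wVol w : E d → ℝ) =ᵐ[vol X.K] w := l2Map_coe _ _ w

theorem wBdry_coe (w : X.W) : (X.wBdry w : E d → ℝ) =ᵐ[bdry X.K] w := l2Map_coe _ _ w

theorem wGrad_coe (w : X.W) : (X.wGrad w : E d → (E d →L[ℝ] ℝ)) =ᵐ[vol X.K] fderiv ℝ w :=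
  l2Map_coe _ _ w

theorem wVol_eq_zero {w : X.W} (h : X.wVol w = 0) : w = 0 := by
  refine Subtype.ext (X.ae_zero w.2 ?_)
  filter_upwards [X.wVol_coe w, Lp.coeFn_zero ℝ 2 (vol X.K)] with x h1 h2
  rw [← h1, h, h2]

theorem avv_sq_norm {F : Type*} [NormedAddCommGroup F] (f : Lp F 2 (vol X.K)) {g : E d → F}
    (h : (f : E d → F) =ᵐ[vol X.K] g) :
    avv X.K (fun x => ‖g x‖ ^ 2) = (X.h ^ d)⁻¹ * ‖f‖ ^ 2 := by
  rw [avv, norm_Lp_sq]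
  refine congrArg _ (integral_congr_ae ?_)
  filter_upwards [h] with x hx
  rw [hx]

theorem avv_sq_eq (f : Lp ℝ 2 (vol X.K)) {g : E d → ℝ} (h : (f : E d → ℝ) =ᵐ[vol X.K] g) :
    avv X.K (fun x => g x ^ 2) = (X.h ^ d)⁻¹ * ‖f‖ ^ 2 := by
  rw [← X.avv_sq_norm f h]
  simp_rw [Real.norm_eq_abs, sq_abs]

theorem avb_sq_eq (f : Lp ℝ 2 (bdry X.K)) {g : E d → ℝ} (h : (f : E d → ℝ) =ᵐ[bdry X.K] g) :
    avb X.K (fun x => g x ^ 2) = (X.h ^ (d - 1))⁻¹ * ‖f‖ ^ 2 := by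
  rw [avb, norm_Lp_sq]
  refine congrArg _ (integral_congr_ae ?_)
  filter_upwards [h] with x hx
  rw [hx, Real.norm_eq_abs, sq_abs]

theorem h_pos (hd : 0 < d) : 0 < X.h := X.polyhedral.diam_pos hd

theorem exists_trace_bound (hd : 0 < d) : ∃ C, 0 ≤ C ∧ ∀ w ∈ X.W,
    avb X.K (fun x => w x ^ 2) ≤ C * avv X.K (fun x => w x ^ 2) := by
  have hh := X.h_pos hd
  obtain ⟨C, hC, h⟩ := exists_sq_bound X.wBdry (0 : X.W →ₗ[ℝ] ℝ) X.wVol (0 : X.W →ₗ[ℝ] ℝ)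
    (fun w h1 _ => by rw [X.wVol_eq_zero h1]; simp)
    (α₁ := (X.h ^ (d - 1))⁻¹) (α₂ := 1) (β₁ := (X.h ^ d)⁻¹) (β₂ := 1) (by positivity) one_pos
    (by positivity) one_pos
  refine ⟨C, hC, fun w hw => ?_⟩
  rw [X.avb_sq_eq _ (X.wBdry_coe ⟨w, hw⟩), X.avv_sq_eq _ (X.wVol_coe ⟨w, hw⟩)]
  simpa using h ⟨w, hw⟩

theorem exists_sup_bound (hd : 0 < d) : ∃ C, 0 ≤ C ∧ ∀ w ∈ X.W, ∀ x ∈ X.K,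
    w x ^ 2 ≤ C * avv X.K (fun x => w x ^ 2) := by
  have hh := X.h_pos hd
  have hc : CompactSpace (closure X.K) :=
    isCompact_iff_compactSpace.1 X.polyhedral.isBounded.isCompact_closure
  let A : X.W →ₗ[ℝ] C(closure X.K, ℝ) :=
    { toFun := fun w => ⟨fun x => (w : E d → ℝ) x,
        (X.contDiff w.2).continuous.comp continuous_subtype_val⟩
      map_add' := fun v w => by ext x; rfl
      map_smul' := fun c w => by ext x; rfl }
  obtain ⟨C, hC, h⟩ := exists_bound_of_ker_le A X.wVol
    (fun w h1 => by rw [X.wVol_eq_zero h1, map_zero])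
  refine ⟨C ^ 2 * X.h ^ d, by positivity, fun w hw x hx => ?_⟩
  rw [X.avv_sq_eq _ (X.wVol_coe ⟨w, hw⟩)]
  have h1 := (A ⟨w, hw⟩).norm_coe_le_norm ⟨x, subset_closure hx⟩
  have h2 : |w x| ≤ C * ‖X.wVol ⟨w, hw⟩‖ := h1.trans (h _)
  calc w x ^ 2 = |w x| ^ 2 := (sq_abs _).symm
    _ ≤ (C * ‖X.wVol ⟨w, hw⟩‖) ^ 2 := by gcongr
    _ = _ := by field_simp

theorem exists_traceSup_bound (hd : 0 < d) : ∃ C, 0 ≤ C ∧ ∀ m, InTrace X.M m →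
    ∀ᵐ x ∂(bdry X.K), m x ^ 2 ≤ C * avb X.K (fun x => m x ^ 2) := by
  have hh := X.h_pos hd
  let A : X.M →ₗ[ℝ] Lp ℝ ⊤ (bdry X.K) :=
    { toFun := fun m => (X.M_bounded m m.2).toLp _
      map_add' := fun v w => by
        rw [← MemLp.toLp_add]
        exact (MemLp.toLp_eq_toLp_iff _ _).2 (Lp.coeFn_add _ _)
      map_smul' := fun c w => by
        rw [RingHom.id_apply, ← MemLp.toLp_const_smul]
        exact (MemLp.toLp_eq_toLp_iff _ _).2 (Lp.coeFn_smul _ _) }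
  obtain ⟨C, hC, h⟩ := exists_bound_of_ker_le A X.M.subtype (fun w h1 => by
    rw [Subtype.ext (a2 := (0 : X.M)) h1, map_zero])
  refine ⟨C ^ 2 * X.h ^ (d - 1), by positivity, fun m hm => ?_⟩
  obtain ⟨μ, hμ, hmμ⟩ := hm
  rw [X.avb_sq_eq μ hmμ.symm]
  have h1 : ∀ᵐ x ∂(bdry X.K), ‖(A ⟨μ, hμ⟩ : E d → ℝ) x‖ ≤ ‖A ⟨μ, hμ⟩‖ := by
    have := ae_le_eLpNormEssSup (f := (A ⟨μ, hμ⟩ : E d → ℝ)) (μ := bdry X.K)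
    filter_upwards [this] with x hx
    rw [Lp.norm_def, eLpNorm_exponent_top]
    have hfin : eLpNormEssSup (A ⟨μ, hμ⟩ : E d → ℝ) (bdry X.K) ≠ ⊤ := by
      have := Lp.eLpNorm_ne_top (A ⟨μ, hμ⟩)
      rwa [eLpNorm_exponent_top] at this
    have h2 := ENNReal.toReal_mono hfin hx
    rwa [toReal_enorm] at h2
  have h3 : (A ⟨μ, hμ⟩ : E d → ℝ) =ᵐ[bdry X.K] μ := (X.M_bounded μ hμ).coeFn_toLp
  filter_upwards [h1, h3, hmμ] with x h4 h5 h6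
  rw [h5, ← h6] at h4
  have h7 : |m x| ≤ C * ‖μ‖ := h4.trans (h ⟨μ, hμ⟩)
  calc m x ^ 2 = |m x| ^ 2 := (sq_abs _).symm
    _ ≤ (C * ‖μ‖) ^ 2 := by gcongr
    _ = _ := by field_simp

/-- A function of `W(K)` that is orthogonal to all divergences is orthogonal to `Wt`. -/
theorem inScalarPerp_of_div {Vt : Submodule ℝ (Flux X.K)} {Wt : Submodule ℝ (E d → ℝ)}
    (h : IsMDecomposition X.K X.V X.W X.M Vt Wt) (hs : IsStabilization X.K X.V X.W X.M Wt X.MS)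
    {w : E d → ℝ} (hw : w ∈ X.W) (h0 : ∀ t ∈ X.V, ∫ x, dvg t x * w x ∂(vol X.K) = 0) :
    InScalarPerp X.K X.W Wt w := by
  refine ⟨hw, fun w' hw' => ?_⟩
  let J : Wt →ₗ[ℝ] Lp ℝ 2 (vol X.K) := X.wVol ∘ₗ Submodule.inclusion h.Wt_le
  have hfin : FiniteDimensional ℝ Wt := Submodule.finiteDimensional_of_le h.Wt_le
  have hinj : Function.Injective J := by
    rw [← LinearMap.ker_eq_bot, LinearMap.ker_eq_bot']
    intro v hv
    have h1 := X.wVol_eq_zero hv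
    exact Submodule.inclusion_injective h.Wt_le (h1.trans (map_zero _).symm)
  have hle : X.V.map (dvgMap X.K) ≤ LinearMap.range J := by
    rintro _ ⟨t, ht, rfl⟩
    obtain ⟨v, hv, hvt⟩ := h.div_mem t ht
    refine ⟨⟨v, hv⟩, Lp.ext ?_⟩
    have h1 : (J ⟨v, hv⟩ : E d → ℝ) =ᵐ[vol X.K] v := X.wVol_coe ⟨v, h.Wt_le hv⟩
    exact h1.trans hvt.symm
  have hdim : Module.finrank ℝ (LinearMap.range J) ≤ Module.finrank ℝ (X.V.map (dvgMap X.K)) := by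
    rw [LinearMap.finrank_range_of_inj hinj]
    have h1 := hs.dim_perp
    have h2 := hs.dim_div
    omega
  have heq := Submodule.eq_of_le_of_finrank_le hle hdim
  have hmem : J ⟨w', hw'⟩ ∈ X.V.map (dvgMap X.K) := by
    rw [heq]; exact LinearMap.mem_range_self J _
  obtain ⟨t, ht, htJ⟩ := hmem
  rw [← h0 t ht]
  refine integral_congr_ae ?_
  have h1 : (J ⟨w', hw'⟩ : E d → ℝ) =ᵐ[vol X.K] w' := X.wVol_coe ⟨w', h.Wt_le hw'⟩
  rw [← htJ] at h1
  filter_upwards [h1] with x hx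
  rw [← hx]
  rfl

theorem inField_of_mem {t : Flux X.K} (ht : t ∈ X.V) : InField X.V (field t) :=
  ⟨t, ht, EventuallyEq.rfl⟩

theorem exists_stab_bound (hd : 0 < d) : ∃ C, 0 ≤ C ∧ ∀ w ∈ X.W, ∀ ξ ζ : E d → ℝ,
    MemLp ξ 2 (vol X.K) → MemLp ζ 2 (bdry X.K) →
    (∀ v δ γ, InField X.V v → IsFlux X.K v δ γ → avv X.K (fun x => (w x - ξ x) * δ x) = 0) →
    (∀ m, InTrace X.MS m → avb X.K (fun x => (w x - ζ x) * m x) = 0) →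
    avv X.K (fun x => w x ^ 2) ≤ C * (avv X.K (fun x => ξ x ^ 2) + avb X.K (fun x => ζ x ^ 2)) := by
  have hh := X.h_pos hd
  obtain ⟨Vt, Wt, hdec, hst⟩ := X.decomposition
  let D := X.V.map (dvgMap X.K)
  have hDfin : FiniteDimensional ℝ D := inferInstance
  obtain ⟨C, hC, h⟩ := exists_sq_bound X.wVol (0 : X.W →ₗ[ℝ] ℝ)
    (D.starProjection.toLinearMap ∘ₗ X.wVol) (X.MS.starProjection.toLinearMap ∘ₗ X.wBdry)
    (fun w h1 h2 => by
      have h1 : D.starProjection (X.wVol w) = 0 := h1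
      have h2 : X.MS.starProjection (X.wBdry w) = 0 := h2
      rw [Submodule.starProjection_apply_eq_zero_iff] at h1 h2
      have h3 := X.inScalarPerp_of_div hdec hst w.2 (fun t ht => by
        have h4 := (Submodule.mem_orthogonal _ _).1 h1 _ (Submodule.mem_map_of_mem ht)
        rw [inner_Lp] at h4
        rw [← h4]
        refine integral_congr_ae ?_
        filter_upwards [X.wVol_coe w] with x hx
        rw [hx]; rfl)
      have h5 := hst.norm_def _ h3 (fun μ hμ => by
        have h4 := (Submodule.mem_orthogonal _ _).1 h2 _ hμ
        rw [inner_Lp] at h4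
        rw [← h4]
        refine integral_congr_ae ?_
        filter_upwards [X.wBdry_coe w] with x hx
        rw [hx, mul_comm])
      rw [Subtype.ext (a2 := (0 : X.W)) h5]
      simp)
    (α₁ := (X.h ^ d)⁻¹) (α₂ := 1) (β₁ := (X.h ^ d)⁻¹) (β₂ := (X.h ^ (d - 1))⁻¹) (by positivity)
    one_pos (by positivity) (by positivity)
  refine ⟨C, hC, fun w hw ξ ζ hξ hζ h1 h2 => ?_⟩
  have h3 := h ⟨w, hw⟩
  simp only [LinearMap.zero_apply, norm_zero, ne_eq, OfNat.ofNat_ne_zero, not_false_eq_true, zero_pow,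
    mul_zero, add_zero] at h3
  rw [X.avv_sq_eq _ (X.wVol_coe ⟨w, hw⟩), X.avv_sq_eq _ hξ.coeFn_toLp, X.avb_sq_eq _ hζ.coeFn_toLp]
  refine h3.trans ?_
  have e1 : D.starProjection (X.wVol ⟨w, hw⟩) = D.starProjection (hξ.toLp ξ) := by
    rw [← sub_eq_zero, ← map_sub, Submodule.starProjection_apply_eq_zero_iff,
      Submodule.mem_orthogonal]
    rintro _ ⟨t, ht, rfl⟩
    have h4 := h1 _ _ _ (X.inField_of_mem ht) (X.V_hdiv ht).isFlux
    have h5 := (mul_eq_zero.1 h4).resolve_left (by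
      have : 0 < Metric.diam X.K := hh
      positivity)
    rw [inner_Lp, ← h5]
    refine integral_congr_ae ?_
    filter_upwards [X.wVol_coe ⟨w, hw⟩, hξ.coeFn_toLp, Lp.coeFn_sub (X.wVol ⟨w, hw⟩) (hξ.toLp ξ)]
      with x h6 h7 h8
    rw [h8, Pi.sub_apply, h6, h7, mul_comm]
    rfl
  have e2 : X.MS.starProjection (X.wBdry ⟨w, hw⟩) = X.MS.starProjection (hζ.toLp ζ) := by
    rw [← sub_eq_zero, ← map_sub, Submodule.starProjection_apply_eq_zero_iff,
      Submodule.mem_orthogonal]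
    intro m hm
    have h4 := h2 _ ⟨m, hm, EventuallyEq.rfl⟩
    have h5 := (mul_eq_zero.1 h4).resolve_left (by
      have : 0 < Metric.diam X.K := hh
      positivity)
    rw [inner_Lp, ← h5]
    refine integral_congr_ae ?_
    filter_upwards [X.wBdry_coe ⟨w, hw⟩, hζ.coeFn_toLp, Lp.coeFn_sub (X.wBdry ⟨w, hw⟩) (hζ.toLp ζ)]
      with x h6 h7 h8
    rw [h8, Pi.sub_apply, h6, h7, mul_comm]
  have e3 : ‖(D.starProjection.toLinearMap ∘ₗ X.wVol) ⟨w, hw⟩‖ ≤ ‖hξ.toLp ξ‖ := by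
    change ‖D.starProjection (X.wVol ⟨w, hw⟩)‖ ≤ _
    rw [e1]
    exact D.norm_starProjection_apply_le _
  have e4 : ‖(X.MS.starProjection.toLinearMap ∘ₗ X.wBdry) ⟨w, hw⟩‖ ≤ ‖hζ.toLp ζ‖ := by
    change ‖X.MS.starProjection (X.wBdry ⟨w, hw⟩)‖ ≤ _
    rw [e2]
    exact X.MS.norm_starProjection_apply_le _
  gcongr

end LocalSpaces

end

section

variable {d : ℕ}

namespace LocalSpaces

variable (X : LocalSpaces d)

theorem green_W {t : Flux X.K} (ht : t ∈ X.Vstar) {w : E d → ℝ} (hw : w ∈ X.W) :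
    (∫ x, fderiv ℝ w x (field t x) ∂(vol X.K)) + ∫ x, dvg t x * w x ∂(vol X.K)
      = ∫ x, ntr t x * w x ∂(bdry X.K) := by
  have h := X.Vstar_hdiv t ht w (X.contDiff hw)
  rwa [X.polyhedral.sum_integral_eq (v := field t) (Lp.memLp t.1) (X.contDiff hw)] at h

theorem inner_grad (w : E d → ℝ) {s t : E d → E d} {x : E d} (hs : ∀ j, s x j = pd j w x) :
    inner ℝ (s x) (t x) = fderiv ℝ w x (t x) := by
  rw [inner_eq_sum, fderiv_eq_sum_pd]
  exact Finset.sum_congr rfl fun j _ => by rw [hs j, mul_comm]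

theorem inner_Lp_grad {w : E d → ℝ} {s t : Flux X.K}
    (hs : ∀ᵐ x ∂(vol X.K), ∀ j, field s x j = pd j w x) :
    inner ℝ s.1 t.1 = ∫ x, fderiv ℝ w x (field t x) ∂(vol X.K) := by
  rw [L2.inner_def]
  refine integral_congr_ae ?_
  filter_upwards [hs] with x hx
  exact inner_grad w hx

theorem exists_grad {w : E d → ℝ} (hw : w ∈ X.W) :
    ∃ t ∈ X.V, ∀ᵐ x ∂(vol X.K), ∀ j, field t x j = pd j w x := by
  obtain ⟨Vt, Wt, h, -⟩ := X.decomposition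
  obtain ⟨t, ht, h1⟩ := h.grad_mem w hw
  exact ⟨t, h.Vt_le ht, h1⟩

theorem exists_normal_bound (hd : 0 < d) : ∃ C, 0 ≤ C ∧ ∀ t δ γ, InField X.Vstar t →
    IsFlux X.K t δ γ → (∀ w ∈ X.W, avv X.K (fun x => fderiv ℝ w x (t x)) = 0) →
    (∀ s, InField X.Vstar s → IsFlux X.K s (fun _ => 0) (fun _ => 0) →
      avv X.K (fun x => inner ℝ (t x) (s x)) = 0) →
    avv X.K (fun x => ‖t x‖ ^ 2) ≤ C * avb X.K (fun x => γ x ^ 2) := by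
  have hh := X.h_pos hd
  have hhd : Metric.diam X.K ≠ 0 := hh.ne'
  let Q : Flux X.K → Prop := fun s => (∃ w ∈ X.W, ∀ᵐ x ∂(vol X.K), ∀ j, field s x j = pd j w x) ∨
    (dvg s =ᵐ[vol X.K] 0 ∧ ntr s =ᵐ[bdry X.K] 0)
  let S : Submodule ℝ X.Vstar :=
    { carrier := {t | ∀ s ∈ X.Vstar, Q s → inner ℝ s.1 t.1.1 = 0}
      add_mem' := fun {a b} ha hb s hs hq => by
        change inner ℝ s.1 (a.1.1 + b.1.1) = 0
        rw [inner_add_right, ha s hs hq, hb s hs hq, add_zero]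
      zero_mem' := fun s _ _ => inner_zero_right _
      smul_mem' := fun c a ha s hs hq => by
        change inner ℝ s.1 (c • a.1.1) = 0
        rw [inner_smul_right, ha s hs hq, mul_zero] }
  let A : S →ₗ[ℝ] Lp (E d) 2 (vol X.K) := LinearMap.fst ℝ _ _ ∘ₗ X.Vstar.subtype ∘ₗ S.subtype
  let B : S →ₗ[ℝ] Lp ℝ 2 (bdry X.K) :=
    LinearMap.snd ℝ _ _ ∘ₗ LinearMap.snd ℝ _ _ ∘ₗ X.Vstar.subtype ∘ₗ S.subtype
  obtain ⟨C, hC, h⟩ := exists_sq_bound (V := S) A (0 : S →ₗ[ℝ] ℝ) B (0 : S →ₗ[ℝ] ℝ)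
    (fun t h1 _ => by
      refine ⟨?_, rfl⟩
      obtain ⟨⟨t, ht⟩, hS⟩ := t
      have hn : ntr t =ᵐ[bdry X.K] 0 := by
        have h1 : t.2.2 = 0 := h1
        change (t.2.2 : E d → ℝ) =ᵐ[bdry X.K] 0
        rw [h1]
        exact Lp.coeFn_zero ℝ 2 (bdry X.K)
      obtain ⟨w, hw, hwt⟩ := X.div_Vstar_mem t ht
      have hg := X.green_W ht hw
      obtain ⟨s, hs, hsw⟩ := X.exists_grad hw
      have h2 : inner ℝ s.1 t.1 = 0 := hS s (X.V_le_Vstar hs) (Or.inl ⟨w, hw, hsw⟩)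
      rw [X.inner_Lp_grad hsw] at h2
      have h3 : ∫ x, ntr t x * w x ∂(bdry X.K) = 0 := by
        refine integral_eq_zero_of_ae ?_
        filter_upwards [hn] with x hx
        rw [hx]; simp
      have h4 : l2 (vol X.K) w = 0 := by
        have h5 : ∫ x, w x ^ 2 ∂(vol X.K) = 0 := by
          rw [h2, h3, zero_add] at hg
          rw [← hg]
          refine integral_congr_ae ?_
          filter_upwards [hwt] with x hx
          rw [hx, pow_two]
        rw [l2, h5, Real.sqrt_zero]
      have h6 := ae_eq_zero_of_l2 (X.memLp_W hw) h4
      have h7 : inner ℝ t.1 t.1 = (0 : ℝ) := hS t ht (Or.inr ⟨hwt.trans h6, hn⟩)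
      exact inner_self_eq_zero.1 h7)
    (α₁ := (X.h ^ d)⁻¹) (α₂ := 1) (β₁ := (X.h ^ (d - 1))⁻¹) (β₂ := 1) (by positivity)
    one_pos (by positivity) one_pos
  refine ⟨C, hC, fun t δ γ ht hf h1 h2 => ?_⟩
  obtain ⟨t', ht', htt⟩ := ht
  obtain ⟨hδ, hγ⟩ := hf.unique X.polyhedral (X.Vstar_hdiv t' ht').isFlux htt
  have hS : ⟨t', ht'⟩ ∈ S := by
    intro s hs hq
    rcases hq with ⟨w, hw, hsw⟩ | ⟨h3, h4⟩
    · rw [X.inner_Lp_grad hsw]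
      have h5 := (mul_eq_zero.1 (h1 w hw)).resolve_left (by positivity)
      rw [← h5]
      refine integral_congr_ae ?_
      filter_upwards [htt] with x hx
      rw [hx]
    · have h5 := h2 (field s) ⟨s, hs, EventuallyEq.rfl⟩
        ((X.Vstar_hdiv s hs).isFlux.congr EventuallyEq.rfl h3 h4)
      have h6 := (mul_eq_zero.1 h5).resolve_left (by positivity)
      rw [real_inner_comm, L2.inner_def, ← h6]
      refine integral_congr_ae ?_
      filter_upwards [htt] with x hx
      rw [hx]; rfl
  have h3 := h ⟨⟨t', ht'⟩, hS⟩
  simp only [LinearMap.zero_apply, norm_zero, ne_eq, OfNat.ofNat_ne_zero, not_false_eq_true, zero_pow,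
    mul_zero, add_zero] at h3
  rw [X.avv_sq_norm t'.1 htt.symm, X.avb_sq_eq t'.2.2 hγ.symm]
  exact h3

theorem grad_kernel {w : E d → ℝ} (hw : w ∈ X.W) {m : Lp ℝ 2 (bdry X.K)} (hm : m ∈ X.M)
    (hq1 : ∀ G ∈ X.V, inner ℝ (X.wVol ⟨w, hw⟩) G.2.1 = inner ℝ m G.2.2)
    (hq2 : ∀ μ ∈ X.MS, inner ℝ (X.wBdry ⟨w, hw⟩ - m) μ = 0) :
    X.wGrad ⟨w, hw⟩ = 0 ∧ X.wBdry ⟨w, hw⟩ - m = 0 := by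
  obtain ⟨Vt, Wt, hdec, hst⟩ := X.decomposition
  have hwm : ∀ G ∈ X.V, ∫ x, fderiv ℝ w x (field G x) ∂(vol X.K)
      = ∫ x, ntr G x * (w x - m x) ∂(bdry X.K) := by
    intro G hG
    have h1 := hq1 G hG
    rw [inner_Lp, inner_Lp] at h1
    have h2 := X.green_W (X.V_le_Vstar hG) hw
    have h3 : ∫ x, dvg G x * w x ∂(vol X.K) = ∫ x, X.wVol ⟨w, hw⟩ x * G.2.1 x ∂(vol X.K) := by
      refine integral_congr_ae ?_
      filter_upwards [X.wVol_coe ⟨w, hw⟩] with x hx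
      rw [hx, mul_comm]; rfl
    have h4 : ∫ x, ntr G x * (w x - m x) ∂(bdry X.K) = ∫ x, ntr G x * w x ∂(bdry X.K)
        - ∫ x, m x * G.2.2 x ∂(bdry X.K) := by
      rw [← integral_sub]
      · refine integral_congr_ae (Eventually.of_forall fun x => ?_)
        simp only [ntr]; ring
      · exact integrable_mul2 (Lp.memLp _) (X.memLp_W_bdry hw)
      · exact integrable_mul2 (Lp.memLp _) (Lp.memLp _)
    linarith
  obtain ⟨μ, hμ, hμe⟩ := (show InTrace X.M m from ⟨m, hm, EventuallyEq.rfl⟩).sub (X.trace_W hw)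
  obtain ⟨⟨G, z⟩, ⟨hG, hz, hGz⟩, -⟩ := hdec.trace_iso μ hμ
  have hGz : (fun x => ntr G x + z x) =ᵐ[bdry X.K] fun x => m x - w x := hGz.trans hμe.symm
  have hperp : ∀ v ∈ X.W, ∫ x, fderiv ℝ v x (field G x) ∂(vol X.K) = 0 := by
    intro v hv
    obtain ⟨t, ht, htv⟩ := hdec.grad_mem v hv
    rw [← X.inner_Lp_grad htv]
    exact hG.2 t ht
  have e1 : ∫ x, ntr G x * z x ∂(bdry X.K) = 0 := by
    rw [← X.green_W (X.V_le_Vstar hG.1) hz.1, hperp z hz.1, zero_add]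
    obtain ⟨w', hw', hwG⟩ := hdec.div_mem G hG.1
    rw [← hz.2 w' hw']
    refine integral_congr_ae ?_
    filter_upwards [hwG] with x hx
    rw [hx]
  have e2 : ∫ x, ntr G x ^ 2 ∂(bdry X.K) = 0 := by
    have h1 := hwm G hG.1
    rw [hperp w hw] at h1
    have h2 : ∫ x, ntr G x * (w x - m x) ∂(bdry X.K)
        = -(∫ x, ntr G x ^ 2 ∂(bdry X.K)) - ∫ x, ntr G x * z x ∂(bdry X.K) := by
      rw [← integral_neg, ← integral_sub]
      · refine integral_congr_ae ?_
        filter_upwards [hGz] with x hx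
        have : w x - m x = -(ntr G x + z x) := by rw [hx]; ring
        rw [this]; ring
      · exact (integrable_sq2 (Lp.memLp _)).neg
      · exact integrable_mul2 (Lp.memLp _) (X.memLp_W_bdry hz.1)
    linarith
  have e3 : ntr G =ᵐ[bdry X.K] 0 :=
    ae_eq_zero_of_l2 (Lp.memLp _) (by rw [l2, e2, Real.sqrt_zero])
  have hz0 : z = 0 := by
    refine hst.norm_def z hz fun μ hμ => ?_
    have h1 := hq2 μ hμ
    rw [inner_Lp, ← neg_eq_zero, ← integral_neg] at h1
    rw [← h1]
    refine integral_congr_ae ?_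
    filter_upwards [hGz, e3, X.wBdry_coe ⟨w, hw⟩, Lp.coeFn_sub (X.wBdry ⟨w, hw⟩) m]
      with x h2 h3 h4 h5
    rw [h5, Pi.sub_apply, h4]
    have h6 : z x = m x - w x := by rw [← h2, h3]; simp
    rw [h6]; ring
  have hmw : m =ᵐ[bdry X.K] w := by
    filter_upwards [hGz, e3] with x h2 h3
    rw [hz0, h3] at h2
    simp only [Pi.zero_apply, add_zero] at h2
    linarith
  constructor
  · obtain ⟨G', hG', hG'w⟩ := X.exists_grad hw
    have h1 := hwm G' hG'
    have h2 : ∫ x, ntr G' x * (w x - m x) ∂(bdry X.K) = 0 := by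
      refine integral_eq_zero_of_ae ?_
      filter_upwards [hmw] with x hx
      rw [hx, sub_self, mul_zero]; rfl
    have h3 : ∫ x, ‖fderiv ℝ w x‖ ^ 2 ∂(vol X.K) = 0 := by
      rw [← h2, ← h1]
      refine integral_congr_ae ?_
      filter_upwards [hG'w] with x hx
      rw [norm_fderiv_sq, fderiv_eq_sum_pd]
      exact Finset.sum_congr rfl fun j _ => by rw [hx j, pow_two]
    have h4 : ‖X.wGrad ⟨w, hw⟩‖ ^ 2 = 0 := by
      rw [norm_Lp_sq, ← h3]
      refine integral_congr_ae ?_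
      filter_upwards [X.wGrad_coe ⟨w, hw⟩] with x hx
      rw [hx]
    exact norm_eq_zero.1 (pow_eq_zero_iff two_ne_zero |>.1 h4)
  · rw [sub_eq_zero]
    exact Lp.ext ((X.wBdry_coe ⟨w, hw⟩).trans hmw.symm)

theorem exists_grad_bound (hd : 0 < d) : ∃ C, 0 ≤ C ∧ ∀ w ∈ X.W, ∀ m, InTrace X.M m →
    ∀ l, InField X.V l → ∀ s, InTrace X.MS s →
    (∀ v δ γ, InField X.V v → IsFlux X.K v δ γ →
      X.h * avv X.K (fun x => inner ℝ (l x) (v x)) + X.h * avv X.K (fun x => w x * δ x)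
        - avb X.K (fun x => m x * γ x) = 0) →
    (∀ μ, InTrace X.MS μ → avb X.K (fun x => (w x - m x - s x) * μ x) = 0) →
    X.h ^ 2 * avv X.K (fun x => ‖fderiv ℝ w x‖ ^ 2) + avb X.K (fun x => (w x - m x) ^ 2)
      ≤ C * (X.h ^ 2 * avv X.K (fun x => ‖l x‖ ^ 2) + avb X.K (fun x => s x ^ 2)) := by
  have hh := X.h_pos hd
  have hhd : Metric.diam X.K ≠ 0 := hh.ne'
  let S : Submodule ℝ (X.W × X.M × X.V × X.MS) :=
    { carrier := {q | (∀ G ∈ X.V, inner ℝ q.2.2.1.1.1 G.1 + inner ℝ (X.wVol q.1) G.2.1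
          - inner ℝ q.2.1.1 G.2.2 = 0) ∧
          ∀ μ ∈ X.MS, inner ℝ (X.wBdry q.1 - q.2.1.1 - q.2.2.2.1) μ = 0}
      add_mem' := fun {a b} ha hb => by
        refine ⟨fun G hG => ?_, fun μ hμ => ?_⟩
        · have h1 := ha.1 G hG
          have h2 := hb.1 G hG
          change inner ℝ (a.2.2.1.1.1 + b.2.2.1.1.1) G.1 + inner ℝ (X.wVol (a.1 + b.1)) G.2.1
            - inner ℝ (a.2.1.1 + b.2.1.1) G.2.2 = 0
          rw [map_add, inner_add_left, inner_add_left, inner_add_left]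
          linarith
        · have h1 := ha.2 μ hμ
          have h2 := hb.2 μ hμ
          change inner ℝ (X.wBdry (a.1 + b.1) - (a.2.1.1 + b.2.1.1) - (a.2.2.2.1 + b.2.2.2.1)) μ = 0
          rw [map_add]
          simp only [inner_sub_left, inner_add_left] at h1 h2 ⊢
          linarith
      zero_mem' := by
        refine ⟨fun G hG => ?_, fun μ hμ => ?_⟩
        · change inner ℝ (0 : Lp (E d) 2 (vol X.K)) G.1 + inner ℝ (X.wVol 0) G.2.1
            - inner ℝ (0 : Lp ℝ 2 (bdry X.K)) G.2.2 = 0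
          simp
        · change inner ℝ (X.wBdry 0 - 0 - 0) μ = 0
          simp
      smul_mem' := fun c a ha => by
        refine ⟨fun G hG => ?_, fun μ hμ => ?_⟩
        · have h1 := ha.1 G hG
          change inner ℝ (c • a.2.2.1.1.1) G.1 + inner ℝ (X.wVol (c • a.1)) G.2.1
            - inner ℝ (c • a.2.1.1) G.2.2 = 0
          rw [map_smul, inner_smul_left, inner_smul_left, inner_smul_left, ← mul_add, ← mul_sub, h1,
            mul_zero]
        · have h1 := ha.2 μ hμ
          change inner ℝ (X.wBdry (c • a.1) - c • a.2.1.1 - c • a.2.2.2.1) μ = 0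
          rw [map_smul, ← smul_sub, ← smul_sub, inner_smul_left, h1, mul_zero] }
  let pw : S →ₗ[ℝ] X.W := LinearMap.fst ℝ _ _ ∘ₗ S.subtype
  let pm : S →ₗ[ℝ] X.M := LinearMap.fst ℝ _ _ ∘ₗ LinearMap.snd ℝ _ _ ∘ₗ S.subtype
  let pl : S →ₗ[ℝ] X.V := LinearMap.fst ℝ _ _ ∘ₗ LinearMap.snd ℝ _ _ ∘ₗ LinearMap.snd ℝ _ _ ∘ₗ S.subtype
  let ps : S →ₗ[ℝ] X.MS :=
    LinearMap.snd ℝ _ _ ∘ₗ LinearMap.snd ℝ _ _ ∘ₗ LinearMap.snd ℝ _ _ ∘ₗ S.subtype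
  let A₁ := X.wGrad ∘ₗ pw
  let A₂ := X.wBdry ∘ₗ pw - X.M.subtype ∘ₗ pm
  let B₁ := LinearMap.fst ℝ _ _ ∘ₗ X.V.subtype ∘ₗ pl
  let B₂ := X.MS.subtype ∘ₗ ps
  obtain ⟨C, hC, h⟩ := exists_sq_bound (V := S) A₁ A₂ B₁ B₂ (fun q hB₁ hB₂ => by
      obtain ⟨⟨⟨w, hw⟩, ⟨m, hm⟩, l, s⟩, hq1, hq2⟩ := q
      have hB₁ : l.1.1 = 0 := hB₁
      have hB₂ : s.1 = 0 := hB₂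
      refine X.grad_kernel hw hm (fun G hG => ?_) (fun μ hμ => ?_)
      · have h1 : inner ℝ l.1.1 G.1 + inner ℝ (X.wVol ⟨w, hw⟩) G.2.1 - inner ℝ m G.2.2 = 0 := hq1 G hG
        rw [hB₁, inner_zero_left, zero_add] at h1
        exact sub_eq_zero.1 h1
      · have h1 : inner ℝ (X.wBdry ⟨w, hw⟩ - m - s.1) μ = 0 := hq2 μ hμ
        rwa [hB₂, sub_zero] at h1)
    (α₁ := X.h ^ 2 * (X.h ^ d)⁻¹) (α₂ := (X.h ^ (d - 1))⁻¹) (β₁ := X.h ^ 2 * (X.h ^ d)⁻¹)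
    (β₂ := (X.h ^ (d - 1))⁻¹) (by positivity) (by positivity) (by positivity) (by positivity)
  refine ⟨C, hC, fun w hw m hm l hl s hs h1 h2 => ?_⟩
  obtain ⟨m', hm', hmm⟩ := hm
  obtain ⟨l', hl', hll⟩ := hl
  obtain ⟨s', hs', hss⟩ := hs
  have hpow : X.h ^ d = X.h * X.h ^ (d - 1) := by rw [← pow_succ', Nat.sub_add_cancel hd]
  have hq : (⟨⟨w, hw⟩, ⟨m', hm'⟩, ⟨l', hl'⟩, ⟨s', hs'⟩⟩ : X.W × X.M × X.V × X.MS) ∈ S := by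
    refine ⟨fun G hG => ?_, fun μ hμ => ?_⟩
    · have h3 := h1 _ _ _ (X.inField_of_mem hG) (X.V_hdiv hG).isFlux
      change inner ℝ l'.1 G.1 + inner ℝ (X.wVol ⟨w, hw⟩) G.2.1 - inner ℝ m' G.2.2 = 0
      rw [L2.inner_def, inner_Lp, inner_Lp]
      have e1 : ∫ x, inner ℝ (l'.1 x) (G.1 x) ∂(vol X.K) = ∫ x, inner ℝ (l x) (field G x) ∂(vol X.K) := by
        refine integral_congr_ae ?_
        filter_upwards [hll] with x hx
        rw [hx]; rfl
      have e2 : ∫ x, X.wVol ⟨w, hw⟩ x * G.2.1 x ∂(vol X.K) = ∫ x, w x * dvg G x ∂(vol X.K) := by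
        refine integral_congr_ae ?_
        filter_upwards [X.wVol_coe ⟨w, hw⟩] with x hx
        rw [hx]; rfl
      have e3 : ∫ x, m' x * G.2.2 x ∂(bdry X.K) = ∫ x, m x * ntr G x ∂(bdry X.K) := by
        refine integral_congr_ae ?_
        filter_upwards [hmm] with x hx
        rw [hx]; rfl
      rw [e1, e2, e3]
      simp only [avv, avb] at h3
      change X.h * ((X.h ^ d)⁻¹ * _) + X.h * ((X.h ^ d)⁻¹ * _) - (X.h ^ (d - 1))⁻¹ * _ = 0 at h3
      rw [hpow] at h3
      have hp : X.h ^ (d - 1) ≠ 0 := by positivity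
      field_simp at h3
      linarith
    · have h3 := (mul_eq_zero.1 (h2 μ ⟨μ, hμ, EventuallyEq.rfl⟩)).resolve_left (by positivity)
      change inner ℝ (X.wBdry ⟨w, hw⟩ - m' - s') μ = 0
      rw [inner_Lp, ← h3]
      refine integral_congr_ae ?_
      filter_upwards [hmm, hss, X.wBdry_coe ⟨w, hw⟩, Lp.coeFn_sub (X.wBdry ⟨w, hw⟩) m',
        Lp.coeFn_sub (X.wBdry ⟨w, hw⟩ - m') s'] with x h4 h5 h6 h7 h8
      rw [h8, Pi.sub_apply, h7, Pi.sub_apply, h6, ← h4, ← h5]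
  have h3 := h ⟨_, hq⟩
  have hd1 : ((X.wBdry ⟨w, hw⟩ - m' : Lp ℝ 2 (bdry X.K)) : E d → ℝ) =ᵐ[bdry X.K] fun x => w x - m x := by
    filter_upwards [hmm, X.wBdry_coe ⟨w, hw⟩, Lp.coeFn_sub (X.wBdry ⟨w, hw⟩) m'] with x h4 h6 h7
    rw [h7, Pi.sub_apply, h6, h4]
  rw [X.avv_sq_norm _ (X.wGrad_coe ⟨w, hw⟩), X.avb_sq_eq _ hd1, X.avv_sq_norm l'.1 hll.symm,
    X.avb_sq_eq s' hss.symm, ← mul_assoc, ← mul_assoc]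
  exact h3

end LocalSpaces

end

section

variable {d : ℕ}

namespace LocalSpaces

variable (X : LocalSpaces d)

theorem exists_const_of_grad {w : E d → ℝ} (hw : w ∈ X.W) (h : X.wGrad ⟨w, hw⟩ = 0) :
    ∃ c, ∀ x ∈ closure X.K, w x = c := by
  have h1 : fderiv ℝ w =ᵐ[vol X.K] 0 := by
    filter_upwards [X.wGrad_coe ⟨w, hw⟩, Lp.coeFn_zero (E d →L[ℝ] ℝ) 2 (vol X.K)] with x h2 h3
    rw [← h2, h, h3]
  have h2 : EqOn (fderiv ℝ w) 0 X.K :=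
    Measure.eqOn_open_of_ae_eq h1 X.polyhedral.isOpen (X.continuous_fderiv hw).continuousOn
      continuousOn_const
  obtain ⟨c, hc⟩ := X.polyhedral.isOpen.exists_is_const_of_fderiv_eq_zero
    X.polyhedral.isConnected.isPreconnected (X.differentiable hw).differentiableOn h2
  exact ⟨c, fun x hx => closure_minimal (s := X.K) (t := {x | w x = c}) (fun y hy => hc y hy)
    (isClosed_eq (X.contDiff hw).continuous continuous_const) hx⟩

theorem exists_friedrichs_bound (hd : 0 < d) : ∃ C, 0 ≤ C ∧ ∀ w ∈ X.W, ∀ m, InTrace X.M m →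
    ∀ a : ℝ, avb X.K (fun x => m x - a) = 0 →
    avv X.K (fun x => (w x - a) ^ 2) + avb X.K (fun x => (m x - a) ^ 2)
      ≤ C * (X.h ^ 2 * avv X.K (fun x => ‖fderiv ℝ w x‖ ^ 2)
        + avb X.K (fun x => (w x - m x) ^ 2)) := by
  have hh := X.h_pos hd
  have hhd : Metric.diam X.K ≠ 0 := hh.ne'
  have := X.polyhedral.isFiniteMeasure_vol
  have := X.polyhedral.isFiniteMeasure_bdry
  let ov : Lp ℝ 2 (vol X.K) := (memLp_const (1 : ℝ)).toLp _
  let ob : Lp ℝ 2 (bdry X.K) := (memLp_const (1 : ℝ)).toLp _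
  have hov : (ov : E d → ℝ) =ᵐ[vol X.K] fun _ => 1 := MemLp.coeFn_toLp _
  have hob : (ob : E d → ℝ) =ᵐ[bdry X.K] fun _ => 1 := MemLp.coeFn_toLp _
  let pw : X.W × X.M × ℝ →ₗ[ℝ] X.W := LinearMap.fst ℝ _ _
  let pm : X.W × X.M × ℝ →ₗ[ℝ] X.M := LinearMap.fst ℝ _ _ ∘ₗ LinearMap.snd ℝ _ _
  let pa : X.W × X.M × ℝ →ₗ[ℝ] ℝ := LinearMap.snd ℝ _ _ ∘ₗ LinearMap.snd ℝ _ _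
  let D : X.W × X.M × ℝ →ₗ[ℝ] Lp ℝ 2 (bdry X.K) := X.M.subtype ∘ₗ pm - pa.smulRight ob
  let S : Submodule ℝ (X.W × X.M × ℝ) := LinearMap.ker ((innerSL ℝ ob).toLinearMap ∘ₗ D)
  have hS : ∀ (m : Lp ℝ 2 (bdry X.K)) (a : ℝ), inner ℝ ob (m - a • ob)
      = ∫ x, (m x - a) ∂(bdry X.K) := by
    intro m a
    rw [inner_Lp]
    refine integral_congr_ae ?_
    filter_upwards [hob, Lp.coeFn_sub m (a • ob), Lp.coeFn_smul a ob] with x h1 h2 h3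
    rw [h2, Pi.sub_apply, h3, Pi.smul_apply, h1, smul_eq_mul]
    ring
  let A₁ : S →ₗ[ℝ] Lp ℝ 2 (vol X.K) := (X.wVol ∘ₗ pw - pa.smulRight ov) ∘ₗ S.subtype
  let A₂ : S →ₗ[ℝ] Lp ℝ 2 (bdry X.K) := D ∘ₗ S.subtype
  let B₁ : S →ₗ[ℝ] Lp (E d →L[ℝ] ℝ) 2 (vol X.K) := X.wGrad ∘ₗ pw ∘ₗ S.subtype
  let B₂ : S →ₗ[ℝ] Lp ℝ 2 (bdry X.K) := (X.wBdry ∘ₗ pw - X.M.subtype ∘ₗ pm) ∘ₗ S.subtype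
  obtain ⟨C, hC, h⟩ := exists_sq_bound (V := S) A₁ A₂ B₁ B₂ (fun q hB₁ hB₂ => by
      obtain ⟨⟨⟨w, hw⟩, ⟨m, hm⟩, a⟩, hq⟩ := q
      have hB₁ : X.wGrad ⟨w, hw⟩ = 0 := hB₁
      have hB₂ : X.wBdry ⟨w, hw⟩ - m = 0 := hB₂
      have hq : inner ℝ ob (m - a • ob) = 0 := hq
      rw [hS] at hq
      obtain ⟨c, hc⟩ := X.exists_const_of_grad hw hB₁
      have hmc : ∀ᵐ x ∂(bdry X.K), m x = c := by
        rw [sub_eq_zero] at hB₂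
        filter_upwards [X.wBdry_coe ⟨w, hw⟩, ae_bdry_mem_frontier X.K] with x h1 h2
        rw [← hB₂, h1]
        exact hc x (frontier_subset_closure h2)
      have hac : c = a := by
        have h1 : ∫ x, (m x - a) ∂(bdry X.K) = ∫ x, (c - a) ∂(bdry X.K) :=
          integral_congr_ae (by filter_upwards [hmc] with x hx; rw [hx])
        rw [h1, integral_const, smul_eq_mul] at hq
        refine sub_eq_zero.1 ((mul_eq_zero.1 hq).resolve_left ?_)
        exact ENNReal.toReal_ne_zero.2
          ⟨by simpa using X.polyhedral.bdry_ne_zero hd, measure_ne_top _ _⟩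
      constructor
      · change X.wVol ⟨w, hw⟩ - a • ov = 0
        refine sub_eq_zero.2 (Lp.ext ?_)
        filter_upwards [X.wVol_coe ⟨w, hw⟩, Lp.coeFn_smul a ov, hov,
          ae_vol_mem X.polyhedral.isOpen.measurableSet] with x h1 h2 h3 h4
        rw [h1, h2, Pi.smul_apply, h3, smul_eq_mul, mul_one]
        exact (hc x (subset_closure h4)).trans hac
      · change m - a • ob = 0
        refine sub_eq_zero.2 (Lp.ext ?_)
        filter_upwards [hmc, Lp.coeFn_smul a ob, hob] with x h1 h2 h3
        rw [h1, h2, Pi.smul_apply, h3, smul_eq_mul, mul_one, hac])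
    (α₁ := (X.h ^ d)⁻¹) (α₂ := (X.h ^ (d - 1))⁻¹) (β₁ := X.h ^ 2 * (X.h ^ d)⁻¹)
    (β₂ := (X.h ^ (d - 1))⁻¹) (by positivity) (by positivity) (by positivity) (by positivity)
  refine ⟨C, hC, fun w hw m hm a ha => ?_⟩
  obtain ⟨m', hm', hmm⟩ := hm
  have hq : (⟨⟨w, hw⟩, ⟨m', hm'⟩, a⟩ : X.W × X.M × ℝ) ∈ S := by
    change inner ℝ ob (m' - a • ob) = 0
    rw [hS, ← (mul_eq_zero.1 ha).resolve_left (by positivity)]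
    refine integral_congr_ae ?_
    filter_upwards [hmm] with x hx
    rw [hx]
  have h3 := h ⟨_, hq⟩
  have e1 : ((X.wVol ⟨w, hw⟩ - a • ov : Lp ℝ 2 (vol X.K)) : E d → ℝ) =ᵐ[vol X.K] fun x => w x - a := by
    filter_upwards [X.wVol_coe ⟨w, hw⟩, Lp.coeFn_smul a ov, hov,
      Lp.coeFn_sub (X.wVol ⟨w, hw⟩) (a • ov)] with x h1 h2 h3 h4
    rw [h4, Pi.sub_apply, h1, h2, Pi.smul_apply, h3, smul_eq_mul, mul_one]
  have e2 : ((m' - a • ob : Lp ℝ 2 (bdry X.K)) : E d → ℝ) =ᵐ[bdry X.K] fun x => m x - a := by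
    filter_upwards [hmm, Lp.coeFn_smul a ob, hob, Lp.coeFn_sub m' (a • ob)] with x h1 h2 h3 h4
    rw [h4, Pi.sub_apply, h1, h2, Pi.smul_apply, h3, smul_eq_mul, mul_one]
  have e3 : ((X.wBdry ⟨w, hw⟩ - m' : Lp ℝ 2 (bdry X.K)) : E d → ℝ) =ᵐ[bdry X.K] fun x => w x - m x := by
    filter_upwards [hmm, X.wBdry_coe ⟨w, hw⟩, Lp.coeFn_sub (X.wBdry ⟨w, hw⟩) m'] with x h4 h6 h7
    rw [h7, Pi.sub_apply, h6, h4]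
  rw [X.avv_sq_norm _ (X.wGrad_coe ⟨w, hw⟩), X.avv_sq_eq _ e1,
    X.avb_sq_eq _ e2, X.avb_sq_eq _ e3, ← mul_assoc]
  exact h3

theorem exists_localBounds (hd : 0 < d) : ∃ C, LocalBounds X C := by
  obtain ⟨C₁, h₁, b₁⟩ := X.exists_trace_bound hd
  obtain ⟨C₂, h₂, b₂⟩ := X.exists_sup_bound hd
  obtain ⟨C₃, h₃, b₃⟩ := X.exists_traceSup_bound hd
  obtain ⟨C₄, h₄, b₄⟩ := X.exists_stab_bound hd
  obtain ⟨C₅, h₅, b₅⟩ := X.exists_normal_bound hd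
  obtain ⟨C₆, h₆, b₆⟩ := X.exists_grad_bound hd
  obtain ⟨C₇, h₇, b₇⟩ := X.exists_friedrichs_bound hd
  have h₈ : 0 ≤ avv X.K (fun _ => 1) := avv_nonneg _ fun _ => zero_le_one
  have h₉ : 0 ≤ avb X.K (fun _ => 1) := avb_nonneg _ fun _ => zero_le_one
  set C := C₁ + C₂ + C₃ + C₄ + C₅ + C₆ + C₇ + avv X.K (fun _ => 1) + avb X.K (fun _ => 1) with hC
  have hv : ∀ f : E d → ℝ, 0 ≤ avv X.K (fun x => f x ^ 2) := fun f => avv_nonneg _ fun x => sq_nonneg _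
  have hb : ∀ f : E d → ℝ, 0 ≤ avb X.K (fun x => f x ^ 2) := fun f => avb_nonneg _ fun x => sq_nonneg _
  have key : ∀ {a x c : ℝ}, a ≤ c * x → 0 ≤ x → c ≤ C → a ≤ C * x := fun h1 h2 h3 =>
    h1.trans (mul_le_mul_of_nonneg_right h3 h2)
  refine ⟨C, by positivity, fun w hw => key (b₁ w hw) (hv _) (by linarith), fun w hw x hx =>
    key (b₂ w hw x hx) (hv _) (by linarith), fun m hm => ?_, fun w hw ξ ζ h1 h2 h3 h4 =>
    key (b₄ w hw ξ ζ h1 h2 h3 h4) (add_nonneg (hv _) (hb _)) (by linarith), ⟨by linarith, by linarith⟩,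
    fun t δ γ h1 h2 h3 h4 => key (b₅ t δ γ h1 h2 h3 h4) (hb _) (by linarith),
    fun w hw m hm l hl s hs h1 h2 => key (b₆ w hw m hm l hl s hs h1 h2)
      (add_nonneg (mul_nonneg (sq_nonneg _) (hv _)) (hb _)) (by linarith),
    fun w hw m hm a ha => key (b₇ w hw m hm a ha)
      (add_nonneg (mul_nonneg (sq_nonneg _) (hv _)) (hb _)) (by linarith)⟩
  filter_upwards [b₃ m hm] with x hx
  exact key hx (hb _) (by linarith)

end LocalSpaces

theorem localBounds_of_le (hd : 0 < d) {X : LocalSpaces d} {Λ : ℝ} (h : localConst X ≤ Λ) :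
    LocalBounds X Λ := (localBounds_localConst (X.exists_localBounds hd)).mono h

end

section

variable {d : ℕ}

namespace LocalSpaces

variable (X : LocalSpaces d)

theorem memLp_top_W (X : LocalSpaces d) {w : E d → ℝ} (hw : w ∈ X.W) : MemLp w ⊤ (vol X.K) :=
  X.polyhedral.memLp_top_vol (X.contDiff hw).continuous

theorem memLp_top_W_bdry (X : LocalSpaces d) {w : E d → ℝ} (hw : w ∈ X.W) : MemLp w ⊤ (bdry X.K) :=
  X.polyhedral.memLp_top_bdry (X.contDiff hw).continuous

theorem memLp_top_trace (X : LocalSpaces d) {g : E d → ℝ} (hg : InTrace X.M g) :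
    MemLp g ⊤ (bdry X.K) := by
  obtain ⟨m, hm, h⟩ := hg
  exact (memLp_congr_ae h).2 (X.M_bounded m hm)

theorem trace_indicator {g : E d → ℝ} (hg : InTrace X.M g) {F : Set (E d)} (hF : F ∈ X.faces) :
    InTrace X.M (F.indicator g) := by
  obtain ⟨m, hm, h⟩ := hg
  refine (X.M_faces m hm F hF).congr ?_
  filter_upwards [h] with x hx
  by_cases hxF : x ∈ F
  · rw [indicator_of_mem hxF, indicator_of_mem hxF, hx]
  · rw [indicator_of_notMem hxF, indicator_of_notMem hxF]

theorem trace_mul_normal {g : E d → ℝ} (hg : InTrace X.M g) (j : Fin d) :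
    InTrace X.M (fun x => g x * outwardNormal X.K x j) := by
  obtain ⟨nF, h⟩ := X.polyhedral.exists_faceNormal
  have h1 : InTrace X.M (fun x => ∑ F ∈ X.faces, nF F j * F.indicator g x) :=
    InTrace.sum fun F hF => (X.trace_indicator hg hF).const_mul _
  refine h1.congr ?_
  filter_upwards [h g j] with x hx
  rw [← hx, mul_comm]

end LocalSpaces

theorem InTrace.eq_zero_of_orth {K : Set (E d)} {S : Submodule ℝ (Lp ℝ 2 (bdry K))} {g : E d → ℝ}
    (hg : InTrace S g) (h : ∀ m ∈ S, ∫ x, g x * m x ∂(bdry K) = 0) : g =ᵐ[bdry K] 0 := by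
  obtain ⟨m, hm, hgm⟩ := id hg
  refine ae_eq_zero_of_l2 hg.memLp ?_
  have h1 := h m hm
  have h2 : ∫ x, g x ^ 2 ∂(bdry K) = 0 := by
    rw [← h1]
    refine integral_congr_ae ?_
    filter_upwards [hgm] with x hx
    rw [hx, pow_two]
  rw [l2, h2, Real.sqrt_zero]

theorem InTrace.integral_eq_zero {K : Set (E d)} {S : Submodule ℝ (Lp ℝ 2 (bdry K))} {f g : E d → ℝ}
    (hg : InTrace S g) (h : ∀ m ∈ S, ∫ x, f x * m x ∂(bdry K) = 0) :
    ∫ x, f x * g x ∂(bdry K) = 0 := by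
  obtain ⟨m, hm, hgm⟩ := hg
  rw [← h m hm]
  refine integral_congr_ae ?_
  filter_upwards [hgm] with x hx
  rw [hx]

theorem const_mem_W {X : LocalSpaces d} {k : ℕ} (h : X.ContainsPoly k) (c : ℝ) :
    (fun _ => c) ∈ X.W :=
  h.W_mem _ ⟨MvPolynomial.C c, by simp, fun x => by simp⟩

variable {Ω : Set (E d)} {N : ℕ}

/-- A family of linear functionals that vanishes on functions of zero mean and on constants. -/
theorem Mesh.sum_eq_zero_of_mean (T : Mesh Ω N) {k : ℕ} (hk : ∀ K, (T.elem K).ContainsPoly k)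
    {F : Fin N → (E d → ℝ) → ℝ}
    (hF : ∀ K, ∀ q ∈ (T.elem K).W, ∀ c : ℝ, F K (fun x => q x - c) = F K q - c * F K (fun _ => 1))
    (h1 : ∑ K, F K (fun _ => 1) = 0) (h0 : ∀ q, T.InQ q → ∑ K, F K (q K) = 0)
    {q : Fin N → E d → ℝ} (hq : ∀ K, q K ∈ (T.elem K).W) : ∑ K, F K (q K) = 0 := by
  have hfin := fun K => (T.elem K).polyhedral.isFiniteMeasure_vol
  rcases Nat.eq_zero_or_pos N with hN | hN
  · subst hN; simp
  set V := ∑ K, ∫ _, (1 : ℝ) ∂(vol (T.elem K).K) with hV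
  have hVK : ∀ K, 0 < ∫ _, (1 : ℝ) ∂(vol (T.elem K).K) := by
    intro K
    rw [integral_const, smul_eq_mul, mul_one]
    refine ENNReal.toReal_pos ?_ (measure_ne_top _ _)
    rw [vol, Measure.restrict_apply_univ]
    exact ((T.elem K).polyhedral.isOpen.measure_pos _ (T.elem K).polyhedral.nonempty).ne'
  have hVpos : 0 < V := Finset.sum_pos (fun K _ => hVK K) ⟨⟨0, hN⟩, Finset.mem_univ _⟩
  set c := (∑ K, ∫ x, q K x ∂(vol (T.elem K).K)) / V with hc
  have h2 := h0 (fun K x => q K x - c) ⟨fun K => (T.elem K).W.sub_mem (hq K) (const_mem_W (hk K) c), by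
    have e : ∀ K, ∫ x, (q K x - c) ∂(vol (T.elem K).K)
        = ∫ x, q K x ∂(vol (T.elem K).K) - c * ∫ _, (1 : ℝ) ∂(vol (T.elem K).K) := by
      intro K
      rw [integral_sub, ← integral_const_mul]
      · simp
      · exact ((T.elem K).memLp_W (hq K)).integrable (by norm_num)
      · exact integrable_const _
    simp_rw [e]
    rw [Finset.sum_sub_distrib, ← Finset.mul_sum, ← hV, hc, div_mul_cancel₀ _ hVpos.ne', sub_self]⟩
  simp_rw [fun K => hF K (q K) (hq K) c] at h2
  rw [Finset.sum_sub_distrib, ← Finset.mul_sum, h1, mul_zero, sub_zero] at h2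
  exact h2

/-- The exact solution, the numerical solution and the projections, with an upper bound `U` of the
exact velocity. -/
structure Config (T : Mesh Ω N) where
  facesΩ : Finset (Set (E d))
  hΩ : IsPolyhedral Ω facesΩ
  hd : 0 < d
  compat : ∀ K, (T.elem K).Compatible
  k : ℕ
  poly : ∀ K, (T.elem K).ContainsPoly k
  ν : ℝ
  hν : 0 < ν
  f : E d → E d
  L : Fin d → E d → E d
  DL : Fin d → Fin d → E d → E d
  u : E d → E d
  p : E d → ℝ
  Dp : E d → E d
  ns : IsNSSolution Ω ν f L DL u p Dp
  Lt : Fin N → Fin d → E d → E d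
  ut : Fin N → E d → E d
  pt : Fin N → E d → ℝ
  tr : IsTraces T L DL u p Dp Lt ut pt
  Lh : T.Tensor
  uh : Fin N → E d → E d
  ph : Fin N → E d → ℝ
  uhat : E d → E d
  β : (K : Fin N) → Flux (T.elem K).K
  sol : IsHDGSolution T ν f Lh uh ph uhat β
  PL : T.Tensor
  Pu : Fin N → E d → E d
  Pp : Fin N → E d → ℝ
  Pm : E d → E d
  proj : IsProjection T L u p ut PL Pu Pp Pm
  U : ℝ
  hU : 0 ≤ U
  u_bound : ∀ᵐ x ∂(vol Ω), ‖u x‖ ≤ U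

namespace Config

variable {T : Mesh Ω N} (S : Config T)

theorem div (S : Config T) (K : Fin N) : DivergenceTheorem (T.elem K).K := (S.poly K).divergenceTheorem

/-- The error of the gradient. -/
def eL (K : Fin N) (i : Fin d) : Flux (T.elem K).K := S.PL K i - S.Lh K i

/-- The error of the velocity. -/
def eu (K : Fin N) (i : Fin d) (x : E d) : ℝ := S.Pu K x i - S.uh K x i

/-- The error of the numerical trace. -/
def eh (i : Fin d) (x : E d) : ℝ := S.Pm x i - S.uhat x i

theorem eL_mem (K : Fin N) (i : Fin d) : S.eL K i ∈ (T.elem K).V :=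
  (T.elem K).V.sub_mem (S.proj.PL_mem K i) (S.sol.L_mem K i)

theorem eu_mem (K : Fin N) (i : Fin d) : S.eu K i ∈ (T.elem K).W :=
  (T.elem K).W.sub_mem (S.proj.Pu_mem K i) (S.sol.u_mem K i)

theorem eh_mem (K : Fin N) (i : Fin d) : InTrace (T.elem K).M (S.eh i) :=
  (S.proj.Pm_mem K i).sub (S.sol.uhat_mem.1 K i)

theorem field_eL (K : Fin N) (i : Fin d) : ∀ᵐ x ∂(vol (T.elem K).K),
    field (S.eL K i) x = field (S.PL K i) x - field (S.Lh K i) x := Lp.coeFn_sub _ _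

theorem ntr_eL (K : Fin N) (i : Fin d) : ∀ᵐ x ∂(bdry (T.elem K).K),
    ntr (S.eL K i) x = ntr (S.PL K i) x - ntr (S.Lh K i) x := Lp.coeFn_sub _ _

theorem u_le (K : Fin N) (i : Fin d) : ∀ᵐ x ∂(vol (T.elem K).K), |S.u x i| ≤ S.U := by
  have h : ∀ᵐ x ∂(vol (T.elem K).K), ‖S.u x‖ ≤ S.U := ae_mono (T.vol_le K) S.u_bound
  filter_upwards [h] with x hx
  exact (PiLp.norm_apply_le (S.u x) i).trans hx

theorem ut_le (K : Fin N) (i : Fin d) : ∀ᵐ x ∂(bdry (T.elem K).K), |S.ut K x i| ≤ S.U :=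
  trace_le_of_bounded (T.elem K).polyhedral (S.div K) (S.tr.u_trace K i) S.hU (S.u_le K i)

theorem memLp_u (K : Fin N) (i : Fin d) : MemLp (fun x => S.u x i) ⊤ (vol (T.elem K).K) :=
  memLp_top_of_ae (S.tr.u_trace K i).1.1 (S.u_le K i)

theorem memLp_ut (K : Fin N) (i : Fin d) : MemLp (fun x => S.ut K x i) ⊤ (bdry (T.elem K).K) :=
  memLp_top_of_ae (S.tr.u_trace K i).2.2.1.1 (S.ut_le K i)

/-- The first equation of the method, one row on one element at a time. -/
theorem gradient_local (K : Fin N) (i : Fin d) {t : Flux (T.elem K).K} (ht : t ∈ (T.elem K).V) :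
    (∑ j, ∫ x, field (S.Lh K i) x j * field t x j ∂(vol (T.elem K).K))
      + ∫ x, S.uh K x i * dvg t x ∂(vol (T.elem K).K)
      - ∫ x, S.uhat x i * ntr t x ∂(bdry (T.elem K).K) = 0 := by
  classical
  let G : T.Tensor := Function.update (fun _ _ => 0) K (Function.update (fun _ => 0) i t)
  have hG1 : G K i = t := by simp [G]
  have hG2 : ∀ i', i' ≠ i → G K i' = 0 := fun i' h => by simp [G, h]
  have hG3 : ∀ K' i', K' ≠ K → G K' i' = 0 := fun K' i' h => by simp [G, h]
  have hGm : T.InG G := by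
    intro K' i'
    by_cases h : K' = K
    · subst h
      by_cases h' : i' = i
      · subst h'; rw [hG1]; exact ht
      · rw [hG2 i' h']; exact Submodule.zero_mem _
    · rw [hG3 K' i' h]; exact Submodule.zero_mem _
  have h := S.sol.gradient_eq G hGm
  let R : ∀ (K' : Fin N), Fin d → Flux (T.elem K').K → ℝ := fun K' i' s =>
    (∑ j, ∫ x, S.ν * field (S.Lh K' i') x j * field s x j ∂(vol (T.elem K').K))
      + ∫ x, S.uh K' x i' * (S.ν * dvg s x) ∂(vol (T.elem K').K)
      - ∫ x, S.uhat x i' * (S.ν * ntr s x) ∂(bdry (T.elem K').K)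
  have hR0 : ∀ K' i', R K' i' 0 = 0 := by
    intro K' i'
    have z1 : ∀ᵐ x ∂(vol (T.elem K').K), field (0 : Flux (T.elem K').K) x = 0 :=
      Lp.coeFn_zero _ _ _
    have z2 : ∀ᵐ x ∂(vol (T.elem K').K), dvg (0 : Flux (T.elem K').K) x = 0 :=
      Lp.coeFn_zero _ _ _
    have z3 : ∀ᵐ x ∂(bdry (T.elem K').K), ntr (0 : Flux (T.elem K').K) x = 0 :=
      Lp.coeFn_zero _ _ _
    have e1 : ∀ j, ∫ x, S.ν * field (S.Lh K' i') x j * field (0 : Flux (T.elem K').K) x j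
        ∂(vol (T.elem K').K) = 0 := fun j => integral_eq_zero_of_ae (by
      filter_upwards [z1] with x hx
      rw [hx]; simp)
    have e2 : ∫ x, S.uh K' x i' * (S.ν * dvg (0 : Flux (T.elem K').K) x) ∂(vol (T.elem K').K) = 0 :=
      integral_eq_zero_of_ae (by
        filter_upwards [z2] with x hx
        rw [hx]; simp)
    have e3 : ∫ x, S.uhat x i' * (S.ν * ntr (0 : Flux (T.elem K').K) x) ∂(bdry (T.elem K').K) = 0 :=
      integral_eq_zero_of_ae (by
        filter_upwards [z3] with x hx
        rw [hx]; simp)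
    simp only [R, e1, e2, e3]
    simp
  have hform : ∀ K', gradientForm (T.elem K') S.ν (S.Lh K') (S.uh K') S.uhat (G K')
      = ∑ i', R K' i' (G K' i') := by
    intro K'
    simp only [gradientForm, R, Finset.sum_add_distrib, Finset.sum_sub_distrib]
  simp_rw [hform] at h
  rw [Finset.sum_eq_single K, Finset.sum_eq_single i, hG1] at h
  · have e1 : ∀ j, ∫ x, S.ν * field (S.Lh K i) x j * field t x j ∂(vol (T.elem K).K)
        = S.ν * ∫ x, field (S.Lh K i) x j * field t x j ∂(vol (T.elem K).K) := fun j => by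
      rw [← integral_const_mul]; simp_rw [mul_assoc]
    have e2 : ∫ x, S.uh K x i * (S.ν * dvg t x) ∂(vol (T.elem K).K)
        = S.ν * ∫ x, S.uh K x i * dvg t x ∂(vol (T.elem K).K) := by
      rw [← integral_const_mul]; simp_rw [mul_left_comm]
    have e3 : ∫ x, S.uhat x i * (S.ν * ntr t x) ∂(bdry (T.elem K).K)
        = S.ν * ∫ x, S.uhat x i * ntr t x ∂(bdry (T.elem K).K) := by
      rw [← integral_const_mul]; simp_rw [mul_left_comm]
    simp only [R] at h
    simp_rw [e1, e2, e3] at h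
    rw [← Finset.mul_sum, ← mul_add, ← mul_sub] at h
    exact (mul_eq_zero.1 h).resolve_left S.hν.ne'
  · intro i' _ h'
    rw [hG2 i' h', hR0]
  · simp
  · intro K' _ h'
    exact Finset.sum_eq_zero fun i' _ => by rw [hG3 K' i' h', hR0]
  · simp

/-- The first error equation. -/
theorem error_gradient (K : Fin N) (i : Fin d) {t : Flux (T.elem K).K} (ht : t ∈ (T.elem K).V) :
    (∑ j, ∫ x, field (S.eL K i) x j * field t x j ∂(vol (T.elem K).K))
      + ∫ x, S.eu K i x * dvg t x ∂(vol (T.elem K).K)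
      - ∫ x, S.eh i x * ntr t x ∂(bdry (T.elem K).K) = 0 := by
  have h1 := S.gradient_local K i ht
  have h2 := green_of_bounded (T.elem K).polyhedral (S.div K) ((T.elem K).V_hdiv ht).isFlux
    (S.tr.u_trace K i) S.hU (S.u_le K i)
  have h3 := S.proj.PL_orth K i t ht
  have h4 := S.proj.Pu_orth K i t ht
  have h5 := ((T.elem K).trace_Vstar ((T.elem K).V_le_Vstar ht)).integral_eq_zero (S.proj.Pm_orth K i)
  have hLj := fun j => memLp_component (S.tr.u_trace K i).2.1 j
  have hPj := fun j => memLp_component (Lp.memLp (S.PL K i).1) j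
  have hHj := fun j => memLp_component (Lp.memLp (S.Lh K i).1) j
  have htj := fun j => memLp_component (Lp.memLp t.1) j
  have a1 : ∀ j, ∫ x, field (S.eL K i) x j * field t x j ∂(vol (T.elem K).K)
      = ∫ x, field t x j * S.L i x j ∂(vol (T.elem K).K)
        - ∫ x, (S.L i x j - field (S.PL K i) x j) * field t x j ∂(vol (T.elem K).K)
        - ∫ x, field (S.Lh K i) x j * field t x j ∂(vol (T.elem K).K) := by
    intro j
    rw [← integral_sub, ← integral_sub]
    · refine integral_congr_ae ?_
      filter_upwards [S.field_eL K i] with x hx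
      rw [hx, PiLp.sub_apply]; ring
    · exact (integrable_mul2 (htj j) (hLj j)).sub (integrable_mul2 ((hLj j).sub (hPj j)) (htj j))
    · exact integrable_mul2 (hHj j) (htj j)
    · exact integrable_mul2 (htj j) (hLj j)
    · exact integrable_mul2 ((hLj j).sub (hPj j)) (htj j)
  have a2 : ∫ x, S.eu K i x * dvg t x ∂(vol (T.elem K).K)
      = ∫ x, dvg t x * S.u x i ∂(vol (T.elem K).K)
        - ∫ x, (S.u x i - S.Pu K x i) * dvg t x ∂(vol (T.elem K).K)
        - ∫ x, S.uh K x i * dvg t x ∂(vol (T.elem K).K) := by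
    have hu := (S.tr.u_trace K i).1
    have hp := (T.elem K).memLp_W (S.proj.Pu_mem K i)
    have hh := (T.elem K).memLp_W (S.sol.u_mem K i)
    have hδ : MemLp (dvg t) 2 (vol (T.elem K).K) := Lp.memLp _
    rw [← integral_sub, ← integral_sub]
    · refine integral_congr_ae (Eventually.of_forall fun x => ?_)
      simp only [eu]; ring
    · exact (integrable_mul2 hδ hu).sub (integrable_mul2 (hu.sub hp) hδ)
    · exact integrable_mul2 hh hδ
    · exact integrable_mul2 hδ hu
    · exact integrable_mul2 (hu.sub hp) hδ
  have a3 : ∫ x, S.eh i x * ntr t x ∂(bdry (T.elem K).K)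
      = ∫ x, ntr t x * S.ut K x i ∂(bdry (T.elem K).K)
        - ∫ x, (S.ut K x i - S.Pm x i) * ntr t x ∂(bdry (T.elem K).K)
        - ∫ x, S.uhat x i * ntr t x ∂(bdry (T.elem K).K) := by
    have hu := (S.tr.u_trace K i).2.2.1
    have hp := (S.proj.Pm_mem K i).memLp
    have hh := (S.sol.uhat_mem.1 K i).memLp
    have hδ : MemLp (ntr t) 2 (bdry (T.elem K).K) := Lp.memLp _
    rw [← integral_sub, ← integral_sub]
    · refine integral_congr_ae (Eventually.of_forall fun x => ?_)
      simp only [eh]; ring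
    · exact (integrable_mul2 hδ hu).sub (integrable_mul2 (hu.sub hp) hδ)
    · exact integrable_mul2 hh hδ
    · exact integrable_mul2 hδ hu
    · exact integrable_mul2 (hu.sub hp) hδ
  have a4 : ∑ j, ∫ x, (S.L i x j - field (S.PL K i) x j) * field t x j ∂(vol (T.elem K).K) = 0 := h3
  simp_rw [a1]
  rw [Finset.sum_sub_distrib, Finset.sum_sub_distrib, a4, a2, h4, a3, h5]
  linarith

end Config

end

section

variable {d : ℕ}

variable {Ω : Set (E d)} {N : ℕ} {facesΩ : Finset (Set (E d))}

/-- Boundary integrals of single-valued normal fluxes that vanish on `∂Ω`. -/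
theorem Mesh.sum_normal_eq_zero (T : Mesh Ω N) (hΩ : IsPolyhedral Ω facesΩ)
    {c : Fin N → E d → Fin d → ℝ} {m : E d → ℝ}
    (hi : ∀ K, Integrable (fun x => (∑ j, c K x j * outwardNormal (T.elem K).K x j) * m x)
      (bdry (T.elem K).K))
    (h0 : ∀ᵐ x ∂(sig d), x ∈ frontier Ω → (∀ K j, c K x j = 0) ∨ m x = 0)
    (h1 : ∀ᵐ x ∂(sig d), x ∈ Ω → ∀ K K', K ≠ K' → x ∈ frontier (T.elem K).K →
      x ∈ frontier (T.elem K').K → ∀ j, c K x j = c K' x j) :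
    ∑ K, ∫ x, (∑ j, c K x j * outwardNormal (T.elem K).K x j) * m x ∂(bdry (T.elem K).K) = 0 := by
  refine T.sum_boundary_eq_zero hΩ hi (fun K => ?_) (fun K K' hne => ?_)
  · refine ae_bdry_iff.2 ?_
    filter_upwards [h0] with x hx _ hxΩ
    rcases hx hxΩ with h | h
    · simp [h]
    · rw [h, mul_zero]
  · filter_upwards [h1] with x hx hxΩ hK hK' hn
    have e : ∑ j, c K' x j * outwardNormal (T.elem K').K x j
        = -∑ j, c K x j * outwardNormal (T.elem K).K x j := by
      rw [← Finset.sum_neg_distrib]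
      refine Finset.sum_congr rfl fun j _ => ?_
      rw [hn, hx hxΩ K K' hne hK hK' j, PiLp.neg_apply, mul_neg]
    rw [e]; ring

namespace Config

variable {T : Mesh Ω N} (S : Config T)

theorem uhat_zero : ∀ᵐ x ∂(sig d), x ∈ frontier Ω → S.uhat x = 0 := ae_bdry_iff.1 S.sol.uhat_mem.2

theorem ut_zero : ∀ᵐ x ∂(sig d), x ∈ frontier Ω → ∀ K, x ∈ frontier (T.elem K).K →
    ∀ i, S.ut K x i = 0 := by
  have h : ∀ i, ∀ᵐ x ∂(sig d), x ∈ frontier Ω → ∀ K, x ∈ frontier (T.elem K).K → S.ut K x i = 0 :=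
    fun i => T.ae_trace_zero S.hΩ (S.ns.u_grad i) (τ := fun K x => S.ut K x i)
      fun K => S.tr.u_trace K i
  filter_upwards [ae_all_iff.2 h] with x hx hxΩ K hK i
  exact hx i hxΩ K hK

theorem Pm_zero : ∀ᵐ x ∂(sig d), x ∈ frontier Ω → ∀ i, S.Pm x i = 0 := by
  have key : ∀ K, ∀ F ∈ (T.elem K).faces, F ⊆ frontier Ω → ∀ i,
      ∀ᵐ x ∂(bdry (T.elem K).K), x ∈ F → S.Pm x i = 0 := by
    intro K F hF hFΩ i
    have h1 := (T.elem K).trace_indicator (S.proj.Pm_mem K i) hF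
    have h2 := h1.integral_eq_zero (S.proj.Pm_orth K i)
    have h3 : F.indicator (fun x => S.Pm x i) =ᵐ[bdry (T.elem K).K] 0 := by
      refine ae_eq_zero_of_l2 h1.memLp ?_
      have h4 : ∫ x, F.indicator (fun x => S.Pm x i) x ^ 2 ∂(bdry (T.elem K).K) = 0 := by
        rw [← neg_eq_zero, ← integral_neg, ← h2]
        refine integral_congr_ae ?_
        filter_upwards [ae_restrict_of_ae (s := frontier (T.elem K).K) S.ut_zero,
          ae_bdry_mem_frontier (T.elem K).K] with x hx hxK
        by_cases hxF : x ∈ F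
        · rw [indicator_of_mem hxF, hx (hFΩ hxF) K hxK i]; ring
        · rw [indicator_of_notMem hxF]; ring
      rw [l2, h4, Real.sqrt_zero]
    filter_upwards [h3] with x hx hxF
    rwa [indicator_of_mem hxF] at hx
  have key' : ∀ᵐ x ∂(sig d), ∀ K, x ∈ frontier (T.elem K).K → (∃ F ∈ (T.elem K).faces, x ∈ F) ∧
      ∀ F ∈ (T.elem K).faces, F ⊆ frontier Ω → x ∈ F → ∀ i, S.Pm x i = 0 := by
    refine ae_all_iff.2 fun K => ae_bdry_iff.1 ?_
    have h1 : ∀ᵐ x ∂(bdry (T.elem K).K), ∀ F ∈ (T.elem K).faces, F ⊆ frontier Ω → x ∈ F →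
        ∀ i, S.Pm x i = 0 := by
      refine (ae_ball_iff (T.elem K).faces.countable_toSet).2 fun F hF => ?_
      by_cases hFΩ : F ⊆ frontier Ω
      · filter_upwards [ae_all_iff.2 (key K F hF hFΩ)] with x hx _ hxF i
        exact hx i hxF
      · exact Eventually.of_forall fun x h => absurd h hFΩ
    filter_upwards [h1, (T.elem K).polyhedral.ae_face] with x h2 h3
    exact ⟨h3, h2⟩
  filter_upwards [key', T.ae_interface S.hΩ] with x hx hi hxΩ i
  have hcl : x ∈ closure Ω := frontier_subset_closure hxΩ
  rw [T.cover, mem_iUnion] at hcl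
  obtain ⟨K, hK⟩ := hcl
  have hxn : x ∉ Ω := by
    rw [S.hΩ.isOpen.frontier_eq] at hxΩ
    exact hxΩ.2
  have hKf : x ∈ frontier (T.elem K).K := by
    rw [(T.elem K).polyhedral.isOpen.frontier_eq]
    exact ⟨hK, fun h => hxn (T.subset K h)⟩
  obtain ⟨⟨F, hF, hxF⟩, h2⟩ := hx K hKf
  rcases T.conforming K F hF with hb | ⟨K', hK', hF'⟩
  · exact h2 F hF hb hxF i
  · have hx' : x ∈ frontier (T.elem K').K := (T.elem K').polyhedral.face_subset hF' hxF
    rcases (hi K hKf).2 with ⟨-, ho⟩ | ⟨ho, -⟩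
    · exact absurd hx' (ho K' hK')
    · exact absurd ho hxn

theorem eh_zero : ∀ᵐ x ∂(sig d), x ∈ frontier Ω → ∀ i, S.eh i x = 0 := by
  filter_upwards [S.Pm_zero, S.uhat_zero] with x h1 h2 hx i
  rw [eh, h1 hx, h2 hx]
  simp

theorem test_mem : T.InV (S.Pu - S.uh) ∧ T.InM0 (S.Pm - S.uhat) := by
  refine ⟨fun K i => S.eu_mem K i, fun K i => S.eh_mem K i, ?_⟩
  refine ae_bdry_iff.2 ?_
  filter_upwards [S.eh_zero] with x hx hxΩ
  ext i
  exact hx hxΩ i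

/-- The normal component of the numerical trace. -/
def un (K : Fin N) (x : E d) : ℝ := ∑ j, S.uhat x j * outwardNormal (T.elem K).K x j

theorem un_mem (K : Fin N) : InTrace (T.elem K).M (S.un K) :=
  InTrace.sum fun j _ => (T.elem K).trace_mul_normal (S.sol.uhat_mem.1 K j) j

theorem ntr_beta (K : Fin N) : ntr (S.β K) =ᵐ[bdry (T.elem K).K] S.un K := by
  have hb := (T.elem K).trace_Vstar (S.sol.postprocess K).mem
  have h1 := (hb.sub (S.un_mem K)).eq_zero_of_orth fun m hm => by
    have h2 := (S.sol.postprocess K).normal m hm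
    simp_rw [sub_mul]
    rw [integral_sub, h2]
    · exact sub_self _
    · exact integrable_mul2 hb.memLp (Lp.memLp _)
    · exact integrable_mul2 (S.un_mem K).memLp (Lp.memLp _)
  filter_upwards [h1] with x hx
  exact sub_eq_zero.1 hx

theorem sum_un_mul {m : E d → ℝ} (hm : ∀ K, MemLp m 2 (bdry (T.elem K).K)) :
    ∑ K, ∫ x, S.un K x * m x ∂(bdry (T.elem K).K) = 0 := by
  refine T.sum_normal_eq_zero S.hΩ (c := fun _ x j => S.uhat x j) (fun K => ?_) ?_ ?_
  · exact integrable_mul2 (S.un_mem K).memLp (hm K)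
  · filter_upwards [S.uhat_zero] with x hx hxΩ
    left
    intro K j
    rw [hx hxΩ]
    rfl
  · exact Eventually.of_forall fun x _ K K' _ _ _ j => rfl

theorem massForm_eq (K : Fin N) {q : E d → ℝ} (hq : q ∈ (T.elem K).W) :
    massForm (T.elem K) (S.uh K) S.uhat q = ∫ x, dvg (S.β K) x * q x ∂(vol (T.elem K).K) := by
  have h1 := (S.sol.postprocess K).grad q hq
  have h2 := (T.elem K).Vstar_hdiv _ (S.sol.postprocess K).mem q ((T.elem K).contDiff hq)
  have h3 : ∫ x, ntr (S.β K) x * q x ∂(bdry (T.elem K).K)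
      = ∫ x, (∑ j, S.uhat x j * outwardNormal (T.elem K).K x j) * q x ∂(bdry (T.elem K).K) := by
    refine integral_congr_ae ?_
    filter_upwards [S.ntr_beta K] with x hx
    rw [hx, un]
  rw [massForm, ← h1, ← h3]
  linarith

theorem dvg_beta (K : Fin N) : dvg (S.β K) =ᵐ[vol (T.elem K).K] 0 := by
  classical
  have hδ : ∀ K, MemLp (dvg (S.β K)) 2 (vol (T.elem K).K) := fun K => Lp.memLp _
  have h : ∀ q : Fin N → E d → ℝ, (∀ K, q K ∈ (T.elem K).W) →
      ∑ K, ∫ x, dvg (S.β K) x * q K x ∂(vol (T.elem K).K) = 0 := by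
    intro q hq
    refine T.sum_eq_zero_of_mean S.poly
      (F := fun K q => ∫ x, dvg (S.β K) x * q x ∂(vol (T.elem K).K)) ?_ ?_ ?_ hq
    · intro K q hq c
      simp_rw [mul_sub]
      rw [integral_sub, ← integral_const_mul]
      · congr 1
        refine integral_congr_ae (Eventually.of_forall fun x => ?_)
        simp only; ring
      · exact integrable_mul2 (hδ K) ((T.elem K).memLp_W hq)
      · have := (T.elem K).polyhedral.isFiniteMeasure_vol
        exact integrable_mul2 (hδ K) (memLp_const c)
    · have e : ∀ K, ∫ x, dvg (S.β K) x * 1 ∂(vol (T.elem K).K)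
          = ∫ x, S.un K x * 1 ∂(bdry (T.elem K).K) := by
        intro K
        have h2 := (T.elem K).Vstar_hdiv _ (S.sol.postprocess K).mem (fun _ => 1) contDiff_const
        have h3 : ∀ (j : Fin d) (x : E d), pd j (fun _ => (1 : ℝ)) x = 0 := fun j x => by simp [pd]
        simp_rw [h3, mul_zero, integral_zero, Finset.sum_const_zero, zero_add] at h2
        rw [h2]
        refine integral_congr_ae ?_
        filter_upwards [S.ntr_beta K] with x hx
        rw [hx]
      simp_rw [e]
      exact S.sum_un_mul fun K => by
        have := (T.elem K).polyhedral.isFiniteMeasure_bdry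
        exact memLp_const 1
    · intro q hq
      rw [← S.sol.mass_eq q hq]
      exact Finset.sum_congr rfl fun K _ => (S.massForm_eq K (hq.1 K)).symm
  obtain ⟨w, hw, hβw⟩ := (T.elem K).div_Vstar_mem _ (S.sol.postprocess K).mem
  have h1 := h (Function.update (fun _ => 0) K w) (fun K' => by
    by_cases hK : K' = K
    · subst hK; simpa using hw
    · rw [Function.update_of_ne hK]; exact Submodule.zero_mem _)
  rw [Finset.sum_eq_single K] at h1
  · rw [Function.update_self] at h1
    refine hβw.trans (ae_eq_zero_of_l2 ((T.elem K).memLp_W hw) ?_)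
    have h2 : ∫ x, w x ^ 2 ∂(vol (T.elem K).K) = 0 := by
      rw [← h1]
      refine integral_congr_ae ?_
      filter_upwards [hβw] with x hx
      rw [hx, pow_two]
    rw [l2, h2, Real.sqrt_zero]
  · intro K' _ hK
    rw [Function.update_of_ne hK]
    simp
  · simp

end Config

end

section

variable {d : ℕ}

variable {Ω : Set (E d)} {N : ℕ}

namespace Config

variable {T : Mesh Ω N} (S : Config T)

/-- The normal component of the trace of the exact velocity. -/
def utn (K : Fin N) (x : E d) : ℝ := ∑ j, S.ut K x j * outwardNormal (T.elem K).K x j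

/-- The normal component of a row of the trace of the exact gradient. -/
def Ltn (K : Fin N) (i : Fin d) (x : E d) : ℝ :=
  ∑ j, S.Lt K i x j * outwardNormal (T.elem K).K x j

theorem memLp_normal (K : Fin N) (j : Fin d) :
    MemLp (fun x => outwardNormal (T.elem K).K x j) ⊤ (bdry (T.elem K).K) :=
  (T.elem K).polyhedral.memLp_top_normal j

theorem memLp_utn (K : Fin N) : MemLp (S.utn K) ⊤ (bdry (T.elem K).K) :=
  memLp_finsetSum _ fun j _ => memLp_bdd_mul (S.memLp_ut K j) (memLp_normal K j)

theorem memLp_Ltn (K : Fin N) (i : Fin d) : MemLp (S.Ltn K i) 2 (bdry (T.elem K).K) :=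
  memLp_finsetSum _ fun j _ => memLp_mul_bdd (S.tr.L_trace K i j).2.2.1 (memLp_normal K j)

theorem memLp_Lij (K : Fin N) (i j : Fin d) : MemLp (fun x => S.L i x j) 2 (vol (T.elem K).K) :=
  (S.tr.L_trace K i j).1

theorem memLp_W_pd (K : Fin N) {v : E d → ℝ} (hv : v ∈ (T.elem K).W) (j : Fin d) :
    MemLp (pd j v) ⊤ (vol (T.elem K).K) := (T.elem K).memLp_top_W ((T.elem K).W_deriv v hv j)

/-- Green's formula for the convective term. -/
theorem conv_green (K : Fin N) (i : Fin d) {v : E d → ℝ} (hv : v ∈ (T.elem K).W) :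
    (∑ j, ∫ x, S.u x i * S.u x j * pd j v x ∂(vol (T.elem K).K))
      + ∫ x, (∑ j, (S.L i x j * S.u x j + S.u x i * S.L j x j)) * v x ∂(vol (T.elem K).K)
      = ∫ x, S.ut K x i * S.utn K x * v x ∂(bdry (T.elem K).K) := by
  set X := T.elem K
  have hvs := X.contDiff hv
  have hvb := X.memLp_top_W hv
  have hu := fun j => S.memLp_u K j
  have hu2 := fun j => (S.tr.u_trace K j).1
  have hL := S.memLp_Lij K
  have hpv := fun j => memLp_W_pd K hv j
  have hflux : IsFlux X.K (fun x => v x • S.u x) (fun x => ∑ j, (S.L j x j * v x + S.u x j * pd j v x))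
      (fun x => S.utn K x * v x) := by
    refine ⟨MemLp.of_eval_piLp fun j => memLp_bdd_mul hvb (hu2 j), memLp_finsetSum _ fun j _ =>
      (memLp_mul_bdd (hL j j) hvb).add (memLp_mul_bdd (hu2 j) (hpv j)),
      memLp_bdd_mul (S.memLp_utn K) (X.memLp_W_bdry hv), fun φ hφ => ?_⟩
    have hφb := X.polyhedral.memLp_top_vol hφ.continuous
    have hφd := fun j => X.polyhedral.memLp_top_vol (contDiff_pd hφ j).continuous
    have h1 : ∀ j, (∫ x, (v x • S.u x) j * pd j φ x ∂(vol X.K))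
        + ∫ x, (S.L j x j * v x + S.u x j * pd j v x) * φ x ∂(vol X.K)
        = ∫ x, S.ut K x j * outwardNormal X.K x j * v x * φ x ∂(bdry X.K) := by
      intro j
      have h2 := (S.tr.u_trace K j).2.2.2 (fun x => φ x * v x) (hφ.mul hvs) j
      have e1 : ∫ x, S.ut K x j * outwardNormal X.K x j * v x * φ x ∂(bdry X.K)
          = ∫ x, S.ut K x j * outwardNormal X.K x j * (φ x * v x) ∂(bdry X.K) := by
        congr 1; ext x; ring
      rw [e1, ← h2, ← integral_add, ← integral_add]
      · congr 1
        ext x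
        rw [pd_mul (smooth_differentiable hφ x) (smooth_differentiable hvs x), PiLp.smul_apply,
          smul_eq_mul]
        ring
      · have := memLp_mul_bdd (hu2 j)
          (X.polyhedral.memLp_top_vol (contDiff_pd (hφ.mul hvs) j).continuous)
        have := X.polyhedral.isFiniteMeasure_vol
        exact MemLp.integrable (q := 2) (by norm_num) (by assumption)
      · have := X.polyhedral.isFiniteMeasure_vol
        exact (memLp_mul_bdd (hL j j)
          (X.polyhedral.memLp_top_vol (hφ.mul hvs).continuous)).integrable (by norm_num)
      · have := X.polyhedral.isFiniteMeasure_vol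
        exact (memLp_mul_bdd (memLp_bdd_mul hvb (hu2 j)) (hφd j)).integrable (by norm_num)
      · have := X.polyhedral.isFiniteMeasure_vol
        exact (memLp_mul_bdd ((memLp_mul_bdd (hL j j) hvb).add
          (memLp_mul_bdd (hu2 j) (hpv j))) hφb).integrable (by norm_num)
    have e2 : ∫ x, (∑ j, (S.L j x j * v x + S.u x j * pd j v x)) * φ x ∂(vol X.K)
        = ∑ j, ∫ x, (S.L j x j * v x + S.u x j * pd j v x) * φ x ∂(vol X.K) := by
      simp_rw [Finset.sum_mul]
      have := X.polyhedral.isFiniteMeasure_vol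
      exact integral_finsetSum _ fun j _ => (memLp_mul_bdd ((memLp_mul_bdd (hL j j) hvb).add
          (memLp_mul_bdd (hu2 j) (hpv j))) hφb).integrable (by norm_num)
    have e3 : ∫ x, S.utn K x * v x * φ x ∂(bdry X.K)
        = ∑ j, ∫ x, S.ut K x j * outwardNormal X.K x j * v x * φ x ∂(bdry X.K) := by
      simp_rw [utn, Finset.sum_mul]
      have := X.polyhedral.isFiniteMeasure_bdry
      exact integral_finsetSum _ fun j _ => (memLp_mul_bdd (memLp_bdd_mul (memLp_bdd_mul
        (S.memLp_ut K j) (memLp_normal K j)) (X.memLp_W_bdry hv))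
        (X.polyhedral.memLp_top_bdry hφ.continuous)).integrable (by norm_num)
    rw [e2, e3, ← Finset.sum_add_distrib]
    exact Finset.sum_congr rfl fun j _ => h1 j
  have hg := green_of_bounded X.polyhedral (S.div K) hflux (S.tr.u_trace K i) S.hU (S.u_le K i)
  have e4 : ∫ x, S.utn K x * v x * S.ut K x i ∂(bdry X.K)
      = ∫ x, S.ut K x i * S.utn K x * v x ∂(bdry X.K) := by
    congr 1; ext x; ring
  rw [← e4, ← hg]
  have e5 : ∫ x, (∑ j, (S.L j x j * v x + S.u x j * pd j v x)) * S.u x i ∂(vol X.K)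
      = ∑ j, ∫ x, (S.L j x j * v x + S.u x j * pd j v x) * S.u x i ∂(vol X.K) := by
    simp_rw [Finset.sum_mul]
    have := X.polyhedral.isFiniteMeasure_vol
    exact integral_finsetSum _ fun j _ => (memLp_mul_bdd ((memLp_mul_bdd (hL j j) hvb).add
        (memLp_mul_bdd (hu2 j) (hpv j))) (hu i)).integrable (by norm_num)
  have e6 : ∫ x, (∑ j, (S.L i x j * S.u x j + S.u x i * S.L j x j)) * v x ∂(vol X.K)
      = ∑ j, ∫ x, (S.L i x j * S.u x j + S.u x i * S.L j x j) * v x ∂(vol X.K) := by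
    simp_rw [Finset.sum_mul]
    have := X.polyhedral.isFiniteMeasure_vol
    exact integral_finsetSum _ fun j _ => (memLp_mul_bdd ((memLp_mul_bdd (hL i j) (hu j)).add
        (memLp_bdd_mul (hu i) (hL j j))) hvb).integrable (by norm_num)
  rw [e5, e6, ← Finset.sum_add_distrib, ← Finset.sum_add_distrib]
  refine Finset.sum_congr rfl fun j _ => ?_
  have := X.polyhedral.isFiniteMeasure_vol
  rw [← integral_add, ← integral_add]
  · congr 1
    ext x
    rw [PiLp.smul_apply, smul_eq_mul]
    ring
  · exact (memLp_bdd_mul hvb (hu2 j)).integrable_mul (hL i j)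
  · exact (memLp_mul_bdd ((memLp_mul_bdd (hL j j) hvb).add
        (memLp_mul_bdd (hu2 j) (hpv j))) (hu i)).integrable (by norm_num)
  · exact (memLp_mul_bdd (memLp_mul_bdd (hu2 i) (hu j)) (hpv j)).integrable (by norm_num)
  · exact (memLp_mul_bdd ((memLp_mul_bdd (hL i j) (hu j)).add
        (memLp_bdd_mul (hu i) (hL j j))) hvb).integrable (by norm_num)

/-- The momentum equation of the exact solution on one element. -/
theorem exact_local (K : Fin N) (i : Fin d) {v : E d → ℝ} (hv : v ∈ (T.elem K).W) :
    S.ν * (∑ j, ∫ x, S.L i x j * pd j v x ∂(vol (T.elem K).K))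
      - S.ν * ∫ x, S.Ltn K i x * v x ∂(bdry (T.elem K).K)
      - (∫ x, S.p x * pd i v x ∂(vol (T.elem K).K))
      + (∫ x, S.pt K x * outwardNormal (T.elem K).K x i * v x ∂(bdry (T.elem K).K))
      - (∑ j, ∫ x, S.u x i * S.u x j * pd j v x ∂(vol (T.elem K).K))
      + ∫ x, S.ut K x i * S.utn K x * v x ∂(bdry (T.elem K).K)
      = ∫ x, S.f x i * v x ∂(vol (T.elem K).K) := by
  set X := T.elem K with hX
  have := X.polyhedral.isFiniteMeasure_vol
  have := X.polyhedral.isFiniteMeasure_bdry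
  have hvs := X.contDiff hv
  have hvb := X.memLp_top_W hv
  have hu := fun j => S.memLp_u K j
  have hL := S.memLp_Lij K
  have hDL : ∀ j, MemLp (fun x => S.DL i j x j) 2 (vol X.K) := fun j =>
    memLp_component (S.tr.L_trace K i j).2.1 j
  have hDp : MemLp (fun x => S.Dp x i) 2 (vol X.K) := memLp_component (S.tr.p_trace K).2.1 i
  have h1 : ∀ j, (∫ x, S.L i x j * pd j v x ∂(vol X.K)) + ∫ x, S.DL i j x j * v x ∂(vol X.K)
      = ∫ x, S.Lt K i x j * outwardNormal X.K x j * v x ∂(bdry X.K) := fun j =>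
    (S.tr.L_trace K i j).2.2.2 v hvs j
  have h2 : (∫ x, S.p x * pd i v x ∂(vol X.K)) + ∫ x, S.Dp x i * v x ∂(vol X.K)
      = ∫ x, S.pt K x * outwardNormal X.K x i * v x ∂(bdry X.K) := (S.tr.p_trace K).2.2.2 v hvs i
  have h3 := S.conv_green K i hv
  have e1 : ∫ x, S.Ltn K i x * v x ∂(bdry X.K)
      = ∑ j, ∫ x, S.Lt K i x j * outwardNormal X.K x j * v x ∂(bdry X.K) := by
    simp_rw [Ltn, Finset.sum_mul]
    exact integral_finsetSum _ fun j _ => (memLp_mul_bdd (memLp_mul_bdd (S.tr.L_trace K i j).2.2.1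
      (memLp_normal K j)) (X.memLp_top_W_bdry hv)).integrable (by norm_num)
  have i1 : ∀ j, Integrable (fun x => S.DL i j x j * v x) (vol X.K) := fun j =>
    (memLp_mul_bdd (hDL j) hvb).integrable (by norm_num)
  have hc : MemLp (fun x => ∑ j, (S.L i x j * S.u x j + S.u x i * S.L j x j)) 2 (vol X.K) :=
    memLp_finsetSum _ fun j _ => (memLp_mul_bdd (hL i j) (hu j)).add (memLp_bdd_mul (hu i) (hL j j))
  have e2 : ∫ x, S.f x i * v x ∂(vol X.K) = -S.ν * (∑ j, ∫ x, S.DL i j x j * v x ∂(vol X.K))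
      + (∫ x, (∑ j, (S.L i x j * S.u x j + S.u x i * S.L j x j)) * v x ∂(vol X.K))
      + ∫ x, S.Dp x i * v x ∂(vol X.K) := by
    rw [← integral_finsetSum _ fun j _ => i1 j, ← integral_const_mul, ← integral_add, ← integral_add]
    · refine integral_congr_ae ?_
      have hm : ∀ᵐ x ∂(vol X.K), ∀ i, -S.ν * (∑ j, S.DL i j x j)
          + (∑ j, (S.L i x j * S.u x j + S.u x i * S.L j x j)) + S.Dp x i = S.f x i :=
        ae_mono (T.vol_le K) S.ns.momentum
      filter_upwards [hm] with x hx
      rw [← hx i, ← Finset.sum_mul]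
      ring
    · exact ((integrable_finsetSum _ fun j _ => i1 j).const_mul _).add
        ((memLp_mul_bdd hc hvb).integrable (by norm_num))
    · exact (memLp_mul_bdd hDp hvb).integrable (by norm_num)
    · exact (integrable_finsetSum _ fun j _ => i1 j).const_mul _
    · exact (memLp_mul_bdd hc hvb).integrable (by norm_num)
  have e3 : (∑ j, ∫ x, S.L i x j * pd j v x ∂(vol X.K)) + ∑ j, ∫ x, S.DL i j x j * v x ∂(vol X.K)
      = ∑ j, ∫ x, S.Lt K i x j * outwardNormal X.K x j * v x ∂(bdry X.K) := by
    rw [← Finset.sum_add_distrib]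
    exact Finset.sum_congr rfl fun j _ => h1 j
  rw [e2, e1, ← e3, ← h2, ← h3]
  ring

theorem sum_Ltn_mul (i : Fin d) :
    ∑ K, ∫ x, S.Ltn K i x * S.eh i x ∂(bdry (T.elem K).K) = 0 := by
  refine T.sum_normal_eq_zero S.hΩ (c := fun K x j => S.Lt K i x j) (fun K => ?_) ?_ ?_
  · exact integrable_mul2 (S.memLp_Ltn K i) (S.eh_mem K i).memLp
  · filter_upwards [S.eh_zero] with x hx hxΩ
    exact Or.inr (hx hxΩ i)
  · have h := fun j => T.ae_trace_eq S.hΩ (S.ns.L_grad i j) (τ := fun K x => S.Lt K i x j)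
      fun K => S.tr.L_trace K i j
    filter_upwards [ae_all_iff.2 h] with x hx hxΩ K K' hne hK hK' j
    exact hx j hxΩ K K' hne hK hK'

theorem sum_pt_mul (i : Fin d) :
    ∑ K, ∫ x, S.pt K x * outwardNormal (T.elem K).K x i * S.eh i x ∂(bdry (T.elem K).K) = 0 := by
  classical
  have h := T.sum_normal_eq_zero S.hΩ (c := fun K x j => if j = i then S.pt K x else 0)
    (m := S.eh i) ?_ ?_ ?_
  · simpa [ite_mul] using h
  · intro K
    have : MemLp (fun x => S.pt K x * outwardNormal (T.elem K).K x i) 2 (bdry (T.elem K).K) :=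
      memLp_mul_bdd (S.tr.p_trace K).2.2.1 (memLp_normal K i)
    simpa [ite_mul] using integrable_mul2 this (S.eh_mem K i).memLp
  · filter_upwards [S.eh_zero] with x hx hxΩ
    exact Or.inr (hx hxΩ i)
  · filter_upwards [T.ae_trace_eq S.hΩ S.ns.p_grad fun K => S.tr.p_trace K]
      with x hx hxΩ K K' hne hK hK' j
    rw [hx hxΩ K K' hne hK hK']

theorem ut_eq : ∀ᵐ x ∂(sig d), x ∈ Ω → ∀ K K', K ≠ K' → x ∈ frontier (T.elem K).K →
    x ∈ frontier (T.elem K').K → ∀ i, S.ut K x i = S.ut K' x i := by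
  have h := fun i => T.ae_trace_eq S.hΩ ((S.ns.u_grad i).hasWeakGrad S.hΩ.isOpen)
    (τ := fun K x => S.ut K x i) fun K => S.tr.u_trace K i
  filter_upwards [ae_all_iff.2 h] with x hx hxΩ K K' hne hK hK' i
  exact hx i hxΩ K K' hne hK hK'

theorem sum_utn_mul (i : Fin d) :
    ∑ K, ∫ x, S.ut K x i * S.utn K x * S.eh i x ∂(bdry (T.elem K).K) = 0 := by
  have e : ∀ K x, ∑ j, S.ut K x i * S.ut K x j * outwardNormal (T.elem K).K x j
      = S.ut K x i * S.utn K x := fun K x => by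
    rw [utn, Finset.mul_sum]
    exact Finset.sum_congr rfl fun j _ => mul_assoc _ _ _
  have h := T.sum_normal_eq_zero S.hΩ (c := fun K x j => S.ut K x i * S.ut K x j)
    (m := S.eh i) ?_ ?_ ?_
  · simpa only [e] using h
  · intro K
    simp only [e]
    exact integrable_mul2 (memLp_mul_bdd (S.tr.u_trace K i).2.2.1 (S.memLp_utn K)) (S.eh_mem K i).memLp
  · filter_upwards [S.eh_zero] with x hx hxΩ
    exact Or.inr (hx hxΩ i)
  · filter_upwards [S.ut_eq] with x hx hxΩ K K' hne hK hK' j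
    rw [hx hxΩ K K' hne hK hK' i, hx hxΩ K K' hne hK hK' j]

end Config

end

section

variable {d : ℕ}

theorem traceProj_mem {K : Set (E d)} (S : Submodule ℝ (Lp ℝ 2 (bdry K)))
    [S.HasOrthogonalProjection] (g : E d → ℝ) : InTrace S (traceProj S g) := by
  classical
  rw [traceProj]
  split_ifs with h
  · exact ⟨_, Submodule.starProjection_apply_mem S _, EventuallyEq.rfl⟩
  · exact InTrace.zero

theorem traceProj_orth {K : Set (E d)} (S : Submodule ℝ (Lp ℝ 2 (bdry K)))
    [S.HasOrthogonalProjection] {g m : E d → ℝ} (hg : MemLp g 2 (bdry K)) (hm : InTrace S m) :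
    ∫ x, (g x - traceProj S g x) * m x ∂(bdry K) = 0 := by
  classical
  refine hm.integral_eq_zero fun m hm => ?_
  have h := Submodule.starProjection_inner_eq_zero (K := S) (hg.toLp g) m hm
  rw [real_inner_comm, L2.inner_def] at h
  rw [← h]
  refine integral_congr_ae ?_
  filter_upwards [Lp.coeFn_sub (hg.toLp g) (S.starProjection (hg.toLp g)), hg.coeFn_toLp]
    with x h1 h2
  rw [h1, Pi.sub_apply, h2, traceProj, dif_pos hg]
  simp [mul_comm]

variable {Ω : Set (E d)} {N : ℕ}

namespace Config

variable {T : Mesh Ω N} (S : Config T)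

/-- The jump between the error of the velocity and that of the numerical trace. -/
def jump (K : Fin N) (i : Fin d) (x : E d) : ℝ := S.eu K i x - S.eh i x

/-- The stabilized part of the jump. -/
def stabJump (K : Fin N) (i : Fin d) : E d → ℝ := traceProj (T.elem K).MS (S.jump K i)

theorem memLp_jump (K : Fin N) (i : Fin d) : MemLp (S.jump K i) ⊤ (bdry (T.elem K).K) :=
  ((T.elem K).memLp_top_W_bdry (S.eu_mem K i)).sub ((T.elem K).memLp_top_trace (S.eh_mem K i))

theorem memLp_two_of_top {K : Fin N} {g : E d → ℝ} (hg : MemLp g ⊤ (bdry (T.elem K).K)) :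
    MemLp g 2 (bdry (T.elem K).K) := by
  have := (T.elem K).polyhedral.isFiniteMeasure_bdry
  exact hg.mono_exponent le_top

theorem MS_le (X : LocalSpaces d) : X.MS ≤ X.M := by
  obtain ⟨_, _, _, h⟩ := X.decomposition
  exact h.le

theorem stabJump_mem (K : Fin N) (i : Fin d) : InTrace (T.elem K).MS (S.stabJump K i) :=
  traceProj_mem _ _

theorem traceProj_uh (K : Fin N) (i : Fin d) : ∀ᵐ x ∂(bdry (T.elem K).K),
    traceProj (T.elem K).MS (fun y => S.uh K y i - S.uhat y i) x = -S.stabJump K i x := by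
  set X := T.elem K
  have hP := X.memLp_W_bdry (S.proj.Pu_mem K i)
  have hH := X.memLp_W_bdry (S.sol.u_mem K i)
  have hm := (S.proj.Pm_mem K i).memLp
  have hh := (S.sol.uhat_mem.1 K i).memLp
  have ht := (S.tr.u_trace K i).2.2.1
  have hg : MemLp (fun y => S.uh K y i - S.uhat y i) 2 (bdry X.K) := hH.sub hh
  have hj := memLp_two_of_top (S.memLp_jump K i)
  have h1 := traceProj_mem X.MS (fun y => S.uh K y i - S.uhat y i)
  have h2 := (h1.add (S.stabJump_mem K i)).eq_zero_of_orth fun m hm' => by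
    have hmL : MemLp m 2 (bdry X.K) := Lp.memLp _
    have hmT : InTrace X.MS m := ⟨m, hm', EventuallyEq.rfl⟩
    have a1 := traceProj_orth X.MS hg hmT
    have a2 := traceProj_orth X.MS hj hmT
    have a3 := S.proj.Pu_trace K i m hm'
    have a4 := S.proj.Pm_orth K i m (MS_le X hm')
    have e : ∀ x, (traceProj X.MS (fun y => S.uh K y i - S.uhat y i) x + S.stabJump K i x) * m x
        = (S.ut K x i - S.Pm x i) * m x - (S.ut K x i - S.Pu K x i) * m x
          - (S.uh K x i - S.uhat x i - traceProj X.MS (fun y => S.uh K y i - S.uhat y i) x) * m x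
          - (S.jump K i x - traceProj X.MS (S.jump K i) x) * m x := by
      intro x
      simp only [stabJump, jump, eu, eh, X]
      ring
    simp_rw [e]
    rw [integral_sub, integral_sub, integral_sub, a1, a2, a3, a4]
    · simp
    · exact integrable_mul2 (ht.sub hm) hmL
    · exact integrable_mul2 (ht.sub hP) hmL
    · exact (integrable_mul2 (ht.sub hm) hmL).sub (integrable_mul2 (ht.sub hP) hmL)
    · exact integrable_mul2 (hg.sub h1.memLp) hmL
    · exact ((integrable_mul2 (ht.sub hm) hmL).sub (integrable_mul2 (ht.sub hP) hmL)).sub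
        (integrable_mul2 (hg.sub h1.memLp) hmL)
    · exact integrable_mul2 (hj.sub (traceProj_mem _ _).memLp) hmL
  filter_upwards [h2] with x hx
  exact eq_neg_of_add_eq_zero_left hx

theorem viscous_error (K : Fin N) (i : Fin d) :
    (S.ν * (∑ j, ∫ x, S.L i x j * pd j (S.eu K i) x ∂(vol (T.elem K).K))
      - S.ν * ∫ x, S.Ltn K i x * S.jump K i x ∂(bdry (T.elem K).K))
    - ((∑ j, ∫ x, S.ν * field (S.Lh K i) x j * pd j (S.eu K i) x ∂(vol (T.elem K).K))
      + ∫ x, (-S.ν * ntr (S.Lh K i) x + S.ν / (T.elem K).h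
          * traceProj (T.elem K).MS (fun y => S.uh K y i - S.uhat y i) x) * S.jump K i x
          ∂(bdry (T.elem K).K))
    = S.ν * (∑ j, ∫ x, field (S.eL K i) x j * field (S.eL K i) x j ∂(vol (T.elem K).K))
      + S.ν / (T.elem K).h * (∫ x, S.stabJump K i x ^ 2 ∂(bdry (T.elem K).K))
      - S.ν * ∫ x, (S.Ltn K i x - ntr (S.PL K i) x) * S.jump K i x ∂(bdry (T.elem K).K) := by
  set X := T.elem K
  have hv := S.eu_mem K i
  have hpd := fun j => X.memLp_W (X.W_deriv _ hv j)
  have hL := S.memLp_Lij K i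
  have hP := fun j => memLp_component (Lp.memLp (S.PL K i).1) j
  have hH := fun j => memLp_component (Lp.memLp (S.Lh K i).1) j
  have hE := fun j => memLp_component (Lp.memLp (S.eL K i).1) j
  have hj := memLp_two_of_top (S.memLp_jump K i)
  have hLt := S.memLp_Ltn K i
  have hPt : MemLp (ntr (S.PL K i)) 2 (bdry X.K) := Lp.memLp _
  have hHt : MemLp (ntr (S.Lh K i)) 2 (bdry X.K) := Lp.memLp _
  have hEt : MemLp (ntr (S.eL K i)) 2 (bdry X.K) := Lp.memLp _
  have hEd : MemLp (dvg (S.eL K i)) 2 (vol X.K) := Lp.memLp _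
  have hvb := X.memLp_W_bdry hv
  have hhb := (S.eh_mem K i).memLp
  have hst := (S.stabJump_mem K i).memLp
  -- volume terms
  have v1 : ∑ j, ∫ x, (S.L i x j - field (S.PL K i) x j) * pd j (S.eu K i) x ∂(vol X.K) = 0 := by
    obtain ⟨t, ht, hg⟩ := X.exists_grad hv
    rw [← S.proj.PL_orth K i t ht]
    refine Finset.sum_congr rfl fun j _ => integral_congr_ae ?_
    filter_upwards [hg] with x hx
    rw [hx]
  have v2 : ∀ j, ∫ x, S.L i x j * pd j (S.eu K i) x ∂(vol X.K)
      - ∫ x, field (S.Lh K i) x j * pd j (S.eu K i) x ∂(vol X.K)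
      = (∫ x, (S.L i x j - field (S.PL K i) x j) * pd j (S.eu K i) x ∂(vol X.K))
        + ∫ x, field (S.eL K i) x j * pd j (S.eu K i) x ∂(vol X.K) := by
    intro j
    rw [← integral_sub, ← integral_add]
    · refine integral_congr_ae ?_
      filter_upwards [S.field_eL K i] with x hx
      rw [hx, PiLp.sub_apply]; ring
    · exact integrable_mul2 ((hL j).sub (hP j)) (hpd j)
    · exact integrable_mul2 (hE j) (hpd j)
    · exact integrable_mul2 (hL j) (hpd j)
    · exact integrable_mul2 (hH j) (hpd j)
  have v3 : (∑ j, ∫ x, S.L i x j * pd j (S.eu K i) x ∂(vol X.K))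
      - ∑ j, ∫ x, field (S.Lh K i) x j * pd j (S.eu K i) x ∂(vol X.K)
      = ∑ j, ∫ x, field (S.eL K i) x j * pd j (S.eu K i) x ∂(vol X.K) := by
    rw [← Finset.sum_sub_distrib]
    simp_rw [v2]
    rw [Finset.sum_add_distrib, v1, zero_add]
  have v4 : ∑ j, ∫ x, S.ν * field (S.Lh K i) x j * pd j (S.eu K i) x ∂(vol X.K)
      = S.ν * ∑ j, ∫ x, field (S.Lh K i) x j * pd j (S.eu K i) x ∂(vol X.K) := by
    rw [Finset.mul_sum]
    simp_rw [mul_assoc, integral_const_mul]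
  have v5 := X.V_hdiv (S.eL_mem K i) (S.eu K i) (X.contDiff hv)
  have v6 := S.error_gradient K i (S.eL_mem K i)
  -- boundary terms
  have b1 : ∫ x, (-S.ν * ntr (S.Lh K i) x + S.ν / X.h
      * traceProj X.MS (fun y => S.uh K y i - S.uhat y i) x) * S.jump K i x ∂(bdry X.K)
      = -S.ν * (∫ x, ntr (S.Lh K i) x * S.jump K i x ∂(bdry X.K))
        - S.ν / X.h * ∫ x, S.stabJump K i x ^ 2 ∂(bdry X.K) := by
    have o := traceProj_orth X.MS hj (S.stabJump_mem K i)
    have o2 : ∫ x, S.stabJump K i x ^ 2 ∂(bdry X.K)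
        = ∫ x, S.stabJump K i x * S.jump K i x ∂(bdry X.K) := by
      rw [eq_comm, ← sub_eq_zero, ← o, ← integral_sub (integrable_mul2 hst hj) (integrable_sq2 hst)]
      congr 1; ext x
      simp only [stabJump, X]; ring
    rw [o2, ← integral_const_mul, ← integral_const_mul, ← integral_sub
      ((integrable_mul2 hHt hj).const_mul _) ((integrable_mul2 hst hj).const_mul _)]
    refine integral_congr_ae ?_
    filter_upwards [S.traceProj_uh K i] with x hx
    rw [hx]; ring
  have b2 : ∫ x, S.Ltn K i x * S.jump K i x ∂(bdry X.K)
      - ∫ x, ntr (S.Lh K i) x * S.jump K i x ∂(bdry X.K)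
      = (∫ x, (S.Ltn K i x - ntr (S.PL K i) x) * S.jump K i x ∂(bdry X.K))
        + ((∫ x, ntr (S.eL K i) x * S.eu K i x ∂(bdry X.K))
          - ∫ x, S.eh i x * ntr (S.eL K i) x ∂(bdry X.K)) := by
    rw [← integral_sub, ← integral_sub, ← integral_add]
    · refine integral_congr_ae ?_
      filter_upwards [S.ntr_eL K i] with x hx
      rw [hx, jump]; ring
    · exact integrable_mul2 (hLt.sub hPt) hj
    · exact (integrable_mul2 hEt hvb).sub (integrable_mul2 hhb hEt)
    · exact integrable_mul2 hEt hvb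
    · exact integrable_mul2 hhb hEt
    · exact integrable_mul2 hLt hj
    · exact integrable_mul2 hHt hj
  have v7 : ∫ x, dvg (S.eL K i) x * S.eu K i x ∂(vol X.K)
      = ∫ x, S.eu K i x * dvg (S.eL K i) x ∂(vol X.K) := by simp_rw [mul_comm]
  rw [v7] at v5
  rw [b1, v4]
  linear_combination S.ν * v3 - S.ν * b2 + S.ν * v5 - S.ν * v6

/-- The third error equation. -/
theorem error_mass {q : Fin N → E d → ℝ} (hq : T.InQ q) :
    ∑ K, ∑ i, ((∫ x, S.eu K i x * pd i (q K) x ∂(vol (T.elem K).K))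
      - ∫ x, q K x * outwardNormal (T.elem K).K x i * S.eh i x ∂(bdry (T.elem K).K)) = 0 := by
  have h := S.sol.mass_eq q hq
  have key : ∀ K, ∑ i, ((∫ x, S.eu K i x * pd i (q K) x ∂(vol (T.elem K).K))
      - ∫ x, q K x * outwardNormal (T.elem K).K x i * S.eh i x ∂(bdry (T.elem K).K))
      = massForm (T.elem K) (S.uh K) S.uhat (q K) := by
    intro K
    set X := T.elem K
    have hqK := hq.1 K
    have hqv := X.memLp_W hqK
    have hqs := X.contDiff hqK
    have hpd := fun j => X.memLp_W (X.W_deriv _ hqK j)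
    have hqn : ∀ i, MemLp (fun x => q K x * outwardNormal X.K x i) 2 (bdry X.K) := fun i =>
      memLp_mul_bdd (X.memLp_W_bdry hqK) (memLp_normal K i)
    have e1 : ∀ i, (∫ x, S.eu K i x * pd i (q K) x ∂(vol X.K))
        - ∫ x, q K x * outwardNormal X.K x i * S.eh i x ∂(bdry X.K)
        = -(∫ x, S.L i x i * q K x ∂(vol X.K)) - (∫ x, S.uh K x i * pd i (q K) x ∂(vol X.K))
          + ∫ x, S.uhat x i * outwardNormal X.K x i * q K x ∂(bdry X.K) := by
      intro i
      have a1 : ∫ x, (S.u x i - S.Pu K x i) * pd i (q K) x ∂(vol X.K) = 0 := by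
        obtain ⟨t, ht, he⟩ := (S.compat K).deriv_mem _ hqK i
        rw [← S.proj.Pu_orth K i t ht]
        refine integral_congr_ae ?_
        filter_upwards [he] with x hx
        rw [hx]
      have a2 : ∫ x, (S.ut K x i - S.Pm x i) * (q K x * outwardNormal X.K x i) ∂(bdry X.K) = 0 :=
        (X.trace_mul_normal (X.trace_W hqK) i).integral_eq_zero (S.proj.Pm_orth K i)
      have a3 := (S.tr.u_trace K i).2.2.2 (q K) hqs i
      have hu := (S.tr.u_trace K i).1
      have hut := (S.tr.u_trace K i).2.2.1
      have hP := X.memLp_W (S.proj.Pu_mem K i)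
      have hH := X.memLp_W (S.sol.u_mem K i)
      have hm := (S.proj.Pm_mem K i).memLp
      have hh := (S.sol.uhat_mem.1 K i).memLp
      have c1 : ∫ x, S.eu K i x * pd i (q K) x ∂(vol X.K)
          = (∫ x, S.u x i * pd i (q K) x ∂(vol X.K))
            - (∫ x, (S.u x i - S.Pu K x i) * pd i (q K) x ∂(vol X.K))
            - ∫ x, S.uh K x i * pd i (q K) x ∂(vol X.K) := by
        rw [← integral_sub, ← integral_sub]
        · congr 1; ext x; rw [eu]; ring
        · exact (integrable_mul2 hu (hpd i)).sub (integrable_mul2 (hu.sub hP) (hpd i))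
        · exact integrable_mul2 hH (hpd i)
        · exact integrable_mul2 hu (hpd i)
        · exact integrable_mul2 (hu.sub hP) (hpd i)
      have c2 : ∫ x, q K x * outwardNormal X.K x i * S.eh i x ∂(bdry X.K)
          = (∫ x, S.ut K x i * (q K x * outwardNormal X.K x i) ∂(bdry X.K))
            - (∫ x, (S.ut K x i - S.Pm x i) * (q K x * outwardNormal X.K x i) ∂(bdry X.K))
            - ∫ x, S.uhat x i * (q K x * outwardNormal X.K x i) ∂(bdry X.K) := by
        rw [← integral_sub, ← integral_sub]
        · congr 1; ext x; rw [eh]; ring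
        · exact (integrable_mul2 hut (hqn i)).sub (integrable_mul2 (hut.sub hm) (hqn i))
        · exact integrable_mul2 hh (hqn i)
        · exact integrable_mul2 hut (hqn i)
        · exact integrable_mul2 (hut.sub hm) (hqn i)
      have c3 : ∫ x, S.ut K x i * (q K x * outwardNormal X.K x i) ∂(bdry X.K)
          = ∫ x, S.ut K x i * outwardNormal X.K x i * q K x ∂(bdry X.K) := by
        congr 1; ext x; ring
      have c4 : ∫ x, S.uhat x i * (q K x * outwardNormal X.K x i) ∂(bdry X.K)
          = ∫ x, S.uhat x i * outwardNormal X.K x i * q K x ∂(bdry X.K) := by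
        congr 1; ext x; ring
      rw [c1, c2, c3, c4, a1, a2]
      linear_combination a3
    simp_rw [e1]
    have hLq : ∀ i, Integrable (fun x => S.L i x i * q K x) (vol X.K) := fun i =>
      integrable_mul2 (S.memLp_Lij K i i) hqv
    have e2 : ∑ i, ∫ x, S.L i x i * q K x ∂(vol X.K) = 0 := by
      rw [← integral_finsetSum _ fun i _ => hLq i]
      refine integral_eq_zero_of_ae ?_
      have hdf : ∀ᵐ x ∂(vol X.K), ∑ i, S.L i x i = 0 := ae_mono (T.vol_le K) S.ns.divergence_free
      filter_upwards [hdf] with x hx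
      rw [← Finset.sum_mul, hx, zero_mul]; rfl
    have e3 : ∫ x, (∑ j, S.uhat x j * outwardNormal X.K x j) * q K x ∂(bdry X.K)
        = ∑ j, ∫ x, S.uhat x j * outwardNormal X.K x j * q K x ∂(bdry X.K) := by
      simp_rw [Finset.sum_mul]
      exact integral_finsetSum _ fun j _ => integrable_mul2
        (memLp_mul_bdd (S.sol.uhat_mem.1 K j).memLp (memLp_normal K j)) (X.memLp_W_bdry hqK)
    rw [Finset.sum_add_distrib, Finset.sum_sub_distrib, Finset.sum_neg_distrib, e2, massForm, e3]
    ring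
  rw [← h]
  exact Finset.sum_congr rfl fun K _ => key K
end Config

end

section

variable {d : ℕ}

variable {Ω : Set (E d)} {N : ℕ}

namespace Config

variable {T : Mesh Ω N} (S : Config T)

theorem memLp_jump_two (K : Fin N) (i : Fin d) : MemLp (S.jump K i) 2 (bdry (T.elem K).K) :=
  memLp_two_of_top (S.memLp_jump K i)

/-- Green's formula for a product of two functions of `W`. -/
theorem green_mul (S : Config T) (K : Fin N) {q v : E d → ℝ} (hq : q ∈ (T.elem K).W) (hv : v ∈ (T.elem K).W)
    (i : Fin d) : (∫ x, q x * pd i v x ∂(vol (T.elem K).K)) + ∫ x, v x * pd i q x ∂(vol (T.elem K).K)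
      = ∫ x, q x * outwardNormal (T.elem K).K x i * v x ∂(bdry (T.elem K).K) := by
  have hqs := (T.elem K).contDiff hq
  have hvs := (T.elem K).contDiff hv
  have h := (S.poly K).divergenceTheorem (fun x => q x * v x) (hqs.mul hvs) i
  rw [← integral_add]
  · have e : ∫ x, q x * outwardNormal (T.elem K).K x i * v x ∂(bdry (T.elem K).K)
        = ∫ x, outwardNormal (T.elem K).K x i * (q x * v x) ∂(bdry (T.elem K).K) := by
      congr 1; ext x; ring
    rw [e, ← h]
    congr 1; ext x
    rw [pd_mul (smooth_differentiable hqs x) (smooth_differentiable hvs x)]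
  · exact integrable_mul2 ((T.elem K).memLp_W hq) ((T.elem K).memLp_W ((T.elem K).W_deriv v hv i))
  · exact integrable_mul2 ((T.elem K).memLp_W hv) ((T.elem K).memLp_W ((T.elem K).W_deriv q hq i))

theorem pressureForm_eq (K : Fin N) : pressureForm (T.elem K) (S.ph K) ((S.Pu - S.uh) K) (S.Pm - S.uhat)
    = ∑ i, (-(∫ x, S.ph K x * pd i (S.eu K i) x ∂(vol (T.elem K).K))
      + ∫ x, S.ph K x * outwardNormal (T.elem K).K x i * S.jump K i x ∂(bdry (T.elem K).K)) := by
  have hp := (T.elem K).memLp_W (S.sol.p_mem.1 K)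
  have e : ∫ x, S.ph K x * ∑ i, pd i (S.eu K i) x ∂(vol (T.elem K).K)
      = ∑ i, ∫ x, S.ph K x * pd i (S.eu K i) x ∂(vol (T.elem K).K) := by
    simp_rw [Finset.mul_sum]
    exact integral_finsetSum _ fun i _ => integrable_mul2 hp
      ((T.elem K).memLp_W ((T.elem K).W_deriv _ (S.eu_mem K i) i))
  rw [Finset.sum_add_distrib, Finset.sum_neg_distrib, ← e]
  rfl

theorem pressure_error :
    ∑ K, ∑ i, (-(∫ x, S.p x * pd i (S.eu K i) x ∂(vol (T.elem K).K))
      + ∫ x, S.pt K x * outwardNormal (T.elem K).K x i * S.jump K i x ∂(bdry (T.elem K).K))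
    - ∑ K, pressureForm (T.elem K) (S.ph K) ((S.Pu - S.uh) K) (S.Pm - S.uhat)
    = ∑ K, ∑ i, ∫ x, (S.pt K x - S.Pp K x) * outwardNormal (T.elem K).K x i * S.jump K i x
        ∂(bdry (T.elem K).K) := by
  simp_rw [S.pressureForm_eq]
  have hp : ∀ K, MemLp S.p 2 (vol (T.elem K).K) := fun K => (S.tr.p_trace K).1
  have hPp : ∀ K, MemLp (S.Pp K) 2 (vol (T.elem K).K) := fun K => (T.elem K).memLp_W (S.proj.Pp_mem.1 K)
  have hPpb : ∀ K, MemLp (S.Pp K) 2 (bdry (T.elem K).K) := fun K =>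
    (T.elem K).memLp_W_bdry (S.proj.Pp_mem.1 K)
  have hph : ∀ K, MemLp (S.ph K) 2 (vol (T.elem K).K) := fun K => (T.elem K).memLp_W (S.sol.p_mem.1 K)
  have hphb : ∀ K, MemLp (S.ph K) 2 (bdry (T.elem K).K) := fun K =>
    (T.elem K).memLp_W_bdry (S.sol.p_mem.1 K)
  have hpd : ∀ K i, MemLp (pd i (S.eu K i)) 2 (vol (T.elem K).K) := fun K i =>
    (T.elem K).memLp_W ((T.elem K).W_deriv _ (S.eu_mem K i) i)
  have hpt : ∀ K, MemLp (S.pt K) 2 (bdry (T.elem K).K) := fun K => (S.tr.p_trace K).2.2.1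
  set q : Fin N → E d → ℝ := fun K x => S.Pp K x - S.ph K x with hq
  have hqW : ∀ K, q K ∈ (T.elem K).W := fun K =>
    (T.elem K).W.sub_mem (S.proj.Pp_mem.1 K) (S.sol.p_mem.1 K)
  have hqQ : T.InQ q := by
    refine ⟨hqW, ?_⟩
    have e : ∀ K, ∫ x, q K x ∂(vol (T.elem K).K)
        = (∫ x, S.Pp K x ∂(vol (T.elem K).K)) - ∫ x, S.ph K x ∂(vol (T.elem K).K) := fun K => by
      have := (T.elem K).polyhedral.isFiniteMeasure_vol
      exact integral_sub ((hPp K).integrable (by norm_num)) ((hph K).integrable (by norm_num))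
    simp_rw [e]
    rw [Finset.sum_sub_distrib, S.proj.Pp_mem.2, S.sol.p_mem.2, sub_zero]
  have hmass := S.error_mass hqQ
  have horth : ∑ K, ∑ i, ∫ x, (S.p x - S.Pp K x) * pd i (S.eu K i) x ∂(vol (T.elem K).K) = 0 := by
    have h := T.sum_eq_zero_of_mean S.poly
      (F := fun K w => ∫ x, (S.p x - S.Pp K x) * w x ∂(vol (T.elem K).K)) ?_ ?_ S.proj.Pp_orth
      (q := fun K x => ∑ i, pd i (S.eu K i) x) (fun K => ?_)
    · rw [← h]
      refine Finset.sum_congr rfl fun K _ => ?_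
      simp_rw [Finset.mul_sum]
      exact (integral_finsetSum _ fun i _ => integrable_mul2 ((hp K).sub (hPp K)) (hpd K i)).symm
    · intro K w hw c
      have := (T.elem K).polyhedral.isFiniteMeasure_vol
      rw [← integral_const_mul, ← integral_sub]
      · congr 1; ext x; ring
      · exact integrable_mul2 ((hp K).sub (hPp K)) ((T.elem K).memLp_W hw)
      · exact (integrable_mul2 ((hp K).sub (hPp K)) (memLp_const 1)).const_mul _
    · have e : ∀ K, ∫ x, (S.p x - S.Pp K x) * 1 ∂(vol (T.elem K).K)
          = (∫ x, S.p x ∂(vol (T.elem K).K)) - ∫ x, S.Pp K x ∂(vol (T.elem K).K) := fun K => by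
        have := (T.elem K).polyhedral.isFiniteMeasure_vol
        simp_rw [mul_one]
        exact integral_sub ((hp K).integrable (by norm_num)) ((hPp K).integrable (by norm_num))
      simp_rw [e]
      have hpΩ : Integrable S.p (vol Ω) := by
        have := S.hΩ.isFiniteMeasure_vol
        exact S.ns.p_grad.1.integrable (by norm_num)
      rw [Finset.sum_sub_distrib, S.proj.Pp_mem.2, ← T.integral_eq_sum hpΩ, S.ns.mean_zero, sub_zero]
    · have e : (fun x => ∑ i, pd i (S.eu K i) x) = ∑ i, pd i (S.eu K i) := by
        ext x; simp
      rw [e]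
      exact Submodule.sum_mem _ fun i _ => (T.elem K).W_deriv _ (S.eu_mem K i) i
  have key : ∀ K i, (-(∫ x, S.p x * pd i (S.eu K i) x ∂(vol (T.elem K).K))
      + ∫ x, S.pt K x * outwardNormal (T.elem K).K x i * S.jump K i x ∂(bdry (T.elem K).K))
      - (-(∫ x, S.ph K x * pd i (S.eu K i) x ∂(vol (T.elem K).K))
      + ∫ x, S.ph K x * outwardNormal (T.elem K).K x i * S.jump K i x ∂(bdry (T.elem K).K))
      = (∫ x, (S.pt K x - S.Pp K x) * outwardNormal (T.elem K).K x i * S.jump K i x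
          ∂(bdry (T.elem K).K))
        - (∫ x, (S.p x - S.Pp K x) * pd i (S.eu K i) x ∂(vol (T.elem K).K))
        + ((∫ x, S.eu K i x * pd i (q K) x ∂(vol (T.elem K).K))
        - ∫ x, q K x * outwardNormal (T.elem K).K x i * S.eh i x ∂(bdry (T.elem K).K)) := by
    intro K i
    have hj := S.memLp_jump_two K i
    have hn := memLp_normal (T := T) K i
    have g := S.green_mul K (hqW K) (S.eu_mem K i) i
    have a1 : (∫ x, S.p x * pd i (S.eu K i) x ∂(vol (T.elem K).K))
        - ∫ x, S.ph K x * pd i (S.eu K i) x ∂(vol (T.elem K).K)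
        = (∫ x, (S.p x - S.Pp K x) * pd i (S.eu K i) x ∂(vol (T.elem K).K))
          + ∫ x, q K x * pd i (S.eu K i) x ∂(vol (T.elem K).K) := by
      rw [← integral_sub, ← integral_add]
      · congr 1; ext x; simp only [hq]; ring
      · exact integrable_mul2 ((hp K).sub (hPp K)) (hpd K i)
      · exact integrable_mul2 ((hPp K).sub (hph K)) (hpd K i)
      · exact integrable_mul2 (hp K) (hpd K i)
      · exact integrable_mul2 (hph K) (hpd K i)
    have a2 : (∫ x, S.pt K x * outwardNormal (T.elem K).K x i * S.jump K i x ∂(bdry (T.elem K).K))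
        - ∫ x, S.ph K x * outwardNormal (T.elem K).K x i * S.jump K i x ∂(bdry (T.elem K).K)
        = (∫ x, (S.pt K x - S.Pp K x) * outwardNormal (T.elem K).K x i * S.jump K i x
          ∂(bdry (T.elem K).K))
          + ((∫ x, q K x * outwardNormal (T.elem K).K x i * S.eu K i x ∂(bdry (T.elem K).K))
            - ∫ x, q K x * outwardNormal (T.elem K).K x i * S.eh i x ∂(bdry (T.elem K).K)) := by
      rw [← integral_sub, ← integral_sub, ← integral_add]
      · congr 1; ext x; simp only [hq, jump]; ring
      · exact integrable_mul2 (memLp_mul_bdd ((hpt K).sub (hPpb K)) hn) hj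
      · exact (integrable_mul2 (memLp_mul_bdd ((hPpb K).sub (hphb K)) hn)
          ((T.elem K).memLp_W_bdry (S.eu_mem K i))).sub (integrable_mul2
          (memLp_mul_bdd ((hPpb K).sub (hphb K)) hn) (S.eh_mem K i).memLp)
      · exact integrable_mul2 (memLp_mul_bdd ((hPpb K).sub (hphb K)) hn)
          ((T.elem K).memLp_W_bdry (S.eu_mem K i))
      · exact integrable_mul2 (memLp_mul_bdd ((hPpb K).sub (hphb K)) hn) (S.eh_mem K i).memLp
      · exact integrable_mul2 (memLp_mul_bdd (hpt K) hn) hj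
      · exact integrable_mul2 (memLp_mul_bdd (hphb K) hn) hj
    linear_combination a2 - a1 - g
  rw [← Finset.sum_sub_distrib]
  simp_rw [← Finset.sum_sub_distrib, key, Finset.sum_add_distrib, Finset.sum_sub_distrib]
  simp_rw [Finset.sum_sub_distrib] at hmass
  rw [horth, hmass]
  ring

theorem memLp_field_beta (K : Fin N) (j : Fin d) :
    MemLp (fun x => field (S.β K) x j) 2 (vol (T.elem K).K) :=
  memLp_component (Lp.memLp (S.β K).1) j

theorem memLp_ntr_beta (K : Fin N) : MemLp (ntr (S.β K)) ⊤ (bdry (T.elem K).K) :=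
  (T.elem K).memLp_top_trace ((T.elem K).trace_Vstar (S.sol.postprocess K).mem)

theorem memLp_posPart (K : Fin N) :
    MemLp (fun x => max (ntr (S.β K) x) 0) ⊤ (bdry (T.elem K).K) :=
  (S.memLp_ntr_beta K).pos_part

/-- The consistency error of the convective term. -/
def convErr (K : Fin N) (i : Fin d) : ℝ :=
  -(∑ j, ∫ x, (S.u x i * S.u x j - S.Pu K x i * field (S.β K) x j) * pd j (S.eu K i) x
      ∂(vol (T.elem K).K))
    + ∫ x, (S.ut K x i * S.utn K x - ntr (S.β K) x * S.Pm x i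
      - max (ntr (S.β K) x) 0 * (S.Pu K x i - S.Pm x i)) * S.jump K i x ∂(bdry (T.elem K).K)

theorem convective_error (K : Fin N) (i : Fin d) :
    S.convErr K i - 1 / 2 * ∫ x, ntr (S.β K) x * S.eh i x ^ 2 ∂(bdry (T.elem K).K)
    ≤ (-(∑ j, ∫ x, S.u x i * S.u x j * pd j (S.eu K i) x ∂(vol (T.elem K).K))
      + ∫ x, S.ut K x i * S.utn K x * S.jump K i x ∂(bdry (T.elem K).K))
    - (-(∑ j, ∫ x, S.uh K x i * field (S.β K) x j * pd j (S.eu K i) x ∂(vol (T.elem K).K))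
      + ∫ x, (ntr (S.β K) x * S.uhat x i + max (ntr (S.β K) x) 0 * (S.uh K x i - S.uhat x i))
        * S.jump K i x ∂(bdry (T.elem K).K)) := by
  set X := T.elem K
  have := X.polyhedral.isFiniteMeasure_vol
  have := X.polyhedral.isFiniteMeasure_bdry
  have hv := S.eu_mem K i
  have hvs := X.contDiff hv
  have hvt := X.memLp_top_W hv
  have hvb := X.memLp_W_bdry hv
  have hvbt := X.memLp_top_W_bdry hv
  have hpd := fun j => X.memLp_W (X.W_deriv _ hv j)
  have hpdt := fun j => X.memLp_top_W (X.W_deriv _ hv j)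
  have hu := S.memLp_u K
  have hb := S.memLp_field_beta K
  have hPt := X.memLp_top_W (S.proj.Pu_mem K i)
  have hHt := X.memLp_top_W (S.sol.u_mem K i)
  have hB := S.memLp_ntr_beta K
  have hB2 := memLp_two_of_top hB
  have hBp := S.memLp_posPart K
  have hj := S.memLp_jump_two K i
  have hjt := S.memLp_jump K i
  have hPm := X.memLp_top_trace (S.proj.Pm_mem K i)
  have hPub := X.memLp_top_W_bdry (S.proj.Pu_mem K i)
  have huhb := X.memLp_top_W_bdry (S.sol.u_mem K i)
  have hht := X.memLp_top_trace (S.sol.uhat_mem.1 K i)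
  have heh := X.memLp_top_trace (S.eh_mem K i)
  have hut := S.memLp_ut K i
  have hutn := S.memLp_utn K
  have i2 : ∀ {g : E d → ℝ}, MemLp g ⊤ (bdry X.K) → MemLp g 2 (bdry X.K) := fun h =>
    h.mono_exponent le_top
  -- volume part
  have a1 : ∀ j, (∫ x, S.u x i * S.u x j * pd j (S.eu K i) x ∂(vol X.K))
      - ∫ x, S.uh K x i * field (S.β K) x j * pd j (S.eu K i) x ∂(vol X.K)
      = (∫ x, (S.u x i * S.u x j - S.Pu K x i * field (S.β K) x j) * pd j (S.eu K i) x ∂(vol X.K))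
        + ∫ x, field (S.β K) x j * (S.eu K i x * pd j (S.eu K i) x) ∂(vol X.K) := by
    intro j
    have hj1 : MemLp (fun x => S.u x i * S.u x j) 2 (vol X.K) :=
      (memLp_bdd_mul (hu i) (hu j)).mono_exponent le_top
    have hj2 : MemLp (fun x => S.Pu K x i * field (S.β K) x j) 2 (vol X.K) := memLp_bdd_mul hPt (hb j)
    have hj3 : MemLp (fun x => S.uh K x i * field (S.β K) x j) 2 (vol X.K) := memLp_bdd_mul hHt (hb j)
    rw [← integral_sub, ← integral_add]
    · congr 1; ext x; rw [eu]; ring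
    · exact integrable_mul2 (hj1.sub hj2) (hpd j)
    · exact integrable_mul2 (hb j) (memLp_bdd_mul hvt (hpd j))
    · exact integrable_mul2 hj1 (hpd j)
    · exact integrable_mul2 hj3 (hpd j)
  have a2 : ∑ j, ∫ x, field (S.β K) x j * (S.eu K i x * pd j (S.eu K i) x) ∂(vol X.K)
      = 1 / 2 * ∫ x, ntr (S.β K) x * S.eu K i x ^ 2 ∂(bdry X.K) := by
    have h := X.Vstar_hdiv _ (S.sol.postprocess K).mem (fun x => S.eu K i x * S.eu K i x) (hvs.mul hvs)
    have e1 : ∫ x, dvg (S.β K) x * (S.eu K i x * S.eu K i x) ∂(vol X.K) = 0 :=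
      integral_eq_zero_of_ae (by
        filter_upwards [S.dvg_beta K] with x hx
        rw [hx]; simp)
    have e2 : ∀ j, ∫ x, field (S.β K) x j * pd j (fun x => S.eu K i x * S.eu K i x) x ∂(vol X.K)
        = 2 * ∫ x, field (S.β K) x j * (S.eu K i x * pd j (S.eu K i) x) ∂(vol X.K) := by
      intro j
      rw [← integral_const_mul]
      congr 1; ext x
      rw [pd_mul (smooth_differentiable hvs x) (smooth_differentiable hvs x)]
      ring
    simp_rw [e2] at h
    rw [e1, ← Finset.mul_sum, add_zero] at h
    simp_rw [pow_two]
    linarith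
  -- boundary part
  set B := ntr (S.β K)
  have c1 : (∫ x, S.ut K x i * S.utn K x * S.jump K i x ∂(bdry X.K))
      - ∫ x, (B x * S.uhat x i + max (B x) 0 * (S.uh K x i - S.uhat x i)) * S.jump K i x ∂(bdry X.K)
      = (∫ x, (S.ut K x i * S.utn K x - B x * S.Pm x i
          - max (B x) 0 * (S.Pu K x i - S.Pm x i)) * S.jump K i x ∂(bdry X.K))
        + ∫ x, (B x * S.eh i x + max (B x) 0 * S.jump K i x) * S.jump K i x ∂(bdry X.K) := by
    rw [← integral_sub, ← integral_add]
    · congr 1; ext x; rw [eh, jump, eu, eh]; ring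
    · exact integrable_mul2 (i2 (((memLp_bdd_mul hut hutn).sub (memLp_bdd_mul hB hPm)).sub
        (memLp_bdd_mul hBp (hPub.sub hPm)))) hj
    · exact integrable_mul2 (i2 ((memLp_bdd_mul hB heh).add (memLp_bdd_mul hBp hjt))) hj
    · exact integrable_mul2 (i2 (memLp_bdd_mul hut hutn)) hj
    · exact integrable_mul2 (i2 ((memLp_bdd_mul hB hht).add (memLp_bdd_mul hBp (huhb.sub hht)))) hj
  have c2 : 1 / 2 * (∫ x, B x * S.eu K i x ^ 2 ∂(bdry X.K))
      - 1 / 2 * (∫ x, B x * S.eh i x ^ 2 ∂(bdry X.K))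
      ≤ ∫ x, (B x * S.eh i x + max (B x) 0 * S.jump K i x) * S.jump K i x ∂(bdry X.K) := by
    rw [← integral_const_mul, ← integral_const_mul, ← integral_sub]
    · refine integral_mono ?_ ?_ fun x => ?_
      · simp_rw [pow_two]
        exact ((integrable_mul2 hB2 (memLp_bdd_mul hvbt hvb)).const_mul _).sub
          ((integrable_mul2 hB2 (i2 (memLp_bdd_mul heh heh))).const_mul _)
      · exact integrable_mul2 (i2 ((memLp_bdd_mul hB heh).add (memLp_bdd_mul hBp hjt))) hj
      · simp only [jump]
        rcases le_total (B x) 0 with h | h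
        · rw [max_eq_right h]
          nlinarith [mul_nonneg (neg_nonneg.2 h) (sq_nonneg (S.eu K i x - S.eh i x))]
        · rw [max_eq_left h]
          nlinarith [mul_nonneg h (sq_nonneg (S.eu K i x - S.eh i x))]
    · simp_rw [pow_two]
      exact (integrable_mul2 hB2 (memLp_bdd_mul hvbt hvb)).const_mul _
    · simp_rw [pow_two]
      exact (integrable_mul2 hB2 (i2 (memLp_bdd_mul heh heh))).const_mul _
  have a3 := Finset.sum_congr (rfl : (Finset.univ : Finset (Fin d)) = Finset.univ) fun j _ => a1 j
  rw [Finset.sum_sub_distrib, Finset.sum_add_distrib, a2] at a3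
  rw [convErr]
  linarith

theorem sum_beta_sq (i : Fin d) :
    ∑ K, ∫ x, ntr (S.β K) x * S.eh i x ^ 2 ∂(bdry (T.elem K).K) = 0 := by
  rw [← S.sum_un_mul (m := fun x => S.eh i x ^ 2)]
  · refine Finset.sum_congr rfl fun K _ => integral_congr_ae ?_
    filter_upwards [S.ntr_beta K] with x hx
    rw [hx]
  · intro K
    have h := (T.elem K).memLp_top_trace (S.eh_mem K i)
    simp_rw [pow_two]
    exact memLp_two_of_top (memLp_bdd_mul h h)

/-- The energy inequality for the error. -/
theorem energy :
    S.ν * ∑ K, ∑ i, ((∑ j, ∫ x, field (S.eL K i) x j * field (S.eL K i) x j ∂(vol (T.elem K).K))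
      + (T.elem K).h⁻¹ * ∫ x, S.stabJump K i x ^ 2 ∂(bdry (T.elem K).K))
    ≤ ∑ K, ∑ i, (S.ν * (∫ x, (S.Ltn K i x - ntr (S.PL K i) x) * S.jump K i x ∂(bdry (T.elem K).K))
      - (∫ x, (S.pt K x - S.Pp K x) * outwardNormal (T.elem K).K x i * S.jump K i x
        ∂(bdry (T.elem K).K)) - S.convErr K i) := by
  have hm := S.sol.momentum_eq _ _ S.test_mem.1 S.test_mem.2
  -- the exact solution
  let VE : Fin N → Fin d → ℝ := fun K i =>
    S.ν * (∑ j, ∫ x, S.L i x j * pd j (S.eu K i) x ∂(vol (T.elem K).K))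
      - S.ν * ∫ x, S.Ltn K i x * S.jump K i x ∂(bdry (T.elem K).K)
  let PE : Fin N → Fin d → ℝ := fun K i =>
    -(∫ x, S.p x * pd i (S.eu K i) x ∂(vol (T.elem K).K))
      + ∫ x, S.pt K x * outwardNormal (T.elem K).K x i * S.jump K i x ∂(bdry (T.elem K).K)
  let CE : Fin N → Fin d → ℝ := fun K i =>
    -(∑ j, ∫ x, S.u x i * S.u x j * pd j (S.eu K i) x ∂(vol (T.elem K).K))
      + ∫ x, S.ut K x i * S.utn K x * S.jump K i x ∂(bdry (T.elem K).K)
  let VH : Fin N → Fin d → ℝ := fun K i =>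
    (∑ j, ∫ x, S.ν * field (S.Lh K i) x j * pd j (S.eu K i) x ∂(vol (T.elem K).K))
      + ∫ x, (-S.ν * ntr (S.Lh K i) x + S.ν / (T.elem K).h
          * traceProj (T.elem K).MS (fun y => S.uh K y i - S.uhat y i) x) * S.jump K i x
          ∂(bdry (T.elem K).K)
  let CH : Fin N → Fin d → ℝ := fun K i =>
    -(∑ j, ∫ x, S.uh K x i * field (S.β K) x j * pd j (S.eu K i) x ∂(vol (T.elem K).K))
      + ∫ x, (ntr (S.β K) x * S.uhat x i + max (ntr (S.β K) x) 0 * (S.uh K x i - S.uhat x i))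
        * S.jump K i x ∂(bdry (T.elem K).K)
  have hVH : ∀ K, viscousForm (T.elem K) S.ν (S.Lh K) (S.uh K) S.uhat ((S.Pu - S.uh) K) (S.Pm - S.uhat)
      = ∑ i, VH K i := fun K => (Finset.sum_add_distrib).symm
  have hCH : ∀ K, convectiveForm (T.elem K) (S.β K) (S.uh K) S.uhat ((S.Pu - S.uh) K) (S.Pm - S.uhat)
      = ∑ i, CH K i := fun K => by
    simp only [CH]
    rw [Finset.sum_add_distrib, Finset.sum_neg_distrib]
    rfl
  have hE : ∀ K i, ∫ x, S.f x i * S.eu K i x ∂(vol (T.elem K).K) = VE K i + PE K i + CE K i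
      - S.ν * (∫ x, S.Ltn K i x * S.eh i x ∂(bdry (T.elem K).K))
      + (∫ x, S.pt K x * outwardNormal (T.elem K).K x i * S.eh i x ∂(bdry (T.elem K).K))
      + ∫ x, S.ut K x i * S.utn K x * S.eh i x ∂(bdry (T.elem K).K) := by
    intro K i
    have hv := (T.elem K).memLp_W_bdry (S.eu_mem K i)
    have hh := (S.eh_mem K i).memLp
    have h1 := S.memLp_Ltn K i
    have h2 : MemLp (fun x => S.pt K x * outwardNormal (T.elem K).K x i) 2 (bdry (T.elem K).K) :=
      memLp_mul_bdd (S.tr.p_trace K).2.2.1 (memLp_normal K i)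
    have h3 : MemLp (fun x => S.ut K x i * S.utn K x) 2 (bdry (T.elem K).K) :=
      memLp_two_of_top (memLp_bdd_mul (S.memLp_ut K i) (S.memLp_utn K))
    have split : ∀ {g : E d → ℝ}, MemLp g 2 (bdry (T.elem K).K) →
        ∫ x, g x * S.jump K i x ∂(bdry (T.elem K).K)
        = (∫ x, g x * S.eu K i x ∂(bdry (T.elem K).K)) - ∫ x, g x * S.eh i x ∂(bdry (T.elem K).K) := by
      intro g hg
      rw [← integral_sub (integrable_mul2 hg hv) (integrable_mul2 hg hh)]
      congr 1; ext x; rw [jump]; ring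
    rw [← S.exact_local K i (S.eu_mem K i)]
    simp only [VE, PE, CE]
    rw [split h1, split h2, split h3]
    ring
  have hR : ∑ K, ∑ i, ∫ x, S.f x i * ((S.Pu - S.uh) K) x i ∂(vol (T.elem K).K)
      = ∑ K, ∑ i, (VE K i + PE K i + CE K i) := by
    have z1 : ∑ K, ∑ i, S.ν * (∫ x, S.Ltn K i x * S.eh i x ∂(bdry (T.elem K).K)) = 0 := by
      rw [Finset.sum_comm]
      refine Finset.sum_eq_zero fun i _ => ?_
      rw [← Finset.mul_sum, S.sum_Ltn_mul, mul_zero]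
    have z2 : ∑ K, ∑ i, ∫ x, S.pt K x * outwardNormal (T.elem K).K x i * S.eh i x
        ∂(bdry (T.elem K).K) = 0 := by
      rw [Finset.sum_comm]
      exact Finset.sum_eq_zero fun i _ => S.sum_pt_mul i
    have z3 : ∑ K, ∑ i, ∫ x, S.ut K x i * S.utn K x * S.eh i x ∂(bdry (T.elem K).K) = 0 := by
      rw [Finset.sum_comm]
      exact Finset.sum_eq_zero fun i _ => S.sum_utn_mul i
    have e : ∑ K, ∑ i, ∫ x, S.f x i * ((S.Pu - S.uh) K) x i ∂(vol (T.elem K).K)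
        = ∑ K, ∑ i, ∫ x, S.f x i * S.eu K i x ∂(vol (T.elem K).K) := rfl
    rw [e]
    simp_rw [hE]
    rw [← add_zero (∑ K, ∑ i, (VE K i + PE K i + CE K i))]
    nth_rewrite 1 [← z3]
    rw [← sub_zero (∑ K, ∑ i, (VE K i + PE K i + CE K i))]
    nth_rewrite 1 [← z1]
    simp_rw [Finset.sum_add_distrib, Finset.sum_sub_distrib, Finset.sum_add_distrib]
    rw [z2]
    ring
  rw [hR] at hm
  simp_rw [hVH, hCH] at hm
  have hP := S.pressure_error
  have hV := fun K i => S.viscous_error K i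
  have hC : ∑ K, ∑ i, (S.convErr K i - 1 / 2 * ∫ x, ntr (S.β K) x * S.eh i x ^ 2 ∂(bdry (T.elem K).K))
      ≤ ∑ K, ∑ i, (CE K i - CH K i) :=
    Finset.sum_le_sum fun K _ => Finset.sum_le_sum fun i _ => S.convective_error K i
  have hb : ∑ K, ∑ i, 1 / 2 * ∫ x, ntr (S.β K) x * S.eh i x ^ 2 ∂(bdry (T.elem K).K) = 0 := by
    rw [Finset.sum_comm]
    refine Finset.sum_eq_zero fun i _ => ?_
    rw [← Finset.mul_sum, S.sum_beta_sq, mul_zero]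
  have hV' : ∑ K, ∑ i, (VE K i - VH K i) = ∑ K, ∑ i,
      (S.ν * (∑ j, ∫ x, field (S.eL K i) x j * field (S.eL K i) x j ∂(vol (T.elem K).K))
      + S.ν / (T.elem K).h * (∫ x, S.stabJump K i x ^ 2 ∂(bdry (T.elem K).K))
      - S.ν * ∫ x, (S.Ltn K i x - ntr (S.PL K i) x) * S.jump K i x ∂(bdry (T.elem K).K)) :=
    Finset.sum_congr rfl fun K _ => Finset.sum_congr rfl fun i _ => hV K i
  have hP' : ∑ K, ∑ i, PE K i
      - ∑ K, pressureForm (T.elem K) (S.ph K) ((S.Pu - S.uh) K) (S.Pm - S.uhat)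
    = ∑ K, ∑ i, ∫ x, (S.pt K x - S.Pp K x) * outwardNormal (T.elem K).K x i * S.jump K i x
        ∂(bdry (T.elem K).K) := hP
  have hl : S.ν * ∑ K, ∑ i,
      ((∑ j, ∫ x, field (S.eL K i) x j * field (S.eL K i) x j ∂(vol (T.elem K).K))
      + (T.elem K).h⁻¹ * ∫ x, S.stabJump K i x ^ 2 ∂(bdry (T.elem K).K))
      = ∑ K, ∑ i, (S.ν * (∑ j, ∫ x, field (S.eL K i) x j * field (S.eL K i) x j ∂(vol (T.elem K).K))
      + S.ν / (T.elem K).h * (∫ x, S.stabJump K i x ^ 2 ∂(bdry (T.elem K).K))) := by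
    rw [Finset.mul_sum]
    refine Finset.sum_congr rfl fun K _ => ?_
    rw [Finset.mul_sum]
    refine Finset.sum_congr rfl fun i _ => ?_
    ring
  rw [hl]
  simp only [Finset.sum_add_distrib, Finset.sum_sub_distrib] at *
  linarith
end Config

end

section

variable {d : ℕ}

namespace LocalBounds

variable {X : LocalSpaces d} {Λ : ℝ}

theorem vol_eq (hd : 0 < d) (X : LocalSpaces d) (f : E d → ℝ) :
    ∫ x, f x ∂(vol X.K) = X.h ^ d * avv X.K f := by
  have := X.h_pos hd
  rw [avv, ← mul_assoc]
  change _ = X.h ^ d * (X.h ^ d)⁻¹ * _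
  rw [mul_inv_cancel₀ (by positivity), one_mul]

theorem bdry_eq (hd : 0 < d) (X : LocalSpaces d) (f : E d → ℝ) :
    X.h * ∫ x, f x ∂(bdry X.K) = X.h ^ d * avb X.K f := by
  have := X.h_pos hd
  rw [avb, ← mul_assoc]
  change _ = X.h ^ d * (X.h ^ (d - 1))⁻¹ * _
  have hX : X.h ^ d = X.h ^ (d - 1) * X.h := by rw [← pow_succ, Nat.sub_add_cancel hd]
  rw [hX, mul_comm (X.h ^ (d - 1)), mul_assoc X.h,
    mul_inv_cancel₀ (by positivity), mul_one]

theorem trace_int (B : LocalBounds X Λ) (hd : 0 < d) {w : E d → ℝ} (hw : w ∈ X.W) :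
    X.h * ∫ x, w x ^ 2 ∂(bdry X.K) ≤ Λ * ∫ x, w x ^ 2 ∂(vol X.K) := by
  have := X.h_pos hd
  rw [bdry_eq hd, vol_eq hd]
  have h := mul_le_mul_of_nonneg_left (B.trace w hw) (by positivity : 0 ≤ X.h ^ d)
  linarith

end LocalBounds

variable {Ω : Set (E d)} {N : ℕ}

namespace Config

variable {T : Mesh Ω N} (S : Config T)

/-- The local contribution to the square of the discrete `H¹`-norm of the error. -/
def oneSq (K : Fin N) (i : Fin d) : ℝ := seminormOneSq (T.elem K).K (S.eu K i) (S.eh i)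

/-- The local contribution to the square of the weighted norm of the projection errors. -/
def zeroSq (K : Fin N) (i : Fin d) : ℝ :=
  normZeroSq (T.elem K).K (fun x => S.u x i - S.Pu K x i) (fun x => S.ut K x i - S.Pu K x i)
    (fun x => S.ut K x i - S.Pm x i)

/-- The local `L²`-norm of the error of the velocity, squared. -/
def euSq (K : Fin N) (i : Fin d) : ℝ := ∫ x, S.eu K i x ^ 2 ∂(vol (T.elem K).K)

/-- The local energy of the error. -/
def energySq (K : Fin N) (i : Fin d) : ℝ :=
  (∑ j, ∫ x, field (S.eL K i) x j * field (S.eL K i) x j ∂(vol (T.elem K).K))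
      + (T.elem K).h⁻¹ * ∫ x, S.stabJump K i x ^ 2 ∂(bdry (T.elem K).K)

variable {Λ : ℝ}

theorem h_pos (S : Config T) (K : Fin N) : 0 < (T.elem K).h := (T.elem K).h_pos S.hd

theorem euSq_nonneg (K : Fin N) (i : Fin d) : 0 ≤ S.euSq K i := integral_nonneg fun _ => sq_nonneg _

theorem oneSq_eq (K : Fin N) (i : Fin d) : S.oneSq K i
    = (∑ j, ∫ x, pd j (S.eu K i) x ^ 2 ∂(vol (T.elem K).K))
      + (T.elem K).h⁻¹ * ∫ x, S.jump K i x ^ 2 ∂(bdry (T.elem K).K) := rfl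

theorem grad_nonneg (K : Fin N) (i : Fin d) :
    0 ≤ ∑ j, ∫ x, pd j (S.eu K i) x ^ 2 ∂(vol (T.elem K).K) :=
  Finset.sum_nonneg fun _ _ => integral_nonneg fun _ => sq_nonneg _

theorem jump_nonneg (K : Fin N) (i : Fin d) : 0 ≤ ∫ x, S.jump K i x ^ 2 ∂(bdry (T.elem K).K) :=
  integral_nonneg fun _ => sq_nonneg _

theorem oneSq_nonneg (K : Fin N) (i : Fin d) : 0 ≤ S.oneSq K i := by
  rw [oneSq_eq]
  have := S.h_pos K
  have := S.grad_nonneg K i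
  have := S.jump_nonneg K i
  positivity

theorem jump_le (K : Fin N) (i : Fin d) :
    (T.elem K).h * ∫ x, S.jump K i x ^ 2 ∂(bdry (T.elem K).K) ≤ (T.elem K).h ^ 2 * S.oneSq K i := by
  have hh := S.h_pos K
  have h1 := S.grad_nonneg K i
  rw [oneSq_eq, mul_add]
  have e : (T.elem K).h ^ 2 * ((T.elem K).h⁻¹ * ∫ x, S.jump K i x ^ 2 ∂(bdry (T.elem K).K))
      = (T.elem K).h * ∫ x, S.jump K i x ^ 2 ∂(bdry (T.elem K).K) := by
    field_simp
  rw [e]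
  have : 0 ≤ (T.elem K).h ^ 2 * ∑ j, ∫ x, pd j (S.eu K i) x ^ 2 ∂(vol (T.elem K).K) := by positivity
  linarith

theorem zeroSq_le (K : Fin N) (i : Fin d) :
    0 ≤ S.zeroSq K i ∧ ∫ x, (S.u x i - S.Pu K x i) ^ 2 ∂(vol (T.elem K).K) ≤ S.zeroSq K i ∧
    (T.elem K).h * ∫ x, (S.ut K x i - S.Pm x i) ^ 2 ∂(bdry (T.elem K).K) ≤ S.zeroSq K i ∧
    (T.elem K).h * ∫ x, (S.Pm x i - S.Pu K x i) ^ 2 ∂(bdry (T.elem K).K) ≤ S.zeroSq K i := by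
  have hh := S.h_pos K
  have e : S.zeroSq K i = (∫ x, (S.u x i - S.Pu K x i) ^ 2 ∂(vol (T.elem K).K))
      + (T.elem K).h * ((∫ x, (S.ut K x i - S.Pm x i) ^ 2 ∂(bdry (T.elem K).K))
        + ∫ x, (S.Pm x i - S.Pu K x i) ^ 2 ∂(bdry (T.elem K).K)) := by
    rw [zeroSq, normZeroSq]
    simp_rw [sub_sub_sub_cancel_left]
    rfl
  have h1 : 0 ≤ ∫ x, (S.u x i - S.Pu K x i) ^ 2 ∂(vol (T.elem K).K) :=
    integral_nonneg fun _ => sq_nonneg _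
  have h2 : 0 ≤ (T.elem K).h * ∫ x, (S.ut K x i - S.Pm x i) ^ 2 ∂(bdry (T.elem K).K) :=
    mul_nonneg hh.le (integral_nonneg fun _ => sq_nonneg _)
  have h3 : 0 ≤ (T.elem K).h * ∫ x, (S.Pm x i - S.Pu K x i) ^ 2 ∂(bdry (T.elem K).K) :=
    mul_nonneg hh.le (integral_nonneg fun _ => sq_nonneg _)
  rw [mul_add] at e
  refine ⟨?_, ?_, ?_, ?_⟩ <;> linarith

theorem oneSq_le_energySq (K : Fin N) (B : LocalBounds (T.elem K) Λ) (i : Fin d) :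
    S.oneSq K i ≤ Λ * S.energySq K i := by
  have hh := S.h_pos K
  set X := T.elem K
  have hd := S.hd
  have hdiv : ∀ f : E d → ℝ, X.h * avv X.K f = (X.h ^ (d - 1))⁻¹ * ∫ x, f x ∂(vol X.K) := by
    intro f
    have h1 := LocalBounds.vol_eq hd X f
    have hX : X.h ^ d = X.h ^ (d - 1) * X.h := by rw [← pow_succ, Nat.sub_add_cancel hd]
    rw [h1, hX, mul_assoc, inv_mul_cancel_left₀ (by positivity)]
  have h := B.grad (S.eu K i) (S.eu_mem K i) (S.eh i) (S.eh_mem K i) (field (S.eL K i))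
    (X.inField_of_mem (S.eL_mem K i)) (S.stabJump K i) (S.stabJump_mem K i) ?_ ?_
  · have h2 := mul_le_mul_of_nonneg_left h (by positivity : 0 ≤ X.h ^ d)
    have hg : ∫ x, ‖fderiv ℝ (S.eu K i) x‖ ^ 2 ∂(vol X.K)
        = ∑ j, ∫ x, pd j (S.eu K i) x ^ 2 ∂(vol X.K) := by
      simp_rw [norm_fderiv_sq]
      exact integral_finsetSum _ fun j _ => integrable_sq2 (X.memLp_W (X.W_deriv _ (S.eu_mem K i) j))
    have hl : ∫ x, ‖field (S.eL K i) x‖ ^ 2 ∂(vol X.K)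
        = ∑ j, ∫ x, field (S.eL K i) x j * field (S.eL K i) x j ∂(vol X.K) := by
      have e : ∀ x, ‖field (S.eL K i) x‖ ^ 2 = ∑ j, field (S.eL K i) x j * field (S.eL K i) x j :=
        fun x => by rw [← inner_eq_sum, real_inner_self_eq_norm_sq]
      simp_rw [e]
      exact integral_finsetSum _ fun j _ => integrable_mul2
        (memLp_component (Lp.memLp (S.eL K i).1) j) (memLp_component (Lp.memLp (S.eL K i).1) j)
    have e1 := LocalBounds.vol_eq hd X (fun x => ‖fderiv ℝ (S.eu K i) x‖ ^ 2)
    have e2 := LocalBounds.vol_eq hd X (fun x => ‖field (S.eL K i) x‖ ^ 2)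
    have e3 := LocalBounds.bdry_eq hd X (fun x => S.jump K i x ^ 2)
    have e4 := LocalBounds.bdry_eq hd X (fun x => S.stabJump K i x ^ 2)
    have e5 : avb X.K (fun x => (S.eu K i x - S.eh i x) ^ 2) = avb X.K (fun x => S.jump K i x ^ 2) := rfl
    rw [hg] at e1
    rw [hl] at e2
    rw [e5] at h2
    rw [oneSq_eq, energySq]
    set a := ∑ j, ∫ x, pd j (S.eu K i) x ^ 2 ∂(vol X.K)
    set b := ∑ j, ∫ x, field (S.eL K i) x j * field (S.eL K i) x j ∂(vol X.K)
    have h3 : X.h ^ 2 * a + X.h * (∫ x, S.jump K i x ^ 2 ∂(bdry X.K))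
        ≤ Λ * (X.h ^ 2 * b + X.h * ∫ x, S.stabJump K i x ^ 2 ∂(bdry X.K)) := by
      rw [e1, e2, e3, e4]
      linarith
    have h4 : X.h ^ 2 * (a + X.h⁻¹ * ∫ x, S.jump K i x ^ 2 ∂(bdry X.K))
        ≤ X.h ^ 2 * (Λ * (b + X.h⁻¹ * ∫ x, S.stabJump K i x ^ 2 ∂(bdry X.K))) := by
      have i1 : X.h ^ 2 * (a + X.h⁻¹ * ∫ x, S.jump K i x ^ 2 ∂(bdry X.K))
          = X.h ^ 2 * a + X.h * (∫ x, S.jump K i x ^ 2 ∂(bdry X.K)) := by field_simp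
      have i2 : X.h ^ 2 * (Λ * (b + X.h⁻¹ * ∫ x, S.stabJump K i x ^ 2 ∂(bdry X.K)))
          = Λ * (X.h ^ 2 * b + X.h * ∫ x, S.stabJump K i x ^ 2 ∂(bdry X.K)) := by field_simp
      rw [i1, i2]
      exact h3
    exact le_of_mul_le_mul_left h4 (by positivity)
  · rintro v δ γ ⟨t, ht, hv⟩ hf
    obtain ⟨hδ, hγ⟩ := hf.unique X.polyhedral (X.V_hdiv ht).isFlux hv
    have h1 := S.error_gradient K i ht
    have a1 : ∫ x, inner ℝ (field (S.eL K i) x) (v x) ∂(vol X.K)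
        = ∑ j, ∫ x, field (S.eL K i) x j * field t x j ∂(vol X.K) := by
      rw [← integral_finsetSum]
      · refine integral_congr_ae ?_
        filter_upwards [hv] with x hx
        rw [inner_eq_sum, hx]
      · exact fun j _ => integrable_mul2
          (memLp_component (Lp.memLp (S.eL K i).1) j) (memLp_component (Lp.memLp t.1) j)
    have a2 : ∫ x, S.eu K i x * δ x ∂(vol X.K) = ∫ x, S.eu K i x * dvg t x ∂(vol X.K) :=
      integral_congr_ae (by filter_upwards [hδ] with x hx; rw [hx])
    have a3 : ∫ x, S.eh i x * γ x ∂(bdry X.K) = ∫ x, S.eh i x * ntr t x ∂(bdry X.K) :=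
      integral_congr_ae (by filter_upwards [hγ] with x hx; rw [hx])
    rw [hdiv, hdiv, a1, a2, avb, a3]
    change _ - (X.h ^ (d - 1))⁻¹ * _ = 0
    rw [← mul_add, ← mul_sub, h1, mul_zero]
  · intro μ hμ
    rw [avb]
    have := traceProj_orth X.MS (S.memLp_jump_two K i) hμ
    rw [stabJump]
    simp only [jump] at this ⊢
    rw [this, mul_zero]

theorem PF_le (K : Fin N) (B : LocalBounds (T.elem K) Λ) (i : Fin d) :
    seminormPFSq (T.elem K).K (S.eu K i) (S.eh i) ≤ Λ * ((T.elem K).h ^ 2 * S.oneSq K i) := by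
  have hh := S.h_pos K
  set X := T.elem K
  have hd := S.hd
  set a := ⨍ y, S.eh i y ∂(bdry X.K) with ha
  have hfin := X.polyhedral.isFiniteMeasure_bdry
  have h0 : ∫ x, (S.eh i x - a) ∂(bdry X.K) = 0 := by
    exact integral_sub_average _ _
  have h := B.friedrichs (S.eu K i) (S.eu_mem K i) (S.eh i) (S.eh_mem K i) a (by
    rw [avb, h0, mul_zero])
  have h2 := mul_le_mul_of_nonneg_left h (by positivity : 0 ≤ X.h ^ d)
  have hg : ∫ x, ‖fderiv ℝ (S.eu K i) x‖ ^ 2 ∂(vol X.K)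
      = ∑ j, ∫ x, pd j (S.eu K i) x ^ 2 ∂(vol X.K) := by
    simp_rw [norm_fderiv_sq]
    exact integral_finsetSum _ fun j _ => integrable_sq2 (X.memLp_W (X.W_deriv _ (S.eu_mem K i) j))
  have e1 := LocalBounds.vol_eq hd X (fun x => ‖fderiv ℝ (S.eu K i) x‖ ^ 2)
  have e2 := LocalBounds.vol_eq hd X (fun x => (S.eu K i x - a) ^ 2)
  have e3 := LocalBounds.bdry_eq hd X (fun x => S.jump K i x ^ 2)
  have e4 := LocalBounds.bdry_eq hd X (fun x => (S.eh i x - a) ^ 2)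
  have e5 : avb X.K (fun x => (S.eu K i x - S.eh i x) ^ 2) = avb X.K (fun x => S.jump K i x ^ 2) := rfl
  rw [hg] at e1
  rw [e5] at h2
  rw [oneSq_eq, seminormPFSq]
  change (∫ x, (S.eu K i x - a) ^ 2 ∂(vol X.K)) + X.h * (∫ x, (S.eh i x - a) ^ 2 ∂(bdry X.K)) ≤ _
  have i1 : X.h ^ 2 * ((∑ j, ∫ x, pd j (S.eu K i) x ^ 2 ∂(vol X.K))
      + X.h⁻¹ * ∫ x, S.jump K i x ^ 2 ∂(bdry X.K))
      = X.h ^ 2 * (∑ j, ∫ x, pd j (S.eu K i) x ^ 2 ∂(vol X.K))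
        + X.h * (∫ x, S.jump K i x ^ 2 ∂(bdry X.K)) := by field_simp
  rw [i1, e1, e2, e3, e4]
  linarith

theorem ae_bdry_of_mem (X : LocalSpaces d) {w : E d → ℝ} (hw : w ∈ X.W) {C : ℝ}
    (h : ∀ x ∈ X.K, w x ^ 2 ≤ C) : ∀ᵐ x ∂(bdry X.K), w x ^ 2 ≤ C := by
  have hc : Continuous fun x => w x ^ 2 := (X.contDiff hw).continuous.pow 2
  filter_upwards [ae_bdry_mem_frontier X.K] with x hx
  exact closure_minimal (t := {x | w x ^ 2 ≤ C}) h (isClosed_le hc continuous_const)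
    (frontier_subset_closure hx)

theorem avv_u_le (K : Fin N) (B : LocalBounds (T.elem K) Λ) (i : Fin d) :
    avv (T.elem K).K (fun x => S.u x i ^ 2) ≤ Λ * S.U ^ 2 := by
  have hh := S.h_pos K
  have hfin := (T.elem K).polyhedral.isFiniteMeasure_vol
  have h1 : avv (T.elem K).K (fun x => S.u x i ^ 2) ≤ avv (T.elem K).K (fun _ => S.U ^ 2 * 1) := by
    refine mul_le_mul_of_nonneg_left ?_ (by have := Metric.diam_nonneg (s := (T.elem K).K); positivity)
    refine integral_mono_ae (integrable_sq2 (S.tr.u_trace K i).1) (integrable_const _) ?_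
    filter_upwards [S.u_le K i] with x hx
    rw [mul_one]
    exact sq_le_sq' (abs_le.1 hx).1 (abs_le.1 hx).2
  rw [avv_const_mul] at h1
  have h2 := mul_le_mul_of_nonneg_left B.size.1 (sq_nonneg S.U)
  linarith

theorem avb_ut_le (K : Fin N) (B : LocalBounds (T.elem K) Λ) (i : Fin d) :
    avb (T.elem K).K (fun x => S.ut K x i ^ 2) ≤ Λ * S.U ^ 2 := by
  have hh := S.h_pos K
  have hfin := (T.elem K).polyhedral.isFiniteMeasure_bdry
  have h1 : avb (T.elem K).K (fun x => S.ut K x i ^ 2) ≤ avb (T.elem K).K (fun _ => S.U ^ 2 * 1) := by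
    refine mul_le_mul_of_nonneg_left ?_ (by have := Metric.diam_nonneg (s := (T.elem K).K); positivity)
    refine integral_mono_ae (integrable_sq2 (S.tr.u_trace K i).2.2.1) (integrable_const _) ?_
    filter_upwards [S.ut_le K i] with x hx
    rw [mul_one]
    exact sq_le_sq' (abs_le.1 hx).1 (abs_le.1 hx).2
  rw [avb_const_mul] at h1
  have h2 := mul_le_mul_of_nonneg_left B.size.2 (sq_nonneg S.U)
  linarith

theorem Pu_sq_le (K : Fin N) (B : LocalBounds (T.elem K) Λ) (i : Fin d) {x : E d}
    (hx : x ∈ (T.elem K).K) : S.Pu K x i ^ 2 ≤ 2 * Λ ^ 3 * S.U ^ 2 := by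
  set X := T.elem K
  have h := B.stab _ (S.proj.Pu_mem K i) (fun x => S.u x i) (fun x => S.ut K x i)
    (S.tr.u_trace K i).1 (S.tr.u_trace K i).2.2.1 ?_ ?_
  · have h1 := B.sup _ (S.proj.Pu_mem K i) x hx
    have h2 := S.avv_u_le K B i
    have h3 := S.avb_ut_le K B i
    have hΛ := B.nonneg
    have h4 : avv X.K (fun x => S.Pu K x i ^ 2) ≤ Λ * (Λ * S.U ^ 2 + Λ * S.U ^ 2) :=
      h.trans (mul_le_mul_of_nonneg_left (add_le_add h2 h3) hΛ)
    have h5 := h1.trans (mul_le_mul_of_nonneg_left h4 hΛ)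
    calc _ ≤ _ := h5
      _ = _ := by ring
  · rintro v δ γ ⟨t, ht, hv⟩ hf
    obtain ⟨hδ, -⟩ := hf.unique X.polyhedral (X.V_hdiv ht).isFlux hv
    have h1 := S.proj.Pu_orth K i t ht
    have e : ∫ x, (S.Pu K x i - S.u x i) * δ x ∂(vol X.K)
        = -∫ x, (S.u x i - S.Pu K x i) * dvg t x ∂(vol X.K) := by
      rw [← integral_neg]
      refine integral_congr_ae ?_
      filter_upwards [hδ] with x hx
      rw [hx]; ring
    rw [avv, e, h1, neg_zero, mul_zero]
  · intro m hm
    have h1 := hm.integral_eq_zero (S.proj.Pu_trace K i)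
    have e : ∫ x, (S.Pu K x i - S.ut K x i) * m x ∂(bdry X.K)
        = -∫ x, (S.ut K x i - S.Pu K x i) * m x ∂(bdry X.K) := by
      rw [← integral_neg]
      congr 1; ext x; ring
    rw [avb, e, h1, neg_zero, mul_zero]

theorem Pm_sq_le (K : Fin N) (B : LocalBounds (T.elem K) Λ) (hΛ : 1 ≤ Λ) (i : Fin d) :
    ∀ᵐ x ∂(bdry (T.elem K).K), S.Pm x i ^ 2 ≤ 2 * Λ ^ 3 * S.U ^ 2 := by
  set X := T.elem K
  have hm := S.proj.Pm_mem K i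
  have h1 := hm.integral_eq_zero (S.proj.Pm_orth K i)
  have ht := (S.tr.u_trace K i).2.2.1
  have h2 : ∫ x, S.Pm x i ^ 2 ∂(bdry X.K) ≤ ∫ x, S.ut K x i ^ 2 ∂(bdry X.K) := by
    have e : ∫ x, S.ut K x i ^ 2 ∂(bdry X.K) = (∫ x, S.Pm x i ^ 2 ∂(bdry X.K))
        + 2 * (∫ x, (S.ut K x i - S.Pm x i) * S.Pm x i ∂(bdry X.K))
        + ∫ x, (S.ut K x i - S.Pm x i) ^ 2 ∂(bdry X.K) := by
      rw [← integral_const_mul, ← integral_add, ← integral_add]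
      · congr 1; ext x; ring
      · exact (integrable_sq2 hm.memLp).add ((integrable_mul2 (ht.sub hm.memLp) hm.memLp).const_mul 2)
      · exact integrable_sq2 (ht.sub hm.memLp)
      · exact integrable_sq2 hm.memLp
      · exact (integrable_mul2 (ht.sub hm.memLp) hm.memLp).const_mul 2
    have h3 : 0 ≤ ∫ x, (S.ut K x i - S.Pm x i) ^ 2 ∂(bdry X.K) := integral_nonneg fun _ => sq_nonneg _
    rw [h1] at e
    linarith
  have h3 : avb X.K (fun x => S.Pm x i ^ 2) ≤ Λ * S.U ^ 2 :=
    (mul_le_mul_of_nonneg_left h2 (by have := Metric.diam_nonneg (s := X.K); positivity)).trans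
      (S.avb_ut_le K B i)
  filter_upwards [B.traceSup _ hm] with x hx
  have h4 := hx.trans (mul_le_mul_of_nonneg_left h3 B.nonneg)
  refine h4.trans ?_
  have h5 : 0 ≤ S.U ^ 2 * (Λ ^ 2 * (Λ - 1)) := by
    have : 0 ≤ Λ - 1 := by linarith
    positivity
  have h6 : 0 ≤ S.U ^ 2 * Λ ^ 3 := by have := B.nonneg; positivity
  nlinarith

end Config

end

section

variable {d : ℕ}

theorem integral_mul_le_young {μ : Measure (E d)} {f g : E d → ℝ} (hf : MemLp f 2 μ)
    (hg : MemLp g 2 μ) {η : ℝ} (hη : 0 < η) :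
    ∫ x, f x * g x ∂μ ≤ η * (∫ x, g x ^ 2 ∂μ) + (4 * η)⁻¹ * ∫ x, f x ^ 2 ∂μ := by
  rw [← integral_const_mul, ← integral_const_mul, ← integral_add]
  · refine integral_mono (integrable_mul2 hf hg)
      (((integrable_sq2 hg).const_mul _).add ((integrable_sq2 hf).const_mul _)) fun x => ?_
    have h : η * g x ^ 2 + (4 * η)⁻¹ * f x ^ 2 - f x * g x
        = (4 * η)⁻¹ * (f x - 2 * η * g x) ^ 2 := by field_simp; ring
    have h2 : 0 ≤ (4 * η)⁻¹ * (f x - 2 * η * g x) ^ 2 := by positivity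
    simp only
    linarith
  · exact (integrable_sq2 hg).const_mul _
  · exact (integrable_sq2 hf).const_mul _

theorem sum_mul_normal_sq_le (K : Set (E d)) (x : E d) (g : Fin d → ℝ) :
    (∑ j, g j * outwardNormal K x j) ^ 2 ≤ d * ∑ j, g j ^ 2 := by
  refine sq_sum_le_card_mul_sum_sq.trans ?_
  rw [Finset.card_univ, Fintype.card_fin]
  refine mul_le_mul_of_nonneg_left (Finset.sum_le_sum fun j _ => ?_) (Nat.cast_nonneg _)
  rw [mul_pow]
  have h := abs_outwardNormal_le K x j
  have h2 : outwardNormal K x j ^ 2 ≤ 1 := (sq_le_one_iff_abs_le_one _).2 h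
  nlinarith [sq_nonneg (g j)]

variable {Ω : Set (E d)} {N : ℕ}

namespace Config

variable {T : Mesh Ω N} (S : Config T)

variable {Λ : ℝ}

theorem isFlux_uh (K : Fin N) : IsFlux (T.elem K).K (S.uh K)
    (fun x => ∑ j, pd j (fun y => S.uh K y j) x)
    (fun x => ∑ j, S.uh K x j * outwardNormal (T.elem K).K x j) := by
  set X := T.elem K
  have hW := S.sol.u_mem K
  have hpd := fun j => X.memLp_W (X.W_deriv _ (hW j) j)
  have hn := fun j => memLp_mul_bdd (X.memLp_W_bdry (hW j)) (memLp_normal (T := T) K j)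
  have := X.polyhedral.isFiniteMeasure_vol
  have := X.polyhedral.isFiniteMeasure_bdry
  refine ⟨MemLp.of_eval_piLp fun j => X.memLp_W (hW j), memLp_finsetSum _ fun j _ => hpd j,
    memLp_finsetSum _ fun j _ => hn j, fun φ hφ => ?_⟩
  have hφb := X.polyhedral.memLp_top_vol hφ.continuous
  have hφt := X.polyhedral.memLp_top_bdry hφ.continuous
  have hφd := fun j => X.polyhedral.memLp_top_vol (contDiff_pd hφ j).continuous
  simp_rw [Finset.sum_mul]
  rw [integral_finsetSum _ fun j _ => (memLp_mul_bdd (hpd j) hφb).integrable (by norm_num),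
    integral_finsetSum _ fun j _ => (memLp_mul_bdd (hn j) hφt).integrable (by norm_num),
    ← Finset.sum_add_distrib]
  refine Finset.sum_congr rfl fun j _ => ?_
  have hs := X.contDiff (hW j)
  have h := (S.poly K).divergenceTheorem (fun x => S.uh K x j * φ x) (hs.mul hφ) j
  have e : ∫ x, S.uh K x j * outwardNormal X.K x j * φ x ∂(bdry X.K)
      = ∫ x, outwardNormal X.K x j * (S.uh K x j * φ x) ∂(bdry X.K) := by
    congr 1; ext x; ring
  rw [e, ← h, ← integral_add]
  · congr 1; ext x
    rw [pd_mul (smooth_differentiable hs x) (smooth_differentiable hφ x)]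
    ring
  · exact (memLp_mul_bdd (X.memLp_W (hW j)) (hφd j)).integrable (by norm_num)
  · exact (memLp_mul_bdd (hpd j) hφb).integrable (by norm_num)

/-- The distance of the post-processed velocity to the numerical velocity. -/
theorem post_bound (K : Fin N) (B : LocalBounds (T.elem K) Λ) :
    ∑ j, ∫ x, (field (S.β K) x j - S.uh K x j) ^ 2 ∂(vol (T.elem K).K)
      ≤ 2 * d * Λ * ∑ j, (S.zeroSq K j + (T.elem K).h ^ 2 * S.oneSq K j) := by
  have hh := S.h_pos K
  have hd := S.hd
  set X := T.elem K
  obtain ⟨t₀, ht₀, hu⟩ := (S.compat K).vec_mem (S.uh K) (S.sol.u_mem K)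
  have hpp := S.sol.postprocess K
  have hflux := (S.isFlux_uh K).unique X.polyhedral (X.Vstar_hdiv _ ht₀).isFlux hu
  set t : Flux X.K := S.β K - t₀ with ht
  have htm : t ∈ X.Vstar := X.Vstar.sub_mem hpp.mem ht₀
  have hf : ∀ᵐ x ∂(vol X.K), ∀ j, field t x j = field (S.β K) x j - S.uh K x j := by
    have h1 : ∀ᵐ x ∂(vol X.K), field t x = field (S.β K) x - field t₀ x := Lp.coeFn_sub _ _
    filter_upwards [h1, hu] with x h1 h2 j
    rw [h1, h2, PiLp.sub_apply]
  have hγ : ∀ᵐ x ∂(bdry X.K), ntr t x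
      = ∑ j, (S.Pm x j - S.Pu K x j + S.jump K j x) * outwardNormal X.K x j := by
    have h1 : ∀ᵐ x ∂(bdry X.K), ntr t x = ntr (S.β K) x - ntr t₀ x := Lp.coeFn_sub _ _
    filter_upwards [h1, hflux.2, S.ntr_beta K] with x h1 h2 h3
    rw [h1, ← h2, h3, un, ← Finset.sum_sub_distrib]
    refine Finset.sum_congr rfl fun j _ => ?_
    rw [jump, eu, eh]; ring
  have hb := S.memLp_field_beta K
  have huh := fun j => X.memLp_W (S.sol.u_mem K j)
  have hN := B.normal (field t) (dvg t) (ntr t) ⟨t, htm, EventuallyEq.rfl⟩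
    (X.Vstar_hdiv _ htm).isFlux ?_ ?_
  · have h1 := mul_le_mul_of_nonneg_left hN (by positivity : 0 ≤ X.h ^ d)
    have e1 := LocalBounds.vol_eq hd X (fun x => ‖field t x‖ ^ 2)
    have e2 := LocalBounds.bdry_eq hd X (fun x => ntr t x ^ 2)
    have h2 : ∫ x, ‖field t x‖ ^ 2 ∂(vol X.K) ≤ Λ * (X.h * ∫ x, ntr t x ^ 2 ∂(bdry X.K)) := by
      rw [e1, e2]; linarith
    have e3 : ∫ x, ‖field t x‖ ^ 2 ∂(vol X.K)
        = ∑ j, ∫ x, (field (S.β K) x j - S.uh K x j) ^ 2 ∂(vol X.K) := by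
      rw [← integral_finsetSum]
      · refine integral_congr_ae ?_
        filter_upwards [hf] with x hx
        rw [EuclideanSpace.norm_sq_eq]
        simp_rw [hx, Real.norm_eq_abs, sq_abs]
      · exact fun j _ => integrable_sq2 ((hb j).sub (huh j))
    have hP := fun j => X.memLp_W_bdry (S.proj.Pu_mem K j)
    have hm := fun j => (S.proj.Pm_mem K j).memLp
    have hj := S.memLp_jump_two K
    have i1 : ∀ j, Integrable (fun x => (S.Pm x j - S.Pu K x j) ^ 2) (bdry X.K) := fun j =>
      integrable_sq2 ((hm j).sub (hP j))
    have i2 : ∀ j, Integrable (fun x => (S.Pm x j - S.Pu K x j) ^ 2 + S.jump K j x ^ 2) (bdry X.K) :=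
      fun j => (i1 j).add (integrable_sq2 (hj j))
    have h3 : ∫ x, ntr t x ^ 2 ∂(bdry X.K) ≤ 2 * d * ∑ j, ((∫ x, (S.Pm x j - S.Pu K x j) ^ 2 ∂(bdry X.K))
        + ∫ x, S.jump K j x ^ 2 ∂(bdry X.K)) := by
      have e4 : ∑ j, ((∫ x, (S.Pm x j - S.Pu K x j) ^ 2 ∂(bdry X.K))
        + ∫ x, S.jump K j x ^ 2 ∂(bdry X.K))
        = ∫ x, ∑ j, ((S.Pm x j - S.Pu K x j) ^ 2 + S.jump K j x ^ 2) ∂(bdry X.K) := by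
        rw [integral_finsetSum _ fun j _ => i2 j]
        exact Finset.sum_congr rfl fun j _ => (integral_add (i1 j) (integrable_sq2 (hj j))).symm
      rw [e4, ← integral_const_mul]
      refine integral_mono_ae (integrable_sq2 (Lp.memLp _)) ((integrable_finsetSum _ fun j _ =>
        i2 j).const_mul _) ?_
      filter_upwards [hγ] with x hx
      rw [hx]
      refine (sum_mul_normal_sq_le X.K x _).trans ?_
      have h5 : ∑ j, (S.Pm x j - S.Pu K x j + S.jump K j x) ^ 2
          ≤ 2 * ∑ j, ((S.Pm x j - S.Pu K x j) ^ 2 + S.jump K j x ^ 2) := by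
        rw [Finset.mul_sum]
        refine Finset.sum_le_sum fun j _ => ?_
        nlinarith [sq_nonneg (S.Pm x j - S.Pu K x j - S.jump K j x)]
      have h6 := mul_le_mul_of_nonneg_left h5 (Nat.cast_nonneg (α := ℝ) d)
      linarith
    have h4 : X.h * ∑ j, ((∫ x, (S.Pm x j - S.Pu K x j) ^ 2 ∂(bdry X.K))
        + ∫ x, S.jump K j x ^ 2 ∂(bdry X.K)) ≤ ∑ j, (S.zeroSq K j + X.h ^ 2 * S.oneSq K j) := by
      rw [Finset.mul_sum]
      refine Finset.sum_le_sum fun j _ => ?_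
      rw [mul_add]
      exact add_le_add (S.zeroSq_le K j).2.2.2 (S.jump_le K j)
    have hΛ := B.nonneg
    rw [← e3]
    calc _ ≤ _ := h2
      _ ≤ Λ * (X.h * (2 * d * ∑ j, ((∫ x, (S.Pm x j - S.Pu K x j) ^ 2 ∂(bdry X.K))
        + ∫ x, S.jump K j x ^ 2 ∂(bdry X.K)))) := by gcongr
      _ = 2 * d * Λ * (X.h * ∑ j, ((∫ x, (S.Pm x j - S.Pu K x j) ^ 2 ∂(bdry X.K))
        + ∫ x, S.jump K j x ^ 2 ∂(bdry X.K))) := by ring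
      _ ≤ _ := by gcongr
  · intro w hw
    have h1 := hpp.grad w hw
    have hpd := fun j => X.memLp_W (X.W_deriv w hw j)
    rw [avv, ← X.polyhedral.sum_integral_eq (v := field t) (Lp.memLp t.1) (X.contDiff hw)]
    have e : ∀ j, ∫ x, field t x j * pd j w x ∂(vol X.K)
        = (∫ x, field (S.β K) x j * pd j w x ∂(vol X.K)) - ∫ x, S.uh K x j * pd j w x ∂(vol X.K) := by
      intro j
      rw [← integral_sub (integrable_mul2 (hb j) (hpd j)) (integrable_mul2 (huh j) (hpd j))]
      refine integral_congr_ae ?_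
      filter_upwards [hf] with x hx
      rw [hx]; ring
    simp_rw [e]
    rw [Finset.sum_sub_distrib, h1, sub_self, mul_zero]
  · rintro s ⟨s', hs', hs⟩ hsf
    obtain ⟨h1, h2⟩ := hsf.unique X.polyhedral (X.Vstar_hdiv _ hs').isFlux hs
    have h3 := hpp.bubble s' hs' h1.symm h2.symm
    have hsj : ∀ j, MemLp (fun x => field s' x j) 2 (vol X.K) := fun j =>
      memLp_component (Lp.memLp s'.1) j
    have e : ∫ x, inner ℝ (field t x) (s x) ∂(vol X.K)
        = ∑ j, ((∫ x, field (S.β K) x j * field s' x j ∂(vol X.K))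
          - ∫ x, S.uh K x j * field s' x j ∂(vol X.K)) := by
      have e' : ∀ j, (∫ x, field (S.β K) x j * field s' x j ∂(vol X.K))
          - ∫ x, S.uh K x j * field s' x j ∂(vol X.K)
          = ∫ x, (field (S.β K) x j - S.uh K x j) * field s' x j ∂(vol X.K) := by
        intro j
        rw [← integral_sub (integrable_mul2 (hb j) (hsj j)) (integrable_mul2 (huh j) (hsj j))]
        congr 1; ext x; ring
      simp_rw [e']
      rw [← integral_finsetSum]
      · refine integral_congr_ae ?_
        filter_upwards [hf, hs] with x hx h4
        rw [inner_eq_sum, h4]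
        simp_rw [hx]
      · exact fun j _ => integrable_mul2 ((hb j).sub (huh j)) (hsj j)
    rw [avv, e, Finset.sum_sub_distrib, h3, sub_self, mul_zero]

/-- The quantity that controls the convective error on one element. -/
def load (K : Fin N) : ℝ :=
  ∑ j, (S.zeroSq K j + S.euSq K j + (T.elem K).h ^ 2 * S.oneSq K j)

theorem load_term_nonneg (K : Fin N) (j : Fin d) :
    0 ≤ S.zeroSq K j + S.euSq K j + (T.elem K).h ^ 2 * S.oneSq K j := by
  have h1 := (S.zeroSq_le K j).1
  have h2 := S.euSq_nonneg K j
  have h3 := S.oneSq_nonneg K j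
  positivity

theorem load_nonneg (K : Fin N) : 0 ≤ S.load K := Finset.sum_nonneg fun j _ => S.load_term_nonneg K j

theorem zeroSq_le_load (K : Fin N) (i : Fin d) : S.zeroSq K i ≤ S.load K := by
  refine le_trans ?_ (Finset.single_le_sum (fun j _ => S.load_term_nonneg K j) (Finset.mem_univ i))
  have h2 := S.euSq_nonneg K i
  have h3 := mul_nonneg (sq_nonneg (T.elem K).h) (S.oneSq_nonneg K i)
  linarith

theorem sq_volume_le {a c q s e b U₂ P₂ : ℝ} (hc : c ^ 2 ≤ U₂) (hq : q ^ 2 ≤ P₂) :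
    (a * c + q * (s + e - b)) ^ 2 ≤ 2 * U₂ * a ^ 2 + 6 * P₂ * (s ^ 2 + e ^ 2 + b ^ 2) := by
  have h1 : (a * c + q * (s + e - b)) ^ 2 ≤ 2 * (a ^ 2 * c ^ 2) + 2 * (q ^ 2 * (s + e - b) ^ 2) := by
    nlinarith [sq_nonneg (a * c - q * (s + e - b))]
  have h2 : (s + e - b) ^ 2 ≤ 3 * (s ^ 2 + e ^ 2 + b ^ 2) := by
    nlinarith [sq_nonneg (s - e), sq_nonneg (s + b), sq_nonneg (e + b)]
  have h3 : a ^ 2 * c ^ 2 ≤ a ^ 2 * U₂ := mul_le_mul_of_nonneg_left hc (sq_nonneg _)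
  have h4 : q ^ 2 * (s + e - b) ^ 2 ≤ P₂ * (3 * (s ^ 2 + e ^ 2 + b ^ 2)) :=
    mul_le_mul hq h2 (sq_nonneg _) ((sq_nonneg _).trans hq)
  linarith

theorem sq_boundary_le {a w m D r b W P₂ : ℝ} (hw : w ^ 2 ≤ W) (hm : m ^ 2 ≤ P₂)
    (hr : r ^ 2 ≤ 4 * P₂) (hb : b = w - D) :
    (a * w + m * D - max b 0 * r) ^ 2 ≤ 3 * W * a ^ 2 + 6 * W * r ^ 2 + 27 * P₂ * D ^ 2 := by
  have h1 : (a * w + m * D - max b 0 * r) ^ 2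
      ≤ 3 * (a ^ 2 * w ^ 2) + 3 * (m ^ 2 * D ^ 2) + 3 * (max b 0 ^ 2 * r ^ 2) := by
    nlinarith [sq_nonneg (a * w - m * D), sq_nonneg (a * w + max b 0 * r),
      sq_nonneg (m * D + max b 0 * r)]
  have h2 : max b 0 ^ 2 ≤ 2 * w ^ 2 + 2 * D ^ 2 := by
    have h3 : max b 0 ^ 2 ≤ b ^ 2 := by
      rcases le_total b 0 with h | h
      · rw [max_eq_right h]; nlinarith [sq_nonneg b]
      · rw [max_eq_left h]
    rw [hb] at h3 ⊢
    nlinarith [sq_nonneg (w + D)]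
  have h3 : a ^ 2 * w ^ 2 ≤ a ^ 2 * W := mul_le_mul_of_nonneg_left hw (sq_nonneg _)
  have h4 : m ^ 2 * D ^ 2 ≤ P₂ * D ^ 2 := mul_le_mul_of_nonneg_right hm (sq_nonneg _)
  have h5 : max b 0 ^ 2 * r ^ 2 ≤ (2 * w ^ 2 + 2 * D ^ 2) * r ^ 2 :=
    mul_le_mul_of_nonneg_right h2 (sq_nonneg _)
  have h6 : w ^ 2 * r ^ 2 ≤ W * r ^ 2 := mul_le_mul_of_nonneg_right hw (sq_nonneg _)
  have h7 : D ^ 2 * r ^ 2 ≤ D ^ 2 * (4 * P₂) := mul_le_mul_of_nonneg_left hr (sq_nonneg _)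
  nlinarith

/-- The volume part of the convective error. -/
def convVol (K : Fin N) (i j : Fin d) (x : E d) : ℝ :=
  S.u x i * S.u x j - S.Pu K x i * field (S.β K) x j

/-- The boundary part of the convective error. -/
def convBdry (K : Fin N) (i : Fin d) (x : E d) : ℝ :=
  S.ut K x i * S.utn K x - ntr (S.β K) x * S.Pm x i
      - max (ntr (S.β K) x) 0 * (S.Pu K x i - S.Pm x i)

theorem memLp_convVol (K : Fin N) (i j : Fin d) : MemLp (S.convVol K i j) 2 (vol (T.elem K).K) := by
  have := (T.elem K).polyhedral.isFiniteMeasure_vol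
  have h1 : MemLp (fun x => S.u x i * S.u x j) 2 (vol (T.elem K).K) :=
    (memLp_bdd_mul (S.memLp_u K i) (S.memLp_u K j)).mono_exponent le_top
  exact h1.sub (memLp_bdd_mul ((T.elem K).memLp_top_W (S.proj.Pu_mem K i)) (S.memLp_field_beta K j))

theorem memLp_convBdry (K : Fin N) (i : Fin d) : MemLp (S.convBdry K i) 2 (bdry (T.elem K).K) := by
  have hPm := (T.elem K).memLp_top_trace (S.proj.Pm_mem K i)
  have hPu := (T.elem K).memLp_top_W_bdry (S.proj.Pu_mem K i)
  exact memLp_two_of_top (((memLp_bdd_mul (S.memLp_ut K i) (S.memLp_utn K)).sub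
    (memLp_bdd_mul (S.memLp_ntr_beta K) hPm)).sub
      (memLp_bdd_mul (S.memLp_posPart K) (hPu.sub hPm)))

theorem convVol_le (K : Fin N) (B : LocalBounds (T.elem K) Λ) (i : Fin d) :
    ∑ j, ∫ x, S.convVol K i j x ^ 2 ∂(vol (T.elem K).K)
      ≤ (2 * d + 12 * Λ ^ 3 + 24 * d * Λ ^ 4) * S.U ^ 2 * S.load K := by
  set X := T.elem K
  have hΛ := B.nonneg
  have hu := fun j => (S.tr.u_trace K j).1
  have hP := fun j => X.memLp_W (S.proj.Pu_mem K j)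
  have hb := S.memLp_field_beta K
  have huh := fun j => X.memLp_W (S.sol.u_mem K j)
  have he := fun j => X.memLp_W (S.eu_mem K j)
  set P₂ := 2 * Λ ^ 3 * S.U ^ 2 with hP₂
  have h1 : ∀ j, ∫ x, S.convVol K i j x ^ 2 ∂(vol X.K)
      ≤ 2 * S.U ^ 2 * S.zeroSq K i + 6 * P₂ * (S.zeroSq K j + S.euSq K j
        + ∫ x, (field (S.β K) x j - S.uh K x j) ^ 2 ∂(vol X.K)) := by
    intro j
    have i1 : Integrable (fun x => (S.u x i - S.Pu K x i) ^ 2) (vol X.K) :=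
      integrable_sq2 ((hu i).sub (hP i))
    have i2 : Integrable (fun x => (S.u x j - S.Pu K x j) ^ 2) (vol X.K) :=
      integrable_sq2 ((hu j).sub (hP j))
    have i3 := integrable_sq2 (he j)
    have i4 : Integrable (fun x => (field (S.β K) x j - S.uh K x j) ^ 2) (vol X.K) :=
      integrable_sq2 ((hb j).sub (huh j))
    have h2 : ∫ x, S.convVol K i j x ^ 2 ∂(vol X.K)
        ≤ ∫ x, (2 * S.U ^ 2 * (S.u x i - S.Pu K x i) ^ 2 + 6 * P₂ * ((S.u x j - S.Pu K x j) ^ 2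
          + S.eu K j x ^ 2 + (field (S.β K) x j - S.uh K x j) ^ 2)) ∂(vol X.K) := by
      refine integral_mono_ae (integrable_sq2 (S.memLp_convVol K i j))
        ((i1.const_mul _).add (((i2.add i3).add i4).const_mul _)) ?_
      filter_upwards [S.u_le K j, ae_vol_mem X.polyhedral.isOpen.measurableSet] with x hx hxK
      have e : S.convVol K i j x = (S.u x i - S.Pu K x i) * S.u x j
          + S.Pu K x i * ((S.u x j - S.Pu K x j) + S.eu K j x - (field (S.β K) x j - S.uh K x j)) := by
        rw [convVol, eu]; ring
      rw [e]
      exact sq_volume_le (sq_le_sq' (abs_le.1 hx).1 (abs_le.1 hx).2) (S.Pu_sq_le K B i hxK)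
    refine h2.trans ?_
    have hi3 : Integrable (fun x => (S.u x j - S.Pu K x j) ^ 2 + S.eu K j x ^ 2) (vol X.K) := i2.add i3
    have hi4 : Integrable (fun x => (S.u x j - S.Pu K x j) ^ 2 + S.eu K j x ^ 2
      + (field (S.β K) x j - S.uh K x j) ^ 2) (vol X.K) := hi3.add i4
    rw [integral_add (i1.const_mul _) (hi4.const_mul _), integral_const_mul, integral_const_mul,
      integral_add hi3 i4, integral_add i2 i3]
    have a1 := (S.zeroSq_le K i).2.1
    have a2 := (S.zeroSq_le K j).2.1
    rw [euSq]
    gcongr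
  refine (Finset.sum_le_sum fun j _ => h1 j).trans ?_
  rw [Finset.sum_add_distrib, Finset.sum_const, Finset.card_univ, Fintype.card_fin, nsmul_eq_mul,
    ← Finset.mul_sum, Finset.sum_add_distrib]
  have b1 := S.post_bound K B
  have b2 : ∑ j, (S.zeroSq K j + X.h ^ 2 * S.oneSq K j) ≤ S.load K := by
    refine Finset.sum_le_sum fun j _ => ?_
    have := S.euSq_nonneg K j
    linarith
  have b3 : ∑ j, (S.zeroSq K j + S.euSq K j) ≤ S.load K := by
    refine Finset.sum_le_sum fun j _ => ?_
    have := mul_nonneg (sq_nonneg X.h) (S.oneSq_nonneg K j)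
    linarith
  have b4 := S.zeroSq_le_load K i
  have hl := S.load_nonneg K
  calc _ ≤ d * (2 * S.U ^ 2 * S.load K) + 6 * P₂ * (S.load K + 2 * d * Λ * S.load K) := by
        gcongr
        exact b1.trans (by gcongr)
    _ = _ := by rw [hP₂]; ring

theorem convBdry_le (K : Fin N) (B : LocalBounds (T.elem K) Λ) (hΛ : 1 ≤ Λ) (i : Fin d) :
    (T.elem K).h * ∫ x, S.convBdry K i x ^ 2 ∂(bdry (T.elem K).K)
      ≤ (9 * d ^ 2 + 162 * d * Λ ^ 4) * S.U ^ 2 * S.load K := by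
  have hh := S.h_pos K
  set X := T.elem K
  have hΛ0 := B.nonneg
  have hut := fun j => (S.tr.u_trace K j).2.2.1
  have hP := fun j => X.memLp_W_bdry (S.proj.Pu_mem K j)
  have hm := fun j => (S.proj.Pm_mem K j).memLp
  have he := fun j => X.memLp_W_bdry (S.eu_mem K j)
  have hj := S.memLp_jump_two K
  set P₂ := 2 * Λ ^ 3 * S.U ^ 2 with hP₂
  set W := (d : ℝ) ^ 2 * S.U ^ 2 with hW
  have i0 : ∀ j, Integrable (fun x => (S.ut K x j - S.Pm x j) ^ 2) (bdry X.K) := fun j =>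
    integrable_sq2 ((hut j).sub (hm j))
  have i1 := i0 i
  have i2 : Integrable (fun x => (S.Pm x i - S.Pu K x i) ^ 2) (bdry X.K) :=
    integrable_sq2 ((hm i).sub (hP i))
  have i3 : ∀ j, Integrable (fun x => (S.ut K x j - S.Pm x j) ^ 2 + S.eu K j x ^ 2) (bdry X.K) := fun j =>
    (i0 j).add (integrable_sq2 (he j))
  have i4 : ∀ j, Integrable (fun x => (S.ut K x j - S.Pm x j) ^ 2 + S.eu K j x ^ 2
      + S.jump K j x ^ 2) (bdry X.K) := fun j => (i3 j).add (integrable_sq2 (hj j))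
  have h1 : ∫ x, S.convBdry K i x ^ 2 ∂(bdry X.K)
      ≤ ∫ x, (3 * W * (S.ut K x i - S.Pm x i) ^ 2 + 6 * W * (S.Pm x i - S.Pu K x i) ^ 2
        + 81 * d * P₂ * ∑ j, ((S.ut K x j - S.Pm x j) ^ 2 + S.eu K j x ^ 2 + S.jump K j x ^ 2))
        ∂(bdry X.K) := by
    refine integral_mono_ae (integrable_sq2 (S.memLp_convBdry K i))
      (((i1.const_mul _).add (i2.const_mul _)).add
        ((integrable_finsetSum _ fun j _ => i4 j).const_mul _)) ?_
    filter_upwards [ae_all_iff.2 (S.ut_le K), S.Pm_sq_le K B hΛ i,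
      ae_bdry_of_mem X (S.proj.Pu_mem K i) (fun x hx => S.Pu_sq_le K B i hx), S.ntr_beta K]
      with x hx h2 h3 h4
    set D := ∑ j, (S.ut K x j - S.Pm x j + S.eu K j x - S.jump K j x) * outwardNormal X.K x j with hD
    have hb : ntr (S.β K) x = S.utn K x - D := by
      rw [h4, un, utn, hD, ← Finset.sum_sub_distrib]
      refine Finset.sum_congr rfl fun j _ => ?_
      rw [jump, eh]; ring
    have hw : S.utn K x ^ 2 ≤ W := by
      refine (sum_mul_normal_sq_le X.K x _).trans ?_
      have : ∑ j : Fin d, S.ut K x j ^ 2 ≤ ∑ _j : Fin d, S.U ^ 2 :=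
        Finset.sum_le_sum fun j _ => sq_le_sq' (abs_le.1 (hx j)).1 (abs_le.1 (hx j)).2
      rw [Finset.sum_const, Finset.card_univ, Fintype.card_fin, nsmul_eq_mul] at this
      calc _ ≤ (d : ℝ) * (d * S.U ^ 2) := mul_le_mul_of_nonneg_left this (Nat.cast_nonneg _)
        _ = W := by rw [hW]; ring
    have hr : (S.Pu K x i - S.Pm x i) ^ 2 ≤ 4 * P₂ := by
      nlinarith [sq_nonneg (S.Pu K x i + S.Pm x i)]
    have h5 := sq_boundary_le (a := S.ut K x i - S.Pm x i) hw h2 hr hb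
    have e : S.convBdry K i x = (S.ut K x i - S.Pm x i) * S.utn K x + S.Pm x i * D
        - max (ntr (S.β K) x) 0 * (S.Pu K x i - S.Pm x i) := by
      rw [convBdry, hb]; ring
    rw [e]
    refine h5.trans ?_
    have h6 : D ^ 2 ≤ d * ∑ j, 3 * ((S.ut K x j - S.Pm x j) ^ 2 + S.eu K j x ^ 2 + S.jump K j x ^ 2) := by
      refine (sum_mul_normal_sq_le X.K x _).trans ?_
      refine mul_le_mul_of_nonneg_left (Finset.sum_le_sum fun j _ => ?_) (Nat.cast_nonneg _)
      nlinarith [sq_nonneg (S.ut K x j - S.Pm x j - S.eu K j x),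
        sq_nonneg (S.ut K x j - S.Pm x j + S.jump K j x), sq_nonneg (S.eu K j x + S.jump K j x)]
    rw [← Finset.mul_sum] at h6
    have h7 : 0 ≤ P₂ := by positivity
    have h8 := mul_le_mul_of_nonneg_left h6 h7
    have e2 : (S.Pu K x i - S.Pm x i) ^ 2 = (S.Pm x i - S.Pu K x i) ^ 2 := by ring
    rw [e2]
    simp only
    linarith
  have h2 : ∫ x, (3 * W * (S.ut K x i - S.Pm x i) ^ 2 + 6 * W * (S.Pm x i - S.Pu K x i) ^ 2
        + 81 * d * P₂ * ∑ j, ((S.ut K x j - S.Pm x j) ^ 2 + S.eu K j x ^ 2 + S.jump K j x ^ 2))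
        ∂(bdry X.K)
      = 3 * W * (∫ x, (S.ut K x i - S.Pm x i) ^ 2 ∂(bdry X.K))
        + 6 * W * (∫ x, (S.Pm x i - S.Pu K x i) ^ 2 ∂(bdry X.K))
        + 81 * d * P₂ * ∑ j, ((∫ x, (S.ut K x j - S.Pm x j) ^ 2 ∂(bdry X.K))
          + (∫ x, S.eu K j x ^ 2 ∂(bdry X.K)) + ∫ x, S.jump K j x ^ 2 ∂(bdry X.K)) := by
    have hi : Integrable (fun x => 3 * W * (S.ut K x i - S.Pm x i) ^ 2
        + 6 * W * (S.Pm x i - S.Pu K x i) ^ 2) (bdry X.K) := (i1.const_mul _).add (i2.const_mul _)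
    rw [integral_add hi ((integrable_finsetSum _ fun j _ => i4 j).const_mul _),
      integral_add (i1.const_mul _) (i2.const_mul _), integral_const_mul, integral_const_mul,
      integral_const_mul, integral_finsetSum _ fun j _ => i4 j]
    congr 2
    refine Finset.sum_congr rfl fun j _ => ?_
    rw [integral_add (i3 j) (integrable_sq2 (hj j)),
      integral_add (i0 j) (integrable_sq2 (he j))]
  rw [h2] at h1
  have a1 := (S.zeroSq_le K i).2.2.1
  have a2 := (S.zeroSq_le K i).2.2.2
  have b4 := S.zeroSq_le_load K i
  have hl := S.load_nonneg K
  have hsum : X.h * ∑ j, ((∫ x, (S.ut K x j - S.Pm x j) ^ 2 ∂(bdry X.K))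
          + (∫ x, S.eu K j x ^ 2 ∂(bdry X.K)) + ∫ x, S.jump K j x ^ 2 ∂(bdry X.K)) ≤ Λ * S.load K := by
    rw [Finset.mul_sum, load, Finset.mul_sum]
    refine Finset.sum_le_sum fun j _ => ?_
    have c1 := (S.zeroSq_le K j).2.2.1
    have c2 := B.trace_int S.hd (S.eu_mem K j)
    have c3 := S.jump_le K j
    have c4 := (S.zeroSq_le K j).1
    have c5 := mul_nonneg (sq_nonneg X.h) (S.oneSq_nonneg K j)
    rw [mul_add, mul_add, euSq]
    nlinarith
  calc _ ≤ X.h * _ := mul_le_mul_of_nonneg_left h1 hh.le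
    _ = 3 * W * (X.h * ∫ x, (S.ut K x i - S.Pm x i) ^ 2 ∂(bdry X.K))
        + 6 * W * (X.h * ∫ x, (S.Pm x i - S.Pu K x i) ^ 2 ∂(bdry X.K))
        + 81 * d * P₂ * (X.h * ∑ j, ((∫ x, (S.ut K x j - S.Pm x j) ^ 2 ∂(bdry X.K))
          + (∫ x, S.eu K j x ^ 2 ∂(bdry X.K)) + ∫ x, S.jump K j x ^ 2 ∂(bdry X.K))) := by ring
    _ ≤ 3 * W * S.load K + 6 * W * S.load K + 81 * d * P₂ * (Λ * S.load K) := by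
        gcongr
        · exact a1.trans b4
        · exact a2.trans b4
    _ = _ := by rw [hW, hP₂]; ring

theorem convErr_le (K : Fin N) (B : LocalBounds (T.elem K) Λ) (hΛ : 1 ≤ Λ) (i : Fin d) {η : ℝ}
    (hη : 0 < η) : -S.convErr K i ≤ η * S.oneSq K i + (4 * η)⁻¹ *
      ((11 * d ^ 2 + 12 * Λ ^ 3 + 186 * d * Λ ^ 4) * S.U ^ 2 * S.load K) := by
  have hh := S.h_pos K
  set X := T.elem K
  have hv := S.eu_mem K i
  have h1 : ∀ j, ∫ x, S.convVol K i j x * pd j (S.eu K i) x ∂(vol X.K)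
      ≤ η * (∫ x, pd j (S.eu K i) x ^ 2 ∂(vol X.K)) + (4 * η)⁻¹ * ∫ x, S.convVol K i j x ^ 2 ∂(vol X.K) :=
    fun j => integral_mul_le_young (S.memLp_convVol K i j) (X.memLp_W (X.W_deriv _ hv j)) hη
  have h2 : ∫ x, (-S.convBdry K i x) * S.jump K i x ∂(bdry X.K)
      ≤ η * X.h⁻¹ * (∫ x, S.jump K i x ^ 2 ∂(bdry X.K))
        + (4 * (η * X.h⁻¹))⁻¹ * ∫ x, (-S.convBdry K i x) ^ 2 ∂(bdry X.K) :=
    integral_mul_le_young (S.memLp_convBdry K i).neg (S.memLp_jump_two K i) (by positivity)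
  simp_rw [neg_mul, integral_neg, neg_sq] at h2
  have h3 := Finset.sum_le_sum fun j (_ : j ∈ Finset.univ) => h1 j
  rw [Finset.sum_add_distrib, ← Finset.mul_sum, ← Finset.mul_sum] at h3
  have e1 : (4 * (η * X.h⁻¹))⁻¹ * ∫ x, S.convBdry K i x ^ 2 ∂(bdry X.K)
      = (4 * η)⁻¹ * (X.h * ∫ x, S.convBdry K i x ^ 2 ∂(bdry X.K)) := by
    field_simp
  rw [e1] at h2
  have h4 := S.convVol_le K B i
  have h5 := S.convBdry_le K B hΛ i
  have e2 : S.convErr K i = -(∑ j, ∫ x, S.convVol K i j x * pd j (S.eu K i) x ∂(vol X.K))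
      + ∫ x, S.convBdry K i x * S.jump K i x ∂(bdry X.K) := rfl
  have h6 : (2 * d + 12 * Λ ^ 3 + 24 * d * Λ ^ 4) * S.U ^ 2 * S.load K
      + (9 * d ^ 2 + 162 * d * Λ ^ 4) * S.U ^ 2 * S.load K
      ≤ (11 * d ^ 2 + 12 * Λ ^ 3 + 186 * d * Λ ^ 4) * S.U ^ 2 * S.load K := by
    have hd1 : (1 : ℝ) ≤ d := by exact_mod_cast S.hd
    have hl := mul_nonneg (sq_nonneg S.U) (S.load_nonneg K)
    have hd2 : (0 : ℝ) ≤ 2 * d ^ 2 - 2 * d := by nlinarith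
    have := mul_nonneg hd2 hl
    linarith
  have h7 : (4 * η)⁻¹ * ((∑ j, ∫ x, S.convVol K i j x ^ 2 ∂(vol X.K))
      + X.h * ∫ x, S.convBdry K i x ^ 2 ∂(bdry X.K)) ≤ (4 * η)⁻¹ *
      ((11 * d ^ 2 + 12 * Λ ^ 3 + 186 * d * Λ ^ 4) * S.U ^ 2 * S.load K) :=
    mul_le_mul_of_nonneg_left (by linarith) (by positivity)
  rw [e2, oneSq_eq]
  rw [mul_add] at h7
  linarith

end Config

end

section

variable {d : ℕ}

theorem pd_coord (j : Fin d) (x : E d) : pd j (fun y : E d => y j) x = 1 := by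
  have h : HasFDerivAt (fun y : E d => y j) (EuclideanSpace.proj j : E d →L[ℝ] ℝ) x :=
    (EuclideanSpace.proj j : E d →L[ℝ] ℝ).hasFDerivAt
  rw [pd, h.fderiv]
  simp

theorem contDiff_coord (j : Fin d) : ContDiff ℝ ∞ fun y : E d => y j :=
  (EuclideanSpace.proj j : E d →L[ℝ] ℝ).contDiff

variable {Ω : Set (E d)} {N : ℕ}

namespace Config

variable {T : Mesh Ω N} (S : Config T)

variable {Λ : ℝ}

theorem poincare_local (K : Fin N) (B : LocalBounds (T.elem K) Λ) (hΛ : 1 ≤ Λ) (i j : Fin d) {R : ℝ}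
    (hR : ∀ x ∈ closure Ω, |x j| ≤ R) (hK : (T.elem K).h ≤ R) :
    1 / 2 * S.euSq K i ≤ (5 + 4 * Λ) * R ^ 2 * S.oneSq K i
      + ∫ x, x j * S.eh i x * outwardNormal (T.elem K).K x j * S.eh i x ∂(bdry (T.elem K).K) := by
  have hh := S.h_pos K
  set X := T.elem K
  have := X.polyhedral.isFiniteMeasure_vol
  have := X.polyhedral.isFiniteMeasure_bdry
  have hΛ0 : 0 < Λ := by linarith
  have hR0 : 0 < R := hh.trans_le hK
  set v := S.eu K i
  have hv : v ∈ X.W := S.eu_mem K i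
  have hs := X.contDiff hv
  have hc := contDiff_coord (d := d) j
  have hvt := X.memLp_top_W hv
  have hv2 := X.memLp_W hv
  have hpd := X.memLp_W (X.W_deriv _ hv j)
  have hxt := X.polyhedral.memLp_top_vol hc.continuous
  have hxb := X.polyhedral.memLp_top_bdry hc.continuous
  have hvb := X.memLp_W_bdry hv
  have hvbt := X.memLp_top_W_bdry hv
  have hJ := S.memLp_jump_two K i
  have hn := memLp_normal (T := T) K j
  have heh := X.memLp_top_trace (S.eh_mem K i)
  have heh2 := (S.eh_mem K i).memLp
  have hdiv := (S.poly K).divergenceTheorem (fun x => x j * (v x * v x)) (hc.mul (hs.mul hs)) j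
  have e1 : ∫ x, pd j (fun x => x j * (v x * v x)) x ∂(vol X.K)
      = S.euSq K i + ∫ x, 2 * (x j * v x * pd j v x) ∂(vol X.K) := by
    rw [euSq, ← integral_add (integrable_sq2 hv2)
      ((integrable_mul2 (memLp_bdd_mul hxt hv2) hpd).const_mul 2)]
    congr 1; ext x
    rw [pd_mul (smooth_differentiable hc x) (smooth_differentiable (hs.mul hs) x), pd_coord,
      pd_mul (smooth_differentiable hs x) (smooth_differentiable hs x)]
    ring
  have i1 : Integrable (fun x => outwardNormal X.K x j * (x j * (v x * v x))) (bdry X.K) :=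
    (memLp_bdd_mul hn (memLp_bdd_mul hxb (memLp_bdd_mul hvbt hvb))).integrable (by norm_num)
  have i2 : Integrable (fun x => x j * S.eh i x * outwardNormal X.K x j * S.eh i x) (bdry X.K) :=
    integrable_mul2 (memLp_mul_bdd (memLp_bdd_mul hxb heh2) hn) heh2
  have b1 : -∫ x, 2 * (x j * v x * pd j v x) ∂(vol X.K)
      ≤ 1 / 4 * S.euSq K i + 4 * R ^ 2 * ∫ x, pd j v x ^ 2 ∂(vol X.K) := by
    rw [euSq, ← integral_neg, ← integral_const_mul, ← integral_const_mul, ← integral_add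
      ((integrable_sq2 hv2).const_mul _) ((integrable_sq2 hpd).const_mul _)]
    refine integral_mono_ae ((integrable_mul2 (memLp_bdd_mul hxt hv2) hpd).const_mul 2).neg
      (((integrable_sq2 hv2).const_mul _).add ((integrable_sq2 hpd).const_mul _)) ?_
    filter_upwards [ae_vol_mem X.polyhedral.isOpen.measurableSet] with x hx
    have h1 := hR x (subset_closure (T.subset K hx))
    have h2 : x j ^ 2 ≤ R ^ 2 := sq_le_sq' (abs_le.1 h1).1 (abs_le.1 h1).2
    have h3 := mul_le_mul_of_nonneg_right h2 (sq_nonneg (pd j v x))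
    nlinarith [sq_nonneg (1 / 2 * v x + 2 * (x j * pd j v x))]
  have b2 : (∫ x, outwardNormal X.K x j * (x j * (v x * v x)) ∂(bdry X.K))
      - ∫ x, x j * S.eh i x * outwardNormal X.K x j * S.eh i x ∂(bdry X.K)
      ≤ X.h / (4 * Λ) * (∫ x, v x ^ 2 ∂(bdry X.K))
        + (4 * Λ * R ^ 2 / X.h + R) * ∫ x, S.jump K i x ^ 2 ∂(bdry X.K) := by
    rw [← integral_sub i1 i2, ← integral_const_mul, ← integral_const_mul, ← integral_add
      ((integrable_sq2 hvb).const_mul _) ((integrable_sq2 hJ).const_mul _)]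
    refine integral_mono_ae (i1.sub i2)
      (((integrable_sq2 hvb).const_mul _).add ((integrable_sq2 hJ).const_mul _)) ?_
    filter_upwards [ae_bdry_mem_frontier X.K] with x hx
    have h1 := hR x (T.frontier_subset_closure K hx)
    set c := x j * outwardNormal X.K x j with hcdef
    have h2 : |c| ≤ R := by
      rw [hcdef, abs_mul]
      calc _ ≤ R * 1 := mul_le_mul h1 (abs_outwardNormal_le _ _ _) (abs_nonneg _) hR0.le
        _ = R := mul_one R
    have e : outwardNormal X.K x j * (x j * (v x * v x))
        - x j * S.eh i x * outwardNormal X.K x j * S.eh i x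
        = 2 * c * (v x * S.jump K i x) - c * S.jump K i x ^ 2 := by
      rw [hcdef, jump]; ring
    rw [e]
    have h3 : -c * S.jump K i x ^ 2 ≤ R * S.jump K i x ^ 2 :=
      mul_le_mul_of_nonneg_right (by linarith [(abs_le.1 h2).1]) (sq_nonneg _)
    have h4 : c ^ 2 ≤ R ^ 2 := sq_le_sq' (abs_le.1 h2).1 (abs_le.1 h2).2
    have h5 : 2 * c * (v x * S.jump K i x) ≤ X.h / (4 * Λ) * v x ^ 2
        + 4 * Λ * c ^ 2 / X.h * S.jump K i x ^ 2 := by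
      have e2 : X.h / (4 * Λ) * v x ^ 2 + 4 * Λ * c ^ 2 / X.h * S.jump K i x ^ 2
          - 2 * c * (v x * S.jump K i x)
          = (4 * Λ * X.h)⁻¹ * (X.h * v x - 4 * Λ * c * S.jump K i x) ^ 2 := by
        field_simp; ring
      have : 0 ≤ (4 * Λ * X.h)⁻¹ * (X.h * v x - 4 * Λ * c * S.jump K i x) ^ 2 := by positivity
      linarith
    have h6 : 4 * Λ * c ^ 2 / X.h * S.jump K i x ^ 2 ≤ 4 * Λ * R ^ 2 / X.h * S.jump K i x ^ 2 := by
      gcongr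
    rw [add_mul]
    linarith
  have b3 := B.trace_int S.hd hv
  have b4 : X.h / (4 * Λ) * (∫ x, v x ^ 2 ∂(bdry X.K)) ≤ 1 / 4 * S.euSq K i := by
    have h1 : X.h / (4 * Λ) * (∫ x, v x ^ 2 ∂(bdry X.K))
        = (4 * Λ)⁻¹ * (X.h * ∫ x, v x ^ 2 ∂(bdry X.K)) := by ring
    have h2 : 1 / 4 * S.euSq K i = (4 * Λ)⁻¹ * (Λ * S.euSq K i) := by field_simp
    rw [h1, h2]
    exact mul_le_mul_of_nonneg_left b3 (by positivity)
  have hG : ∫ x, pd j v x ^ 2 ∂(vol X.K) ≤ ∑ j, ∫ x, pd j v x ^ 2 ∂(vol X.K) :=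
    Finset.single_le_sum (f := fun j => ∫ x, pd j v x ^ 2 ∂(vol X.K))
      (fun j _ => integral_nonneg fun _ => sq_nonneg _) (Finset.mem_univ j)
  have hJ0 := S.jump_nonneg K i
  have b5 : (4 * Λ * R ^ 2 / X.h + R) * (∫ x, S.jump K i x ^ 2 ∂(bdry X.K))
      ≤ (5 + 4 * Λ) * R ^ 2 * (X.h⁻¹ * ∫ x, S.jump K i x ^ 2 ∂(bdry X.K)) := by
    have h1 : (4 * Λ * R ^ 2 / X.h + R) * (∫ x, S.jump K i x ^ 2 ∂(bdry X.K))
        = (4 * Λ * R ^ 2 + R * X.h) * (X.h⁻¹ * ∫ x, S.jump K i x ^ 2 ∂(bdry X.K)) := by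
      field_simp
    rw [h1]
    refine mul_le_mul_of_nonneg_right ?_ (by positivity)
    nlinarith
  have b6 : 4 * R ^ 2 * (∫ x, pd j v x ^ 2 ∂(vol X.K))
      ≤ (5 + 4 * Λ) * R ^ 2 * ∑ j, ∫ x, pd j v x ^ 2 ∂(vol X.K) := by
    refine mul_le_mul ?_ hG (integral_nonneg fun _ => sq_nonneg _) (by positivity)
    nlinarith [sq_nonneg R]
  rw [oneSq_eq, mul_add]
  linarith

theorem poincare (B : ∀ K, LocalBounds (T.elem K) Λ) (hΛ : 1 ≤ Λ) (i j : Fin d) {R : ℝ}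
    (hR : ∀ x ∈ closure Ω, |x j| ≤ R) (hK : ∀ K, (T.elem K).h ≤ R) :
    ∑ K, S.euSq K i ≤ 2 * (5 + 4 * Λ) * R ^ 2 * ∑ K, S.oneSq K i := by
  classical
  have h0 : ∑ K, ∫ x, x j * S.eh i x * outwardNormal (T.elem K).K x j * S.eh i x
      ∂(bdry (T.elem K).K) = 0 := by
    have h := T.sum_normal_eq_zero S.hΩ (c := fun K x l => if l = j then x j * S.eh i x else 0)
      (m := S.eh i) ?_ ?_ ?_
    · simpa [ite_mul] using h
    · intro K
      have hxb := (T.elem K).polyhedral.memLp_top_bdry (contDiff_coord (d := d) j).continuous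
      simpa [ite_mul] using integrable_mul2
        (memLp_mul_bdd (memLp_bdd_mul hxb (S.eh_mem K i).memLp) (memLp_normal K j)) (S.eh_mem K i).memLp
    · filter_upwards [S.eh_zero] with x hx hxΩ
      exact Or.inr (hx hxΩ i)
    · exact Eventually.of_forall fun x _ K K' _ _ _ l => rfl
  have h1 := Finset.sum_le_sum fun K (_ : K ∈ Finset.univ) =>
    S.poincare_local K (B K) hΛ i j hR (hK K)
  rw [Finset.sum_add_distrib, h0, ← Finset.mul_sum, ← Finset.mul_sum] at h1
  linarith

theorem energySq_nonneg (K : Fin N) (i : Fin d) : 0 ≤ S.energySq K i := by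
  have := S.h_pos K
  refine add_nonneg (Finset.sum_nonneg fun j _ => integral_nonneg fun x => mul_self_nonneg _)
    (mul_nonneg (by positivity) (integral_nonneg fun x => sq_nonneg _))

theorem oneSq_sum_le (B : ∀ K, LocalBounds (T.elem K) Λ) :
    ∑ K, ∑ i, S.oneSq K i ≤ Λ * ∑ K, ∑ i, S.energySq K i := by
  rw [Finset.mul_sum]
  refine Finset.sum_le_sum fun K _ => ?_
  rw [Finset.mul_sum]
  exact Finset.sum_le_sum fun i _ => S.oneSq_le_energySq K (B K) i

theorem euSq_sum_le (B : ∀ K, LocalBounds (T.elem K) Λ) (hΛ : 1 ≤ Λ) {R : ℝ}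
    (hR : ∀ x ∈ closure Ω, ∀ j, |x j| ≤ R) (hK : ∀ K, (T.elem K).h ≤ R) :
    ∑ K, ∑ i, S.euSq K i ≤ 2 * (5 + 4 * Λ) * R ^ 2 * ∑ K, ∑ i, S.oneSq K i := by
  rw [Finset.sum_comm, Finset.sum_comm (f := fun K i => S.oneSq K i), Finset.mul_sum]
  exact Finset.sum_le_sum fun i _ => S.poincare B hΛ i i (fun x hx => hR x hx i) hK

/-- The approximation terms on one element. -/
def approxSq (K : Fin N) : ℝ :=
  (T.elem K).h * ((∑ i, ∫ x, (S.ν * (S.Ltn K i x - ntr (S.PL K i) x)) ^ 2 ∂(bdry (T.elem K).K))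
      + ∫ x, (S.pt K x - S.Pp K x) ^ 2 ∂(bdry (T.elem K).K))

theorem energy_local (K : Fin N) (B : LocalBounds (T.elem K) Λ) (hΛ : 1 ≤ Λ) {η : ℝ} (hη : 0 < η) :
    ∑ i, (S.ν * (∫ x, (S.Ltn K i x - ntr (S.PL K i) x) * S.jump K i x ∂(bdry (T.elem K).K))
      - (∫ x, (S.pt K x - S.Pp K x) * outwardNormal (T.elem K).K x i * S.jump K i x
        ∂(bdry (T.elem K).K)) - S.convErr K i)
    ≤ 3 * η * ∑ i, S.oneSq K i + (4 * η)⁻¹ * (d * (S.approxSq K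
      + (11 * d ^ 2 + 12 * Λ ^ 3 + 186 * d * Λ ^ 4) * S.U ^ 2 * S.load K)) := by
  have hh := S.h_pos K
  have hp : MemLp (fun x => S.pt K x - S.Pp K x) 2 (bdry (T.elem K).K) :=
    (S.tr.p_trace K).2.2.1.sub ((T.elem K).memLp_W_bdry (S.proj.Pp_mem.1 K))
  have hj := S.memLp_jump_two K
  set δp := ∫ x, (S.pt K x - S.Pp K x) ^ 2 ∂(bdry (T.elem K).K) with hδp
  set C := (11 * d ^ 2 + 12 * Λ ^ 3 + 186 * d * Λ ^ 4) * S.U ^ 2 * S.load K with hC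
  have young : ∀ i (g : E d → ℝ), MemLp g 2 (bdry (T.elem K).K) →
      ∫ x, g x * S.jump K i x ∂(bdry (T.elem K).K)
      ≤ η * S.oneSq K i + (4 * η)⁻¹ * ((T.elem K).h * ∫ x, g x ^ 2 ∂(bdry (T.elem K).K)) := by
    intro i g hg
    have h := integral_mul_le_young hg (hj i) (η := η * (T.elem K).h⁻¹) (by positivity)
    have e : (4 * (η * (T.elem K).h⁻¹))⁻¹ * ∫ x, g x ^ 2 ∂(bdry (T.elem K).K)
        = (4 * η)⁻¹ * ((T.elem K).h * ∫ x, g x ^ 2 ∂(bdry (T.elem K).K)) := by field_simp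
    rw [e] at h
    have h2 := mul_nonneg hη.le (S.grad_nonneg K i)
    rw [oneSq_eq, mul_add]
    linarith
  have h1 : ∀ i, S.ν * (∫ x, (S.Ltn K i x - ntr (S.PL K i) x) * S.jump K i x ∂(bdry (T.elem K).K))
      - (∫ x, (S.pt K x - S.Pp K x) * outwardNormal (T.elem K).K x i * S.jump K i x
        ∂(bdry (T.elem K).K)) - S.convErr K i
      ≤ 3 * η * S.oneSq K i + (4 * η)⁻¹ *
        ((T.elem K).h * (∫ x, (S.ν * (S.Ltn K i x - ntr (S.PL K i) x)) ^ 2 ∂(bdry (T.elem K).K))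
          + (T.elem K).h * δp + C) := by
    intro i
    have hL : MemLp (fun x => S.ν * (S.Ltn K i x - ntr (S.PL K i) x)) 2 (bdry (T.elem K).K) :=
      ((S.memLp_Ltn K i).sub (Lp.memLp _)).const_mul _
    have hn := memLp_normal (T := T) K i
    have a1 := young i _ hL
    have a2 := young i (fun x => -((S.pt K x - S.Pp K x) * outwardNormal (T.elem K).K x i))
      (memLp_mul_bdd hp hn).neg
    have a3 := S.convErr_le K B hΛ i hη
    simp_rw [neg_mul, integral_neg, neg_sq] at a2
    simp_rw [mul_assoc S.ν, integral_const_mul] at a1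
    have a4 : ∫ x, ((S.pt K x - S.Pp K x) * outwardNormal (T.elem K).K x i) ^ 2 ∂(bdry (T.elem K).K)
        ≤ δp := by
      refine integral_mono (integrable_sq2 (memLp_mul_bdd hp hn)) (integrable_sq2 hp) fun x => ?_
      have h2 : outwardNormal (T.elem K).K x i ^ 2 ≤ 1 :=
        (sq_le_one_iff_abs_le_one _).2 (abs_outwardNormal_le _ _ _)
      simp only [mul_pow]
      nlinarith [sq_nonneg (S.pt K x - S.Pp K x)]
    have a5 : (4 * η)⁻¹ * ((T.elem K).h * ∫ x, ((S.pt K x - S.Pp K x)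
        * outwardNormal (T.elem K).K x i) ^ 2 ∂(bdry (T.elem K).K)) ≤ (4 * η)⁻¹ * ((T.elem K).h * δp) := by
      gcongr
    rw [mul_add, mul_add]
    linarith
  refine (Finset.sum_le_sum fun i _ => h1 i).trans ?_
  rw [Finset.sum_add_distrib, ← Finset.mul_sum, ← Finset.mul_sum, Finset.sum_add_distrib,
    Finset.sum_add_distrib, Finset.sum_const, Finset.sum_const, Finset.card_univ, Fintype.card_fin,
    nsmul_eq_mul, nsmul_eq_mul, ← Finset.mul_sum, approxSq, ← hδp]
  have hd1 : (1 : ℝ) ≤ d := by exact_mod_cast S.hd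
  have h2 : 0 ≤ (T.elem K).h * ∑ i, ∫ x, (S.ν * (S.Ltn K i x - ntr (S.PL K i) x)) ^ 2
      ∂(bdry (T.elem K).K) :=
    mul_nonneg hh.le (Finset.sum_nonneg fun i _ => integral_nonneg fun x => sq_nonneg _)
  refine add_le_add le_rfl (mul_le_mul_of_nonneg_left ?_ (by positivity))
  nlinarith

theorem energySq_sum_le (B : ∀ K, LocalBounds (T.elem K) Λ) (hΛ : 1 ≤ Λ) {R C : ℝ}
    (hR : ∀ x ∈ closure Ω, ∀ j, |x j| ≤ R) (hK : ∀ K, (T.elem K).h ≤ R)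
    (hC : C = 11 * d ^ 2 + 12 * Λ ^ 3 + 186 * d * Λ ^ 4)
    (hU : 12 * Λ ^ 2 * C * d * ((11 + 8 * Λ) * R ^ 2) * S.U ^ 2 ≤ S.ν ^ 2) :
    ∑ K, ∑ i, S.energySq K i ≤ 6 * Λ * d * (1 + C) * (S.ν⁻¹) ^ 2 *
      ((∑ K, S.approxSq K) + S.U ^ 2 * ∑ i, ∑ K, S.zeroSq K i) := by
  have hν := S.hν
  have hΛ0 : 0 < Λ := by linarith
  have hC0 : 0 ≤ C := by rw [hC]; positivity
  set G := ∑ K, ∑ i, S.energySq K i with hG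
  set M := ∑ K, ∑ i, S.oneSq K i with hM
  set Z := ∑ i, ∑ K, S.zeroSq K i with hZ
  set A := ∑ K, S.approxSq K with hA
  have hM1 : M ≤ Λ * G := S.oneSq_sum_le B
  have hM0 : 0 ≤ M := Finset.sum_nonneg fun K _ => Finset.sum_nonneg fun i _ => S.oneSq_nonneg K i
  have hG0 : 0 ≤ G := Finset.sum_nonneg fun K _ => Finset.sum_nonneg fun i _ => S.energySq_nonneg K i
  have hZ0 : 0 ≤ Z := Finset.sum_nonneg fun i _ => Finset.sum_nonneg fun K _ => (S.zeroSq_le K i).1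
  have hA0 : 0 ≤ A := Finset.sum_nonneg fun K _ => mul_nonneg (S.h_pos K).le (add_nonneg
    (Finset.sum_nonneg fun i _ => integral_nonneg fun x => sq_nonneg _)
    (integral_nonneg fun x => sq_nonneg _))
  have hload : ∑ K, S.load K ≤ Z + (11 + 8 * Λ) * R ^ 2 * M := by
    have h1 := S.euSq_sum_le B hΛ hR hK
    have h2 : ∑ K, S.load K = Z + (∑ K, ∑ i, S.euSq K i)
        + ∑ K, ∑ i, (T.elem K).h ^ 2 * S.oneSq K i := by
      rw [hZ, Finset.sum_comm, ← Finset.sum_add_distrib, ← Finset.sum_add_distrib]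
      refine Finset.sum_congr rfl fun K _ => ?_
      rw [load, Finset.sum_add_distrib, Finset.sum_add_distrib]
    have h3 : ∑ K, ∑ i, (T.elem K).h ^ 2 * S.oneSq K i ≤ R ^ 2 * M := by
      rw [hM, Finset.mul_sum]
      refine Finset.sum_le_sum fun K _ => ?_
      rw [Finset.mul_sum]
      refine Finset.sum_le_sum fun i _ => mul_le_mul_of_nonneg_right ?_ (S.oneSq_nonneg K i)
      exact pow_le_pow_left₀ (S.h_pos K).le (hK K) 2
    rw [h2]
    linarith
  set η := S.ν / (12 * Λ) with hη
  have hη0 : 0 < η := by positivity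
  have hen := S.energy.trans
    (Finset.sum_le_sum fun K (_ : K ∈ Finset.univ) => S.energy_local K (B K) hΛ hη0)
  rw [Finset.sum_add_distrib, ← Finset.mul_sum, ← Finset.mul_sum, ← Finset.mul_sum,
    Finset.sum_add_distrib, ← Finset.mul_sum, ← hC] at hen
  change S.ν * G ≤ 3 * η * M + (4 * η)⁻¹ * (d * (A + C * S.U ^ 2 * ∑ K, S.load K)) at hen
  have e1 : (4 * η)⁻¹ = 3 * Λ * S.ν⁻¹ := by rw [hη]; field_simp; norm_num
  have h1 : 3 * η * M ≤ S.ν * G / 4 := by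
    have e : S.ν * G / 4 = 3 * η * (Λ * G) := by rw [hη]; field_simp; ring
    rw [e]
    exact mul_le_mul_of_nonneg_left hM1 (by positivity)
  have hd0 : (0 : ℝ) ≤ d := Nat.cast_nonneg d
  have h2 : (4 * η)⁻¹ * (d * (A + C * S.U ^ 2 * ∑ K, S.load K))
      ≤ 3 * Λ * S.ν⁻¹ * (d * (A + C * S.U ^ 2 * (Z + (11 + 8 * Λ) * R ^ 2 * (Λ * G)))) := by
    rw [e1]
    have h3 : ∑ K, S.load K ≤ Z + (11 + 8 * Λ) * R ^ 2 * (Λ * G) :=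
      hload.trans (by gcongr)
    gcongr
  have h4 : 3 * Λ * S.ν⁻¹ * (d * (C * S.U ^ 2 * ((11 + 8 * Λ) * R ^ 2 * (Λ * G)))) ≤ S.ν * G / 4 := by
    have e : 3 * Λ * S.ν⁻¹ * (d * (C * S.U ^ 2 * ((11 + 8 * Λ) * R ^ 2 * (Λ * G))))
        = (12 * Λ ^ 2 * C * d * ((11 + 8 * Λ) * R ^ 2) * S.U ^ 2) * (S.ν⁻¹ * G / 4) := by ring
    have e2 : S.ν * G / 4 = S.ν ^ 2 * (S.ν⁻¹ * G / 4) := by field_simp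
    rw [e, e2]
    exact mul_le_mul_of_nonneg_right hU (by positivity)
  have h5 : A + C * S.U ^ 2 * Z ≤ (1 + C) * (A + S.U ^ 2 * Z) := by
    have := mul_nonneg hC0 hA0
    have := mul_nonneg (sq_nonneg S.U) hZ0
    nlinarith
  have h6 : S.ν * G / 2 ≤ 3 * Λ * S.ν⁻¹ * (d * ((1 + C) * (A + S.U ^ 2 * Z))) := by
    have h7 : 3 * Λ * S.ν⁻¹ * (d * (A + C * S.U ^ 2 * Z))
        ≤ 3 * Λ * S.ν⁻¹ * (d * ((1 + C) * (A + S.U ^ 2 * Z))) := by gcongr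
    have e : 3 * Λ * S.ν⁻¹ * (d * (A + C * S.U ^ 2 * (Z + (11 + 8 * Λ) * R ^ 2 * (Λ * G))))
        = 3 * Λ * S.ν⁻¹ * (d * (A + C * S.U ^ 2 * Z))
          + 3 * Λ * S.ν⁻¹ * (d * (C * S.U ^ 2 * ((11 + 8 * Λ) * R ^ 2 * (Λ * G)))) := by ring
    rw [e] at h2
    linarith
  have e3 : G = 2 * S.ν⁻¹ * (S.ν * G / 2) := by field_simp
  rw [e3]
  calc _ ≤ 2 * S.ν⁻¹ * (3 * Λ * S.ν⁻¹ * (d * ((1 + C) * (A + S.U ^ 2 * Z)))) := by gcongr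
    _ = _ := by ring

end Config

end

section

variable {d : ℕ}

variable {Ω : Set (E d)} {N : ℕ}

theorem Mesh.elem_h_le (T : Mesh Ω N) (K : Fin N) : (T.elem K).h ≤ T.h :=
  le_ciSup (f := fun K => (T.elem K).h) (Set.finite_range _).bddAbove K

namespace Config

variable {T : Mesh Ω N} (S : Config T)

variable {Λ : ℝ}

theorem tensorNorm_le (S : Config T) :
    tensorNorm T (S.PL - S.Lh) ≤ √(∑ K, ∑ i, S.energySq K i) := by
  refine Real.sqrt_le_sqrt (Finset.sum_le_sum fun K _ => Finset.sum_le_sum fun i _ => ?_)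
  have e : ∫ x, ‖field (S.eL K i) x‖ ^ 2 ∂(vol (T.elem K).K)
      = ∑ j, ∫ x, field (S.eL K i) x j * field (S.eL K i) x j ∂(vol (T.elem K).K) := by
    have h : ∀ x, ‖field (S.eL K i) x‖ ^ 2 = ∑ j, field (S.eL K i) x j * field (S.eL K i) x j :=
      fun x => by rw [← inner_eq_sum, real_inner_self_eq_norm_sq]
    simp_rw [h]
    exact integral_finsetSum _ fun j _ => integrable_mul2
      (memLp_component (Lp.memLp (S.eL K i).1) j) (memLp_component (Lp.memLp (S.eL K i).1) j)
  change ∫ x, ‖field (S.eL K i) x‖ ^ 2 ∂(vol (T.elem K).K) ≤ _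
  rw [e, energySq]
  have := S.h_pos K
  exact le_add_of_nonneg_right (mul_nonneg (by positivity) (integral_nonneg fun x => sq_nonneg _))

theorem normOne_eq : normOne T (S.Pu - S.uh) (S.Pm - S.uhat) = √(∑ K, ∑ i, S.oneSq K i) := by
  rw [Finset.sum_comm]
  rfl

theorem velocityNorm_eq : velocityNorm T (S.Pu - S.uh) = √(∑ K, ∑ i, S.euSq K i) := by
  rw [velocityNorm]
  congr 1
  refine Finset.sum_congr rfl fun K _ => ?_
  simp only [euSq]
  rw [← integral_finsetSum _ fun i _ => integrable_sq2 ((T.elem K).memLp_W (S.eu_mem K i))]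
  congr 1; ext x
  rw [EuclideanSpace.norm_sq_eq]
  simp_rw [Real.norm_eq_abs, sq_abs]
  rfl

theorem normPF_le (B : ∀ K, LocalBounds (T.elem K) Λ) (hΛ : 1 ≤ Λ) :
    T.h⁻¹ * normPF T (S.Pu - S.uh) (S.Pm - S.uhat) ≤ √(Λ * ∑ K, ∑ i, S.oneSq K i) := by
  have hh : 0 ≤ T.h := Real.iSup_nonneg fun K => (S.h_pos K).le
  have hM0 : 0 ≤ ∑ K, ∑ i, S.oneSq K i :=
    Finset.sum_nonneg fun K _ => Finset.sum_nonneg fun i _ => S.oneSq_nonneg K i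
  have h1 : normPF T (S.Pu - S.uh) (S.Pm - S.uhat) ≤ T.h * √(Λ * ∑ K, ∑ i, S.oneSq K i) := by
    rw [normPF, ← Real.sqrt_sq hh, ← Real.sqrt_mul (sq_nonneg _)]
    refine Real.sqrt_le_sqrt ?_
    rw [Finset.sum_comm, Finset.mul_sum, Finset.mul_sum]
    refine Finset.sum_le_sum fun K _ => ?_
    rw [Finset.mul_sum, Finset.mul_sum]
    refine Finset.sum_le_sum fun i _ => ?_
    have h2 := S.PF_le K (B K) i
    have h3 : (T.elem K).h ^ 2 ≤ T.h ^ 2 := pow_le_pow_left₀ (S.h_pos K).le (T.elem_h_le K) 2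
    calc _ ≤ _ := h2
      _ ≤ Λ * (T.h ^ 2 * S.oneSq K i) := mul_le_mul_of_nonneg_left
          (mul_le_mul_of_nonneg_right h3 (S.oneSq_nonneg K i)) (by linarith)
      _ = _ := by ring
  calc _ ≤ T.h⁻¹ * (T.h * √(Λ * ∑ K, ∑ i, S.oneSq K i)) :=
        mul_le_mul_of_nonneg_left h1 (inv_nonneg.2 hh)
    _ = (T.h⁻¹ * T.h) * √(Λ * ∑ K, ∑ i, S.oneSq K i) := by ring
    _ ≤ 1 * √(Λ * ∑ K, ∑ i, S.oneSq K i) :=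
        mul_le_mul_of_nonneg_right inv_mul_le_one (Real.sqrt_nonneg _)
    _ = _ := one_mul _

/-- The error estimate, with explicit constants. -/
theorem error_le (B : ∀ K, LocalBounds (T.elem K) Λ) (hΛ : 1 ≤ Λ) {R C : ℝ}
    (hR : ∀ x ∈ closure Ω, ∀ j, |x j| ≤ R) (hK : ∀ K, (T.elem K).h ≤ R)
    (hC : C = 11 * d ^ 2 + 12 * Λ ^ 3 + 186 * d * Λ ^ 4)
    (hU : 12 * Λ ^ 2 * C * d * ((11 + 8 * Λ) * R ^ 2) * S.U ^ 2 ≤ S.ν ^ 2) :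
    tensorNorm T (S.PL - S.Lh) + normOne T (S.Pu - S.uh) (S.Pm - S.uhat)
      + T.h⁻¹ * normPF T (S.Pu - S.uh) (S.Pm - S.uhat) + velocityNorm T (S.Pu - S.uh)
    ≤ (1 + √Λ + Λ + √(2 * (5 + 4 * Λ) * R ^ 2 * Λ)) * √(6 * Λ * d * (1 + C)) * S.ν⁻¹ *
      √((∑ K, S.approxSq K) + S.U ^ 2 * ∑ i, ∑ K, S.zeroSq K i) := by
  have hΛ0 : 0 ≤ Λ := by linarith
  have hν := S.hν
  have hC0 : 0 ≤ C := by rw [hC]; positivity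
  set G := ∑ K, ∑ i, S.energySq K i with hG
  have hM := S.oneSq_sum_le B
  have h1 := S.tensorNorm_le
  have h2 : normOne T (S.Pu - S.uh) (S.Pm - S.uhat) ≤ √Λ * √G := by
    rw [S.normOne_eq, ← Real.sqrt_mul hΛ0]
    exact Real.sqrt_le_sqrt hM
  have h3 : T.h⁻¹ * normPF T (S.Pu - S.uh) (S.Pm - S.uhat) ≤ Λ * √G := by
    refine (S.normPF_le B hΛ).trans ?_
    rw [← Real.sqrt_sq hΛ0, ← Real.sqrt_mul (sq_nonneg _), Real.sqrt_sq hΛ0]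
    refine Real.sqrt_le_sqrt ((mul_le_mul_of_nonneg_left hM hΛ0).trans_eq ?_)
    ring
  have h4 : velocityNorm T (S.Pu - S.uh) ≤ √(2 * (5 + 4 * Λ) * R ^ 2 * Λ) * √G := by
    rw [S.velocityNorm_eq, ← Real.sqrt_mul (by positivity)]
    refine Real.sqrt_le_sqrt ((S.euSq_sum_le B hΛ hR hK).trans
      ((mul_le_mul_of_nonneg_left hM (by positivity)).trans_eq ?_))
    ring
  have h5 : √G ≤ √(6 * Λ * d * (1 + C)) * S.ν⁻¹ *
      √((∑ K, S.approxSq K) + S.U ^ 2 * ∑ i, ∑ K, S.zeroSq K i) := by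
    rw [← Real.sqrt_sq (inv_nonneg.2 hν.le), ← Real.sqrt_mul (by positivity),
      ← Real.sqrt_mul (by positivity)]
    exact Real.sqrt_le_sqrt (S.energySq_sum_le B hΛ hR hK hC hU)
  calc _ ≤ (1 + √Λ + Λ + √(2 * (5 + 4 * Λ) * R ^ 2 * Λ)) * √G := by linarith
    _ ≤ (1 + √Λ + Λ + √(2 * (5 + 4 * Λ) * R ^ 2 * Λ)) * (√(6 * Λ * d * (1 + C)) * S.ν⁻¹ *
      √((∑ K, S.approxSq K) + S.U ^ 2 * ∑ i, ∑ K, S.zeroSq K i)) :=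
        mul_le_mul_of_nonneg_left h5 (by positivity)
    _ = _ := by ring

end Config

end

end HDG

end

theorem theorem5p4 (d : ℕ) (hd : d = 2 ∨ d = 3) :
    ∃ c : HDG.LocalSpaces d → ℝ, (∀ X Y : HDG.LocalSpaces d, X.Similar Y → c X = c Y) ∧
    ∀ (Ω : Set (HDG.E d)) (facesΩ : Finset (Set (HDG.E d))), HDG.IsPolyhedral Ω facesΩ →
    ∀ Λ : ℝ, ∃ C > (0 : ℝ), ∃ ε > (0 : ℝ),
    ∀ (N : ℕ) (T : HDG.Mesh Ω N), (∀ K, c (T.elem K) ≤ Λ) →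
    (∀ K, (T.elem K).Compatible) →
    ∀ k : ℕ, (∀ K, (T.elem K).ContainsPoly k) →
    ∀ (ν : ℝ), 0 < ν → ∀ f : HDG.E d → HDG.E d, MemLp f 2 (HDG.vol Ω) →
    -- the exact solution and its traces
    ∀ (L : Fin d → HDG.E d → HDG.E d) (DL : Fin d → Fin d → HDG.E d → HDG.E d)
      (u : HDG.E d → HDG.E d) (p : HDG.E d → ℝ) (Dp : HDG.E d → HDG.E d),
      HDG.IsNSSolution Ω ν f L DL u p Dp →
    ∀ (Lt : Fin N → Fin d → HDG.E d → HDG.E d) (ut : Fin N → HDG.E d → HDG.E d)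
      (pt : Fin N → HDG.E d → ℝ), HDG.IsTraces T L DL u p Dp Lt ut pt →
    -- the numerical solution
    ∀ (Lh : T.Tensor) (uh : Fin N → HDG.E d → HDG.E d) (ph : Fin N → HDG.E d → ℝ)
      (uhat : HDG.E d → HDG.E d) (β : (K : Fin N) → HDG.Flux (T.elem K).K),
      HDG.IsHDGSolution T ν f Lh uh ph uhat β →
    -- the projections of the exact solution
    ∀ (PL : T.Tensor) (Pu : Fin N → HDG.E d → HDG.E d) (Pp : Fin N → HDG.E d → ℝ)
      (Pm : HDG.E d → HDG.E d), HDG.IsProjection T L u p ut PL Pu Pp Pm →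
    -- smallness of the data and of the exact velocity
    eLpNorm f 2 (HDG.vol Ω) ≤ ENNReal.ofReal (ε * ν ^ 2) →
    eLpNorm u ⊤ (HDG.vol Ω) ≤ ENNReal.ofReal (ε * ν) →
    HDG.tensorNorm T (PL - Lh)
      + HDG.normOne T (Pu - uh) (Pm - uhat)
      + T.h⁻¹ * HDG.normPF T (Pu - uh) (Pm - uhat)
      + HDG.velocityNorm T (Pu - uh)
      ≤ C * ν⁻¹ * √(HDG.thetaNS T ν u Lt ut pt PL Pu Pp Pm) := by
  have hd0 : 0 < d := by omega
  refine ⟨HDG.localConst, fun X Y h => HDG.localConst_similar hd0 h, ?_⟩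
  intro Ω facesΩ hΩ Λ₀
  obtain ⟨R₀, hR₀⟩ := hΩ.isBounded.closure.subset_closedBall 0
  set Λ := max Λ₀ 1 with hΛdef
  have hΛ : 1 ≤ Λ := le_max_right _ _
  set R := 2 * max R₀ 1 with hRdef
  have hR1 : 1 ≤ max R₀ 1 := le_max_right _ _
  have hR0 : 0 < R := by positivity
  set C : ℝ := 11 * d ^ 2 + 12 * Λ ^ 3 + 186 * d * Λ ^ 4 with hC
  set D : ℝ := 12 * Λ ^ 2 * C * d * ((11 + 8 * Λ) * R ^ 2) with hD
  have hΛ0 : 0 < Λ := by linarith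
  have hC0 : 0 < C := by positivity
  have hD0 : 0 ≤ D := by positivity
  have hR : ∀ x ∈ closure Ω, ‖x‖ ≤ R / 2 := fun x hx => by
    have h := mem_closedBall_zero_iff.1 (hR₀ hx)
    have : R / 2 = max R₀ 1 := by rw [hRdef]; ring
    rw [this]
    exact h.trans (le_max_left _ _)
  refine ⟨(1 + √Λ + Λ + √(2 * (5 + 4 * Λ) * R ^ 2 * Λ)) * √(6 * Λ * d * (1 + C)), by positivity,
    (1 + D)⁻¹, by positivity, ?_⟩
  intro N T hc hcompat k hpoly ν hν f _ L DL u p Dp hns Lt ut pt htr Lh uh ph uhat β hsol PL Pu Pp Pm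
    hproj _ hu
  have hfin : eLpNorm u ⊤ (HDG.vol Ω) ≠ ⊤ := ne_top_of_le_ne_top ENNReal.ofReal_ne_top hu
  have hUle : (eLpNorm u ⊤ (HDG.vol Ω)).toReal ≤ (1 + D)⁻¹ * ν :=
    ENNReal.toReal_le_of_le_ofReal (by positivity) hu
  have hbound : ∀ᵐ x ∂(HDG.vol Ω), ‖u x‖ ≤ (eLpNorm u ⊤ (HDG.vol Ω)).toReal := by
    have h := ae_le_eLpNormEssSup (f := u) (μ := HDG.vol Ω)
    rw [← eLpNorm_exponent_top] at h
    filter_upwards [h] with x hx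
    rw [← toReal_enorm]
    exact ENNReal.toReal_mono hfin hx
  have B : ∀ K, HDG.LocalBounds (T.elem K) Λ := fun K =>
    HDG.localBounds_of_le hd0 ((hc K).trans (le_max_left _ _))
  let S : HDG.Config T :=
    { facesΩ := facesΩ, hΩ := hΩ, hd := hd0, compat := hcompat, k := k, poly := hpoly, ν := ν, hν := hν,
      f := f, L := L, DL := DL, u := u, p := p, Dp := Dp, ns := hns, Lt := Lt, ut := ut,
      pt := pt, tr := htr, Lh := Lh, uh := uh, ph := ph, uhat := uhat, β := β, sol := hsol, PL := PL,
      Pu := Pu, Pp := Pp, Pm := Pm, proj := hproj, U := (eLpNorm u ⊤ (HDG.vol Ω)).toReal,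
      hU := ENNReal.toReal_nonneg, u_bound := hbound }
  have hRj : ∀ x ∈ closure Ω, ∀ j, |x j| ≤ R := fun x hx j =>
    (PiLp.norm_apply_le x j).trans ((hR x hx).trans (by linarith))
  have hK : ∀ K, (T.elem K).h ≤ R := fun K => by
    have h := Metric.diam_le_of_subset_closedBall (s := (T.elem K).K) (x := 0) (r := R / 2)
      (by positivity) fun x hx => mem_closedBall_zero_iff.2 (hR x (subset_closure (T.subset K hx)))
    have e : 2 * (R / 2) = R := by ring
    rwa [e] at h
  have hsmall : D * S.U ^ 2 ≤ ν ^ 2 := by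
    have h1 : S.U ^ 2 ≤ ((1 + D)⁻¹ * ν) ^ 2 := pow_le_pow_left₀ ENNReal.toReal_nonneg hUle 2
    have h2 : D * (1 + D)⁻¹ ^ 2 ≤ 1 := by
      rw [inv_pow, ← div_eq_mul_inv, div_le_one (by positivity)]
      nlinarith
    calc D * S.U ^ 2 ≤ D * ((1 + D)⁻¹ * ν) ^ 2 := mul_le_mul_of_nonneg_left h1 hD0
      _ = (D * (1 + D)⁻¹ ^ 2) * ν ^ 2 := by ring
      _ ≤ 1 * ν ^ 2 := mul_le_mul_of_nonneg_right h2 (sq_nonneg ν)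
      _ = ν ^ 2 := one_mul _
  exact S.error_le B hΛ hRj hK hC hsmall
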